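/- **Theorem (Yang–Baxter equation for symmetrically fused rectangular blocks of the dilute $A_L$ models).** *Elementary weights.* Let $L\ge1$, $L\neq2$, let the nome $p$ be real with $|p|<1$, and let $\lambda=\frac{\pi}{4}\frac{L}{L+1}$ or $\lambda=\frac{\pi}{4}\frac{L+2}{L+1}$. The heights are $1,\dots,L$; heights $a,b$ are adjacent, $a\sim b$, if $|a-b|\le1$. Let $\vartheta_1,\vartheta_4$ be the theta functions of nome $p$ and $S_a=(-1)^a\vartheta_1(4a\lambda)/\vartheta_4(2a\lambda)$. (All weights below are homogeneous of degree $0$ in $\vartheta_1$, so the constant factor $p^{1/4}$ of $\vartheta_1$ is dropped; this includes $p=0$.) The face weights $W(a\,b\,c\,d\,|\,u)$, with corners in the order bottom left, bottom right, top right, top left, and $u\in\mathbb C$, are $$\begin{aligned} W(a\,a\,a\,a|u)&=\tfrac{\vartheta_1(6\lambda-u)\vartheta_1(3\lambda+u)}{\vartheta_1(6\lambda)\vartheta_1(3\lambda)}-\Big(\tfrac{S_{a+1}}{S_a}\tfrac{\vartheta_4(2a\lambda-5\lambda)}{\vartheta_4(2a\lambda+\lambda)}+\tfrac{S_{a-1}}{S_a}\tfrac{\vartheta_4(2a\lambda+5\lambda)}{\vartheta_4(2a\lambda-\lambda)}\Big)\tfrac{\vartheta_1(u)\vartheta_1(3\lambda-u)}{\vartheta_1(6\lambda)\vartheta_1(3\lambda)}\\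 W(a\,a\,a\,a{\pm}1|u)&=W(a\,a{\pm}1\,a\,a|u)=\tfrac{\vartheta_1(3\lambda-u)\vartheta_4(\pm2a\lambda+\lambda-u)}{\vartheta_1(3\lambda)\vartheta_4(\pm2a\lambda+\lambda)}\\ W(a{\pm}1\,a\,a\,a|u)&=W(a\,a\,a{\pm}1\,a|u)=\Big(\tfrac{S_{a\pm1}}{S_a}\Big)^{1/2}\tfrac{\vartheta_1(u)\vartheta_4(\pm2a\lambda-2\lambda+u)}{\vartheta_1(3\lambda)\vartheta_4(\pm2a\lambda+\lambda)}\\ W(a\,a{\pm}1\,a{\pm}1\,a|u)&=W(a\,a\,a{\pm}1\,a{\pm}1|u)=\Big(\tfrac{\vartheta_4(\pm2a\lambda+3\lambda)\vartheta_4(\pm2a\lambda-\lambda)}{\vartheta_4(\pm2a\lambda+\lambda)^2}\Big)^{1/2}\tfrac{\vartheta_1(u)\vartheta_1(3\lambda-u)}{\vartheta_1(2\lambda)\vartheta_1(3\lambda)}\\ W(a\,a{\mp}1\,a\,a{\pm}1|u)&=\tfrac{\vartheta_1(2\lambda-u)\vartheta_1(3\lambda-u)}{\vartheta_1(2\lambda)\vartheta_1(3\lambda)}\\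 W(a{\pm}1\,a\,a{\mp}1\,a|u)&=-\Big(\tfrac{S_{a-1}S_{a+1}}{S_a^2}\Big)^{1/2}\tfrac{\vartheta_1(u)\vartheta_1(\lambda-u)}{\vartheta_1(2\lambda)\vartheta_1(3\lambda)}\\ W(a{\pm}1\,a\,a{\pm}1\,a|u)&=\tfrac{\vartheta_1(3\lambda-u)\vartheta_1(\pm4a\lambda+2\lambda+u)}{\vartheta_1(3\lambda)\vartheta_1(\pm4a\lambda+2\lambda)}+\tfrac{S_{a\pm1}}{S_a}\tfrac{\vartheta_1(u)\vartheta_1(\pm4a\lambda-\lambda+u)}{\vartheta_1(3\lambda)\vartheta_1(\pm4a\lambda+2\lambda)} \end{aligned}$$ and $0$ otherwise; where $\vartheta_1(\pm4a\lambda+2\lambda)=0$, the last weight is given instead by $$\tfrac{\vartheta_1(3\lambda+u)\vartheta_1(\pm4a\lambda-4\lambda+u)}{\vartheta_1(3\lambda)\vartheta_1(\pm4a\lambda-4\lambda)}+\Big(\tfrac{S_{a\mp1}}{S_a}\tfrac{\vartheta_1(4\lambda)}{\vartheta_1(2\lambda)}-\tfrac{\vartheta_4(\pm2a\lambda-5\lambda)}{\vartheta_4(\pm2a\lambda+\lambda)}\Big)\tfrac{\vartheta_1(u)\vartheta_1(\pm4a\lambda-\lambda+u)}{\vartheta_1(3\lambda)\vartheta_1(\pm4a\lambda-4\lambda)}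 .$$ *Projectors and independent paths.* An $n$-step path from $a$ to $b$ is a sequence $(x_0,\dots,x_n)$ of heights with $x_0=a$, $x_n=b$, $x_i\sim x_{i+1}$. For $n$-step paths $x$ (bottom) and $y$ (top) put $R_n(u)^y_x=\prod_{k=0}^{n-1}W(x_k\,x_{k+1}\,y_{k+1}\,y_k\,|\,u+2k\lambda)$. Define operators on $(n+1)$-step paths by $P_{(0,0)}=\mathrm{id}$ and, for $n\ge 1$, $$P_{(n,0)}(u)^{(a,a_1,\dots,a_n,b)}_{(a,b_1,\dots,b_n,b)}=\sum_{x}P_{(n-1,0)}(-2(n-1)\lambda)^{x}_{(b_1,\dots,b_n,b)}\,R_n(u)^{(a,a_1,\dots,a_n)}_{x},$$ $x$ running over the $n$-step paths from $b_1$ to $b$. A set of $n$-step paths from $a$ to $b$ is *independent* if the vectors $\big(P_{(n-1,0)}(-2(n-1)\lambda)^x_y\big)_y$, $x$ in the set, are linearly independent ($y$ runs over the $n$-step paths from $a$ to $b$). For all $n,a,b$ choose a maximal independent set, with elements $[a,b;(n,0)|\alpha]$, $1\le\alpha\le N^{(n)}_{a,b}$. The choice is arbitrary, except that for $a\ne b$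 the path $[b,a;(n,0)|\alpha]$ is the reverse of $[a,b;(n,0)|\alpha]$. The coefficients $\phi_{(n,0)}[a,b](x|\alpha)$ of a path $x$ from $a$ to $b$ are defined by $P_{(n-1,0)}(-2(n-1)\lambda)^{x}_{y}=\sum_\alpha\phi_{(n,0)}[a,b](x|\alpha)\,P_{(n-1,0)}(-2(n-1)\lambda)^{[a,b;(n,0)|\alpha]}_{y}$ for all $y$. *Fused weights.* For $m,n\ge1$ put $$W_{(n,0)}\big(a\,b\,c\,d;\alpha,\beta\,|\,u\big)=\sum_{x}\phi_{(n,0)}[a,b](x|\alpha)\,R_n(u)^{[d,c;(n,0)|\beta]}_{x},$$ $x$ running over the $n$-step paths from $a$ to $b$, and, with the bond variables in the order bottom, right, top, left, $$W^{(m,0)}_{(n,0)}\big(a\,b\,c\,d;\alpha,\nu,\beta,\mu\,|\,u\big)=\sum_{x}\phi_{(m,0)}[a,d](x|\mu)\sum_{\alpha_2,\dots,\alpha_m}\ \prod_{k=1}^{m}W_{(n,0)}\big(x_k\,e_k\,e_{k+1}\,x_{k+1};\alpha_k,\alpha_{k+1}\,|\,u-2(m-k)\lambda\big),$$ where $x=(x_1,\dots,x_{m+1})$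 runs over the $m$-step paths from $a$ to $d$, $(e_1,\dots,e_{m+1})=[b,c;(m,0)|\nu]$, $\alpha_1=\alpha$, $\alpha_{m+1}=\beta$, and $1\le\alpha_k\le N^{(n)}_{x_k,e_k}$. *Claim.* For all positive integers $m,n,l$, all $u,v\in\mathbb C$, all heights $a,b,c,d,e,f$ and all bond variables $1\le\alpha\le N^{(n)}_{a,b}$, $1\le\beta\le N^{(m)}_{b,c}$, $1\le\gamma\le N^{(l)}_{d,c}$, $1\le\mu\le N^{(n)}_{e,d}$, $1\le\nu\le N^{(m)}_{f,e}$, $1\le\rho\le N^{(l)}_{a,f}$, $$\begin{aligned} &\sum_{g}\sum_{\eta_1,\eta_2,\eta_3}W^{(m,0)}_{(n,0)}(f\,g\,d\,e;\eta_1,\eta_3,\mu,\nu|u)\,W^{(m,0)}_{(l,0)}(g\,b\,c\,d;\eta_2,\beta,\gamma,\eta_3|u-v)\,W^{(l,0)}_{(n,0)}(a\,b\,g\,f;\alpha,\eta_2,\eta_1,\rho|v)\\ ={}&\sum_{g}\sum_{\eta_1,\eta_2,\eta_3}W^{(m,0)}_{(n,0)}(a\,b\,c\,g;\alpha,\beta,\eta_1,\eta_3|u)\,W^{(m,0)}_{(l,0)}(f\,a\,g\,e;\rho,\eta_3,\eta_2,\nu|u-v)\,W^{(l,0)}_{(n,0)}(g\,c\,d\,e;\eta_1,\gamma,\mu,\eta_2|v),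 \end{aligned}$$ where $g$ runs over all heights and each bond variable $\eta_i$ over all bonds of its edge: $\eta_1,\eta_2,\eta_3$ are bonds of the edges $(f,g),(b,g),(g,d)$ of levels $n,l,m$ on the left, and of the edges $(g,c),(g,e),(a,g)$ of levels $n,l,m$ on the right. -/

import Mathlib

namespace DiluteA

noncomputable section

/-! ### Theta functions and face weights

Throughout, `p` is the nome and `lam` the crossing parameter. -/

/-- The theta function `ϑ₁(u)` of nome `p`, without its constant factor `p ^ (1/4)`:
`2 ∑ₙ (-1)ⁿ p^{n(n+1)} sin ((2n+1)u)`. The face weights are homogeneous of degree zero in `ϑ₁`,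
so the constant factor cancels from each of them; leaving it out includes the critical
case `p = 0`, and needs no root of a negative nome. -/
def theta1 (p : ℝ) (u : ℂ) : ℂ :=
  2 * ∑' n : ℕ, (-1 : ℂ) ^ n * (p : ℂ) ^ (n * (n + 1)) * Complex.sin ((2 * (n : ℂ) + 1) * u)

/-- The theta function `ϑ₄(u) = 1 + 2 ∑_{n ≥ 1} (-1)ⁿ p^{n²} cos (2nu)` of nome `p`. -/
def theta4 (p : ℝ) (u : ℂ) : ℂ :=
  1 + 2 * ∑' n : ℕ, (-1 : ℂ) ^ (n + 1) * (p : ℂ) ^ ((n + 1) ^ 2) *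
    Complex.cos (2 * ((n : ℂ) + 1) * u)

/-- The principal square root. It is only taken of positive real numbers. -/
def sqrtC (z : ℂ) : ℂ := z ^ (1 / 2 : ℂ)

/-- The crossing factor `S_a = (-1)^a ϑ₁(4aλ) / ϑ₄(2aλ)`. -/
def S (p lam : ℝ) (a : ℤ) : ℂ :=
  (-1 : ℂ) ^ a * theta1 p (4 * a * lam) / theta4 p (2 * a * lam)

/-- `W(a a a a | u)`. -/
def w1 (p lam : ℝ) (a : ℤ) (u : ℂ) : ℂ :=
  theta1 p (6 * lam - u) * theta1 p (3 * lam + u) / (theta1 p (6 * lam) * theta1 p (3 * lam))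
  - (S p lam (a + 1) / S p lam a
        * (theta4 p (2 * a * lam - 5 * lam) / theta4 p (2 * a * lam + lam))
      + S p lam (a - 1) / S p lam a
        * (theta4 p (2 * a * lam + 5 * lam) / theta4 p (2 * a * lam - lam)))
    * (theta1 p u * theta1 p (3 * lam - u) / (theta1 p (6 * lam) * theta1 p (3 * lam)))

/-- `W(a a a a±1 | u) = W(a a±1 a a | u)`, where `s = ±1`. -/
def w2 (p lam : ℝ) (s a : ℤ) (u : ℂ) : ℂ :=
  theta1 p (3 * lam - u) * theta4 p (s * 2 * a * lam + lam - u)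
    / (theta1 p (3 * lam) * theta4 p (s * 2 * a * lam + lam))

/-- `W(a±1 a a a | u) = W(a a a±1 a | u)`, where `s = ±1`. -/
def w3 (p lam : ℝ) (s a : ℤ) (u : ℂ) : ℂ :=
  sqrtC (S p lam (a + s) / S p lam a)
    * (theta1 p u * theta4 p (s * 2 * a * lam - 2 * lam + u)
      / (theta1 p (3 * lam) * theta4 p (s * 2 * a * lam + lam)))

/-- `W(a a±1 a±1 a | u) = W(a a a±1 a±1 | u)`, where `s = ±1`. -/
def w4 (p lam : ℝ) (s a : ℤ) (u : ℂ) : ℂ :=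
  sqrtC (theta4 p (s * 2 * a * lam + 3 * lam) * theta4 p (s * 2 * a * lam - lam)
      / theta4 p (s * 2 * a * lam + lam) ^ 2)
    * (theta1 p u * theta1 p (3 * lam - u) / (theta1 p (2 * lam) * theta1 p (3 * lam)))

/-- `W(a a∓1 a a±1 | u)`. -/
def w5 (p lam : ℝ) (u : ℂ) : ℂ :=
  theta1 p (2 * lam - u) * theta1 p (3 * lam - u) / (theta1 p (2 * lam) * theta1 p (3 * lam))

/-- `W(a±1 a a∓1 a | u)`. -/
def w6 (p lam : ℝ) (a : ℤ) (u : ℂ) : ℂ :=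
  -(sqrtC (S p lam (a - 1) * S p lam (a + 1) / S p lam a ^ 2))
    * (theta1 p u * theta1 p (lam - u) / (theta1 p (2 * lam) * theta1 p (3 * lam)))

open Classical in
/-- `W(a±1 a a±1 a | u)`, where `s = ±1`. There are two equal expressions for this weight; the
second one is used where the denominator `ϑ₁(±4aλ+2λ)` of the first one vanishes. -/
def w7 (p lam : ℝ) (s a : ℤ) (u : ℂ) : ℂ :=
  if theta1 p (s * 4 * a * lam + 2 * lam) ≠ 0 then
    theta1 p (3 * lam - u) * theta1 p (s * 4 * a * lam + 2 * lam + u)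
        / (theta1 p (3 * lam) * theta1 p (s * 4 * a * lam + 2 * lam))
    + S p lam (a + s) / S p lam a
      * (theta1 p u * theta1 p (s * 4 * a * lam - lam + u)
        / (theta1 p (3 * lam) * theta1 p (s * 4 * a * lam + 2 * lam)))
  else
    theta1 p (3 * lam + u) * theta1 p (s * 4 * a * lam - 4 * lam + u)
        / (theta1 p (3 * lam) * theta1 p (s * 4 * a * lam - 4 * lam))
    + (S p lam (a - s) / S p lam a * (theta1 p (4 * lam) / theta1 p (2 * lam))
        - theta4 p (s * 2 * a * lam - 5 * lam) / theta4 p (s * 2 * a * lam + lam))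
      * (theta1 p u * theta1 p (s * 4 * a * lam - lam + u)
        / (theta1 p (3 * lam) * theta1 p (s * 4 * a * lam - 4 * lam)))

/-- The face weight `W(a b c d | u)` of the dilute models. The corners of the face are, in this
order: bottom left, bottom right, top right, top left. -/
def faceWeight (p lam : ℝ) (a b c d : ℤ) (u : ℂ) : ℂ :=
  if a = b ∧ b = c ∧ c = d then w1 p lam a u
  else if a = b ∧ b = c ∧ |d - a| = 1 then w2 p lam (d - a) a u
  else if a = c ∧ c = d ∧ |b - a| = 1 then w2 p lam (b - a) a u
  else if b = c ∧ c = d ∧ |a - b| = 1 then w3 p lam (a - b) b u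
  else if a = b ∧ b = d ∧ |c - b| = 1 then w3 p lam (c - b) b u
  else if a = d ∧ b = c ∧ |b - a| = 1 then w4 p lam (b - a) a u
  else if a = b ∧ c = d ∧ |c - a| = 1 then w4 p lam (c - a) a u
  else if a = c ∧ |b - a| = 1 ∧ d - a = -(b - a) then w5 p lam u
  else if b = d ∧ |a - b| = 1 ∧ c - b = -(a - b) then w6 p lam b u
  else if a = c ∧ b = d ∧ |a - b| = 1 then w7 p lam (a - b) b u
  else 0

/-- The face weight of the dilute `A_L` model; `i : Fin L` stands for the height `i + 1`. -/
def W (L : ℕ) (p lam : ℝ) (a b c d : Fin L) (u : ℂ) : ℂ :=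
  faceWeight p lam ((a : ℕ) + 1) ((b : ℕ) + 1) ((c : ℕ) + 1) ((d : ℕ) + 1) u

/-! ### Paths and projectors -/

/-- Adjacency of heights for the effective adjacency matrix `I + A`. -/
def Adj (L : ℕ) (a b : Fin L) : Prop := |((a : ℕ) : ℤ) - ((b : ℕ) : ℤ)| ≤ 1

open Classical in
/-- The set of `n`-step paths from `a` to `b` on the effective adjacency diagram. -/
def paths (L n : ℕ) (a b : Fin L) : Finset (Fin (n + 1) → Fin L) :=
  Finset.univ.filter fun q =>
    q 0 = a ∧ q (Fin.last n) = b ∧ ∀ i : Fin n, Adj L (q i.castSucc) (q i.succ)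

/-- A row of `n` elementary faces with spectral parameters `u, u+2λ, …, u+2(n-1)λ` (from left to
right), with heights `bot` along the bottom and `top` along the top. -/
def rowWeight (L : ℕ) (p lam : ℝ) (n : ℕ) (u : ℂ) (bot top : Fin (n + 1) → Fin L) : ℂ :=
  ∏ k : Fin n, W L p lam (bot k.castSucc) (bot k.succ) (top k.succ) (top k.castSucc)
    (u + 2 * ((k : ℕ) : ℂ) * lam)

/-- The operator `P_{(n,0)}(u)` on `(n+1)`-step paths, with upper path `up` and lower path `low`:
a triangular array of faces, whose top row has the spectral parameters `u, u+2λ, …, u+2(n-1)λ`,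
and whose remaining rows form `P_{(n-1,0)}(-2(n-1)λ)`. -/
def proj (L : ℕ) (p lam : ℝ) :
    (n : ℕ) → ℂ → (Fin (n + 2) → Fin L) → (Fin (n + 2) → Fin L) → ℂ
  | 0, _, up, low => if up = low then 1 else 0
  | n + 1, u, up, low =>
      if up 0 = low 0 ∧ up (Fin.last (n + 2)) = low (Fin.last (n + 2)) then
        ∑ c ∈ paths L (n + 1) (low 1) (low (Fin.last (n + 2))),
          proj L p lam n (-2 * (n : ℂ) * lam) c (Fin.tail low)
            * rowWeight L p lam (n + 1) u c (Fin.init up)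
      else 0

/-- The projector `P_{(n-1,0)}(-2(n-1)λ)` of level `(n,0)` fusion, acting on `n`-step paths.
(Level zero is irrelevant.) -/
def symProj (L : ℕ) (p lam : ℝ) :
    (n : ℕ) → (Fin (n + 1) → Fin L) → (Fin (n + 1) → Fin L) → ℂ
  | 0, up, low => if up = low then 1 else 0
  | n + 1, up, low => proj L p lam n (-2 * (n : ℂ) * lam) up low

/-! ### Independent paths -/

/-- A choice of maximal sets of independent paths: `path n a b α`, for `1 ≤ α ≤ num n a b`, is the
`α`-th element `[a,b;(n,0)|α]` of the chosen set `indpath_{(n,0)}[a,b]`. Since one and the same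
bond is read as going from `a` to `b` by one face and from `b` to `a` by another one, the paths from
`b` to `a` are the reversed paths from `a` to `b`, with the same labels. -/
structure IndPaths (L : ℕ) (p lam : ℝ) where
  /-- the number of independent paths -/
  num : ℕ → Fin L → Fin L → ℕ
  /-- the independent paths -/
  path : (n : ℕ) → Fin L → Fin L → ℕ → (Fin (n + 1) → Fin L)
  mem : ∀ n a b, ∀ α ∈ Finset.Icc 1 (num n a b), path n a b α ∈ paths L n a b
  /-- the chosen paths are independent -/
  indep : ∀ n a b, ∀ x : ℕ → ℂ,
    (∀ low ∈ paths L n a b,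
      ∑ α ∈ Finset.Icc 1 (num n a b), x α * symProj L p lam n (path n a b α) low = 0) →
    ∀ α ∈ Finset.Icc 1 (num n a b), x α = 0
  /-- every path is dependent on the chosen ones -/
  maximal : ∀ n a b, ∀ q ∈ paths L n a b, ∃ x : ℕ → ℂ, ∀ low ∈ paths L n a b,
    symProj L p lam n q low
      = ∑ α ∈ Finset.Icc 1 (num n a b), x α * symProj L p lam n (path n a b α) low
  num_reverse : ∀ n a b, num n b a = num n a b
  path_reverse : ∀ n a b, a ≠ b → ∀ α ∈ Finset.Icc 1 (num n a b),
    path n b a α = path n a b α ∘ Fin.rev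

open Classical in
/-- The coefficient `φ_{(n,0)}[a,b](q|α)`: the coordinates of the path `q` with respect to the
independent paths (these coordinates are unique, by `IndPaths.indep`). -/
def IndPaths.phi {L : ℕ} {p lam : ℝ} (B : IndPaths L p lam) (n : ℕ) (a b : Fin L)
    (q : Fin (n + 1) → Fin L) : ℕ → ℂ :=
  if h : q ∈ paths L n a b then Classical.choose (B.maximal n a b q h) else 0

/-! ### Fused weights -/

/-- The fused weight `W_{(n,0)}(a b c d; α β | u)` of a row of `n` faces. -/
def fusedRow {L : ℕ} {p lam : ℝ} (B : IndPaths L p lam) (n : ℕ) (u : ℂ) (a b c d : Fin L)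
    (α β : ℕ) : ℂ :=
  ∑ q ∈ paths L n a b, B.phi n a b q α * rowWeight L p lam n u q (B.path n d c β)

/-- The fused weight `W^{(m,0)}_{(n,0)}(a b c d; α ν β μ | u)` of a block with `m` rows and `n`
columns. The corners are in the order of `faceWeight`; the bond variables are those of the bottom,
right, top and left edge, in this order. The `k`-th row from the bottom, `k = 1, …, m`, has the
spectral parameter `u - 2(m-k)λ` (below, `k` is counted from `0`), and `t` runs over the bond
variables `α₁ = α, α₂, …, α_m, α_{m+1} = β` on the horizontal edges. -/
def fusedFace {L : ℕ} {p lam : ℝ} (B : IndPaths L p lam) (m n : ℕ) (u : ℂ) (a b c d : Fin L)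
    (α ν β μ : ℕ) : ℂ :=
  ∑ q ∈ paths L m a d, B.phi m a d q μ *
    ∑ t ∈ (Fintype.piFinset fun k : Fin (m + 1) =>
        Finset.Icc 1 (B.num n (q k) (B.path m b c ν k))).filter
          (fun t => t 0 = α ∧ t (Fin.last m) = β),
      ∏ k : Fin m,
        fusedRow B n (u - 2 * ((m : ℂ) - 1 - ((k : ℕ) : ℂ)) * lam)
          (q k.castSucc) (B.path m b c ν k.castSucc) (B.path m b c ν k.succ) (q k.succ)
          (t k.castSucc) (t k.succ)

end

end DiluteA

/-!
The equation for fused faces rests on three facts: the elementary weights satisfy the Yang-Baxter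
equation, rows of faces can be pushed through the projectors, and every bond sum is the expansion of a
functional that factors through a projector.

*Elementary weights.* As a function of `u`, a weight is a theta function of order two whose total shift
depends on the four corners (`HeightModel.weight_mem`). In the
unrestricted model the heights are integers and the height `a` enters through `x + 2aλ`, with a
generic real `x` that keeps every denominator away from zero. There the difference of the two sides
of the Yang-Baxter equation is a theta function of order four in `u`, and also in `v`. It vanishes at
`u = 0`, `u = v`, `u = 3λ` and `u = v + 3λ`, by the initial condition, the symmetry of the weights
under `u ↦ 3λ - u`, and the inversion relation. A theta function of order four with four zeros whose
sum is not its total shift is zero (`thetaSpace_eq_zero`); this settles all hexagons except those for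
which the shift is degenerate both in `u` and in `v`. In these the heights on the boundary take at
most two adjacent values, and a direct evaluation at `(u, v) = (2λ, λ)` supplies the missing zero
(`HeightModel.ybe_of_point`).

*Restriction.* The weights of the `A_L` model are the limits of the unrestricted ones as `x` tends
to `0` (`IsApproximation`). The crossing factors of the heights `0` and `L + 1` tend to zero, so these
two heights drop out of the sums in the limit. What the fusion procedure uses is collected in `IsSolvable`:
the symmetries, the Yang-Baxter equation, the inversion relation at `u = 2λ`, where the right-hand
side vanishes, and two weights that do not vanish at `2λ`.

*Fusion.* By the Yang-Baxter equation, a row of faces with spectral parameters `u, u + 2λ, …` passes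
through the projector (`IsSolvable.symProj_push`), and the projector is symmetric
(`IsSolvable.symProj_comm`). A functional of paths is called `Fusible` if it factors through the
projector. Such a functional is determined by its values at the independent paths, with coefficients
`φ` (`IndPaths.sum_phi_mul`), and rows of faces preserve this property. For an edge between distinct
heights, the independent paths of the two orientations are reversals of each other; for an edge
between equal heights they are chosen only once, and a bond that is read in both directions requires
that the projector does not distinguish a closed path from its reversal
(`IsSolvable.symProj_rev_of_closed`). This holds because the inversion relation at `2λ` yields local
linear relations that lower the peaks of a path, until what remains is a palindrome.

A fused face is therefore a block of `m × n` elementary faces, with coefficients `φ` at two edges and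
independent paths at the other two (`fusedFace_eq_openFace`). Every sum over a bond
becomes a sum over all paths along that edge, and the claim reduces to the Yang-Baxter equation for
blocks (`IsSolvable.block_ybe`), an iteration of the elementary one.
-/

namespace DiluteA

/-! ### Theta series over the integers -/

section

theorem summable_pow_sq_mul_pow {r : ℝ} (h0 : 0 ≤ r) (h1 : r < 1) (C : ℝ) :
    Summable fun n : ℕ => r ^ (n ^ 2) * C ^ n := by
  apply summable_of_ratio_norm_eventually_le (r := 1 / 2) (by norm_num)
  have ht : Filter.Tendsto (fun n : ℕ => r ^ (2 * n + 1) * |C|) Filter.atTop (nhds 0) := by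
    have := (tendsto_pow_atTop_nhds_zero_of_lt_one h0 h1).comp
      (Filter.tendsto_atTop_mono (fun n : ℕ => (by omega : n ≤ 2 * n + 1)) Filter.tendsto_id)
    simpa using this.mul_const |C|
  filter_upwards [ht.eventually (gt_mem_nhds (by norm_num : (0 : ℝ) < 1 / 2))] with n hn
  have e : r ^ ((n + 1) ^ 2) * C ^ (n + 1) = r ^ (2 * n + 1) * C * (r ^ (n ^ 2) * C ^ n) := by
    rw [show (n + 1) ^ 2 = n ^ 2 + (2 * n + 1) by ring, pow_add]; ring
  rw [e, norm_mul]
  gcongr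
  rw [norm_mul, Real.norm_eq_abs, Real.norm_eq_abs, abs_of_nonneg (by positivity)]
  exact hn.le

/-- The power of the nome with a non-negative integer exponent. -/
noncomputable def nomePow (p : ℝ) (k : ℤ) : ℂ := (p : ℂ) ^ k.toNat

theorem nomePow_add (p : ℝ) {j k : ℤ} (hj : 0 ≤ j) (hk : 0 ≤ k) :
    nomePow p (j + k) = nomePow p j * nomePow p k := by
  rw [nomePow, nomePow, nomePow, ← pow_add, Int.toNat_add hj hk]

theorem nomePow_sq (p : ℝ) (k : ℤ) : nomePow (p ^ 2) k = nomePow p (2 * k) := by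
  rw [nomePow, nomePow, Complex.ofReal_pow, ← pow_mul]
  congr 1; omega

theorem norm_nomePow_le {p : ℝ} (hp : |p| < 1) {k : ℤ} {n : ℕ} (h : (n : ℤ) ≤ k) :
    ‖nomePow p k‖ ≤ |p| ^ n := by
  rw [nomePow, norm_pow, Complex.norm_real, Real.norm_eq_abs]
  exact pow_le_pow_of_le_one (abs_nonneg _) hp.le (by omega)

/-- Absolute convergence of a two-sided series whose exponents `e n` grow at least like `n²`; all theta
series below are of this form. -/
theorem summable_norm_gauss {p : ℝ} (hp : |p| < 1) (e : ℤ → ℤ)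
    (h1 : ∀ n : ℕ, ((n ^ 2 : ℕ) : ℤ) ≤ e n) (h2 : ∀ n : ℕ, ((n ^ 2 : ℕ) : ℤ) ≤ e (-(n + 1)))
    (s : ℤ → ℂ) (hs : ∀ n, ‖s n‖ ≤ 1) (a b : ℂ) :
    Summable fun n : ℤ => ‖s n * nomePow p (e n) * Complex.exp (a * n + b)‖ := by
  have key : ∀ n : ℕ, ∀ m : ℤ, ((n ^ 2 : ℕ) : ℤ) ≤ e m → |m| ≤ n + 1 →
      ‖s m * nomePow p (e m) * Complex.exp (a * m + b)‖
        ≤ Real.exp (‖a‖ + ‖b‖) * (|p| ^ (n ^ 2) * Real.exp ‖a‖ ^ n) := by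
    intro n m hm hmn
    rw [norm_mul, norm_mul]
    have h3 : ‖Complex.exp (a * m + b)‖ ≤ Real.exp (‖a‖ + ‖b‖) * Real.exp ‖a‖ ^ n := by
      refine (Complex.norm_exp_le_exp_norm _).trans ?_
      rw [← Real.exp_nat_mul, ← Real.exp_add]
      apply Real.exp_le_exp.mpr
      refine (norm_add_le _ _).trans ?_
      rw [norm_mul]
      have : ‖(m : ℂ)‖ ≤ n + 1 := by
        rw [Complex.norm_intCast]; exact_mod_cast hmn
      nlinarith [norm_nonneg a, mul_le_mul_of_nonneg_left this (norm_nonneg a)]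
    calc ‖s m‖ * ‖nomePow p (e m)‖ * ‖Complex.exp (a * m + b)‖
        ≤ 1 * |p| ^ (n ^ 2) * (Real.exp (‖a‖ + ‖b‖) * Real.exp ‖a‖ ^ n) := by
          gcongr
          · exact hs m
          · exact norm_nomePow_le hp hm
      _ = _ := by ring
  have hS := (summable_pow_sq_mul_pow (abs_nonneg p) hp (Real.exp ‖a‖)).mul_left
    (Real.exp (‖a‖ + ‖b‖))
  apply Summable.of_nat_of_neg_add_one
  · exact Summable.of_nonneg_of_le (fun _ => norm_nonneg _)
      (fun n => key n n (h1 n) (by rw [abs_of_nonneg (by positivity)]; omega)) hS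
  · exact Summable.of_nonneg_of_le (fun _ => norm_nonneg _)
      (fun n => key n _ (h2 n) (by rw [abs_neg, abs_of_nonneg (by positivity)])) hS

theorem norm_neg_one_zpow (n : ℤ) : ‖(-1 : ℂ) ^ n‖ ≤ 1 := by
  rw [norm_zpow]; simp

/-- The summand of the two-sided series for `ϑ₁`. -/
noncomputable def term1 (p : ℝ) (u : ℂ) (n : ℤ) : ℂ :=
  (-1) ^ n * nomePow p (n * (n + 1)) * Complex.exp ((2 * u * Complex.I) * n + u * Complex.I)

/-- The summand of the two-sided series for `ϑ₄`. -/
noncomputable def term4 (p : ℝ) (u : ℂ) (n : ℤ) : ℂ :=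
  (-1) ^ n * nomePow p (n ^ 2) * Complex.exp ((2 * u * Complex.I) * n + 0)

theorem summable_term1 {p : ℝ} (hp : |p| < 1) (u : ℂ) : Summable fun n => ‖term1 p u n‖ :=
  summable_norm_gauss hp (fun n => n * (n + 1)) (fun n => by push_cast; nlinarith)
    (fun n => by push_cast; nlinarith) _ norm_neg_one_zpow _ _

theorem summable_term4 {p : ℝ} (hp : |p| < 1) (u : ℂ) : Summable fun n => ‖term4 p u n‖ :=
  summable_norm_gauss hp (fun n => n ^ 2) (fun n => by push_cast; nlinarith)
    (fun n => by rw [neg_sq]; push_cast; nlinarith [Nat.cast_nonneg (α := ℤ) n]) _ norm_neg_one_zpow _ _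

/-- The two-sided form of `ϑ₁`; the terms `n` and `-1 - n` form the sine. -/
theorem theta1_eq_tsum {p : ℝ} (hp : |p| < 1) (u : ℂ) :
    theta1 p u = -Complex.I * ∑' n : ℤ, term1 p u n := by
  have hs := (summable_term1 hp u).of_norm
  have i1 : Summable fun n : ℕ => term1 p u n := hs.comp_injective Nat.cast_injective
  have i2 : Summable fun n : ℕ => term1 p u (-(n + 1)) :=
    hs.comp_injective (fun a b h => by simpa using h)
  rw [tsum_of_nat_of_neg_add_one i1 i2, ← i1.tsum_add i2, theta1, ← tsum_mul_left, ← tsum_mul_left]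
  congr 1; ext n
  have e1 : nomePow p ((n : ℤ) * (n + 1)) = (p : ℂ) ^ (n * (n + 1)) := by
    rw [nomePow]; rfl
  have e2 : nomePow p (-((n : ℤ) + 1) * (-((n : ℤ) + 1) + 1)) = (p : ℂ) ^ (n * (n + 1)) := by
    rw [← e1]; congr 1; ring
  have e3 : (-1 : ℂ) ^ (-((n : ℤ) + 1)) = -(-1) ^ n := by
    rw [zpow_neg, zpow_add₀ (by norm_num), zpow_natCast]
    rcases neg_one_pow_eq_or ℂ n with h | h <;> rw [h] <;> norm_num
  rw [term1, term1, e1, e2, e3, zpow_natCast, Complex.sin]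
  push_cast
  rw [show 2 * u * Complex.I * n + u * Complex.I = (2 * n + 1) * u * Complex.I by ring,
    show 2 * u * Complex.I * (-(n + 1)) + u * Complex.I = -((2 * n + 1) * u) * Complex.I by ring]
  ring

/-- The two-sided form of `ϑ₄`; the terms `n` and `-n` form the cosine. -/
theorem theta4_eq_tsum {p : ℝ} (hp : |p| < 1) (u : ℂ) :
    theta4 p u = ∑' n : ℤ, term4 p u n := by
  have hs := (summable_term4 hp u).of_norm
  have i1 : Summable fun n : ℕ => term4 p u (n + 1) :=
    hs.comp_injective (fun a b h => by simpa using h)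
  have i2 : Summable fun n : ℕ => term4 p u (-(n + 1)) :=
    hs.comp_injective (fun a b h => by simpa using h)
  rw [tsum_of_add_one_of_neg_add_one i1 i2, add_right_comm, ← i1.tsum_add i2, theta4,
    ← tsum_mul_left, add_comm]
  have e0 : term4 p u 0 = 1 := by simp [term4, nomePow]
  rw [e0]
  congr 2; ext n
  have e1 : nomePow p (((n : ℤ) + 1) ^ 2) = (p : ℂ) ^ ((n + 1) ^ 2) := by
    rw [nomePow]; congr 1
  have e2 : nomePow p ((-((n : ℤ) + 1)) ^ 2) = (p : ℂ) ^ ((n + 1) ^ 2) := by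
    rw [← e1]; congr 1
  have e4 : (-1 : ℂ) ^ ((n : ℤ) + 1) = (-1) ^ (n + 1) := by exact_mod_cast zpow_natCast (-1 : ℂ) (n + 1)
  have e3 : (-1 : ℂ) ^ (-((n : ℤ) + 1)) = (-1) ^ (n + 1) := by
    rw [zpow_neg, e4]
    rcases neg_one_pow_eq_or ℂ (n + 1) with h | h <;> rw [h] <;> norm_num
  rw [term4, term4, e1, e2, e3, e4, Complex.cos]
  push_cast
  rw [show 2 * u * Complex.I * (n + 1) + 0 = 2 * (n + 1) * u * Complex.I by ring,
    show 2 * u * Complex.I * (-(n + 1)) + 0 = -(2 * (n + 1) * u) * Complex.I by ring]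
  ring

/-- The bijection behind products of theta functions: a pair of integers `(m, n)` is either
`(j + k, j - k)` or `(j + k + 1, j - k)`, according to the parity of `m + n`. -/
noncomputable def parityEquiv : (ℤ × ℤ) ⊕ (ℤ × ℤ) ≃ ℤ × ℤ :=
  Equiv.ofBijective
    (Sum.elim (fun q => (q.1 + q.2, q.1 - q.2)) (fun q => (q.1 + q.2 + 1, q.1 - q.2))) <| by
    constructor
    · rintro (⟨a, b⟩ | ⟨a, b⟩) (⟨c, d⟩ | ⟨c, d⟩) h <;>
        simp only [Sum.elim_inl, Sum.elim_inr, Prod.mk.injEq, Sum.inl.injEq, Sum.inr.injEq,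
          reduceCtorEq] at h ⊢ <;> omega
    · rintro ⟨m, n⟩
      rcases Int.even_or_odd' (m + n) with ⟨k, h | h⟩
      · exact ⟨Sum.inl (k, m - k), by simp; omega⟩
      · exact ⟨Sum.inr (k, m - k - 1), by simp; omega⟩

/-- The product of two series over `ℤ`, in terms of half the sum and half the difference of the two
indices. -/
theorem tsum_mul_tsum_parity {F G : ℤ → ℂ} (hF : Summable fun n => ‖F n‖)
    (hG : Summable fun n => ‖G n‖) :
    (∑' n, F n) * ∑' n, G n = (∑' q : ℤ × ℤ, F (q.1 + q.2) * G (q.1 - q.2))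
      + ∑' q : ℤ × ℤ, F (q.1 + q.2 + 1) * G (q.1 - q.2) := by
  have hs := summable_mul_of_summable_norm hF hG
  rw [tsum_mul_tsum_of_summable_norm hF hG, ← parityEquiv.tsum_eq]
  have hs' := (parityEquiv.summable_iff (f := fun z : ℤ × ℤ => F z.1 * G z.2)).mpr hs
  have h1 := (hs'.comp_injective (Sum.inl_injective (β := ℤ × ℤ))).hasSum
  have h2 := (hs'.comp_injective (Sum.inr_injective (α := ℤ × ℤ))).hasSum
  exact (HasSum.sum h1 h2).tsum_eq

/-- The theta series `A(x) = ∑ₙ p^{2n²} e^{4inx}`. -/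
noncomputable def seriesA (p : ℝ) (x : ℂ) : ℂ :=
  ∑' n : ℤ, 1 * nomePow p (2 * n ^ 2) * Complex.exp (4 * x * Complex.I * n + 0)

/-- The theta series `B(x) = ∑ₙ p^{2n(n+1)} e^{2i(2n+1)x}`. -/
noncomputable def seriesB (p : ℝ) (x : ℂ) : ℂ :=
  ∑' n : ℤ, 1 * nomePow p (2 * (n * (n + 1))) * Complex.exp (4 * x * Complex.I * n + 2 * x * Complex.I)

theorem summable_seriesA {p : ℝ} (hp : |p| < 1) (x : ℂ) :
    Summable fun n : ℤ => ‖1 * nomePow p (2 * n ^ 2) * Complex.exp (4 * x * Complex.I * n + 0)‖ :=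
  summable_norm_gauss hp (fun n => 2 * n ^ 2) (fun n => by push_cast; nlinarith)
    (fun n => by rw [neg_sq]; push_cast; nlinarith [Nat.cast_nonneg (α := ℤ) n]) (fun _ => 1) (by simp) _ _

theorem summable_seriesB {p : ℝ} (hp : |p| < 1) (x : ℂ) :
    Summable fun n : ℤ => ‖1 * nomePow p (2 * (n * (n + 1)))
      * Complex.exp (4 * x * Complex.I * n + 2 * x * Complex.I)‖ :=
  summable_norm_gauss hp (fun n => 2 * (n * (n + 1))) (fun n => by push_cast; nlinarith)
    (fun n => by push_cast; nlinarith) (fun _ => 1) (by simp) _ _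

theorem int_mul_succ_nonneg (n : ℤ) : 0 ≤ n * (n + 1) := by
  rcases le_or_gt 0 n with h | h <;> nlinarith

theorem neg_one_zpow_add_mul_sub (j k : ℤ) : (-1 : ℂ) ^ (j + k) * (-1) ^ (j - k) = 1 := by
  rw [← zpow_add₀ (by norm_num), show j + k + (j - k) = 2 * j by ring]
  exact (even_two_mul j).neg_one_zpow

theorem neg_one_zpow_succ_mul_sub (j k : ℤ) : (-1 : ℂ) ^ (j + k + 1) * (-1) ^ (j - k) = -1 := by
  rw [← zpow_add₀ (by norm_num), show j + k + 1 + (j - k) = 2 * j + 1 by ring]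
  exact (odd_two_mul_add_one j).neg_one_zpow

/-- With `theta1_mul_theta1`, this makes every three-term identity between theta functions a polynomial
identity in the values of `seriesA` and `seriesB`. -/
theorem theta4_mul_theta4 {p : ℝ} (hp : |p| < 1) (x y : ℂ) :
    theta4 p (x + y) * theta4 p (x - y)
      = seriesA p x * seriesA p y - p * (seriesB p x * seriesB p y) := by
  rw [theta4_eq_tsum hp, theta4_eq_tsum hp,
    tsum_mul_tsum_parity (summable_term4 hp _) (summable_term4 hp _), seriesA, seriesA, seriesB,
    seriesB, tsum_mul_tsum_of_summable_norm (summable_seriesA hp x) (summable_seriesA hp y),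
    tsum_mul_tsum_of_summable_norm (summable_seriesB hp x) (summable_seriesB hp y),
    ← tsum_mul_left]
  conv_rhs => rw [sub_eq_add_neg, ← tsum_neg]
  have hn : ∀ n : ℤ, 0 ≤ 2 * (n * (n + 1)) := fun n => by have := int_mul_succ_nonneg n; omega
  congr 2 <;> ext ⟨j, k⟩
  · simp only [term4]
    calc _ = ((-1) ^ (j + k) * (-1) ^ (j - k)) * (nomePow p ((j + k) ^ 2) * nomePow p ((j - k) ^ 2))
          * (Complex.exp (2 * (x + y) * Complex.I * (j + k : ℤ) + 0)
            * Complex.exp (2 * (x - y) * Complex.I * (j - k : ℤ) + 0)) := by ring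
      _ = 1 * (nomePow p (2 * j ^ 2) * nomePow p (2 * k ^ 2))
          * (Complex.exp (4 * x * Complex.I * j + 0) * Complex.exp (4 * y * Complex.I * k + 0)) := by
        rw [neg_one_zpow_add_mul_sub, ← nomePow_add p (by positivity) (by positivity),
          ← nomePow_add p (by positivity) (by positivity), ← Complex.exp_add, ← Complex.exp_add]
        congr 1
        · congr 2; ring
        · congr 1; push_cast; ring
      _ = _ := by ring
  · simp only [term4]
    have hp1 : (p : ℂ) = nomePow p 1 := by simp [nomePow]
    calc _ = ((-1) ^ (j + k + 1) * (-1) ^ (j - k))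
          * (nomePow p ((j + k + 1) ^ 2) * nomePow p ((j - k) ^ 2))
          * (Complex.exp (2 * (x + y) * Complex.I * (j + k + 1 : ℤ) + 0)
            * Complex.exp (2 * (x - y) * Complex.I * (j - k : ℤ) + 0)) := by ring
      _ = (-1) * (nomePow p 1 * (nomePow p (2 * (j * (j + 1))) * nomePow p (2 * (k * (k + 1)))))
          * (Complex.exp (4 * x * Complex.I * j + 2 * x * Complex.I)
            * Complex.exp (4 * y * Complex.I * k + 2 * y * Complex.I)) := by
        rw [neg_one_zpow_succ_mul_sub, ← nomePow_add p (by positivity) (by positivity),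
          ← nomePow_add p (hn j) (hn k), ← nomePow_add p (by norm_num) (add_nonneg (hn j) (hn k)),
          ← Complex.exp_add, ← Complex.exp_add]
        congr 1
        · congr 2; ring
        · congr 1; push_cast; ring
      _ = _ := by rw [← hp1]; ring

theorem theta1_mul_theta1 {p : ℝ} (hp : |p| < 1) (x y : ℂ) :
    theta1 p (x + y) * theta1 p (x - y)
      = seriesA p x * seriesB p y - seriesB p x * seriesA p y := by
  rw [theta1_eq_tsum hp, theta1_eq_tsum hp,
    mul_mul_mul_comm, show -Complex.I * -Complex.I = -1 by simp,
    tsum_mul_tsum_parity (summable_term1 hp _) (summable_term1 hp _), seriesA, seriesA, seriesB,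
    seriesB, tsum_mul_tsum_of_summable_norm (summable_seriesA hp x) (summable_seriesB hp y),
    tsum_mul_tsum_of_summable_norm (summable_seriesB hp x) (summable_seriesA hp y),
    mul_add, ← tsum_mul_left, ← tsum_mul_left, add_comm]
  conv_rhs => rw [sub_eq_add_neg, ← tsum_neg]
  have hn : ∀ n : ℤ, 0 ≤ 2 * (n * (n + 1)) := fun n => by have := int_mul_succ_nonneg n; omega
  have hn1 := int_mul_succ_nonneg
  have hs : ∀ n : ℤ, 0 ≤ 2 * n ^ 2 := fun n => by positivity
  rw [← (Equiv.prodShear (Equiv.addRight (-1 : ℤ)) (fun _ => Equiv.refl ℤ)).tsum_eq]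
  congr 2 <;> ext ⟨j, k⟩
  · simp only [term1, Equiv.prodShear_apply, Equiv.coe_addRight, Equiv.refl_apply]
    have hsgn : (-1 : ℂ) ^ (j + -1 + k + 1) * (-1) ^ (j + -1 - k) = -1 := by
      rw [show j + -1 - k = (j - k) - 1 by ring, show j + -1 + k + 1 = j + k by ring,
        zpow_sub₀ (by norm_num), ← mul_div_assoc, neg_one_zpow_add_mul_sub]; norm_num
    calc _ = (-1) * ((-1) ^ (j + -1 + k + 1) * (-1) ^ (j + -1 - k))
          * (nomePow p ((j + -1 + k + 1) * (j + -1 + k + 1 + 1))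
            * nomePow p ((j + -1 - k) * (j + -1 - k + 1)))
          * (Complex.exp (2 * (x + y) * Complex.I * (j + -1 + k + 1 : ℤ) + (x + y) * Complex.I)
            * Complex.exp (2 * (x - y) * Complex.I * (j + -1 - k : ℤ) + (x - y) * Complex.I)) := by
            ring
      _ = (1 * (nomePow p (2 * j ^ 2) * nomePow p (2 * (k * (k + 1)))))
          * (Complex.exp (4 * x * Complex.I * j + 0)
            * Complex.exp (4 * y * Complex.I * k + 2 * y * Complex.I)) := by
        rw [hsgn, ← nomePow_add p (hn1 _) (hn1 _),
          ← nomePow_add p (hs j) (hn k), ← Complex.exp_add, ← Complex.exp_add]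
        rw [show (-1 : ℂ) * -1 = 1 by norm_num]
        congr 1
        · congr 2; ring
        · congr 1; push_cast; ring
      _ = _ := by ring
  · simp only [term1]
    calc _ = (-1) * ((-1) ^ (j + k) * (-1) ^ (j - k))
          * (nomePow p ((j + k) * (j + k + 1)) * nomePow p ((j - k) * (j - k + 1)))
          * (Complex.exp (2 * (x + y) * Complex.I * (j + k : ℤ) + (x + y) * Complex.I)
            * Complex.exp (2 * (x - y) * Complex.I * (j - k : ℤ) + (x - y) * Complex.I)) := by ring
      _ = (-1) * (nomePow p (2 * (j * (j + 1))) * nomePow p (2 * k ^ 2))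
          * (Complex.exp (4 * x * Complex.I * j + 2 * x * Complex.I)
            * Complex.exp (4 * y * Complex.I * k + 0)) := by
        rw [neg_one_zpow_add_mul_sub, mul_one, ← nomePow_add p (hn1 _) (hn1 _),
          ← nomePow_add p (hn j) (hs k), ← Complex.exp_add, ← Complex.exp_add]
        congr 1
        · congr 2; ring
        · congr 1; push_cast; ring
      _ = _ := by ring

end

/-! ### Zeros and signs on the real axis -/

section

theorem theta1_neg (p : ℝ) (u : ℂ) : theta1 p (-u) = -theta1 p u := by
  simp only [theta1, mul_neg, Complex.sin_neg, tsum_neg]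

theorem theta4_neg (p : ℝ) (u : ℂ) : theta4 p (-u) = theta4 p u := by
  simp only [theta4, mul_neg, Complex.cos_neg]

theorem theta1_zero (p : ℝ) : theta1 p 0 = 0 := by
  simp [theta1]

theorem summable_norm_nomePow_quadratic {p : ℝ} (hp : |p| < 1) :
    Summable fun n : ℤ => ‖nomePow p (2 * n * (2 * n + 1))‖ := by
  simpa using summable_norm_gauss hp (fun n => 2 * n * (2 * n + 1))
    (fun n => by push_cast; nlinarith [Nat.cast_nonneg (α := ℤ) n])
    (fun n => by push_cast; nlinarith [Nat.cast_nonneg (α := ℤ) n]) (fun _ => 1) (by simp) 0 0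

/-- The constant `∑ₖ p^{2k(2k+1)}` of the transformation of `ϑ₁` from the nome `p` to `p²`. -/
noncomputable def landenConst (p : ℝ) : ℂ := ∑' k : ℤ, nomePow p (2 * k * (2 * k + 1))

theorem nonneg_two_mul (j : ℤ) : 0 ≤ 2 * j * (2 * j + 1) := int_mul_succ_nonneg (2 * j)

theorem summable_landen {p : ℝ} (hp : |p| < 1) (z : ℂ) :
    Summable fun n : ℤ => ‖nomePow p (2 * n * (2 * n + 1))
      * Complex.exp (4 * z * Complex.I * n + z * Complex.I)‖ := by
  simpa using summable_norm_gauss hp (fun n => 2 * n * (2 * n + 1))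
    (fun n => by push_cast; nlinarith [Nat.cast_nonneg (α := ℤ) n])
    (fun n => by push_cast; nlinarith [Nat.cast_nonneg (α := ℤ) n]) (fun _ => 1) (by simp) _ _

theorem summable_landen' {p : ℝ} (hp : |p| < 1) (z : ℂ) :
    Summable fun n : ℤ => ‖nomePow p ((2 * n + 1) * (2 * n + 2))
      * Complex.exp (4 * z * Complex.I * n + 3 * z * Complex.I)‖ := by
  simpa using summable_norm_gauss hp (fun n => (2 * n + 1) * (2 * n + 2))
    (fun n => by push_cast; nlinarith [Nat.cast_nonneg (α := ℤ) n])
    (fun n => by push_cast; nlinarith [Nat.cast_nonneg (α := ℤ) n]) (fun _ => 1) (by simp) _ _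

theorem summable_nomePow_odd {p : ℝ} (hp : |p| < 1) :
    Summable fun n : ℤ => ‖nomePow p ((2 * n + 1) * (2 * n + 2))‖ := by
  simpa using summable_landen' hp 0

/-- Separating the terms of even and odd index. -/
theorem tsum_int_even_add_odd {f : ℤ → ℂ} (hf : Summable f) :
    ∑' n, f n = ∑' n, f (2 * n) + ∑' n, f (2 * n + 1) := by
  have h1 := (hf.comp_injective (i := fun n : ℤ => 2 * n) (fun a b h => by simpa using h)).hasSum
  have h2 := (hf.comp_injective (i := fun n : ℤ => 2 * n + 1)
    (fun a b h => by simpa using h)).hasSum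
  have i1 : Function.Injective fun n : ℤ => 2 * n := fun a b h => by simpa using h
  have i2 : Function.Injective fun n : ℤ => 2 * n + 1 := fun a b h => by simpa using h
  have h1' := (i1.hasSum_range_iff (f := f)).mpr h1
  have h2' := (i2.hasSum_range_iff (f := f)).mpr h2
  refine (HasSum.add_isCompl ?_ h1' h2').tsum_eq
  constructor
  · rw [Set.disjoint_iff]
    rintro _ ⟨⟨a, rfl⟩, ⟨b, hb⟩⟩
    simp only at hb
    omega
  · rw [codisjoint_iff_le_sup]
    intro n _
    rcases Int.even_or_odd' n with ⟨k, h | h⟩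
    · exact Or.inl ⟨k, h.symm⟩
    · exact Or.inr ⟨k, h.symm⟩

/-- The transformation of `ϑ₁` from the nome `p` to `p²`, which keeps the argument. -/
theorem landenConst_mul_theta1 {p : ℝ} (hp : |p| < 1) (z : ℂ) :
    landenConst p * theta1 p z = theta1 (p ^ 2) z * theta4 (p ^ 2) z := by
  have hp2 : |p ^ 2| < 1 := by rw [abs_pow]; exact pow_lt_one₀ (abs_nonneg _) hp (by norm_num)
  have hodd : ∑' k : ℤ, nomePow p ((2 * k + 1) * (2 * k + 2)) = landenConst p := by
    rw [landenConst, ← ((Equiv.neg ℤ).trans (Equiv.addRight (-1))).tsum_eq]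
    congr 1; ext k
    simp only [Equiv.trans_apply, Equiv.neg_apply, Equiv.coe_addRight]
    congr 1; ring
  rw [theta1_eq_tsum hp, theta1_eq_tsum hp2, theta4_eq_tsum hp2, mul_assoc,
    tsum_mul_tsum_parity (summable_term1 hp2 _) (summable_term4 hp2 _),
    tsum_int_even_add_odd (summable_term1 hp z).of_norm, mul_left_comm, mul_add]
  nth_rw 2 [← hodd]
  rw [landenConst]
  have t1 : ∀ n : ℤ, term1 p z (2 * n) = nomePow p (2 * n * (2 * n + 1))
      * Complex.exp (4 * z * Complex.I * n + z * Complex.I) := fun n => by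
    rw [term1, (even_two_mul n).neg_one_zpow, one_mul]
    congr 2; push_cast; ring
  have t2 : ∀ n : ℤ, term1 p z (2 * n + 1) = -(nomePow p ((2 * n + 1) * (2 * n + 2))
      * Complex.exp (4 * z * Complex.I * n + 3 * z * Complex.I)) := fun n => by
    rw [term1, (odd_two_mul_add_one n).neg_one_zpow, neg_one_mul, neg_mul]
    congr 2
    · congr 1; ring
    · congr 1; push_cast; ring
  simp_rw [t1, t2, tsum_neg]
  rw [mul_comm (∑' k : ℤ, nomePow p (2 * k * (2 * k + 1))),
    mul_comm (∑' k : ℤ, nomePow p ((2 * k + 1) * (2 * k + 2))), neg_mul (∑' _, _), neg_mul Complex.I,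
    tsum_mul_tsum_of_summable_norm (summable_landen hp z)
    (summable_norm_nomePow_quadratic hp), tsum_mul_tsum_of_summable_norm (summable_landen' hp z)
    (summable_nomePow_odd hp), ← tsum_neg, neg_mul]
  congr 4 <;> ext ⟨j, k⟩
  · simp only [term1, term4, nomePow_sq]
    calc _ = (nomePow p (2 * j * (2 * j + 1)) * nomePow p (2 * k * (2 * k + 1)))
          * Complex.exp (4 * z * Complex.I * j + z * Complex.I) := by ring
      _ = ((-1) ^ (j + k) * (-1) ^ (j - k))
          * (nomePow p (2 * ((j + k) * (j + k + 1))) * nomePow p (2 * (j - k) ^ 2))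
          * (Complex.exp (2 * z * Complex.I * (j + k : ℤ) + z * Complex.I)
            * Complex.exp (2 * z * Complex.I * (j - k : ℤ) + 0)) := by
        rw [neg_one_zpow_add_mul_sub, one_mul,
          ← nomePow_add p (nonneg_two_mul j) (nonneg_two_mul k), ← nomePow_add p
            (by have := int_mul_succ_nonneg (j + k); omega) (by positivity), ← Complex.exp_add]
        congr 1
        · congr 1; ring
        · congr 1; push_cast; ring
      _ = _ := by ring
  · simp only [term1, term4, nomePow_sq]
    have h0 : ∀ j : ℤ, 0 ≤ (2 * j + 1) * (2 * j + 2) := fun j => by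
      have := int_mul_succ_nonneg (2 * j + 1); rw [show 2 * j + 1 + 1 = 2 * j + 2 by ring] at this
      exact this
    calc _ = -((nomePow p ((2 * j + 1) * (2 * j + 2)) * nomePow p ((2 * k + 1) * (2 * k + 2)))
          * Complex.exp (4 * z * Complex.I * j + 3 * z * Complex.I)) := by ring
      _ = ((-1) ^ (j + k + 1) * (-1) ^ (j - k))
          * (nomePow p (2 * ((j + k + 1) * (j + k + 1 + 1))) * nomePow p (2 * (j - k) ^ 2))
          * (Complex.exp (2 * z * Complex.I * (j + k + 1 : ℤ) + z * Complex.I)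
            * Complex.exp (2 * z * Complex.I * (j - k : ℤ) + 0)) := by
        rw [neg_one_zpow_succ_mul_sub, neg_one_mul, neg_mul,
          ← nomePow_add p (h0 j) (h0 k), ← nomePow_add p
            (by have := int_mul_succ_nonneg (j + k + 1); omega) (by positivity), ← Complex.exp_add]
        congr 2
        · congr 1; ring
        · congr 1; push_cast; ring
      _ = _ := by ring

theorem term4_neg_nome (p : ℝ) (z : ℂ) (n : ℤ) : term4 (-p) z n
    = nomePow p (n ^ 2) * Complex.exp ((2 * z * Complex.I) * n + 0) := by
  have : (-1 : ℂ) ^ n * nomePow (-p) (n ^ 2) = nomePow p (n ^ 2) := by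
    rw [nomePow, nomePow, Complex.ofReal_neg, neg_pow, ← mul_assoc]
    have : (-1 : ℂ) ^ n * (-1) ^ (n ^ 2).toNat = 1 := by
      rw [← zpow_natCast, Int.toNat_of_nonneg (by positivity), ← zpow_add₀ (by norm_num)]
      apply Even.neg_one_zpow
      rw [show n + n ^ 2 = n * (n + 1) by ring]
      exact Int.even_mul_succ_self n
    rw [this, one_mul]
  rw [term4, this]

/-- The transformation of `ϑ₄` from the nome `p` to `p²`, which doubles the argument. -/
theorem theta4_mul_theta4_neg_nome {p : ℝ} (hp : |p| < 1) (z : ℂ) :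
    theta4 p z * theta4 (-p) z = theta4 (p ^ 2) (2 * z) * theta4 (p ^ 2) 0 := by
  have hp2 : |p ^ 2| < 1 := by rw [abs_pow]; exact pow_lt_one₀ (abs_nonneg _) hp (by norm_num)
  have hpn : |-p| < 1 := by rwa [abs_neg]
  rw [theta4_eq_tsum hp, theta4_eq_tsum hpn, theta4_eq_tsum hp2, theta4_eq_tsum hp2,
    tsum_mul_tsum_parity (summable_term4 hp _) (summable_term4 hpn _),
    tsum_mul_tsum_of_summable_norm (summable_term4 hp2 _) (summable_term4 hp2 _)]
  -- the odd part is antisymmetric under `k ↦ -1 - k`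
  have hodd : ∑' q : ℤ × ℤ, term4 p z (q.1 + q.2 + 1) * term4 (-p) z (q.1 - q.2) = 0 := by
    rw [← self_eq_neg, ← tsum_neg,
      ← (Equiv.prodCongr (Equiv.refl ℤ) ((Equiv.neg ℤ).trans (Equiv.addRight (-1)))).tsum_eq]
    congr 1; ext ⟨j, k⟩
    simp only [Equiv.prodCongr_apply, Equiv.refl_apply, Prod.map, Equiv.trans_apply,
      Equiv.neg_apply, Equiv.coe_addRight, term4_neg_nome]
    simp only [term4]
    have hs : (-1 : ℂ) ^ (j + (-k + -1) + 1) = -(-1) ^ (j + k + 1) := by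
      rw [show j + (-k + -1) + 1 = (j + k + 1) + (-(2 * k + 1)) by ring,
        zpow_add₀ (by norm_num), (odd_two_mul_add_one k).neg.neg_one_zpow]; ring
    rw [hs, show j + (-k + -1) + 1 = j - k by ring, show j - (-k + -1) = j + k + 1 by ring]
    ring
  rw [hodd, add_zero]
  congr 1; ext ⟨j, k⟩
  simp only [term4_neg_nome]
  simp only [term4, nomePow_sq]
  have hs : (-1 : ℂ) ^ (j + k) = (-1) ^ j * (-1) ^ k := zpow_add₀ (by norm_num) _ _
  calc _ = (-1) ^ (j + k) * (nomePow p ((j + k) ^ 2) * nomePow p ((j - k) ^ 2))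
        * (Complex.exp (2 * z * Complex.I * (j + k : ℤ) + 0)
          * Complex.exp (2 * z * Complex.I * (j - k : ℤ) + 0)) := by ring
    _ = (-1) ^ j * (-1) ^ k * (nomePow p (2 * j ^ 2) * nomePow p (2 * k ^ 2))
        * (Complex.exp (2 * (2 * z) * Complex.I * j + 0)
          * Complex.exp (2 * 0 * Complex.I * k + 0)) := by
      rw [hs, ← nomePow_add p (by positivity) (by positivity),
        ← nomePow_add p (by positivity) (by positivity), ← Complex.exp_add, ← Complex.exp_add]
      congr 1
      · congr 2; ring
      · congr 1; push_cast; ring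
    _ = _ := by ring

theorem norm_sin_le (u : ℂ) : ‖Complex.sin u‖ ≤ Real.exp ‖u‖ := by
  rw [Complex.sin]
  have h1 := Complex.norm_exp_le_exp_norm (-u * Complex.I)
  have h2 := Complex.norm_exp_le_exp_norm (u * Complex.I)
  rw [norm_mul, Complex.norm_I, mul_one] at h1 h2
  rw [norm_neg] at h1
  rw [norm_div, norm_mul, Complex.norm_I, mul_one, Complex.norm_ofNat]
  linarith [norm_sub_le (Complex.exp (-u * Complex.I)) (Complex.exp (u * Complex.I))]

theorem norm_cos_le (u : ℂ) : ‖Complex.cos u‖ ≤ Real.exp ‖u‖ := by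
  rw [Complex.cos]
  have h1 := Complex.norm_exp_le_exp_norm (-u * Complex.I)
  have h2 := Complex.norm_exp_le_exp_norm (u * Complex.I)
  rw [norm_mul, Complex.norm_I, mul_one] at h1 h2
  rw [norm_neg] at h1
  rw [norm_div, Complex.norm_ofNat]
  linarith [norm_add_le (Complex.exp (u * Complex.I)) (Complex.exp (-u * Complex.I))]

theorem differentiable_of_ball {f : ℂ → ℂ}
    (h : ∀ R : ℝ, 0 < R → DifferentiableOn ℂ f (Metric.ball 0 R)) : Differentiable ℂ f := by
  intro z
  refine (h (‖z‖ + 1) (by positivity)).differentiableAt (Metric.isOpen_ball.mem_nhds ?_)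
  simp

theorem differentiable_theta1 {p : ℝ} (hp : |p| < 1) : Differentiable ℂ (theta1 p) := by
  apply differentiable_of_ball
  intro R hR
  unfold theta1
  apply DifferentiableOn.const_mul
  refine Complex.differentiableOn_tsum_of_summable_norm
    (u := fun n : ℕ => Real.exp R * (|p| ^ (n ^ 2) * Real.exp (2 * R) ^ n))
    ((summable_pow_sq_mul_pow (abs_nonneg p) hp _).mul_left _) (fun n => ?_)
    Metric.isOpen_ball (fun n w hw => ?_)
  · exact Differentiable.differentiableOn (by fun_prop)
  · rw [norm_mul, norm_mul, norm_pow, norm_neg, norm_one, one_pow, one_mul, norm_pow,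
      Complex.norm_real, Real.norm_eq_abs]
    have h1 : |p| ^ (n * (n + 1)) ≤ |p| ^ (n ^ 2) :=
      pow_le_pow_of_le_one (abs_nonneg _) hp.le (by nlinarith)
    have h2 : ‖Complex.sin ((2 * n + 1) * w)‖ ≤ Real.exp R * Real.exp (2 * R) ^ n := by
      refine (norm_sin_le _).trans ?_
      rw [← Real.exp_nat_mul, ← Real.exp_add]
      apply Real.exp_le_exp.mpr
      have hw' : ‖w‖ ≤ R := by simpa using (mem_ball_zero_iff.mp hw).le
      have : ‖(2 * n + 1 : ℂ)‖ = 2 * n + 1 := by exact_mod_cast Complex.norm_natCast (2 * n + 1)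
      rw [norm_mul, this]
      nlinarith [mul_le_mul_of_nonneg_left hw' (by positivity : (0 : ℝ) ≤ 2 * n + 1)]
    calc _ ≤ |p| ^ (n ^ 2) * (Real.exp R * Real.exp (2 * R) ^ n) := by gcongr
      _ = _ := by ring

theorem differentiable_theta4 {p : ℝ} (hp : |p| < 1) : Differentiable ℂ (theta4 p) := by
  apply differentiable_of_ball
  intro R hR
  unfold theta4
  apply DifferentiableOn.const_add
  apply DifferentiableOn.const_mul
  refine Complex.differentiableOn_tsum_of_summable_norm
    (u := fun n : ℕ => Real.exp (2 * R) * (|p| ^ (n ^ 2) * Real.exp (2 * R) ^ n))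
    ((summable_pow_sq_mul_pow (abs_nonneg p) hp _).mul_left _) (fun n => ?_)
    Metric.isOpen_ball (fun n w hw => ?_)
  · exact Differentiable.differentiableOn (by fun_prop)
  · rw [norm_mul, norm_mul, norm_pow, norm_neg, norm_one, one_pow, one_mul, norm_pow,
      Complex.norm_real, Real.norm_eq_abs]
    have h1 : |p| ^ ((n + 1) ^ 2) ≤ |p| ^ (n ^ 2) :=
      pow_le_pow_of_le_one (abs_nonneg _) hp.le (Nat.pow_le_pow_left (by omega) 2)
    have h2 : ‖Complex.cos (2 * (n + 1) * w)‖ ≤ Real.exp (2 * R) * Real.exp (2 * R) ^ n := by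
      refine (norm_cos_le _).trans ?_
      rw [← Real.exp_nat_mul, ← Real.exp_add]
      apply Real.exp_le_exp.mpr
      have hw' : ‖w‖ ≤ R := by simpa using (mem_ball_zero_iff.mp hw).le
      have : ‖(2 * (n + 1) : ℂ)‖ = 2 * (n + 1) := by
        exact_mod_cast Complex.norm_natCast (2 * (n + 1))
      rw [norm_mul, this]
      nlinarith [mul_le_mul_of_nonneg_left hw' (by positivity : (0 : ℝ) ≤ 2 * (n + 1))]
    calc _ ≤ |p| ^ (n ^ 2) * (Real.exp (2 * R) * Real.exp (2 * R) ^ n) := by gcongr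
      _ = _ := by ring

end

section

/-- `ϑ₁` on the real axis. -/
noncomputable def realTheta1 (p y : ℝ) : ℝ :=
  2 * ∑' n : ℕ, (-1) ^ n * p ^ (n * (n + 1)) * Real.sin ((2 * n + 1) * y)

/-- `ϑ₄` on the real axis. -/
noncomputable def realTheta4 (p y : ℝ) : ℝ :=
  1 + 2 * ∑' n : ℕ, (-1) ^ (n + 1) * p ^ ((n + 1) ^ 2) * Real.cos (2 * (n + 1) * y)

theorem theta1_ofReal (p y : ℝ) : theta1 p y = realTheta1 p y := by
  rw [theta1, realTheta1]; push_cast; rfl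

theorem theta4_ofReal (p y : ℝ) : theta4 p y = realTheta4 p y := by
  rw [theta4, realTheta4]; push_cast; rfl

theorem realTheta4_summable {p : ℝ} (hp : |p| < 1) (y : ℝ) :
    Summable fun n : ℕ => (-1) ^ (n + 1) * p ^ ((n + 1) ^ 2) * Real.cos (2 * (n + 1) * y) := by
  refine Summable.of_norm_bounded (g := fun n => |p| ^ n)
    (summable_geometric_of_lt_one (abs_nonneg _) hp) fun n => ?_
  rw [norm_mul, norm_mul, norm_pow, norm_neg, norm_one, one_pow, one_mul, norm_pow]
  calc ‖p‖ ^ ((n + 1) ^ 2) * ‖Real.cos (2 * (n + 1) * y)‖ ≤ ‖p‖ ^ ((n + 1) ^ 2) * 1 := by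
        gcongr; exact Real.abs_cos_le_one _
    _ ≤ |p| ^ n := by
        rw [mul_one, Real.norm_eq_abs]
        exact pow_le_pow_of_le_one (abs_nonneg _) hp.le (by nlinarith)

theorem abs_sin_odd_mul_le (n : ℕ) (y : ℝ) :
    |Real.sin ((2 * n + 1) * y)| ≤ (2 * n + 1) * |Real.sin y| := by
  have h : ∀ m : ℕ, |Real.sin (m * y)| ≤ m * |Real.sin y| := by
    intro m
    induction m with
    | zero => simp
    | succ m ih =>
      push_cast
      rw [add_mul, one_mul, Real.sin_add]
      refine (abs_add_le _ _).trans ?_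
      rw [abs_mul, abs_mul]
      nlinarith [Real.abs_cos_le_one y, Real.abs_cos_le_one (m * y), abs_nonneg (Real.sin y),
        abs_nonneg (Real.sin (m * y)), abs_nonneg (Real.cos y), abs_nonneg (Real.cos (m * y))]
  exact_mod_cast h (2 * n + 1)

/-- For a small nome, `ϑ₁` is close to the first term `2 sin y` of its series, relative to `sin y`. -/
theorem realTheta1_sub_le {p : ℝ} (hp : |p| < 1 / 10) (y : ℝ) :
    |realTheta1 p y - 2 * Real.sin y| ≤ |Real.sin y| := by
  have hp0 := abs_nonneg p
  -- the tail of the series is dominated by a geometric series of ratio `2|p|`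
  have hb : ∀ n : ℕ, ‖(-1) ^ (n + 1) * p ^ ((n + 1) * ((n + 1) + 1))
      * Real.sin ((2 * (n + 1 : ℕ) + 1) * y)‖ ≤ (3 * |p| * |Real.sin y|) * (2 * |p|) ^ n := by
    intro n
    rw [norm_mul, norm_mul, norm_pow, norm_neg, norm_one, one_pow, one_mul, norm_pow]
    have h1 : ‖p‖ ^ ((n + 1) * ((n + 1) + 1)) ≤ |p| ^ (n + 1) :=
      pow_le_pow_of_le_one hp0 (by linarith) (by nlinarith)
    have h2 : (2 * ((n + 1 : ℕ) : ℝ) + 1) ≤ 3 * 2 ^ n := by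
      have : ∀ n : ℕ, 2 * (n + 1) + 1 ≤ 3 * 2 ^ n := by
        intro n
        induction n with
        | zero => norm_num
        | succ n ih => rw [pow_succ]; omega
      exact_mod_cast this n
    calc _ ≤ |p| ^ (n + 1) * ((2 * ((n + 1 : ℕ) : ℝ) + 1) * |Real.sin y|) := by
          gcongr; exact abs_sin_odd_mul_le (n + 1) y
      _ ≤ |p| ^ (n + 1) * (3 * 2 ^ n * |Real.sin y|) := by gcongr
      _ = _ := by rw [mul_pow]; ring
  have hg : Summable fun n : ℕ => (3 * |p| * |Real.sin y|) * (2 * |p|) ^ n :=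
    (summable_geometric_of_lt_one (by positivity) (by linarith)).mul_left _
  have hs : Summable fun n : ℕ => (-1) ^ n * p ^ (n * (n + 1)) * Real.sin ((2 * n + 1) * y) :=
    (summable_nat_add_iff 1).mp (Summable.of_norm_bounded hg hb)
  rw [realTheta1, hs.tsum_eq_zero_add]
  have ht := tsum_of_norm_bounded hg.hasSum hb
  rw [tsum_mul_left, tsum_geometric_of_lt_one (by positivity) (by linarith), Real.norm_eq_abs] at ht
  simp only [pow_zero, one_mul, zero_mul, CharP.cast_eq_zero, mul_zero, zero_add]
  rw [show ∀ a b : ℝ, 2 * (a + b) - 2 * a = 2 * b by intros; ring, abs_mul, abs_two]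
  have h3 : 3 * |p| * |Real.sin y| * (1 - 2 * |p|)⁻¹ ≤ |Real.sin y| / 2 := by
    rw [← div_eq_mul_inv, div_le_iff₀ (by linarith)]
    nlinarith [abs_nonneg (Real.sin y)]
  linarith

theorem realTheta4_sub_one_le {p : ℝ} (hp : |p| < 1 / 10) (y : ℝ) :
    |realTheta4 p y - 1| < 1 := by
  have hp0 := abs_nonneg p
  have hb : ∀ n : ℕ, ‖(-1) ^ (n + 1) * p ^ ((n + 1) ^ 2) * Real.cos (2 * (n + 1) * y)‖
      ≤ |p| * |p| ^ n := by
    intro n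
    rw [norm_mul, norm_mul, norm_pow, norm_neg, norm_one, one_pow, one_mul, norm_pow]
    calc ‖p‖ ^ ((n + 1) ^ 2) * ‖Real.cos (2 * (n + 1) * y)‖ ≤ |p| ^ (n + 1) * 1 := by
          gcongr
          · exact pow_le_pow_of_le_one hp0 (by linarith) (by nlinarith)
          · exact Real.abs_cos_le_one _
      _ = _ := by ring
  have ht := tsum_of_norm_bounded
    ((summable_geometric_of_lt_one hp0 (by linarith)).mul_left |p|).hasSum hb
  rw [tsum_mul_left, tsum_geometric_of_lt_one hp0 (by linarith), Real.norm_eq_abs] at ht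
  rw [realTheta4, add_sub_cancel_left, abs_mul, abs_two]
  have : |p| * (1 - |p|)⁻¹ < 1 / 2 := by
    rw [← div_eq_mul_inv, div_lt_iff₀ (by linarith)]; linarith
  linarith

theorem abs_sq_lt_one {p : ℝ} (hp : |p| < 1) : |p ^ 2| < 1 := by
  rw [abs_pow]; exact pow_lt_one₀ (abs_nonneg _) hp (by norm_num)

/-- Finitely many squarings make the nome small. -/
theorem exists_pow_two_pow_lt {p : ℝ} (hp : |p| < 1) : ∃ k : ℕ, |p| ^ 2 ^ k < 1 / 10 := by
  obtain ⟨m, hm⟩ := exists_pow_lt_of_lt_one (by norm_num : (0 : ℝ) < 1 / 10) hp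
  exact ⟨m, lt_of_le_of_lt (pow_le_pow_of_le_one (abs_nonneg _) hp.le Nat.lt_two_pow_self.le) hm⟩

/-- `ϑ₄` has no real zeros: passing to the nome `p²`, a real zero persists until the nome is so
small that the series is dominated by its constant term. -/
theorem realTheta4_ne_zero {p : ℝ} (hp : |p| < 1) (y : ℝ) : realTheta4 p y ≠ 0 := by
  obtain ⟨k, hk⟩ := exists_pow_two_pow_lt hp
  induction k generalizing p y with
  | zero =>
    intro h
    have := realTheta4_sub_one_le (by simpa using hk) y
    rw [h] at this; norm_num at this
  | succ k ih =>
    intro h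
    have h1 := theta4_mul_theta4_neg_nome hp y
    rw [theta4_ofReal p y, h, Complex.ofReal_zero, zero_mul] at h1
    have hk' : |p ^ 2| ^ 2 ^ k < 1 / 10 := by rwa [abs_pow, ← pow_mul, ← pow_succ']
    rw [show (2 * y : ℂ) = ((2 * y : ℝ) : ℂ) by push_cast; rfl,
      show (0 : ℂ) = ((0 : ℝ) : ℂ) by rfl, theta4_ofReal, theta4_ofReal, ← Complex.ofReal_mul,
      Complex.ofReal_inj] at h1
    rcases mul_eq_zero.mp h1.symm with h2 | h2
    · exact ih (abs_sq_lt_one hp) _ hk' h2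
    · exact ih (abs_sq_lt_one hp) _ hk' h2

theorem continuous_realTheta4 {p : ℝ} (hp : |p| < 1) : Continuous (realTheta4 p) := by
  have h : Continuous fun y : ℝ => (theta4 p (y : ℂ)).re :=
    Complex.continuous_re.comp ((differentiable_theta4 hp).continuous.comp Complex.continuous_ofReal)
  exact h.congr fun y => by rw [theta4_ofReal, Complex.ofReal_re]

theorem realTheta4_pos {p : ℝ} (hp : |p| < 1) (y : ℝ) : 0 < realTheta4 p y := by
  -- in `ϑ₄(0) + ϑ₄(π/2)` only even powers of the nome are left, with positive coefficients
  have hsum : 0 < realTheta4 p 0 + realTheta4 p (Real.pi / 2) := by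
    rw [realTheta4, realTheta4]
    have h := (realTheta4_summable hp 0).tsum_add (realTheta4_summable hp (Real.pi / 2))
    have : 0 ≤ ∑' n : ℕ, ((-1) ^ (n + 1) * p ^ ((n + 1) ^ 2) * Real.cos (2 * (n + 1) * 0)
        + (-1) ^ (n + 1) * p ^ ((n + 1) ^ 2) * Real.cos (2 * (n + 1) * (Real.pi / 2))) := by
      apply tsum_nonneg
      intro n
      have hc : Real.cos (2 * (n + 1) * (Real.pi / 2)) = (-1) ^ (n + 1) := by
        rw [show 2 * ((n : ℝ) + 1) * (Real.pi / 2) = ((n + 1 : ℕ) : ℝ) * Real.pi by push_cast; ring,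
          Real.cos_nat_mul_pi]
      rw [hc, mul_zero, Real.cos_zero]
      rcases Nat.even_or_odd (n + 1) with he | ho
      · rw [he.neg_one_pow]
        have : 0 ≤ p ^ ((n + 1) ^ 2) := (he.pow_of_ne_zero (by norm_num)).pow_nonneg p
        linarith
      · rw [ho.neg_one_pow]; linarith
    linarith
  have hc := continuous_realTheta4 hp
  by_contra hy
  have hy' : realTheta4 p y < 0 := lt_of_le_of_ne (not_lt.mp hy) (realTheta4_ne_zero hp y)
  have hex : ∃ z, 0 < realTheta4 p z := by
    by_contra hno
    push Not at hno
    linarith [hno 0, hno (Real.pi / 2)]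
  obtain ⟨z, hz⟩ := hex
  obtain ⟨w, hw⟩ := mem_range_of_exists_le_of_exists_ge hc ⟨y, hy'.le⟩ ⟨z, hz.le⟩
  exact realTheta4_ne_zero hp w hw

theorem landenConst_pos {p : ℝ} (hp : |p| < 1) : ∃ r : ℝ, 0 < r ∧ landenConst p = r := by
  have he : ∀ k : ℤ, nomePow p (2 * k * (2 * k + 1))
      = ((p ^ (2 * k * (2 * k + 1)).toNat : ℝ) : ℂ) := fun k => by rw [nomePow]; push_cast; rfl
  have hn : ∀ k : ℤ, 0 ≤ p ^ (2 * k * (2 * k + 1)).toNat := fun k => by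
    apply Even.pow_nonneg
    rw [← Int.even_coe_nat, Int.toNat_of_nonneg (nonneg_two_mul k), mul_assoc]
    exact even_two_mul _
  have hs := (summable_norm_nomePow_quadratic hp).of_norm
  simp_rw [he] at hs
  refine ⟨∑' k : ℤ, p ^ (2 * k * (2 * k + 1)).toNat, ?_, ?_⟩
  · exact (Complex.summable_ofReal.mp hs).tsum_pos hn 0 (by simp)
  · rw [landenConst, Complex.ofReal_tsum]; simp_rw [he]

/-- On the real axis `ϑ₁` has the sign of the sine. -/
theorem realTheta1_mul_sin_pos {p : ℝ} (hp : |p| < 1) {y : ℝ} (hy : Real.sin y ≠ 0) :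
    0 < realTheta1 p y * Real.sin y := by
  obtain ⟨k, hk⟩ := exists_pow_two_pow_lt hp
  induction k generalizing p with
  | zero =>
    have h := realTheta1_sub_le (by simpa using hk) y
    have h1 : |realTheta1 p y - 2 * Real.sin y| * |Real.sin y| ≤ Real.sin y ^ 2 := by
      rw [← sq_abs (Real.sin y), sq]; gcongr
    rw [← abs_mul] at h1
    nlinarith [neg_abs_le ((realTheta1 p y - 2 * Real.sin y) * Real.sin y), sq_pos_of_ne_zero hy]
  | succ k ih =>
    obtain ⟨r, hr, hr'⟩ := landenConst_pos hp
    have h1 := landenConst_mul_theta1 hp y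
    rw [hr', theta1_ofReal, theta1_ofReal, theta4_ofReal, ← Complex.ofReal_mul,
      ← Complex.ofReal_mul, Complex.ofReal_inj] at h1
    have h2 := ih (abs_sq_lt_one hp) (by rwa [abs_pow, ← pow_mul, ← pow_succ'])
    have h4 := realTheta4_pos (abs_sq_lt_one hp) y
    have h3 : r * (realTheta1 p y * Real.sin y)
        = realTheta4 (p ^ 2) y * (realTheta1 (p ^ 2) y * Real.sin y) := by
      rw [← mul_assoc, h1]; ring
    have h5 : 0 < r * (realTheta1 p y * Real.sin y) := by rw [h3]; positivity
    exact pos_of_mul_pos_right h5 hr.le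

theorem theta1_ofReal_ne_zero {p : ℝ} (hp : |p| < 1) {y : ℝ} (hy : Real.sin y ≠ 0) :
    theta1 p y ≠ 0 := by
  rw [theta1_ofReal, Complex.ofReal_ne_zero]
  intro h
  have := realTheta1_mul_sin_pos hp hy
  rw [h, zero_mul] at this
  exact lt_irrefl _ this

theorem theta4_ofReal_ne_zero {p : ℝ} (hp : |p| < 1) (y : ℝ) : theta4 p y ≠ 0 := by
  rw [theta4_ofReal, Complex.ofReal_ne_zero]
  exact realTheta4_ne_zero hp y

end

/-! ### Spaces of theta functions -/

section

/-- What the proof of the Yang-Baxter equation needs to know about `f = ϑ₁` and `g = ϑ₄`. -/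
structure ThetaPair (f g : ℂ → ℂ) : Prop where
  odd : ∀ u, f (-u) = -f u
  even : ∀ u, g (-u) = g u
  three_f : ∀ x y z w, f (x + y) * f (x - y) * (f (z + w) * f (z - w))
    + f (y + z) * f (y - z) * (f (x + w) * f (x - w))
    + f (z + x) * f (z - x) * (f (y + w) * f (y - w)) = 0
  three_g : ∀ s t r q, g (s + t) * g (s - t) * (f (r + q) * f (r - q))
    + g (s + r) * g (s - r) * (f (q + t) * f (q - t))
    + g (s + q) * g (s - q) * (f (t + r) * f (t - r)) = 0
  f_ne : ∀ y : ℝ, Real.sin y ≠ 0 → f y ≠ 0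
  g_ne : ∀ y : ℝ, g y ≠ 0
  diff_f : Differentiable ℂ f
  diff_g : Differentiable ℂ g

/-- The two three-term identities follow by expanding the products in `seriesA` and `seriesB`. -/
theorem thetaPair {p : ℝ} (hp : |p| < 1) : ThetaPair (theta1 p) (theta4 p) where
  odd := theta1_neg p
  even := theta4_neg p
  three_f x y z w := by simp only [theta1_mul_theta1 hp]; ring
  three_g s t r q := by simp only [theta1_mul_theta1 hp, theta4_mul_theta4 hp]; ring
  f_ne _ hy := theta1_ofReal_ne_zero hp hy
  g_ne y := theta4_ofReal_ne_zero hp y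
  diff_f := differentiable_theta1 hp
  diff_g := differentiable_theta4 hp

/-- The function `f` or `g`, according to the parity. -/
def thetaOf (f g : ℂ → ℂ) (ε : ZMod 2) : ℂ → ℂ := if ε = 0 then f else g

@[simp] theorem thetaOf_zero (f g : ℂ → ℂ) : thetaOf f g 0 = f := if_pos rfl

@[simp] theorem thetaOf_one (f g : ℂ → ℂ) : thetaOf f g 1 = g := if_neg (by decide)

theorem zmod_two_eq (ε : ZMod 2) : ε = 0 ∨ ε = 1 := by
  revert ε
  decide

namespace ThetaPair

variable {f g : ℂ → ℂ}

theorem zero (H : ThetaPair f g) : f 0 = 0 := by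
  have := H.odd 0
  rw [neg_zero] at this
  exact self_eq_neg.mp this

theorem thetaOf_neg (H : ThetaPair f g) (ε : ZMod 2) :
    ∃ c : ℂ, ∀ u, thetaOf f g ε (-u) = c * thetaOf f g ε u := by
  rcases zmod_two_eq ε with rfl | rfl
  · exact ⟨-1, fun u => by simpa using H.odd u⟩
  · exact ⟨1, fun u => by simpa using H.even u⟩

/-- Interpolation at two points `z` and `w` of a product of two theta functions. -/
theorem two_factor (H : ThetaPair f g) (η₁ η₂ : ZMod 2) (z w a b u : ℂ) :
    f (z - w) * thetaOf f g (η₁ + η₂) (z + w - a - b)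
        * (thetaOf f g η₁ (u - a) * thetaOf f g η₂ (u - b))
      = thetaOf f g η₁ (z - a) * thetaOf f g η₂ (z - b)
          * (f (u - w) * thetaOf f g (η₁ + η₂) (u - a - b + w))
        - thetaOf f g η₁ (w - a) * thetaOf f g η₂ (w - b)
          * (f (u - z) * thetaOf f g (η₁ + η₂) (u - a - b + z)) := by
  have mixed : ∀ a b : ℂ, f (z - w) * g (z + w - a - b) * (f (u - a) * g (u - b))
      = f (z - a) * g (z - b) * (f (u - w) * g (u - a - b + w))
        - f (w - a) * g (w - b) * (f (u - z) * g (u - a - b + z)) := by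
    intro a b
    have h := H.three_g ((u + z + w - a - 2 * b) / 2) ((u - z - w + a) / 2) ((z - u - w + a) / 2)
      ((w - u - z + a) / 2)
    rw [show (u + z + w - a - 2 * b) / 2 + (u - z - w + a) / 2 = u - b by ring,
      show (u + z + w - a - 2 * b) / 2 - (u - z - w + a) / 2 = z + w - a - b by ring,
      show (u + z + w - a - 2 * b) / 2 + (z - u - w + a) / 2 = z - b by ring,
      show (u + z + w - a - 2 * b) / 2 - (z - u - w + a) / 2 = u - a - b + w by ring,
      show (u + z + w - a - 2 * b) / 2 + (w - u - z + a) / 2 = w - b by ring,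
      show (u + z + w - a - 2 * b) / 2 - (w - u - z + a) / 2 = u - a - b + z by ring,
      show (z - u - w + a) / 2 + (w - u - z + a) / 2 = -(u - a) by ring,
      show (z - u - w + a) / 2 - (w - u - z + a) / 2 = z - w by ring,
      show (w - u - z + a) / 2 + (u - z - w + a) / 2 = -(z - a) by ring,
      show (w - u - z + a) / 2 - (u - z - w + a) / 2 = -(u - w) by ring,
      show (u - z - w + a) / 2 + (z - u - w + a) / 2 = -(w - a) by ring,
      show (u - z - w + a) / 2 - (z - u - w + a) / 2 = u - z by ring] at h
    simp only [H.odd] at h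
    linear_combination -h
  rcases zmod_two_eq η₁ with rfl | rfl <;> rcases zmod_two_eq η₂ with rfl | rfl
  · have h := H.three_f (u - (a + b) / 2) ((b - a) / 2) (z - (a + b) / 2) (w - (a + b) / 2)
    rw [show u - (a + b) / 2 + (b - a) / 2 = u - a by ring,
      show u - (a + b) / 2 - (b - a) / 2 = u - b by ring,
      show z - (a + b) / 2 + (w - (a + b) / 2) = z + w - a - b by ring,
      show z - (a + b) / 2 - (w - (a + b) / 2) = z - w by ring,
      show (b - a) / 2 + (z - (a + b) / 2) = z - a by ring,
      show (b - a) / 2 - (z - (a + b) / 2) = -(z - b) by ring,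
      show u - (a + b) / 2 + (w - (a + b) / 2) = u - a - b + w by ring,
      show u - (a + b) / 2 - (w - (a + b) / 2) = u - w by ring,
      show z - (a + b) / 2 + (u - (a + b) / 2) = u - a - b + z by ring,
      show z - (a + b) / 2 - (u - (a + b) / 2) = -(u - z) by ring,
      show (b - a) / 2 + (w - (a + b) / 2) = w - a by ring,
      show (b - a) / 2 - (w - (a + b) / 2) = -(w - b) by ring] at h
    simp only [H.odd] at h
    simp only [add_zero, thetaOf_zero]
    linear_combination h
  · simpa using mixed a b
  · have := mixed b a
    simp only [add_zero, thetaOf_zero, thetaOf_one]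
    rw [show z + w - a - b = z + w - b - a by ring, show u - a - b + w = u - b - a + w by ring,
      show u - a - b + z = u - b - a + z by ring]
    linear_combination this
  · have h := H.three_g ((b - a) / 2) (u - (a + b) / 2) (z - (a + b) / 2) (w - (a + b) / 2)
    rw [show (b - a) / 2 + (u - (a + b) / 2) = u - a by ring,
      show (b - a) / 2 - (u - (a + b) / 2) = -(u - b) by ring,
      show z - (a + b) / 2 + (w - (a + b) / 2) = z + w - a - b by ring,
      show z - (a + b) / 2 - (w - (a + b) / 2) = z - w by ring,
      show (b - a) / 2 + (z - (a + b) / 2) = z - a by ring,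
      show (b - a) / 2 - (z - (a + b) / 2) = -(z - b) by ring,
      show w - (a + b) / 2 + (u - (a + b) / 2) = u - a - b + w by ring,
      show w - (a + b) / 2 - (u - (a + b) / 2) = -(u - w) by ring,
      show (b - a) / 2 + (w - (a + b) / 2) = w - a by ring,
      show (b - a) / 2 - (w - (a + b) / 2) = -(w - b) by ring,
      show u - (a + b) / 2 + (z - (a + b) / 2) = u - a - b + z by ring,
      show u - (a + b) / 2 - (z - (a + b) / 2) = u - z by ring] at h
    simp only [H.odd, H.even] at h
    simp only [CharTwo.add_self_eq_zero, thetaOf_zero, thetaOf_one]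
    linear_combination h

end ThetaPair

/-- A product of shifted theta functions; a factor is given by its parity and its zero. -/
def thetaProd (f g : ℂ → ℂ) (l : List (ZMod 2 × ℝ)) (u : ℂ) : ℂ :=
  (l.map fun q => thetaOf f g q.1 (u - q.2)).prod

/-- The space spanned by the products of `n` shifted theta functions with total parity `ε` and
total shift `σ`. -/
def thetaSpace (f g : ℂ → ℂ) (n : ℕ) (ε : ZMod 2) (σ : ℝ) : Submodule ℂ (ℂ → ℂ) :=
  Submodule.span ℂ {F | ∃ l : List (ZMod 2 × ℝ), l.length = n ∧ (l.map Prod.fst).sum = ε ∧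
    (l.map Prod.snd).sum = σ ∧ F = thetaProd f g l}

theorem thetaProd_mem (f g : ℂ → ℂ) (l : List (ZMod 2 × ℝ)) :
    thetaProd f g l ∈ thetaSpace f g l.length (l.map Prod.fst).sum (l.map Prod.snd).sum :=
  Submodule.subset_span ⟨l, rfl, rfl, rfl, rfl⟩

theorem thetaSpace_mul {f g : ℂ → ℂ} {n n' : ℕ} {ε ε' : ZMod 2} {σ σ' : ℝ} {F G : ℂ → ℂ}
    (hF : F ∈ thetaSpace f g n ε σ) (hG : G ∈ thetaSpace f g n' ε' σ') :
    (fun u => F u * G u) ∈ thetaSpace f g (n + n') (ε + ε') (σ + σ') := by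
  have h1 := Submodule.mul_mem_mul hF hG
  rw [thetaSpace, thetaSpace, Submodule.span_mul_span] at h1
  refine Submodule.span_mono ?_ h1
  rintro _ ⟨_, ⟨l, h1, h2, h3, rfl⟩, _, ⟨l', h1', h2', h3', rfl⟩, rfl⟩
  refine ⟨l ++ l', by simp [h1, h1'], by simp [h2, h2'], by simp [h3, h3'], ?_⟩
  ext u
  simp [thetaProd]

/-- Shifting the argument of a theta function of order `n` by `v` shifts each of its `n` zeros. -/
theorem thetaSpace_shift {f g : ℂ → ℂ} {n : ℕ} {ε : ZMod 2} {σ : ℝ} {F : ℂ → ℂ} (v : ℝ)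
    (hF : F ∈ thetaSpace f g n ε σ) :
    (fun u => F (u - v)) ∈ thetaSpace f g n ε (σ + n * v) := by
  induction hF using Submodule.span_induction with
  | mem F h =>
    obtain ⟨l, h1, h2, h3, rfl⟩ := h
    refine Submodule.subset_span ⟨l.map fun q => (q.1, q.2 + v), by simpa using h1, ?_, ?_, ?_⟩
    · simpa [Function.comp_def] using h2
    · rw [← h1, ← h3]
      clear h1 h2 h3
      induction l with
      | nil => simp
      | cons q l ih =>
        simp only [List.map_cons, List.sum_cons, List.length_cons] at ih ⊢
        rw [ih]; push_cast; ring
    · ext u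
      simp only [thetaProd, List.map_map, Function.comp_def]
      congr 2; ext q; congr 1; push_cast; ring
  | zero => exact Submodule.zero_mem _
  | add F G _ _ hF hG => exact Submodule.add_mem _ hF hG
  | smul c F _ hF => exact Submodule.smul_mem _ c hF

theorem thetaSpace_reflect {f g : ℂ → ℂ} (H : ThetaPair f g) {n : ℕ} {ε : ZMod 2} {σ : ℝ}
    {F : ℂ → ℂ} (hF : F ∈ thetaSpace f g n ε σ) :
    (fun u => F (-u)) ∈ thetaSpace f g n ε (-σ) := by
  induction hF using Submodule.span_induction with
  | mem F h =>
    obtain ⟨l, rfl, rfl, rfl, rfl⟩ := h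
    have : ∃ c : ℂ, (fun u => thetaProd f g l (-u))
        = c • thetaProd f g (l.map fun q => (q.1, -q.2)) := by
      induction l with
      | nil => exact ⟨1, by ext u; simp [thetaProd]⟩
      | cons q l ih =>
        obtain ⟨c, hc⟩ := ih
        obtain ⟨d, hd⟩ := H.thetaOf_neg q.1
        refine ⟨d * c, ?_⟩
        ext u
        have hu := congrFun hc u
        simp only [thetaProd, List.map_cons, List.prod_cons, Pi.smul_apply, smul_eq_mul] at hu ⊢
        rw [hu, show -u - (q.2 : ℂ) = -(u - ((-q.2 : ℝ) : ℂ)) by push_cast; ring, hd]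
        ring
    obtain ⟨c, hc⟩ := this
    rw [hc]
    have hm := thetaProd_mem f g (l.map fun q => (q.1, -q.2))
    apply Submodule.smul_mem
    convert! hm using 2
    · simp
    · simp [Function.comp_def]
    · simp [Function.comp_def, List.sum_neg]
  | zero => exact Submodule.zero_mem _
  | add F G _ _ hF hG => exact Submodule.add_mem _ hF hG
  | smul c F _ hF => exact Submodule.smul_mem _ c hF

theorem eventually_sin_ne_zero (y : ℝ) {k : ℝ} (hk : k ≠ 0) :
    ∀ᶠ w in Filter.cocountable, Real.sin (y + k * w) ≠ 0 := by
  rw [Filter.Eventually, Filter.mem_cocountable]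
  refine (Set.countable_range fun n : ℤ => (n * Real.pi - y) / k).mono ?_
  intro w hw
  simp only [Set.mem_compl_iff, Set.mem_ofPred_eq, not_not] at hw
  obtain ⟨n, hn⟩ := Real.sin_eq_zero_iff.mp hw
  refine ⟨n, ?_⟩
  change (n * Real.pi - y) / k = w
  rw [hn]; field_simp; ring

theorem ThetaPair.thetaOf_ne {f g : ℂ → ℂ} (H : ThetaPair f g) (ε : ZMod 2) {y : ℝ}
    (hy : Real.sin y ≠ 0) : thetaOf f g ε y ≠ 0 := by
  rcases zmod_two_eq ε with rfl | rfl
  · simpa using H.f_ne y hy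
  · simpa using H.g_ne y

/-- Modulo multiples of `f (· - z)`, every product of theta functions is a multiple of one fixed
product, for a generic choice of the parameter `w` of the latter. -/
theorem thetaProd_reduce {f g : ℂ → ℂ} (H : ThetaPair f g) (z : ℝ) (q : ZMod 2 × ℝ)
    (l : List (ZMod 2 × ℝ)) : ∀ᶠ w : ℝ in Filter.cocountable, ∃ c : ℂ,
      ∃ G ∈ thetaSpace f g l.length (((q :: l).map Prod.fst).sum)
        (((q :: l).map Prod.snd).sum - z), ∀ u, thetaProd f g (q :: l) u
          = f (u - z) * G u + c * (f (u - w) ^ l.length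
            * thetaOf f g ((q :: l).map Prod.fst).sum
              (u - ((q :: l).map Prod.snd).sum + l.length * w)) := by
  induction l generalizing q with
  | nil =>
    refine Filter.Eventually.of_forall fun w => ⟨1, 0, Submodule.zero_mem _, fun u => ?_⟩
    simp [thetaProd]
  | cons q' l ih =>
    filter_upwards [ih q', eventually_sin_ne_zero z (k := -1) (by norm_num),
      eventually_sin_ne_zero (z - ((q :: q' :: l).map Prod.snd).sum) (k := l.length + 1)
        (by positivity)] with w hw hw1 hw2
    obtain ⟨c, G, hG, hc⟩ := hw
    set ε := ((q' :: l).map Prod.fst).sum with hε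
    set σ := ((q' :: l).map Prod.snd).sum with hσ
    have e1 : ((q :: q' :: l).map Prod.fst).sum = q.1 + ε := by
      rw [hε, List.map_cons, List.sum_cons]
    have e2 : ((q :: q' :: l).map Prod.snd).sum = q.2 + σ := by
      rw [hσ, List.map_cons, List.sum_cons]
    rw [e2] at hw2
    rw [e1, e2, List.length_cons]
    have n1 : f ((z : ℂ) - w) ≠ 0 := by
      have := H.f_ne _ hw1
      rwa [show ((z + -1 * w : ℝ) : ℂ) = (z : ℂ) - w by push_cast; ring] at this
    set N : ℝ := l.length * w with hN
    have n2 : thetaOf f g (q.1 + ε) ((z : ℂ) + w - q.2 - ((σ - N : ℝ) : ℂ)) ≠ 0 := by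
      have := H.thetaOf_ne (q.1 + ε) hw2
      rwa [show ((z - (q.2 + σ) + (l.length + 1) * w : ℝ) : ℂ)
        = (z : ℂ) + w - q.2 - ((σ - N : ℝ) : ℂ) by rw [hN]; push_cast; ring] at this
    set c1 := thetaOf f g q.1 ((z : ℂ) - q.2) * thetaOf f g ε ((z : ℂ) - ((σ - N : ℝ) : ℂ))
    set c2 := thetaOf f g q.1 ((w : ℂ) - q.2) * thetaOf f g ε ((w : ℂ) - ((σ - N : ℝ) : ℂ))
    set D := f ((z : ℂ) - w) * thetaOf f g (q.1 + ε) ((z : ℂ) + w - q.2 - ((σ - N : ℝ) : ℂ))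
    have hD : D ≠ 0 := mul_ne_zero n1 n2
    refine ⟨c * (c1 / D), fun u => thetaOf f g q.1 (u - q.2) * G u
      - c * (c2 / D) * (f (u - w) ^ l.length
        * thetaOf f g (q.1 + ε) (u - ((q.2 + (σ - N) - z : ℝ) : ℂ))), ?_, fun u => ?_⟩
    · apply Submodule.sub_mem
      · have h1 := thetaSpace_mul (thetaProd_mem f g [q]) hG
        convert! h1 using 2
        · simp [add_comm]
        · simp
        · simp; ring
        · simp [thetaProd]
      · apply Submodule.smul_mem (x := fun u => f (u - w) ^ l.length
          * thetaOf f g (q.1 + ε) (u - ((q.2 + (σ - N) - z : ℝ) : ℂ)))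
        have h1 := thetaProd_mem f g (List.replicate l.length ((0 : ZMod 2), w)
          ++ [(q.1 + ε, q.2 + (σ - N) - z)])
        convert! h1 using 2
        · simp
        · simp
        · simp [hN]; ring
        · simp [thetaProd]
    · have h1 : thetaProd f g (q :: q' :: l) u
          = thetaOf f g q.1 (u - q.2) * thetaProd f g (q' :: l) u := by simp [thetaProd]
      have h2 := H.two_factor q.1 ε z w q.2 ((σ - N : ℝ) : ℂ) u
      rw [h1, hc u]
      have e3 : u - σ + l.length * w = u - ((σ - N : ℝ) : ℂ) := by rw [hN]; push_cast; ring
      have e4 : u - ((q.2 + σ : ℝ) : ℂ) + ((l.length + 1 : ℕ) : ℂ) * w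
          = u - q.2 - ((σ - N : ℝ) : ℂ) + w := by rw [hN]; push_cast; ring
      have e5 : u - ((q.2 + (σ - N) - z : ℝ) : ℂ) = u - q.2 - ((σ - N : ℝ) : ℂ) + z := by
        push_cast; ring
      beta_reduce
      rw [e3, e4, e5, pow_succ]
      have h3 : thetaOf f g q.1 (u - q.2) * thetaOf f g ε (u - ((σ - N : ℝ) : ℂ))
          = c1 / D * (f (u - w) * thetaOf f g (q.1 + ε) (u - q.2 - ((σ - N : ℝ) : ℂ) + w))
            - c2 / D * (f (u - z) * thetaOf f g (q.1 + ε) (u - q.2 - ((σ - N : ℝ) : ℂ) + z)) := by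
        field_simp
        linear_combination h2
      linear_combination c * f (u - w) ^ l.length * h3

theorem cocountable_real_neBot : (Filter.cocountable : Filter ℝ).NeBot := by
  refine ⟨fun h => ?_⟩
  have h1 : (∅ : Set ℝ) ∈ Filter.cocountable := by rw [h]; trivial
  rw [Filter.mem_cocountable, Set.compl_empty] at h1
  exact Set.not_countable_univ h1

/-- A theta function that vanishes at `z` is divisible by `f (· - z)`. -/
theorem thetaSpace_divide {f g : ℂ → ℂ} (H : ThetaPair f g) {n : ℕ} (hn : n ≠ 0) {ε : ZMod 2}
    {σ : ℝ} {F : ℂ → ℂ} (hF : F ∈ thetaSpace f g (n + 1) ε σ) (z : ℝ) (hz : F z = 0) :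
    ∃ G ∈ thetaSpace f g n ε (σ - z), ∀ u, F u = f (u - z) * G u := by
  have key : ∀ᶠ w : ℝ in Filter.cocountable, ∃ c : ℂ, ∃ G ∈ thetaSpace f g n ε (σ - z),
      ∀ u, F u = f (u - z) * G u
        + c * (f (u - w) ^ n * thetaOf f g ε (u - σ + n * w)) := by
    clear hz
    induction hF using Submodule.span_induction with
    | mem F h =>
      obtain ⟨l, h1, rfl, rfl, rfl⟩ := h
      match l, h1 with
      | q :: l, h1 =>
        have hl : l.length = n := by simpa using h1
        subst hl
        exact thetaProd_reduce H z q l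
    | zero => exact Filter.Eventually.of_forall fun w => ⟨0, 0, Submodule.zero_mem _, by simp⟩
    | add F F' _ _ hF hF' =>
      filter_upwards [hF, hF'] with w ⟨c, G, hG, h⟩ ⟨c', G', hG', h'⟩
      refine ⟨c + c', G + G', Submodule.add_mem _ hG hG', fun u => ?_⟩
      rw [Pi.add_apply, h, h', Pi.add_apply]; ring
    | smul a F _ hF =>
      filter_upwards [hF] with w ⟨c, G, hG, h⟩
      refine ⟨a * c, a • G, Submodule.smul_mem _ _ hG, fun u => ?_⟩
      rw [Pi.smul_apply, h, Pi.smul_apply, smul_eq_mul, smul_eq_mul]; ring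
  have := cocountable_real_neBot
  obtain ⟨w, ⟨c, G, hG, h⟩, hw1, hw2⟩ := (key.and ((eventually_sin_ne_zero z (k := -1)
    (by norm_num)).and (eventually_sin_ne_zero (z - σ) (k := n) (by exact_mod_cast hn)))).exists
  have hc : c = 0 := by
    have h0 := h z
    rw [hz, sub_self, H.zero, zero_mul, zero_add] at h0
    have n1 := H.f_ne _ hw1
    have n2 := H.thetaOf_ne ε hw2
    rw [show ((z + -1 * w : ℝ) : ℂ) = (z : ℂ) - w by push_cast; ring] at n1
    rw [show ((z - σ + n * w : ℝ) : ℂ) = (z : ℂ) - σ + n * w by push_cast; ring] at n2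
    exact (mul_eq_zero.mp h0.symm).resolve_right (mul_ne_zero (pow_ne_zero _ n1) n2)
  exact ⟨G, hG, fun u => by rw [h u, hc]; ring⟩

/-- A theta function of order four is zero if it vanishes at four distinct points whose sum is not
its total shift. -/
theorem thetaSpace_eq_zero {f g : ℂ → ℂ} (H : ThetaPair f g) {ε : ZMod 2} {σ : ℝ} {F : ℂ → ℂ}
    (hF : F ∈ thetaSpace f g 4 ε σ) (z₁ z₂ z₃ z₄ : ℝ) (h₁ : F z₁ = 0) (h₂ : F z₂ = 0)
    (h₃ : F z₃ = 0) (h₄ : F z₄ = 0) (h₂₁ : Real.sin (z₂ - z₁) ≠ 0) (h₃₁ : Real.sin (z₃ - z₁) ≠ 0)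
    (h₄₁ : Real.sin (z₄ - z₁) ≠ 0) (h₃₂ : Real.sin (z₃ - z₂) ≠ 0) (h₄₂ : Real.sin (z₄ - z₂) ≠ 0)
    (h₄₃ : Real.sin (z₄ - z₃) ≠ 0)
    (hσ : thetaOf f g ε ((z₁ + z₂ + z₃ + z₄ - σ : ℝ) : ℂ) ≠ 0) (u : ℂ) : F u = 0 := by
  have ne : ∀ {a b : ℝ}, Real.sin (a - b) ≠ 0 → f ((a : ℂ) - b) ≠ 0 := fun {a b} h => by
    rw [← Complex.ofReal_sub]; exact H.f_ne _ h
  obtain ⟨G₁, hG₁, e₁⟩ := thetaSpace_divide H (by norm_num) hF z₁ h₁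
  have v : ∀ {a : ℝ}, F a = 0 → Real.sin (a - z₁) ≠ 0 → G₁ a = 0 := fun {a} ha hs => by
    rw [e₁] at ha; exact (mul_eq_zero.mp ha).resolve_left (ne hs)
  obtain ⟨G₂, hG₂, e₂⟩ := thetaSpace_divide H (by norm_num) hG₁ z₂ (v h₂ h₂₁)
  have v₂ : ∀ {a : ℝ}, G₁ a = 0 → Real.sin (a - z₂) ≠ 0 → G₂ a = 0 := fun {a} ha hs => by
    rw [e₂] at ha; exact (mul_eq_zero.mp ha).resolve_left (ne hs)
  obtain ⟨G₃, hG₃, e₃⟩ := thetaSpace_divide H (by norm_num) hG₂ z₃ (v₂ (v h₃ h₃₁) h₃₂)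
  have h0 := v₂ (v h₄ h₄₁) h₄₂
  rw [e₃] at h0
  have h0' := (mul_eq_zero.mp h0).resolve_left (ne h₄₃)
  have hG : ∃ c : ℂ, ∀ u, G₃ u = c * thetaOf f g ε (u - ((σ - z₁ - z₂ - z₃ : ℝ) : ℂ)) := by
    clear e₃ h0 h0'
    induction hG₃ using Submodule.span_induction with
    | mem F h =>
      obtain ⟨l, h1, h2, h3, rfl⟩ := h
      obtain ⟨q, rfl⟩ := List.length_eq_one_iff.mp h1
      refine ⟨1, fun u => ?_⟩
      simp only [List.map_cons, List.map_nil, List.sum_singleton] at h2 h3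
      rw [← h2, ← h3]
      simp [thetaProd]
    | zero => exact ⟨0, by simp⟩
    | add F F' _ _ hF hF' =>
      obtain ⟨c, hc⟩ := hF
      obtain ⟨c', hc'⟩ := hF'
      exact ⟨c + c', fun u => by rw [Pi.add_apply, hc, hc']; ring⟩
    | smul a F _ hF =>
      obtain ⟨c, hc⟩ := hF
      exact ⟨a * c, fun u => by rw [Pi.smul_apply, hc, smul_eq_mul]; ring⟩
  obtain ⟨c, hc⟩ := hG
  rw [hc, show (z₄ : ℂ) - ((σ - z₁ - z₂ - z₃ : ℝ) : ℂ) = ((z₁ + z₂ + z₃ + z₄ - σ : ℝ) : ℂ) by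
    push_cast; ring] at h0'
  have hc0 := (mul_eq_zero.mp h0').resolve_right hσ
  rw [e₁, e₂, e₃, hc, hc0]; ring

end

/-! ### Three-term identities -/

section

namespace ThetaPair

variable {f g : ℂ → ℂ}

/-- The three-term identity in the form in which it is used below. -/
theorem mixed (H : ThetaPair f g) (y α β γ δ : ℂ) :
    f (β - δ) * f (2 * y + β + δ) * (g (y + γ + α) * g (y + γ - α))
      = f (γ - δ) * f (2 * y + γ + δ) * (g (y + β + α) * g (y + β - α))
        + f (β - γ) * f (2 * y + β + γ) * (g (y + δ + α) * g (y + δ - α)) := by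
  have h := H.three_g α (y + β) (y + γ) (y + δ)
  rw [show α + (y + β) = y + β + α by ring, show α - (y + β) = -(y + β - α) by ring,
    show α + (y + γ) = y + γ + α by ring, show α - (y + γ) = -(y + γ - α) by ring,
    show α + (y + δ) = y + δ + α by ring, show α - (y + δ) = -(y + δ - α) by ring,
    show y + γ + (y + δ) = 2 * y + γ + δ by ring, show y + γ - (y + δ) = γ - δ by ring,
    show y + δ + (y + β) = 2 * y + β + δ by ring, show y + δ - (y + β) = -(β - δ) by ring,
    show y + β + (y + γ) = 2 * y + β + γ by ring, show y + β - (y + γ) = β - γ by ring,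
    H.even, H.even, H.even, H.odd] at h
  linear_combination -h

theorem even_three (H : ThetaPair f g) (y α β γ : ℂ) :
    f (α + γ) * f (α - γ) * (g (y + β) * g (y - β))
      = f (β + γ) * f (β - γ) * (g (y + α) * g (y - α))
        + f (α + β) * f (α - β) * (g (y + γ) * g (y - γ)) := by
  have h := H.three_g y α β γ
  rw [show γ - α = -(α - γ) by ring, H.odd, add_comm γ α] at h
  linear_combination -h

theorem odd_three (H : ThetaPair f g) (x y z w : ℂ) :
    f (x + y) * f (x - y) * (f (z + w) * f (z - w))
      = f (z + y) * f (z - y) * (f (x + w) * f (x - w))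
        + f (x + z) * f (x - z) * (f (y + w) * f (y - w)) := by
  have h := H.three_f x y z w
  rw [show y - z = -(z - y) by ring, show z - x = -(x - z) by ring, H.odd, H.odd, add_comm y z,
    add_comm z x] at h
  linear_combination h

end ThetaPair

/-! ### The face weights as functions of a continuous height -/

noncomputable section

variable (f g : ℂ → ℂ) (l y u : ℂ)

/-- The ratio `S_{a+1} / S_a` at the height with `2aλ = y`. -/
def heightRatio : ℂ := -(f (2 * y + 4 * l) * g y / (f (2 * y) * g (y + 2 * l)))

/-- The weight of a constant face, at the height with `2aλ = y`. In this definition and in those that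
follow, `f = ϑ₁`, `g = ϑ₄`, and `l` is the crossing parameter `λ`; square roots are left out. -/
def face1 : ℂ :=
  f (6 * l - u) * f (3 * l + u) / (f (6 * l) * f (3 * l))
    - (heightRatio f g l y * (g (y - 5 * l) / g (y + l))
      + heightRatio f g l (-y) * (g (y + 5 * l) / g (y - l)))
      * (f u * f (3 * l - u) / (f (6 * l) * f (3 * l)))

/-- The weight of a face with the corners `a a a a±1`, where `y = ±2aλ`. -/
def face2 : ℂ := f (3 * l - u) * g (y + l - u) / (f (3 * l) * g (y + l))

/-- The weight of a face with the corners `a±1 a a a`, without its factor `(S_{a±1}/S_a)^{1/2}`, where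
`y = ±2aλ`. -/
def face3 : ℂ := f u * g (y - 2 * l + u) / (f (3 * l) * g (y + l))

/-- The weight of a face with the corners `a a±1 a±1 a`, without its square root. -/
def face4 : ℂ := f u * f (3 * l - u) / (f (2 * l) * f (3 * l))

/-- The weight of a face with the corners `a a∓1 a a±1`. -/
def face5 : ℂ := f (2 * l - u) * f (3 * l - u) / (f (2 * l) * f (3 * l))

/-- The weight of a face with the corners `a±1 a a∓1 a`, without its square root. -/
def face6 : ℂ := -(f u * f (l - u) / (f (2 * l) * f (3 * l)))

/-- The weight of a face with the corners `a±1 a a±1 a`, where `y = ±2aλ`. -/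
def face7 : ℂ :=
  f (3 * l - u) * f (2 * y + 2 * l + u) / (f (3 * l) * f (2 * y + 2 * l))
    + heightRatio f g l y * (f u * f (2 * y - l + u) / (f (3 * l) * f (2 * y + 2 * l)))

end

namespace ThetaPair

variable {f g : ℂ → ℂ}

/-- The ratio `S_{a-1} / S_a`. -/
theorem heightRatio_neg (H : ThetaPair f g) (l y : ℂ) :
    heightRatio f g l (-y) = -(f (2 * y - 4 * l) * g y / (f (2 * y) * g (y - 2 * l))) := by
  rw [heightRatio, show 2 * -y + 4 * l = -(2 * y - 4 * l) by ring,
    show 2 * -y = -(2 * y) by ring, show -y + 2 * l = -(y - 2 * l) by ring, H.odd, H.odd, H.even,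
    H.even]
  ring

theorem heightRatio_mul (H : ThetaPair f g) {l y : ℂ} (h2 : f (2 * y) ≠ 0)
    (hg2 : g (y + 2 * l) ≠ 0) :
    f (2 * l) * f (2 * y) * (heightRatio f g l y * g (y - 2 * l))
      = f (2 * l) * f (2 * y) * g (y + 4 * l) - f (4 * l) * f (2 * y + 2 * l) * g y := by
  have h : f (4 * l) * f (2 * y + 2 * l) * (g (y + 2 * l) * g y)
      = f (2 * l) * f (2 * y) * (g (y + 4 * l) * g (y + 2 * l))
        + f (2 * l) * f (2 * y + 4 * l) * (g y * g (y - 2 * l)) := by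
    have h := H.mixed y l (3 * l) l (-l)
    ring_nf at h ⊢
    linear_combination h
  rw [heightRatio]
  generalize f (2 * l) = f2 at *
  generalize f (4 * l) = f4 at *
  generalize f (2 * y) = F0 at *
  generalize f (2 * y + 2 * l) = F2 at *
  generalize f (2 * y + 4 * l) = F4 at *
  generalize g y = g0 at *
  generalize g (y + 2 * l) = g2 at *
  generalize g (y + 4 * l) = g4 at *
  generalize g (y - 2 * l) = k2 at *
  field_simp
  linear_combination h

/-- This is one component of the statement that the row vector of the crossing factors is
annihilated by the face weights at `-3λ`. -/
theorem crossing_kernel (H : ThetaPair f g) {l y : ℂ} (h2l : f (2 * l) ≠ 0) (h3l : f (3 * l) ≠ 0)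
    (h2 : f (2 * y) ≠ 0) (h22 : f (2 * y + 2 * l) ≠ 0)
    (hg1 : g (y + l) ≠ 0) (hg2 : g (y + 2 * l) ≠ 0) (hg2' : g (y - 2 * l) ≠ 0) :
    heightRatio f g l (-y) * (f (4 * l) / f (2 * l)) - g (y - 5 * l) / g (y + l)
      = heightRatio f g l y * f (2 * y - 4 * l) / f (2 * y + 2 * l)
        - f (6 * l) * f (2 * y - l) / (f (3 * l) * f (2 * y + 2 * l)) := by
  have h1 := H.heightRatio_mul h2 hg2
  have h3 : f (6 * l) * f (2 * y - l) * (g (y + l) * g (y - 2 * l))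
      = f (3 * l) * f (2 * y - 4 * l) * (g (y + 4 * l) * g (y + l))
        + f (3 * l) * f (2 * y + 2 * l) * (g (y - 2 * l) * g (y - 5 * l)) := by
    have h := H.mixed y (3 * l / 2) (5 * l / 2) (-l / 2) (-7 * l / 2)
    ring_nf at h ⊢
    linear_combination h
  rw [H.heightRatio_neg]
  generalize heightRatio f g l y = r at *
  generalize f (2 * l) = f2 at *
  generalize f (3 * l) = f3 at *
  generalize f (4 * l) = f4 at *
  generalize f (6 * l) = f6 at *
  generalize f (2 * y) = F0 at *
  generalize f (2 * y + 2 * l) = F2 at *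
  generalize f (2 * y - l) = E1 at *
  generalize f (2 * y - 4 * l) = E4 at *
  generalize g y = g0 at *
  generalize g (y + l) = g1 at *
  generalize g (y + 2 * l) = g2 at *
  generalize g (y + 4 * l) = g4 at *
  generalize g (y - 2 * l) = k2 at *
  generalize g (y - 5 * l) = k5 at *
  have e1 : r = (f2 * F0 * g4 - f4 * F2 * g0) / (f2 * F0 * k2) := by
    field_simp
    linear_combination h1
  have e3 : f6 * E1 / (f3 * F2) = E4 * g4 / (F2 * k2) + k5 / g1 := by
    field_simp
    linear_combination h3
  rw [e1, e3]
  field_simp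
  ring

/-- The second expression for the face weight with the centre at the height `y`. -/
theorem face7_eq (H : ThetaPair f g) {l y : ℂ} (h2l : f (2 * l) ≠ 0) (h3l : f (3 * l) ≠ 0)
    (h2 : f (2 * y) ≠ 0) (h22 : f (2 * y + 2 * l) ≠ 0) (h24 : f (2 * y - 4 * l) ≠ 0)
    (hg1 : g (y + l) ≠ 0) (hg2 : g (y + 2 * l) ≠ 0) (hg2' : g (y - 2 * l) ≠ 0) (u : ℂ) :
    face7 f g l y u
      = f (3 * l + u) * f (2 * y - 4 * l + u) / (f (3 * l) * f (2 * y - 4 * l))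
        + (heightRatio f g l (-y) * (f (4 * l) / f (2 * l)) - g (y - 5 * l) / g (y + l))
          * (f u * f (2 * y - l + u) / (f (3 * l) * f (2 * y - 4 * l))) := by
  rw [H.crossing_kernel h2l h3l h2 h22 hg1 hg2 hg2', face7]
  have h : f (3 * l) * f (2 * y + 2 * l) * (f (3 * l + u) * f (2 * y - 4 * l + u))
      = f (6 * l) * f (2 * y - l) * (f u * f (2 * y - l + u))
        + f (3 * l) * f (2 * y - 4 * l) * (f (3 * l - u) * f (2 * y + 2 * l + u)) := by
    have h := H.odd_three (y + 5 * l / 2 + u / 2) (y - l / 2 - u / 2) (y - l / 2 + u / 2)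
      (y - 7 * l / 2 + u / 2)
    ring_nf at h ⊢
    linear_combination h
  generalize heightRatio f g l y = r at *
  generalize f (3 * l + u) = fa at *
  generalize f (3 * l - u) = fb at *
  generalize f (2 * y - 4 * l + u) = fc at *
  generalize f (2 * y + 2 * l + u) = fd at *
  generalize f (2 * y - l + u) = fe at *
  generalize f (3 * l) = f3 at *
  generalize f (6 * l) = f6 at *
  generalize f (2 * y + 2 * l) = F2 at *
  generalize f (2 * y - l) = E1 at *
  generalize f (2 * y - 4 * l) = E4 at *
  field_simp
  linear_combination -h

theorem face7_at_one (H : ThetaPair f g) {l y : ℂ} (h3l : f (3 * l) ≠ 0)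
    (h2 : f (2 * y) ≠ 0) (h22 : f (2 * y + 2 * l) ≠ 0)
    (hg1 : g (y + l) ≠ 0) (hg2 : g (y + 2 * l) ≠ 0) :
    face7 f g l y l = f l * g (y + 3 * l) / (f (3 * l) * g (y + l)) := by
  have h : f (2 * l) * f (2 * y + 3 * l) * (g (y + 2 * l) * g (y + l))
      = f l * f (2 * y + 2 * l) * (g (y + 3 * l) * g (y + 2 * l))
        + f l * f (2 * y + 4 * l) * (g (y + l) * g y) := by
    have h := H.mixed y (l / 2) (5 * l / 2) (3 * l / 2) (l / 2)
    ring_nf at h ⊢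
    linear_combination h
  rw [face7, heightRatio, show 3 * l - l = 2 * l by ring, show 2 * y + 2 * l + l = 2 * y + 3 * l by
    ring, show 2 * y - l + l = 2 * y by ring]
  generalize f l = f1 at *
  generalize f (2 * l) = f2 at *
  generalize f (3 * l) = f3 at *
  generalize f (2 * y) = F0 at *
  generalize f (2 * y + 2 * l) = F2 at *
  generalize f (2 * y + 3 * l) = F3 at *
  generalize f (2 * y + 4 * l) = F4 at *
  generalize g y = g0 at *
  generalize g (y + l) = g1 at *
  generalize g (y + 2 * l) = g2 at *
  generalize g (y + 3 * l) = g3 at *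
  field_simp
  linear_combination h

theorem face7_at_two (H : ThetaPair f g) {l y : ℂ} (h3l : f (3 * l) ≠ 0)
    (h2 : f (2 * y) ≠ 0) (h22 : f (2 * y + 2 * l) ≠ 0)
    (hg1 : g (y + l) ≠ 0) (hg2 : g (y + 2 * l) ≠ 0) :
    face7 f g l y (2 * l)
      = heightRatio f g l y * (f l * g (y - l) / (f (3 * l) * g (y + l))) := by
  have h : f (2 * l) * f (2 * y + l) * (g (y + l) * g y)
      = f l * f (2 * y) * (g (y + 2 * l) * g (y + l))
        + f l * f (2 * y + 2 * l) * (g y * g (y - l)) := by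
    have h := H.mixed y (l / 2) (3 * l / 2) (l / 2) (-l / 2)
    ring_nf at h ⊢
    linear_combination h
  rw [face7, heightRatio, show 3 * l - 2 * l = l by ring,
    show 2 * y + 2 * l + 2 * l = 2 * y + 4 * l by ring, show 2 * y - l + 2 * l = 2 * y + l by ring]
  generalize f l = f1 at *
  generalize f (2 * l) = f2 at *
  generalize f (3 * l) = f3 at *
  generalize f (2 * y) = F0 at *
  generalize f (2 * y + l) = F1 at *
  generalize f (2 * y + 2 * l) = F2 at *
  generalize f (2 * y + 4 * l) = F4 at *
  generalize g y = g0 at *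
  generalize g (y + l) = g1 at *
  generalize g (y + 2 * l) = g2 at *
  generalize g (y - l) = k1 at *
  field_simp
  linear_combination -F4 * h

/-- The diagonal entry `I₊₊(λ)` of the inversion relation. -/
theorem face7_inversion (H : ThetaPair f g) {l y : ℂ} (h2l : f (2 * l) ≠ 0) (h3l : f (3 * l) ≠ 0)
    (h2 : f (2 * y) ≠ 0) (h22 : f (2 * y + 2 * l) ≠ 0)
    (hg1 : g (y + l) ≠ 0) (hg2 : g (y + 2 * l) ≠ 0) :
    f l * g (y + 3 * l) / (f (3 * l) * g (y + l)) * face7 f g l y (-l)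
      - heightRatio f g l y * (f l ^ 2 * g (y - l) * g (y - 3 * l) / (f (3 * l) * g (y + l)) ^ 2)
      = f l * f (4 * l) / (f (2 * l) * f (3 * l)) := by
  have h1 : f (4 * l) * f (2 * y) * (g (y + l) * g (y - l))
      = f (2 * l) * f (2 * y - 2 * l) * (g (y + 3 * l) * g (y + l))
        + f (2 * l) * f (2 * y + 2 * l) * (g (y - l) * g (y - 3 * l)) := by
    have h := H.mixed y l (2 * l) 0 (-2 * l)
    ring_nf at h ⊢
    linear_combination h
  have h3 : f (3 * l) * f (2 * y + 2 * l) * (g (y + 2 * l) * g (y + l))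
      = f (2 * l) * f (2 * y + l) * (g (y + 3 * l) * g (y + 2 * l))
        + f l * f (2 * y + 4 * l) * (g y * g (y - l)) := by
    have h := H.mixed y (l / 2) (5 * l / 2) (3 * l / 2) (-l / 2)
    ring_nf at h ⊢
    linear_combination h
  rw [face7, heightRatio, show 3 * l - -l = 4 * l by ring,
    show 2 * y + 2 * l + -l = 2 * y + l by ring, show 2 * y - l + -l = 2 * y - 2 * l by ring, H.odd]
  generalize f l = f1 at *
  generalize f (2 * l) = f2 at *
  generalize f (3 * l) = f3 at *
  generalize f (4 * l) = f4 at *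
  generalize f (2 * y) = F0 at *
  generalize f (2 * y + l) = F1 at *
  generalize f (2 * y + 2 * l) = F2 at *
  generalize f (2 * y + 4 * l) = F4 at *
  generalize f (2 * y - 2 * l) = E2 at *
  generalize g y = g0 at *
  generalize g (y + l) = g1 at *
  generalize g (y + 2 * l) = g2 at *
  generalize g (y + 3 * l) = g3 at *
  generalize g (y - l) = k1 at *
  generalize g (y - 3 * l) = k3 at *
  field_simp
  linear_combination -f1 ^ 2 * F4 * g0 * h1 - f1 * f4 * F0 * g1 * h3

/-- The combination of crossing factors in the weight of a constant face. -/
theorem heightRatio_sum (H : ThetaPair f g) {l y : ℂ} (h2l : f (2 * l) ≠ 0)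
    (h4l : f (4 * l) ≠ 0) (h6l : f (6 * l) ≠ 0) (h2 : f (2 * y) ≠ 0)
    (hg2 : g (y + 2 * l) ≠ 0) (hg2' : g (y - 2 * l) ≠ 0) :
    f l * f (4 * l) * (heightRatio f g l y * (g (y - l) * g (y - 5 * l))
        + heightRatio f g l (-y) * (g (y + l) * g (y + 5 * l)))
      = f (6 * l) * f l * (g (y + 3 * l) * g (y - 3 * l))
        - f (7 * l) * f (2 * l) * (g (y + l) * g (y - l)) := by
  set r := heightRatio f g l y with hr
  set s := heightRatio f g l (-y) with hs
  have r1 : r * g (y - 2 * l) = g (y + 4 * l)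
      - f (4 * l) * f (2 * y + 2 * l) * g y / (f (2 * l) * f (2 * y)) := by
    have := H.heightRatio_mul h2 hg2
    rw [← hr] at this
    generalize f (2 * l) = f2 at *
    generalize f (4 * l) = f4 at *
    generalize f (2 * y) = F0 at *
    generalize f (2 * y + 2 * l) = F2 at *
    generalize g y = g0 at *
    generalize g (y + 4 * l) = g4 at *
    generalize g (y - 2 * l) = k2 at *
    field_simp
    linear_combination this
  have s1 : s * g (y + 2 * l) = g (y - 4 * l)
      - f (4 * l) * f (2 * y - 2 * l) * g y / (f (2 * l) * f (2 * y)) := by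
    have := H.heightRatio_mul (l := l) (y := -y) (by rwa [mul_neg, H.odd, neg_ne_zero])
      (by rwa [show -y + 2 * l = -(y - 2 * l) by ring, H.even])
    rw [show -y - 2 * l = -(y + 2 * l) by ring, show 2 * -y = -(2 * y) by ring,
      show -y + 4 * l = -(y - 4 * l) by ring,
      show -(2 * y) + 2 * l = -(2 * y - 2 * l) by ring, H.odd, H.odd, H.even, H.even, H.even] at this
    rw [← hs] at this
    generalize f (2 * l) = f2 at *
    generalize f (4 * l) = f4 at *
    generalize f (2 * y) = F0 at *
    generalize f (2 * y - 2 * l) = E2 at *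
    generalize g y = g0 at *
    generalize g (y + 2 * l) = g2 at *
    generalize g (y - 4 * l) = k4 at *
    field_simp
    linear_combination -this
  have e1 : ∀ m : ℂ, f (2 * m) * f (2 * y) * (g (y + m) * g (y - m))
      = f m * g y * (f (2 * y + m) * g (y - 2 * m) + f (2 * y - m) * g (y + 2 * m)) := by
    intro m
    have h := H.mixed y m m 0 (-m)
    ring_nf at h ⊢
    linear_combination h
  have F1 : r * (g (y - 2 * l) * g (y - 4 * l)) + s * (g (y + 2 * l) * g (y + 4 * l))
      = 2 * (g (y + 4 * l) * g (y - 4 * l))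
        - f (4 * l) ^ 2 / f (2 * l) ^ 2 * (g (y + 2 * l) * g (y - 2 * l)) := by
    have h := e1 (2 * l)
    rw [show 2 * (2 * l) = 4 * l by ring] at h
    have : r * (g (y - 2 * l) * g (y - 4 * l)) + s * (g (y + 2 * l) * g (y + 4 * l))
      = (r * g (y - 2 * l)) * g (y - 4 * l) + (s * g (y + 2 * l)) * g (y + 4 * l) := by ring
    rw [this, r1, s1]
    generalize f (2 * l) = f2 at *
    generalize f (4 * l) = f4 at *
    generalize f (2 * y) = F0 at *
    generalize f (2 * y + 2 * l) = F2 at *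
    generalize f (2 * y - 2 * l) = E2 at *
    generalize g y = g0 at *
    generalize g (y + 2 * l) = g2 at *
    generalize g (y + 4 * l) = g4 at *
    generalize g (y - 2 * l) = k2 at *
    generalize g (y - 4 * l) = k4 at *
    field_simp
    linear_combination f4 * h
  have F5 : f (4 * l) * (r * (g (y + 2 * l) * g (y - 8 * l)) + s * (g (y - 2 * l) * g (y + 8 * l)))
      = -(f (8 * l) * (g (y + 4 * l) * g (y - 4 * l))) := by
    have h := e1 (4 * l)
    rw [show 2 * (4 * l) = 8 * l by ring] at h
    rw [hr, hs, H.heightRatio_neg, heightRatio]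
    generalize f (4 * l) = f4 at *
    generalize f (8 * l) = f8 at *
    generalize f (2 * y) = F0 at *
    generalize f (2 * y + 4 * l) = F4 at *
    generalize f (2 * y - 4 * l) = E4 at *
    generalize g y = g0 at *
    generalize g (y + 2 * l) = g2 at *
    generalize g (y + 4 * l) = g4 at *
    generalize g (y + 8 * l) = g8 at *
    generalize g (y - 2 * l) = k2 at *
    generalize g (y - 4 * l) = k4 at *
    generalize g (y - 8 * l) = k8 at *
    field_simp
    linear_combination h
  have F2 : f (6 * l) * f (4 * l) * (r * (g (y - l) * g (y - 5 * l))
        + s * (g (y + l) * g (y + 5 * l)))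
      = f (7 * l) * f (3 * l) * (r * (g (y - 2 * l) * g (y - 4 * l))
          + s * (g (y + 2 * l) * g (y + 4 * l)))
        + f (3 * l) * f l * (r * (g (y + 2 * l) * g (y - 8 * l))
          + s * (g (y - 2 * l) * g (y + 8 * l))) := by
    have h1 := H.even_three (y - 3 * l) (5 * l) (2 * l) l
    have h2 := H.even_three (y + 3 * l) (5 * l) (2 * l) l
    ring_nf at h1 h2 ⊢
    linear_combination r * h1 + s * h2
  have a1 : f (6 * l) * (g (y + l) * g (y - l)) = (f (5 * l) * f (3 * l) * (g (y + 2 * l)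
      * g (y - 2 * l)) - f (3 * l) * f l * (g (y + 4 * l) * g (y - 4 * l))) / f (2 * l) := by
    have h := H.even_three y (4 * l) (2 * l) l
    rw [eq_div_iff h2l]
    ring_nf at h ⊢
    linear_combination -h
  have a3 : f (6 * l) * (g (y + 3 * l) * g (y - 3 * l)) = (f (7 * l) * f l * (g (y + 2 * l)
      * g (y - 2 * l)) + f (5 * l) * f l * (g (y + 4 * l) * g (y - 4 * l))) / f (2 * l) := by
    have h := H.even_three y (4 * l) (3 * l) (2 * l)
    rw [eq_div_iff h2l]
    ring_nf at h ⊢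
    linear_combination h
  have c1 : f (5 * l) * f (3 * l) * f (2 * l) ^ 2
      = f (3 * l) * f l * f (4 * l) ^ 2 + f (6 * l) * f (2 * l) * f l ^ 2 := by
    have h := H.odd_three (4 * l) l (2 * l) 0
    ring_nf at h ⊢
    linear_combination h
  have c2 : f (7 * l) * f (3 * l) * (f (4 * l) * f (2 * l))
      = f (5 * l) * f l * (f (6 * l) * f (4 * l)) + f (8 * l) * f (2 * l) * (f (3 * l) * f l) := by
    have h := H.odd_three (5 * l) (2 * l) (3 * l) l
    ring_nf at h ⊢
    linear_combination h
  rw [F1] at F2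
  apply mul_left_cancel₀ h6l
  have F5' : f (3 * l) * f l * (r * (g (y + 2 * l) * g (y - 8 * l))
      + s * (g (y - 2 * l) * g (y + 8 * l)))
      = -(f (3 * l) * f l * f (8 * l) / f (4 * l) * (g (y + 4 * l) * g (y - 4 * l))) := by
    linear_combination (norm := skip) f (3 * l) * f l / f (4 * l) * F5
    generalize f l = f1 at *
    generalize f (3 * l) = f3 at *
    generalize f (4 * l) = f4 at *
    generalize f (8 * l) = f8 at *
    generalize g (y + 2 * l) = g2 at *
    generalize g (y + 4 * l) = g4 at *
    generalize g (y + 8 * l) = g8 at *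
    generalize g (y - 2 * l) = k2 at *
    generalize g (y - 4 * l) = k4 at *
    generalize g (y - 8 * l) = k8 at *
    field_simp
    ring
  rw [F5'] at F2
  have : f (6 * l) * (f (6 * l) * f l * (g (y + 3 * l) * g (y - 3 * l))
        - f (7 * l) * f (2 * l) * (g (y + l) * g (y - l)))
      = f (6 * l) * f l * (f (6 * l) * (g (y + 3 * l) * g (y - 3 * l)))
        - f (7 * l) * f (2 * l) * (f (6 * l) * (g (y + l) * g (y - l))) := by ring
  rw [this, a1, a3, show ∀ a b c d : ℂ, a * (b * c * d) = b * (a * c * d) by intros; ring, F2]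
  clear hr hs r1 s1 F1 F5 F5' F2 a1 a3 this e1
  generalize f l = f1 at *
  generalize f (2 * l) = f2 at *
  generalize f (3 * l) = f3 at *
  generalize f (4 * l) = f4 at *
  generalize f (5 * l) = f5 at *
  generalize f (6 * l) = f6 at *
  generalize f (7 * l) = f7 at *
  generalize f (8 * l) = f8 at *
  generalize g (y + 2 * l) = g2 at *
  generalize g (y + 4 * l) = g4 at *
  generalize g (y - 2 * l) = k2 at *
  generalize g (y - 4 * l) = k4 at *
  field_simp
  linear_combination g2 * k2 * f7 * f4 * c1 + f1 * g4 * k4 * f2 * c2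

/-- At `-λ`, `λ` and `2λ` the weights factorize. -/
theorem face1_neg_one (H : ThetaPair f g) {l y : ℂ} (h2l : f (2 * l) ≠ 0) (h3l : f (3 * l) ≠ 0)
    (h4l : f (4 * l) ≠ 0) (h6l : f (6 * l) ≠ 0) (h2 : f (2 * y) ≠ 0)
    (hg1 : g (y + l) ≠ 0) (hg1' : g (y - l) ≠ 0)
    (hg2 : g (y + 2 * l) ≠ 0) (hg2' : g (y - 2 * l) ≠ 0) :
    face1 f g l y (-l)
      = f l * g (y + 3 * l) * g (y - 3 * l) / (f (3 * l) * g (y + l) * g (y - l)) := by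
  have h := H.heightRatio_sum h2l h4l h6l h2 hg2 hg2'
  rw [face1, show 6 * l - -l = 7 * l by ring, show 3 * l + -l = 2 * l by ring,
    show 3 * l - -l = 4 * l by ring, H.odd]
  set r := heightRatio f g l y
  set s := heightRatio f g l (-y)
  generalize f l = f1 at *
  generalize f (2 * l) = f2 at *
  generalize f (3 * l) = f3 at *
  generalize f (4 * l) = f4 at *
  generalize f (6 * l) = f6 at *
  generalize f (7 * l) = f7 at *
  generalize g (y + l) = g1 at *
  generalize g (y + 3 * l) = g3 at *
  generalize g (y + 5 * l) = g5 at *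
  generalize g (y - l) = k1 at *
  generalize g (y - 3 * l) = k3 at *
  generalize g (y - 5 * l) = k5 at *
  field_simp
  linear_combination h

theorem face1_at_two (H : ThetaPair f g) {l y : ℂ} (h1l : f l ≠ 0) (h2l : f (2 * l) ≠ 0)
    (h3l : f (3 * l) ≠ 0) (h4l : f (4 * l) ≠ 0) (h6l : f (6 * l) ≠ 0) (h2 : f (2 * y) ≠ 0)
    (hg1 : g (y + l) ≠ 0) (hg1' : g (y - l) ≠ 0)
    (hg2 : g (y + 2 * l) ≠ 0) (hg2' : g (y - 2 * l) ≠ 0) :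
    face1 f g l y (2 * l)
      = f (2 * l) ^ 2 * g y ^ 2 / (f l * f (3 * l) * g (y + l) * g (y - l)) := by
  have h := H.heightRatio_sum h2l h4l h6l h2 hg2 hg2'
  have a3 : f (3 * l) ^ 2 * (g (y + l) * g (y - l))
      = f l ^ 2 * (g (y + 3 * l) * g (y - 3 * l)) + f (4 * l) * f (2 * l) * g y ^ 2 := by
    have h := H.even_three y (3 * l) l 0
    ring_nf at h ⊢
    linear_combination h
  have c : f (6 * l) * f (2 * l) * f (3 * l) ^ 2
      = f (5 * l) * f l * f (4 * l) ^ 2 + f (7 * l) * f l * f (2 * l) ^ 2 := by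
    have h := H.odd_three (4 * l) (2 * l) (3 * l) 0
    ring_nf at h ⊢
    linear_combination h
  rw [face1, show 6 * l - 2 * l = 4 * l by ring, show 3 * l + 2 * l = 5 * l by ring,
    show 3 * l - 2 * l = l by ring]
  set r := heightRatio f g l y
  set s := heightRatio f g l (-y)
  have q : r * (g (y - 5 * l) / g (y + l)) + s * (g (y + 5 * l) / g (y - l))
      = (f (6 * l) * f l * (g (y + 3 * l) * g (y - 3 * l))
        - f (7 * l) * f (2 * l) * (g (y + l) * g (y - l)))
        / (f l * f (4 * l) * (g (y + l) * g (y - l))) := by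
    generalize f l = f1 at *
    generalize f (2 * l) = f2 at *
    generalize f (4 * l) = f4 at *
    generalize f (6 * l) = f6 at *
    generalize f (7 * l) = f7 at *
    generalize g (y + l) = g1 at *
    generalize g (y + 3 * l) = g3 at *
    generalize g (y + 5 * l) = g5 at *
    generalize g (y - l) = k1 at *
    generalize g (y - 3 * l) = k3 at *
    generalize g (y - 5 * l) = k5 at *
    field_simp
    linear_combination h
  rw [q]
  clear q h
  generalize f l = f1 at *
  generalize f (2 * l) = f2 at *
  generalize f (3 * l) = f3 at *
  generalize f (4 * l) = f4 at *
  generalize f (5 * l) = f5 at *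
  generalize f (6 * l) = f6 at *
  generalize f (7 * l) = f7 at *
  generalize g y = g0 at *
  generalize g (y + l) = g1 at *
  generalize g (y + 3 * l) = g3 at *
  generalize g (y - l) = k1 at *
  generalize g (y - 3 * l) = k3 at *
  field_simp
  linear_combination f6 * f2 * a3 - g1 * k1 * c

end ThetaPair
end

/-! ### The face weights as elements of spaces of theta functions -/

section

/-- An entire function is zero if it vanishes on the real axis outside of a countable set. -/
theorem entire_eq_zero {F : ℂ → ℂ} (hF : Differentiable ℂ F)
    (h : ∀ᶠ v : ℝ in Filter.cocountable, F v = 0) (z : ℂ) : F z = 0 := by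
  have h1 : ∀ v : ℝ, F v = 0 := by
    have hd : Dense {v : ℝ | F v = 0} := by
      have := (Filter.mem_cocountable.mp h).dense_compl ℝ
      rwa [compl_compl] at this
    have hc : IsClosed {v : ℝ | F v = 0} :=
      isClosed_eq (hF.continuous.comp Complex.continuous_ofReal) continuous_const
    intro v
    have : v ∈ closure {v : ℝ | F v = 0} := hd v
    rwa [hc.closure_eq] at this
  have ha : AnalyticOnNhd ℂ F Set.univ := hF.differentiableOn.analyticOnNhd isOpen_univ
  refine ha.eqOn_zero_of_preconnected_of_frequently_eq_zero isPreconnected_univ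
    (Set.mem_univ 0) ?_ (Set.mem_univ z)
  have ht : Filter.Tendsto (fun n : ℕ => ((1 / ((n : ℝ) + 1) : ℝ) : ℂ)) Filter.atTop
      (nhdsWithin 0 {0}ᶜ) := by
    apply tendsto_nhdsWithin_of_tendsto_nhds_of_eventually_within
    · exact (Complex.continuous_ofReal.tendsto' 0 0 Complex.ofReal_zero).comp
        tendsto_one_div_add_atTop_nhds_zero_nat
    · refine Filter.Eventually.of_forall fun n => ?_
      simp only [Set.mem_compl_iff, Set.mem_singleton_iff, Complex.ofReal_eq_zero]
      positivity
  exact ht.frequently (Filter.Frequently.of_forall fun n => h1 _)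

theorem thetaSpace_differentiable {f g : ℂ → ℂ} (H : ThetaPair f g) {n : ℕ} {ε : ZMod 2} {σ : ℝ}
    {F : ℂ → ℂ} (hF : F ∈ thetaSpace f g n ε σ) : Differentiable ℂ F := by
  induction hF using Submodule.span_induction with
  | mem F h =>
    obtain ⟨l, -, -, -, rfl⟩ := h
    induction l with
    | nil =>
      have : thetaProd f g [] = fun _ => 1 := by ext u; simp [thetaProd]
      rw [this]
      exact differentiable_const 1
    | cons q l ih =>
      have : thetaProd f g (q :: l) = fun u => thetaOf f g q.1 (u - q.2) * thetaProd f g l u := by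
        ext u; simp [thetaProd]
      rw [this]
      refine Differentiable.mul ?_ ih
      have : Differentiable ℂ (thetaOf f g q.1) := by
        rcases zmod_two_eq q.1 with h | h <;> rw [h]
        · simpa using H.diff_f
        · simpa using H.diff_g
      exact this.comp (differentiable_id.sub_const _)
  | zero => exact differentiable_const 0
  | add F G _ _ hF hG => exact hF.add hG
  | smul c F _ hF => exact hF.const_smul c

/-- A product of two theta functions, given by their zeros; every weight is a combination of such
products with the same sum of zeros. -/
theorem mem_thetaSpace_two {f g : ℂ → ℂ} {F : ℂ → ℂ} {ε : ZMod 2} {σ : ℝ} (c : ℂ)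
    (ε₁ ε₂ : ZMod 2) (z₁ z₂ : ℝ) (hε : ε₁ + ε₂ = ε) (hσ : z₁ + z₂ = σ)
    (hF : ∀ u, F u = c * (thetaOf f g ε₁ (u - z₁) * thetaOf f g ε₂ (u - z₂))) :
    F ∈ thetaSpace f g 2 ε σ := by
  have h := Submodule.smul_mem _ c (thetaProd_mem f g [(ε₁, z₁), (ε₂, z₂)])
  convert! h using 1
  · simp [hε, hσ]
  · ext u
    simp [hF, thetaProd]

namespace ThetaPair

variable {f g : ℂ → ℂ}

theorem f_sub (H : ThetaPair f g) (a b : ℂ) : f (a - b) = -f (b - a) := by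
  rw [← H.odd, neg_sub]

theorem g_sub (H : ThetaPair f g) (a b : ℂ) : g (a - b) = g (b - a) := by
  rw [← H.even, neg_sub]

theorem face1_mem (H : ThetaPair f g) (l y : ℝ) : face1 f g l y ∈ thetaSpace f g 2 0 (3 * l) := by
  refine Submodule.sub_mem (x := fun u => f (6 * l - u) * f (3 * l + u) / (f (6 * l) * f (3 * l)))
    (y := fun u => (heightRatio f g l y * (g (y - 5 * l) / g (y + l))
      + heightRatio f g l (-y) * (g (y + 5 * l) / g (y - l)))
      * (f u * f (3 * l - u) / (f (6 * l) * f (3 * l)))) _ ?_ ?_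
  · refine mem_thetaSpace_two (-1 / (f (6 * l) * f (3 * l))) 0 0 (6 * l) (-3 * l) rfl (by ring)
      fun u => ?_
    rw [H.f_sub (6 * l)]
    push_cast
    rw [show u - -3 * (l : ℂ) = 3 * l + u by ring, thetaOf_zero]
    ring
  · refine mem_thetaSpace_two (-(heightRatio f g l y * (g (y - 5 * l) / g (y + l))
      + heightRatio f g l (-y) * (g (y + 5 * l) / g (y - l))) / (f (6 * l) * f (3 * l)))
      0 0 0 (3 * l) rfl (by ring) fun u => ?_
    rw [H.f_sub (3 * l) u]
    push_cast
    rw [thetaOf_zero, sub_zero]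
    ring

theorem face2_mem (H : ThetaPair f g) (l y : ℝ) :
    face2 f g l y ∈ thetaSpace f g 2 1 (4 * l + y) := by
  refine mem_thetaSpace_two (-1 / (f (3 * l) * g (y + l))) 0 1 (3 * l) (y + l) rfl (by ring)
    fun u => ?_
  rw [face2, H.f_sub (3 * l) u, H.g_sub (y + l) u]
  push_cast
  rw [thetaOf_zero, thetaOf_one]
  ring

theorem face3_mem (l y : ℝ) :
    face3 f g l y ∈ thetaSpace f g 2 1 (2 * l - y) := by
  refine mem_thetaSpace_two (1 / (f (3 * l) * g (y + l))) 0 1 0 (2 * l - y) rfl (by ring)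
    fun u => ?_
  rw [face3]
  push_cast
  rw [thetaOf_zero, thetaOf_one, sub_zero, show u - (2 * (l : ℂ) - y) = y - 2 * l + u by ring]
  ring

theorem face4_mem (H : ThetaPair f g) (l : ℝ) : face4 f l ∈ thetaSpace f g 2 0 (3 * l) := by
  refine mem_thetaSpace_two (-1 / (f (2 * l) * f (3 * l))) 0 0 0 (3 * l) rfl (by ring) fun u => ?_
  rw [face4, H.f_sub (3 * l) u]
  push_cast
  rw [thetaOf_zero, sub_zero]
  ring

theorem face5_mem (H : ThetaPair f g) (l : ℝ) : face5 f l ∈ thetaSpace f g 2 0 (5 * l) := by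
  refine mem_thetaSpace_two (1 / (f (2 * l) * f (3 * l))) 0 0 (2 * l) (3 * l) rfl (by ring)
    fun u => ?_
  rw [face5, H.f_sub (3 * l) u, H.f_sub (2 * l) u]
  push_cast
  rw [thetaOf_zero]
  ring

theorem face6_mem (H : ThetaPair f g) (l : ℝ) : face6 f l ∈ thetaSpace f g 2 0 l := by
  refine mem_thetaSpace_two (1 / (f (2 * l) * f (3 * l))) 0 0 0 l rfl (by ring)
    fun u => ?_
  rw [face6, H.f_sub l u]
  push_cast
  rw [thetaOf_zero, sub_zero]
  ring

theorem face7_mem (H : ThetaPair f g) (l y : ℝ) :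
    face7 f g l y ∈ thetaSpace f g 2 0 (l - 2 * y) := by
  refine Submodule.add_mem (x := fun u => f (3 * l - u) * f (2 * y + 2 * l + u)
      / (f (3 * l) * f (2 * y + 2 * l)))
    (y := fun u => heightRatio f g l y * (f u * f (2 * y - l + u)
      / (f (3 * l) * f (2 * y + 2 * l)))) _ ?_ ?_
  · refine mem_thetaSpace_two (-1 / (f (3 * l) * f (2 * y + 2 * l))) 0 0 (3 * l) (-2 * y - 2 * l)
      rfl (by ring) fun u => ?_
    rw [H.f_sub (3 * l)]
    push_cast
    rw [show u - (-2 * (y : ℂ) - 2 * l) = 2 * y + 2 * l + u by ring, thetaOf_zero]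
    ring
  · refine mem_thetaSpace_two (heightRatio f g l y / (f (3 * l) * f (2 * y + 2 * l)))
      0 0 0 (l - 2 * y) rfl (by ring) fun u => ?_
    push_cast
    rw [thetaOf_zero, sub_zero, show u - ((l : ℂ) - 2 * y) = 2 * y - l + u by ring]
    ring

end ThetaPair

/-! ### Values and symmetries of the face weights -/

namespace ThetaPair

variable {f g : ℂ → ℂ}

theorem face1_zero (H : ThetaPair f g) {l : ℂ} (y : ℂ) (h3 : f (3 * l) ≠ 0) (h6 : f (6 * l) ≠ 0) :
    face1 f g l y 0 = 1 := by
  rw [face1, H.zero, sub_zero, add_zero, div_self (mul_ne_zero h6 h3)]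
  ring

theorem face1_cross (l y u : ℂ) : face1 f g l y (3 * l - u) = face1 f g l y u := by
  simp only [face1]
  rw [show 6 * l - (3 * l - u) = 3 * l + u by ring, show 3 * l + (3 * l - u) = 6 * l - u by ring,
    show 3 * l - (3 * l - u) = u by ring]
  ring

theorem face1_neg (H : ThetaPair f g) (l y u : ℂ) : face1 f g l (-y) u = face1 f g l y u := by
  simp only [face1]
  rw [show -y - 5 * l = -(y + 5 * l) by ring, show -y + l = -(y - l) by ring,
    show -y + 5 * l = -(y - 5 * l) by ring, show -y - l = -(y + l) by ring, H.even, H.even, H.even,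
    H.even, neg_neg]
  ring

theorem face2_zero {l y : ℂ} (h3 : f (3 * l) ≠ 0) (h1 : g (y + l) ≠ 0) :
    face2 f g l y 0 = 1 := by
  rw [face2, sub_zero, sub_zero, div_self (mul_ne_zero h3 h1)]

theorem face3_cross (l y u : ℂ) :
    face3 f g l y (3 * l - u) = face2 f g l y u := by
  rw [face3, face2, show y - 2 * l + (3 * l - u) = y + l - u by ring]

theorem face3_zero (H : ThetaPair f g) (l y : ℂ) : face3 f g l y 0 = 0 := by
  rw [face3, H.zero]; ring

theorem face4_cross (l u : ℂ) : face4 f l (3 * l - u) = face4 f l u := by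
  rw [face4, face4, show 3 * l - (3 * l - u) = u by ring]
  ring

theorem face4_zero (H : ThetaPair f g) (l : ℂ) : face4 f l 0 = 0 := by
  rw [face4, H.zero]; ring

theorem face5_zero {l : ℂ} (h2 : f (2 * l) ≠ 0) (h3 : f (3 * l) ≠ 0) : face5 f l 0 = 1 := by
  rw [face5, sub_zero, sub_zero, div_self (mul_ne_zero h2 h3)]

theorem face6_cross (H : ThetaPair f g) (l u : ℂ) : face6 f l (3 * l - u) = face5 f l u := by
  rw [face6, face5, show l - (3 * l - u) = -(2 * l - u) by ring, H.odd]
  ring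

theorem face6_zero (H : ThetaPair f g) (l : ℂ) : face6 f l 0 = 0 := by
  rw [face6, H.zero]; ring

theorem face7_zero (H : ThetaPair f g) {l y : ℂ} (h3 : f (3 * l) ≠ 0)
    (h : f (2 * y + 2 * l) ≠ 0) : face7 f g l y 0 = 1 := by
  rw [face7, sub_zero, add_zero, H.zero, div_self (mul_ne_zero h3 h)]
  ring

theorem heightRatio_inv (H : ThetaPair f g) {l y : ℂ} (h0 : f (2 * y) ≠ 0)
    (h4 : f (2 * y + 4 * l) ≠ 0) (g0 : g y ≠ 0) (g2 : g (y + 2 * l) ≠ 0) :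
    heightRatio f g l y * heightRatio f g l (-y - 2 * l) = 1 := by
  rw [heightRatio, heightRatio, show 2 * (-y - 2 * l) + 4 * l = -(2 * y) by ring,
    show 2 * (-y - 2 * l) = -(2 * y + 4 * l) by ring, show -y - 2 * l = -(y + 2 * l) by ring,
    show -(y + 2 * l) + 2 * l = -y by ring, H.odd, H.odd, H.even, H.even]
  generalize f (2 * y + 4 * l) = a at *
  generalize f (2 * y) = b at *
  generalize g (y + 2 * l) = c at *
  field_simp

theorem face7_cross (H : ThetaPair f g) {l y : ℂ} (h0 : f (2 * y) ≠ 0)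
    (h4 : f (2 * y + 4 * l) ≠ 0) (g0 : g y ≠ 0) (g2 : g (y + 2 * l) ≠ 0) (u : ℂ) :
    face7 f g l y (3 * l - u) = heightRatio f g l y * face7 f g l (-y - 2 * l) u := by
  have h := H.heightRatio_inv h0 h4 g0 g2
  rw [face7, face7, show 3 * l - (3 * l - u) = u by ring,
    show 2 * y + 2 * l + (3 * l - u) = 2 * y + 5 * l - u by ring,
    show 2 * y - l + (3 * l - u) = 2 * y + 2 * l - u by ring,
    show 2 * (-y - 2 * l) + 2 * l + u = -(2 * y + 2 * l - u) by ring,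
    show 2 * (-y - 2 * l) + 2 * l = -(2 * y + 2 * l) by ring,
    show 2 * (-y - 2 * l) - l + u = -(2 * y + 5 * l - u) by ring, H.odd, H.odd, H.odd, mul_neg,
    mul_neg, mul_neg, neg_div_neg_eq, neg_div_neg_eq]
  linear_combination -(f u * f (2 * y + 5 * l - u) / (f (3 * l) * f (2 * y + 2 * l))) * h

end ThetaPair
end

/-! ### The unrestricted model at a generic shift of the heights -/

section

/-- The dilute model with heights in `ℤ`, where the height `a` enters the weights through
`x + 2aλ`, with a generic real number `x`. The crossing factors `S_a` and the factors
`ϑ₄(x+(2a+3)λ) ϑ₄(x+(2a-1)λ) / ϑ₄(x+(2a+1)λ)²` are given by their square roots `sigma a` and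
`tau a`. -/
structure HeightModel where
  f : ℂ → ℂ
  g : ℂ → ℂ
  pair : ThetaPair f g
  lam : ℝ
  x : ℝ
  sigma : ℤ → ℂ
  tau : ℤ → ℂ
  sin_one : Real.sin lam ≠ 0
  sin_two : Real.sin (2 * lam) ≠ 0
  sin_three : Real.sin (3 * lam) ≠ 0
  sin_four : Real.sin (4 * lam) ≠ 0
  sin_six : Real.sin (6 * lam) ≠ 0
  sin_generic : ∀ k : ℤ, Real.sin (2 * x + k * lam) ≠ 0
  sigma_ne : ∀ a, sigma a ≠ 0
  sigma_sq : ∀ a : ℤ, sigma (a + 1) ^ 2 = heightRatio f g lam (x + 2 * a * lam) * sigma a ^ 2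
  tau_sq : ∀ a : ℤ, tau a ^ 2 = g (x + 2 * a * lam + 3 * lam) * g (x + 2 * a * lam - lam)
    / g (x + 2 * a * lam + lam) ^ 2

namespace HeightModel

noncomputable section

variable (M : HeightModel)

/-- The argument `±(x + 2aλ)` of the weights of the faces around the height `a`; `s = ±1`. -/
def pos (s a : ℤ) : ℝ := s * (M.x + 2 * a * M.lam)

/-- The weight of a face with the height `b` at the bottom right and at the top left corner. -/
def mainFace (b a c : ℤ) (u : ℂ) : ℂ :=
  if a = c then
    if a = b then face1 M.f M.g M.lam (M.pos 1 b) u else face7 M.f M.g M.lam (M.pos (a - b) b) u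
  else M.sigma a * M.sigma c / M.sigma b ^ 2 *
    (if a = b then face3 M.f M.g M.lam (M.pos (c - b) b) u
      else if c = b then face3 M.f M.g M.lam (M.pos (a - b) b) u
      else face6 M.f M.lam u)

/-- The weight of a face with the height `a` at the bottom left and at the top right corner, and
different heights `b` and `d` at the other ones. -/
def crossFace (a b d : ℤ) (u : ℂ) : ℂ :=
  if a = b then face2 M.f M.g M.lam (M.pos (d - a) a) u
  else if a = d then face2 M.f M.g M.lam (M.pos (b - a) a) u
  else face5 M.f M.lam u

/-- The face weights of the unrestricted model. -/
def weight (a b c d : ℤ) (u : ℂ) : ℂ :=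
  if |a - b| ≤ 1 ∧ |b - c| ≤ 1 ∧ |c - d| ≤ 1 ∧ |d - a| ≤ 1 then
    if b = d then M.mainFace b a c u
    else if a = c then M.crossFace a b d u
    else M.tau (min a c) * face4 M.f M.lam u
  else 0

/-- The exponent that describes the quasi-periodicity of the weights in the heights. -/
def expo (a : ℤ) : ℝ := M.lam * a ^ 2 + a * M.x

end

variable {M : HeightModel}

theorem f1 : M.f M.lam ≠ 0 := M.pair.f_ne _ M.sin_one
theorem f2 : M.f (2 * M.lam) ≠ 0 := by simpa using M.pair.f_ne _ M.sin_two
theorem f3 : M.f (3 * M.lam) ≠ 0 := by simpa using M.pair.f_ne _ M.sin_three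
theorem f4 : M.f (4 * M.lam) ≠ 0 := by simpa using M.pair.f_ne _ M.sin_four
theorem f6 : M.f (6 * M.lam) ≠ 0 := by simpa using M.pair.f_ne _ M.sin_six

theorem sin_pos_ne {s : ℤ} (hs : s = 1 ∨ s = -1) (a k : ℤ) :
    Real.sin (2 * M.pos s a + k * M.lam) ≠ 0 := by
  rcases hs with rfl | rfl
  · have := M.sin_generic (4 * a + k)
    rwa [pos, show 2 * (((1 : ℤ) : ℝ) * (M.x + 2 * a * M.lam)) + k * M.lam
      = 2 * M.x + ((4 * a + k : ℤ) : ℝ) * M.lam by push_cast; ring]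
  · have := M.sin_generic (4 * a - k)
    rwa [pos, show 2 * (((-1 : ℤ) : ℝ) * (M.x + 2 * a * M.lam)) + k * M.lam
      = -(2 * M.x + ((4 * a - k : ℤ) : ℝ) * M.lam) by push_cast; ring, Real.sin_neg, neg_ne_zero]

theorem F_ne {s : ℤ} (hs : s = 1 ∨ s = -1) (a k : ℤ) :
    M.f (2 * M.pos s a + k * M.lam) ≠ 0 := by
  simpa using M.pair.f_ne _ (M.sin_pos_ne hs a k)

theorem F0 {s : ℤ} (hs : s = 1 ∨ s = -1) (a : ℤ) : M.f (2 * M.pos s a) ≠ 0 := by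
  simpa using M.F_ne hs a 0

theorem F2 {s : ℤ} (hs : s = 1 ∨ s = -1) (a : ℤ) : M.f (2 * M.pos s a + 2 * M.lam) ≠ 0 := by
  simpa using M.F_ne hs a 2

theorem F4 {s : ℤ} (hs : s = 1 ∨ s = -1) (a : ℤ) : M.f (2 * M.pos s a + 4 * M.lam) ≠ 0 := by
  simpa using M.F_ne hs a 4

theorem G_ne (y k : ℝ) : M.g (y + k * M.lam) ≠ 0 := by
  simpa using M.pair.g_ne (y + k * M.lam)

theorem G0 (y : ℝ) : M.g y ≠ 0 := M.pair.g_ne y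
theorem G1 (y : ℝ) : M.g (y + M.lam) ≠ 0 := by simpa using M.G_ne y 1
theorem G2 (y : ℝ) : M.g (y + 2 * M.lam) ≠ 0 := by simpa using M.G_ne y 2
theorem G1' (y : ℝ) : M.g (y - M.lam) ≠ 0 := by simpa [sub_eq_add_neg] using M.G_ne y (-1)
theorem G2' (y : ℝ) : M.g (y - 2 * M.lam) ≠ 0 := by simpa [sub_eq_add_neg] using M.G_ne y (-2)

theorem pos_neg (s a : ℤ) : M.pos (-s) a = -M.pos s a := by
  rw [pos, pos]; push_cast; ring

/-- The face around `a + s` seen from the other side: the substitution `y ↦ -y - 2λ`. -/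
theorem pos_flip {s : ℤ} (hs : s = 1 ∨ s = -1) (a : ℤ) :
    M.pos (-s) (a + s) = -M.pos s a - 2 * M.lam := by
  rw [pos, pos]
  rcases hs with rfl | rfl <;> (push_cast; ring)

/-- The ratio of the crossing factors at two adjacent heights. -/
theorem sigma_ratio {s : ℤ} (hs : s = 1 ∨ s = -1) (a : ℤ) :
    M.sigma (a + s) ^ 2 = heightRatio M.f M.g M.lam (M.pos s a) * M.sigma a ^ 2 := by
  rcases hs with rfl | rfl
  · rw [M.sigma_sq, pos]; push_cast; rw [one_mul]
  · have h1 := M.sigma_sq (a + -1)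
    have h2 := M.pair.heightRatio_inv (M.F0 (.inl rfl) (a - 1)) (M.F4 (.inl rfl) (a - 1))
      (M.G0 (M.pos 1 (a - 1))) (M.G2 (M.pos 1 (a - 1)))
    rw [neg_add_cancel_right] at h1
    rw [show -((M.pos 1 (a - 1) : ℝ) : ℂ) - 2 * M.lam = ((M.pos (-1) a : ℝ) : ℂ) by
      rw [show (-1 : ℤ) = -1 from rfl, show a = (a - 1) + 1 by ring, M.pos_flip (.inl rfl)]
      push_cast; ring_nf] at h2
    rw [h1, ← mul_assoc, mul_comm (heightRatio _ _ _ _)]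
    rw [show (M.x : ℂ) + 2 * ((a + -1 : ℤ) : ℂ) * M.lam = ((M.pos 1 (a - 1) : ℝ) : ℂ) by
      rw [pos]; push_cast; ring, h2, one_mul]

/-! ### Symmetries and zeros of the weights -/

theorem mainFace_comm (b a c : ℤ) (u : ℂ) : M.mainFace b a c u = M.mainFace b c a u := by
  by_cases h : a = c
  · subst h; rfl
  · rw [mainFace, mainFace, if_neg h, if_neg (Ne.symm h), mul_comm (M.sigma a)]
    by_cases h1 : a = b
    · have h2 : c ≠ b := fun h2 => h (h1.trans h2.symm)
      rw [if_pos h1, if_neg h2, if_pos h1]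
    · rw [if_neg h1]
      by_cases h2 : c = b
      · rw [if_pos h2, if_pos h2]
      · rw [if_neg h2, if_neg h2, if_neg h1]

theorem crossFace_comm {a b d : ℤ} (h : b ≠ d) (u : ℂ) :
    M.crossFace a b d u = M.crossFace a d b u := by
  rw [crossFace, crossFace]
  by_cases h1 : a = b
  · have h2 : a ≠ d := fun h2 => h (h1.symm.trans h2)
    rw [if_pos h1, if_neg h2, if_pos h1]
  · by_cases h2 : a = d
    · rw [if_neg h1, if_pos h2, if_pos h2]
    · rw [if_neg h1, if_neg h2, if_neg h2, if_neg h1]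

theorem weight_swap (a b c d : ℤ) (u : ℂ) : M.weight a b c d u = M.weight c b a d u := by
  rw [weight, weight]
  refine if_congr ?_ ?_ rfl
  · rw [abs_sub_comm a b, abs_sub_comm b c, abs_sub_comm c d, abs_sub_comm d a]; tauto
  · rw [M.mainFace_comm b a c, min_comm a c]
    by_cases h : a = c
    · subst h; rfl
    · rw [if_neg h, if_neg (Ne.symm h)]

theorem weight_swap' (a b c d : ℤ) (u : ℂ) : M.weight a b c d u = M.weight a d c b u := by
  rw [weight, weight]
  refine if_congr ?_ ?_ rfl
  · rw [abs_sub_comm a b, abs_sub_comm b c, abs_sub_comm c d, abs_sub_comm d a]; tauto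
  · by_cases h : b = d
    · subst h; rfl
    · rw [if_neg h, if_neg (Ne.symm h), M.crossFace_comm h]

theorem weight_rotate (a b c d : ℤ) (u : ℂ) : M.weight a b c d u = M.weight c d a b u := by
  rw [M.weight_swap, M.weight_swap']

theorem sub_eq_pm {a b : ℤ} (h : |a - b| ≤ 1) (hab : a ≠ b) : a - b = 1 ∨ a - b = -1 := by
  rw [abs_le] at h
  omega

/-- At `u = 0` a face forces its bottom left and top right heights to be equal. -/
theorem weight_zero {a b c d : ℤ} (h1 : |a - b| ≤ 1) (h2 : |b - c| ≤ 1) (h3 : |c - d| ≤ 1)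
    (h4 : |d - a| ≤ 1) : M.weight a b c d 0 = if a = c then 1 else 0 := by
  rw [weight, if_pos ⟨h1, h2, h3, h4⟩]
  have nz := @sub_eq_pm
  by_cases hbd : b = d
  · rw [if_pos hbd, mainFace]
    by_cases hac : a = c
    · rw [if_pos hac, if_pos hac]
      by_cases hab : a = b
      · rw [if_pos hab, M.pair.face1_zero _ M.f3 M.f6]
      · rw [if_neg hab, M.pair.face7_zero M.f3 (M.F2 (nz h1 hab) b)]
    · rw [if_neg hac, if_neg hac, M.pair.face3_zero, M.pair.face3_zero, M.pair.face6_zero]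
      simp
  · rw [if_neg hbd, M.pair.face4_zero, mul_zero]
    by_cases hac : a = c
    · rw [if_pos hac, if_pos hac, crossFace, ThetaPair.face2_zero M.f3 (M.G1 _),
        ThetaPair.face2_zero M.f3 (M.G1 _), ThetaPair.face5_zero M.f2 M.f3]
      simp
    · rw [if_neg hac, if_neg hac]

theorem mainFace_cross {a b c : ℤ} (hac : a ≠ c) (u : ℂ) :
    M.mainFace b a c (3 * M.lam - u)
      = M.sigma a * M.sigma c / M.sigma b ^ 2 * M.crossFace b a c u := by
  rw [mainFace, if_neg hac, crossFace, ThetaPair.face3_cross, ThetaPair.face3_cross,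
    M.pair.face6_cross]
  simp only [eq_comm]

/-- Crossing symmetry `u ↦ 3λ - u`, a rotation of the face by a right angle. -/
theorem weight_cross (a b c d : ℤ) (u : ℂ) : M.weight a b c d (3 * M.lam - u)
    = M.sigma a * M.sigma c / (M.sigma b * M.sigma d) * M.weight d a b c u := by
  have ha := M.sigma_ne a
  have hb := M.sigma_ne b
  have hc := M.sigma_ne c
  have hd := M.sigma_ne d
  by_cases H : |a - b| ≤ 1 ∧ |b - c| ≤ 1 ∧ |c - d| ≤ 1 ∧ |d - a| ≤ 1
  swap
  · rw [weight, weight, if_neg H, if_neg (by tauto), mul_zero]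
  rw [weight, weight, if_pos H, if_pos (c := |d - a| ≤ 1 ∧ |a - b| ≤ 1 ∧ |b - c| ≤ 1 ∧ |c - d| ≤ 1)
    (by tauto)]
  obtain ⟨h1, h2, h3, h4⟩ := H
  by_cases hbd : b = d
  · subst hbd
    rw [if_pos rfl]
    by_cases hac : a = c
    · subst hac
      rw [if_pos rfl, mainFace, mainFace, if_pos rfl, if_pos rfl]
      by_cases hab : a = b
      · subst hab
        rw [if_pos rfl, if_pos rfl, ThetaPair.face1_cross]
        field_simp
      · have hs := sub_eq_pm h1 hab
        rw [if_neg hab, if_neg (Ne.symm hab), M.pair.face7_cross (M.F0 hs b) (M.F4 hs b) (M.G0 _)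
          (M.G2 _)]
        have h5 := M.sigma_ratio hs b
        have h6 := M.pos_flip hs b
        rw [add_sub_cancel] at h5 h6
        rw [neg_sub] at h6
        rw [show M.sigma a * M.sigma a / (M.sigma b * M.sigma b)
          = heightRatio M.f M.g M.lam (M.pos (a - b) b) by
          rw [← sq, ← sq, h5]; field_simp, h6]
        push_cast
        rfl
    · rw [if_neg hac, if_pos rfl, M.mainFace_cross hac, sq]
  · rw [if_neg hbd]
    by_cases hac : a = c
    · subst hac
      have := M.mainFace_cross (a := d) (b := a) (c := b) (Ne.symm hbd)
        (3 * M.lam - u)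
      rw [sub_sub_cancel] at this
      rw [if_pos rfl, if_pos rfl, this, M.crossFace_comm (Ne.symm hbd)]
      field_simp
    · rw [if_neg hac, if_neg hac, if_neg (fun h => hbd h.symm), ThetaPair.face4_cross]
      have : (a = b ∧ c = d) ∨ (a = d ∧ c = b) := by
        simp only [abs_le] at h1 h2 h3 h4
        omega
      rcases this with ⟨rfl, rfl⟩ | ⟨rfl, rfl⟩
      · rw [min_comm]; field_simp
      · field_simp

/-- As a function of `u`, a weight is a theta function of order two; its quasi-periodicity depends on
the heights. -/
theorem weight_mem (a b c d : ℤ) : M.weight a b c d ∈ thetaSpace M.f M.g 2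
    ((b + d - a - c : ℤ) : ZMod 2) (3 * M.lam + M.expo b + M.expo d - M.expo a - M.expo c) := by
  by_cases H : |a - b| ≤ 1 ∧ |b - c| ≤ 1 ∧ |c - d| ≤ 1 ∧ |d - a| ≤ 1
  swap
  · convert! Submodule.zero_mem _
    ext u
    rw [weight, if_neg H]; rfl
  have he : M.weight a b c d = if b = d then M.mainFace b a c
      else if a = c then M.crossFace a b d else M.tau (min a c) • face4 M.f M.lam := by
    ext u
    rw [weight, if_pos H]
    split_ifs <;> rfl
  rw [he]
  obtain ⟨h1, h2, h3, h4⟩ := H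
  have e3 : ∀ {a b : ℤ}, a - b = 1 ∨ a - b = -1 →
      2 * M.lam - M.pos (a - b) b = 3 * M.lam + M.expo b - M.expo a ∧
      4 * M.lam + M.pos (a - b) b = 3 * M.lam + M.expo a - M.expo b ∧
      M.lam - 2 * M.pos (a - b) b = 3 * M.lam + 2 * M.expo b - 2 * M.expo a := by
    intro a b h
    rw [pos, expo, expo]
    rcases h with h | h
    · rw [h, show a = b + 1 by omega]; push_cast; refine ⟨?_, ?_, ?_⟩ <;> ring
    · rw [h, show a = b - 1 by omega]; push_cast; refine ⟨?_, ?_, ?_⟩ <;> ring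
  have p1 : ∀ {k : ℤ}, k = 1 ∨ k = -1 → (k : ZMod 2) = 1 := by
    rintro k (rfl | rfl) <;> rfl
  have p0 : ∀ k : ℤ, ((2 * k : ℤ) : ZMod 2) = 0 := by
    intro k; push_cast; rw [show (2 : ZMod 2) = 0 from rfl, zero_mul]
  by_cases hbd : b = d
  · subst hbd
    rw [if_pos rfl]
    by_cases hac : a = c
    · subst hac
      rw [show b + b - a - a = 2 * (b - a) by ring, p0]
      by_cases hab : a = b
      · subst hab
        convert! M.pair.face1_mem M.lam (M.pos 1 a) using 1
        · congr 1; ring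
        · ext u; simp [mainFace]
      · have e := (e3 (sub_eq_pm h1 hab)).2.2
        convert! M.pair.face7_mem M.lam (M.pos (a - b) b) using 1
        · rw [e]; congr 1; ring
        · ext u; simp [mainFace, hab]
    · by_cases hab : a = b
      · subst hab
        have hs := sub_eq_pm (a := c) (b := a) (by rwa [abs_sub_comm]) (Ne.symm hac)
        convert! Submodule.smul_mem _ (M.sigma a * M.sigma c / M.sigma a ^ 2)
          (ThetaPair.face3_mem M.lam (M.pos (c - a) a)) using 1
        · rw [(e3 hs).1, show a + a - a - c = -(c - a) by ring, p1 (by omega)]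
          congr 1; ring
        · ext u; simp [mainFace, hac]
      · have hs := sub_eq_pm h1 hab
        by_cases hcb : c = b
        · subst hcb
          convert! Submodule.smul_mem _ (M.sigma a * M.sigma c / M.sigma c ^ 2)
            (ThetaPair.face3_mem M.lam (M.pos (a - c) c)) using 1
          · rw [(e3 hs).1, show c + c - a - c = -(a - c) by ring, p1 (by omega)]
            congr 1; ring
          · ext u; simp [mainFace, hab]
        · have hs' := sub_eq_pm (a := c) (b := b) (by rwa [abs_sub_comm]) hcb
          convert! Submodule.smul_mem _ (M.sigma a * M.sigma c / M.sigma b ^ 2)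
            (M.pair.face6_mem M.lam) using 1
          · rw [show b + b - a - c = 2 * 0 by omega, p0]
            congr 1
            rw [show c = b - (a - b) by omega, expo, expo, expo]
            rcases hs with hs | hs
            · rw [hs, show a = b + 1 by omega]; push_cast; ring
            · rw [hs, show a = b - 1 by omega]; push_cast; ring
          · ext u; simp [mainFace, hab, hac, hcb]
  · rw [if_neg hbd]
    by_cases hac : a = c
    · subst hac
      rw [if_pos rfl]
      by_cases hab : a = b
      · subst hab
        have hs := sub_eq_pm (a := d) (b := a) h4 (Ne.symm hbd)
        convert! M.pair.face2_mem M.lam (M.pos (d - a) a) using 1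
        · rw [(e3 hs).2.1, show a + d - a - a = d - a by ring, p1 hs]
          congr 1; ring
        · ext u; simp [crossFace]
      · have hs := sub_eq_pm (a := b) (b := a) h2 (Ne.symm hab)
        by_cases had : a = d
        · subst had
          convert! M.pair.face2_mem M.lam (M.pos (b - a) a) using 1
          · rw [(e3 hs).2.1, show b + a - a - a = b - a by ring, p1 hs]
            congr 1; ring
          · ext u; simp [crossFace, hab]
        · have hs' := sub_eq_pm (a := d) (b := a) h4 (Ne.symm had)
          convert! M.pair.face5_mem M.lam using 1
          · rw [show b + d - a - a = 2 * 0 by omega, p0]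
            congr 1
            rw [show d = a - (b - a) by omega, expo, expo, expo]
            rcases hs with hs | hs
            · rw [hs, show b = a + 1 by omega]; push_cast; ring
            · rw [hs, show b = a - 1 by omega]; push_cast; ring
          · ext u; simp [crossFace, hab, had]
    · rw [if_neg hac]
      have : (a = b ∧ c = d) ∨ (a = d ∧ c = b) := by
        simp only [abs_le] at h1 h2 h3 h4
        omega
      have hm := Submodule.smul_mem _ (M.tau (min a c)) (M.pair.face4_mem M.lam)
      rcases this with ⟨rfl, rfl⟩ | ⟨rfl, rfl⟩
      · convert! hm using 1
        rw [show a + c - a - c = 2 * 0 by omega, p0]; congr 1; ring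
      · convert! hm using 1
        rw [show c + a - a - c = 2 * 0 by omega, p0]; congr 1; ring

theorem weight_differentiable (a b c d : ℤ) : Differentiable ℂ (M.weight a b c d) :=
  thetaSpace_differentiable M.pair (M.weight_mem a b c d)

theorem weight_eq_zero {a b c d : ℤ} (u : ℂ)
    (h : ¬(|a - b| ≤ 1 ∧ |b - c| ≤ 1 ∧ |c - d| ≤ 1 ∧ |d - a| ≤ 1)) : M.weight a b c d u = 0 :=
  if_neg h

end HeightModel
end

/-! ### The inversion relation -/

section

namespace ThetaPair

variable {f g : ℂ → ℂ}

/-- The component of `main_kernel` at a height `c ≠ b`. -/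
theorem kernel_side (H : ThetaPair f g) {l y : ℂ} (h2l : f (2 * l) ≠ 0) (h3l : f (3 * l) ≠ 0)
    (h2 : f (2 * y) ≠ 0) (h22 : f (2 * y + 2 * l) ≠ 0)
    (hg1 : g (y + l) ≠ 0) (hg2 : g (y + 2 * l) ≠ 0) (hg2' : g (y - 2 * l) ≠ 0) :
    face7 f g l y (-(3 * l)) + face3 f g l y (-(3 * l))
      + heightRatio f g l (-y) * face6 f l (-(3 * l)) = 0 := by
  have h := H.crossing_kernel h2l h3l h2 h22 hg1 hg2 hg2'
  rw [face7, face3, face6, show 3 * l - -(3 * l) = 6 * l by ring,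
    show 2 * y + 2 * l + -(3 * l) = 2 * y - l by ring,
    show 2 * y - l + -(3 * l) = 2 * y - 4 * l by ring,
    show y - 2 * l + -(3 * l) = y - 5 * l by ring, show l - -(3 * l) = 4 * l by ring, H.odd]
  generalize heightRatio f g l (-y) = s at *
  generalize heightRatio f g l y = r at *
  have e1 : -f (3 * l) * g (y - 5 * l) / (f (3 * l) * g (y + l)) = -(g (y - 5 * l) / g (y + l)) := by
    rw [neg_mul, neg_div, mul_div_mul_left _ _ h3l]
  have e2 : -(-f (3 * l) * f (4 * l) / (f (2 * l) * f (3 * l))) = f (4 * l) / f (2 * l) := by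
    rw [neg_mul, neg_div, neg_neg, mul_comm (f (2 * l)), mul_div_mul_left _ _ h3l]
  have e3 : r * (-f (3 * l) * f (2 * y - 4 * l) / (f (3 * l) * f (2 * y + 2 * l)))
      = -(r * f (2 * y - 4 * l) / f (2 * y + 2 * l)) := by
    rw [neg_mul, neg_div, mul_div_mul_left _ _ h3l]; ring
  rw [e1, e2, e3]
  linear_combination h

/-- The component of `main_kernel` at the height `c = b`. -/
theorem kernel_centre (H : ThetaPair f g) {l y : ℂ} (h3l : f (3 * l) ≠ 0) (h6l : f (6 * l) ≠ 0) :
    face1 f g l y (-(3 * l)) + heightRatio f g l y * face3 f g l y (-(3 * l))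
      + heightRatio f g l (-y) * face3 f g l (-y) (-(3 * l)) = 0 := by
  rw [face1, face3, face3, show 3 * l - -(3 * l) = 6 * l by ring, add_neg_cancel, H.zero,
    show y - 2 * l + -(3 * l) = y - 5 * l by ring,
    show -y - 2 * l + -(3 * l) = -(y + 5 * l) by ring, show -y + l = -(y - l) by ring, H.even,
    H.even, H.odd]
  have e1 : ∀ a b : ℂ, -f (3 * l) * a / (f (3 * l) * b) = -(a / b) := fun a b => by
    rw [neg_mul, neg_div, mul_div_mul_left _ _ h3l]
  have e2 : -f (3 * l) * f (6 * l) / (f (6 * l) * f (3 * l)) = -1 := by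
    rw [mul_comm (f (6 * l)), e1, div_self h6l]
  rw [e1, e1, e2]
  ring

/-- The entry of the inversion relation at `u = λ` between the heights `b + s` and `b - s`. The last term
vanishes, as `face6` does at `λ`. -/
theorem offdiag_sides (H : ThetaPair f g) {l y : ℂ} (h2l : f (2 * l) ≠ 0) (h3l : f (3 * l) ≠ 0)
    (h2 : f (2 * y) ≠ 0) (h22 : f (2 * y + 2 * l) ≠ 0)
    (hg1 : g (y + l) ≠ 0) (hg2 : g (y + 2 * l) ≠ 0) (hg1' : g (y - l) ≠ 0) (z : ℂ) :
    face7 f g l y l * face6 f l (-l) + face3 f g l y l * face3 f g l (-y) (-l)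
      + face6 f l l * z = 0 := by
  rw [H.face7_at_one h3l h2 h22 hg1 hg2, face6, face6, face3, face3, sub_self, H.zero,
    show l - -l = 2 * l by ring, show y - 2 * l + l = y - l by ring,
    show -y - 2 * l + -l = -(y + 3 * l) by ring, show -y + l = -(y - l) by ring, H.even, H.even,
    H.odd]
  generalize f (2 * l) = a at *
  generalize f (3 * l) = b at *
  generalize g (y + 3 * l) = c at *
  generalize g (y + l) = d at *
  generalize g (y - l) = e at *
  field_simp
  ring

/-- The entry of the inversion relation at `u = λ` between the heights `b + s` and `b`. -/
theorem offdiag_centre (H : ThetaPair f g) {l y : ℂ} (h2l : f (2 * l) ≠ 0) (h3l : f (3 * l) ≠ 0)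
    (h4l : f (4 * l) ≠ 0) (h6l : f (6 * l) ≠ 0)
    (h2 : f (2 * y) ≠ 0) (h22 : f (2 * y + 2 * l) ≠ 0)
    (hg1 : g (y + l) ≠ 0) (hg2 : g (y + 2 * l) ≠ 0) (hg1' : g (y - l) ≠ 0)
    (hg2' : g (y - 2 * l) ≠ 0) (z : ℂ) :
    face7 f g l y l * face3 f g l y (-l) + face3 f g l y l * face1 f g l y (-l)
      + face6 f l l * z = 0 := by
  rw [H.face7_at_one h3l h2 h22 hg1 hg2, H.face1_neg_one h2l h3l h4l h6l h2 hg1 hg1' hg2 hg2',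
    face6, face3, face3, sub_self, H.zero, show y - 2 * l + l = y - l by ring,
    show y - 2 * l + -l = y - 3 * l by ring, H.odd]
  generalize f (2 * l) = a at *
  generalize f (3 * l) = b at *
  generalize g (y + 3 * l) = c at *
  generalize g (y + l) = d at *
  generalize g (y - l) = e at *
  generalize g (y - 3 * l) = k at *
  field_simp
  ring

/-- The diagonal entry of the inversion relation at `u = λ` for the height `b + s`. -/
theorem diag_side (H : ThetaPair f g) {l y : ℂ} (h2l : f (2 * l) ≠ 0) (h3l : f (3 * l) ≠ 0)
    (h2 : f (2 * y) ≠ 0) (h22 : f (2 * y + 2 * l) ≠ 0)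
    (hg1 : g (y + l) ≠ 0) (hg2 : g (y + 2 * l) ≠ 0) (z : ℂ) :
    face7 f g l y l * face7 f g l y (-l)
      + heightRatio f g l y * (face3 f g l y l * face3 f g l y (-l)) + z * face6 f l l
      = face5 f l l * face5 f l (-l) := by
  have h := H.face7_inversion h2l h3l h2 h22 hg1 hg2
  rw [H.face7_at_one h3l h2 h22 hg1 hg2, face6, face3, face3, face5, face5, sub_self, H.zero,
    show y - 2 * l + l = y - l by ring, show 2 * l - l = l by ring,
    show 3 * l - l = 2 * l by ring, show 2 * l - -l = 3 * l by ring,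
    show 3 * l - -l = 4 * l by ring, show y - 2 * l + -l = y - 3 * l by ring, H.odd]
  have e : f l * f (2 * l) / (f (2 * l) * f (3 * l)) * (f (3 * l) * f (4 * l)
      / (f (2 * l) * f (3 * l))) = f l * f (4 * l) / (f (2 * l) * f (3 * l)) := by
    generalize f (2 * l) = a at *
    generalize f (3 * l) = b at *
    field_simp
  rw [e]
  linear_combination h

/-- If the two outer heights differ by one, the inversion relation is a relation between matrices with
two rows; this is a diagonal entry. -/
theorem two_diag (H : ThetaPair f g) {l y : ℂ} (h2l : f (2 * l) ≠ 0) (h3l : f (3 * l) ≠ 0)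
    (hg1 : g (y + l) ≠ 0) (v : ℂ) :
    face2 f g l y v * face2 f g l y (-v)
      + g (y + 3 * l) * g (y - l) / g (y + l) ^ 2 * (face4 f l v * face4 f l (-v))
      = face5 f l v * face5 f l (-v) := by
  have h : f (2 * l) ^ 2 * (g (y + l + v) * g (y + l - v))
      = f (2 * l - v) * f (2 * l + v) * g (y + l) ^ 2
        + f v ^ 2 * (g (y + 3 * l) * g (y - l)) := by
    have h := H.even_three (y + l) (2 * l) v 0
    ring_nf at h ⊢
    linear_combination h
  rw [face2, face2, face4, face4, face5, face5, sub_neg_eq_add, sub_neg_eq_add, sub_neg_eq_add,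
    H.odd]
  generalize f (2 * l) = a at *
  generalize f (3 * l) = b at *
  generalize g (y + l) = c at *
  generalize f (2 * l - v) = c1 at *
  generalize f (2 * l + v) = c2 at *
  generalize f (3 * l - v) = d1 at *
  generalize f (3 * l + v) = d2 at *
  generalize g (y + l + v) = e1 at *
  generalize g (y + l - v) = e2 at *
  generalize g (y + 3 * l) = k1 at *
  generalize g (y - l) = k2 at *
  field_simp
  linear_combination d1 * d2 * h

/-- An off-diagonal entry of the matrix product in `two_diag`. -/
theorem two_offdiag (H : ThetaPair f g) (l y v : ℂ) :
    face2 f g l y v * face4 f l (-v) + face4 f l v * face2 f g l (-y - 2 * l) (-v) = 0 := by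
  rw [face2, face2, face4, face4, sub_neg_eq_add,
    show -y - 2 * l + l - -v = -(y + l - v) by ring, show -y - 2 * l + l = -(y + l) by ring, H.even,
    H.even, H.odd]
  ring

end ThetaPair

namespace HeightModel

variable {M : HeightModel}

/-- The function `ρ` of the inversion relation. -/
noncomputable def rho (M : HeightModel) (v : ℂ) : ℂ := face5 M.f M.lam v * face5 M.f M.lam (-v)

theorem rho_neg (v : ℂ) : M.rho (-v) = M.rho v := by
  rw [rho, rho, neg_neg, mul_comm]

theorem rho_mem : M.rho ∈ thetaSpace M.f M.g 4 0 0 := by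
  have h := thetaSpace_mul (M.pair.face5_mem M.lam)
    (thetaSpace_reflect M.pair (M.pair.face5_mem M.lam))
  rwa [add_neg_cancel] at h

theorem weight_main {a b c : ℤ} (ha : |a - b| ≤ 1) (hc : |c - b| ≤ 1) (u : ℂ) :
    M.weight a b c b u = M.mainFace b a c u := by
  rw [weight, if_pos ⟨ha, by rwa [abs_sub_comm], hc, by rwa [abs_sub_comm]⟩, if_pos rfl]

section

variable {s : ℤ} (hs : s = 1 ∨ s = -1) (b : ℤ) (u : ℂ)
include hs

theorem neg_pm : -s = 1 ∨ -s = -1 := by omega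

theorem main_centre : M.mainFace b b b u = face1 M.f M.g M.lam (M.pos s b) u := by
  rw [mainFace, if_pos rfl, if_pos rfl]
  rcases hs with rfl | rfl
  · rfl
  · rw [M.pos_neg, Complex.ofReal_neg, M.pair.face1_neg]

theorem main_side : M.mainFace b (b + s) (b + s) u = face7 M.f M.g M.lam (M.pos s b) u := by
  rw [mainFace, if_pos rfl, if_neg (by omega), add_sub_cancel_left]

theorem main_centre_side : M.mainFace b b (b + s) u
    = M.sigma (b + s) / M.sigma b * face3 M.f M.g M.lam (M.pos s b) u := by
  have := M.sigma_ne b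
  rw [mainFace, if_neg (by omega), if_pos rfl, add_sub_cancel_left]
  field_simp

theorem main_side_centre : M.mainFace b (b + s) b u
    = M.sigma (b + s) / M.sigma b * face3 M.f M.g M.lam (M.pos s b) u := by
  rw [M.mainFace_comm, M.main_centre_side hs]

theorem main_sides : M.mainFace b (b + s) (b + -s) u
    = M.sigma (b + s) * M.sigma (b + -s) / M.sigma b ^ 2 * face6 M.f M.lam u := by
  rw [mainFace, if_neg (by omega), if_neg (by omega), if_neg (by omega)]

end

theorem near_cases {s : ℤ} (hs : s = 1 ∨ s = -1) {a b : ℤ} (h : |a - b| ≤ 1) :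
    a = b + s ∨ a = b ∨ a = b + -s := by
  rw [abs_le] at h
  omega

theorem near {s : ℤ} (hs : s = 1 ∨ s = -1) (b : ℤ) :
    |b + s - b| ≤ 1 ∧ |b - b| ≤ 1 ∧ |b + -s - b| ≤ 1 := by
  simp only [abs_le]
  omega

theorem sum_near {s : ℤ} (hs : s = 1 ∨ s = -1) {b : ℤ} {G : Finset ℤ}
    (hG : ∀ g, |g - b| ≤ 1 → g ∈ G) {F : ℤ → ℂ} (hF : ∀ g, ¬|g - b| ≤ 1 → F g = 0) :
    ∑ g ∈ G, F g = F (b + s) + F b + F (b + -s) := by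
  have h : ({b + s, b, b + -s} : Finset ℤ) ⊆ G := by
    intro g hg
    simp only [Finset.mem_insert, Finset.mem_singleton] at hg
    obtain ⟨h1, h2, h3⟩ := near hs b
    rcases hg with rfl | rfl | rfl
    · exact hG _ h1
    · exact hG _ h2
    · exact hG _ h3
  rw [← Finset.sum_subset h, Finset.sum_insert (by simp; omega), Finset.sum_insert (by simp; omega),
    Finset.sum_singleton, add_assoc]
  intro g _ hg
  refine hF g fun hn => hg ?_
  rcases near_cases hs hn with h | h | h <;> simp [h]

/-- The crossing factors are annihilated by the weights at `-3λ`. -/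
theorem main_kernel {b c : ℤ} (hc : |c - b| ≤ 1) {s : ℤ} (hs : s = 1 ∨ s = -1) :
    M.sigma (b + s) * M.mainFace b (b + s) c (-(3 * M.lam))
      + M.sigma b * M.mainFace b b c (-(3 * M.lam))
      + M.sigma (b + -s) * M.mainFace b (b + -s) c (-(3 * M.lam)) = 0 := by
  have hb := M.sigma_ne b
  have side : ∀ {s : ℤ}, s = 1 ∨ s = -1 →
      M.sigma (b + s) * M.mainFace b (b + s) (b + s) (-(3 * M.lam))
      + M.sigma b * M.mainFace b b (b + s) (-(3 * M.lam))
      + M.sigma (b + -s) * M.mainFace b (b + -s) (b + s) (-(3 * M.lam)) = 0 := by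
    intro s hs
    have h := M.pair.kernel_side M.f2 M.f3 (M.F0 hs b) (M.F2 hs b) (M.G1 _) (M.G2 _) (M.G2' _)
    have e := M.sigma_ratio (neg_pm hs) b
    rw [M.pos_neg, Complex.ofReal_neg] at e
    rw [M.main_side hs, M.main_centre_side hs, M.mainFace_comm, M.main_sides hs]
    generalize face7 M.f M.g M.lam (M.pos s b) (-(3 * M.lam)) = A at *
    generalize face3 M.f M.g M.lam (M.pos s b) (-(3 * M.lam)) = B at *
    generalize face6 M.f M.lam (-(3 * M.lam)) = C at *
    field_simp
    linear_combination M.sigma (b + s) * (M.sigma b ^ 2 * h + C * e)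
  rcases near_cases hs hc with rfl | rfl | rfl
  · exact side hs
  · have h := M.pair.kernel_centre (y := M.pos s c) M.f3 M.f6
    have e := M.sigma_ratio hs c
    have e' := M.sigma_ratio (neg_pm hs) c
    rw [M.pos_neg, Complex.ofReal_neg] at e'
    rw [M.main_centre hs, M.main_side_centre hs, M.main_side_centre (neg_pm hs), M.pos_neg,
      Complex.ofReal_neg]
    generalize face1 M.f M.g M.lam (M.pos s c) (-(3 * M.lam)) = A at *
    generalize face3 M.f M.g M.lam (M.pos s c) (-(3 * M.lam)) = B at *
    generalize face3 M.f M.g M.lam (-(M.pos s c)) (-(3 * M.lam)) = C at *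
    field_simp
    linear_combination M.sigma c ^ 2 * h + B * e + C * e'
  · have := side (neg_pm hs)
    rw [neg_neg] at this
    linear_combination this

/-- The left-hand side of the inversion relation. -/
noncomputable def invSum (M : HeightModel) (G : Finset ℤ) (a b c f : ℤ) (v : ℂ) : ℂ :=
  ∑ g ∈ G, M.weight a b g f v * M.weight g b c f (-v)

/-- The left-hand side of the inversion relation is a theta function of order four, so that
`thetaSpace_eq_zero` reduces the relation to four values of `u`. -/
theorem invSum_mem (G : Finset ℤ) (a b c f : ℤ) : M.invSum G a b c f ∈ thetaSpace M.f M.g 4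
    ((a + c : ℤ) : ZMod 2) (M.expo c - M.expo a) := by
  have : M.invSum G a b c f = ∑ g ∈ G, fun v => M.weight a b g f v * M.weight g b c f (-v) := by
    ext v; rw [invSum, Finset.sum_apply]
  rw [this]
  refine Submodule.sum_mem _ fun g _ => ?_
  have h := thetaSpace_mul (M.weight_mem a b g f)
    (thetaSpace_reflect M.pair (M.weight_mem g b c f))
  convert! h using 1
  congr 1
  · push_cast
    have h2 : (2 : ZMod 2) = 0 := rfl
    linear_combination ((a : ZMod 2) + c - b - f + g) * h2
  · ring

theorem weight_three (a b c : ℤ) (ha : |a - b| ≤ 1) (hc : |c - b| ≤ 1) :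
    M.weight a b c b (3 * M.lam) = M.sigma a * M.sigma c / M.sigma b ^ 2 := by
  have h := M.weight_cross a b c b 0
  rw [sub_zero, M.weight_zero (by rwa [abs_sub_comm]) ha (by rwa [abs_sub_comm]) hc, if_pos rfl,
    mul_one] at h
  rw [h, sq]

section

variable {a b c : ℤ} (ha : |a - b| ≤ 1) (hc : |c - b| ≤ 1)
  {G : Finset ℤ} (hG : ∀ g, |g - b| ≤ 1 → g ∈ G)
include ha hc hG

theorem invSum_eq {s : ℤ} (hs : s = 1 ∨ s = -1) (v : ℂ) : M.invSum G a b c b v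
    = M.mainFace b a (b + s) v * M.mainFace b (b + s) c (-v)
      + M.mainFace b a b v * M.mainFace b b c (-v)
      + M.mainFace b a (b + -s) v * M.mainFace b (b + -s) c (-v) := by
  obtain ⟨h1, h2, h3⟩ := near hs b
  rw [invSum, sum_near hs hG, M.weight_main ha h1, M.weight_main ha h2, M.weight_main ha h3,
    M.weight_main h1 hc, M.weight_main h2 hc, M.weight_main h3 hc]
  intro g hg
  rw [M.weight_eq_zero _ (by rw [abs_sub_comm b g]; tauto), zero_mul]

theorem invSum_zero : M.invSum G a b c b 0 = if a = c then 1 else 0 := by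
  have w : ∀ x y : ℤ, |x - b| ≤ 1 → |y - b| ≤ 1 → M.mainFace b x y 0 = if x = y then 1 else 0 := by
    intro x y hx hy
    rw [← M.weight_main hx hy, M.weight_zero hx (by rwa [abs_sub_comm]) hy (by rwa [abs_sub_comm])]
  obtain ⟨h1, h2, h3⟩ := near (.inl rfl : (1 : ℤ) = 1 ∨ (1 : ℤ) = -1) b
  rw [M.invSum_eq ha hc hG (.inl rfl), neg_zero, w _ _ ha h1, w _ _ ha h2, w _ _ ha h3,
    w _ _ h1 hc, w _ _ h2 hc, w _ _ h3 hc]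
  rcases near_cases (.inl rfl : (1 : ℤ) = 1 ∨ (1 : ℤ) = -1) ha with rfl | rfl | rfl <;> simp

/-- At `u = 3λ` the relation holds by `main_kernel`. -/
theorem invSum_three : M.invSum G a b c b (3 * M.lam) = 0 := by
  have hs : (1 : ℤ) = 1 ∨ (1 : ℤ) = -1 := .inl rfl
  obtain ⟨h1, h2, h3⟩ := near hs b
  have h := M.main_kernel hc hs
  rw [M.invSum_eq ha hc hG hs, ← M.weight_main ha h1, ← M.weight_main ha h2, ← M.weight_main ha h3,
    M.weight_three a b _ ha h1, M.weight_three a b _ ha h2, M.weight_three a b _ ha h3]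
  linear_combination M.sigma a / M.sigma b ^ 2 * h

theorem invSum_neg_three : M.invSum G a b c b (-(3 * M.lam)) = 0 := by
  have hs : (1 : ℤ) = 1 ∨ (1 : ℤ) = -1 := .inl rfl
  obtain ⟨h1, h2, h3⟩ := near hs b
  have h := M.main_kernel ha hs
  rw [M.invSum_eq ha hc hG hs, neg_neg, ← M.weight_main h1 hc, ← M.weight_main h2 hc,
    ← M.weight_main h3 hc, M.weight_three _ b _ h1 hc, M.weight_three _ b _ h2 hc,
    M.weight_three _ b _ h3 hc, M.mainFace_comm b a, M.mainFace_comm b a, M.mainFace_comm b a]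
  linear_combination M.sigma c / M.sigma b ^ 2 * h

end

/-- The interpolation points for the inversion relation. -/
theorem inversion_interpolation {ε : ZMod 2} {σ : ℝ} {F : ℂ → ℂ}
    (hF : F ∈ thetaSpace M.f M.g 4 ε σ) (h0 : F 0 = 0) (h3 : F (3 * M.lam) = 0)
    (h3' : F (-(3 * M.lam)) = 0) (h1 : F M.lam = 0)
    (hσ : thetaOf M.f M.g ε ((M.lam - σ : ℝ) : ℂ) ≠ 0) (v : ℂ) : F v = 0 := by
  refine thetaSpace_eq_zero M.pair hF 0 (3 * M.lam) (-(3 * M.lam)) M.lam (by simpa using h0)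
    (by simpa using h3) (by simpa using h3') h1 ?_ ?_ ?_ ?_ ?_ ?_ ?_ v
  · rw [sub_zero]; exact M.sin_three
  · rw [sub_zero, Real.sin_neg, neg_ne_zero]; exact M.sin_three
  · rw [sub_zero]; exact M.sin_one
  · rw [show -(3 * M.lam) - 3 * M.lam = -(6 * M.lam) by ring, Real.sin_neg, neg_ne_zero]
    exact M.sin_six
  · rw [show M.lam - 3 * M.lam = -(2 * M.lam) by ring, Real.sin_neg, neg_ne_zero]
    exact M.sin_two
  · rw [show M.lam - -(3 * M.lam) = 4 * M.lam by ring]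
    exact M.sin_four
  · rwa [show 0 + 3 * M.lam + -(3 * M.lam) + M.lam - σ = M.lam - σ by ring]

section

variable {b : ℤ} {G : Finset ℤ} (hG : ∀ g, |g - b| ≤ 1 → g ∈ G) {s : ℤ} (hs : s = 1 ∨ s = -1)
include hG hs

theorem invSum_side_side (v : ℂ) : M.invSum G (b + s) b (b + s) b v = M.rho v := by
  obtain ⟨h1, h2, h3⟩ := near hs b
  rw [← sub_eq_zero]
  have hm : M.invSum G (b + s) b (b + s) b - M.rho ∈ thetaSpace M.f M.g 4 0 0 := by
    refine Submodule.sub_mem _ ?_ M.rho_mem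
    convert! M.invSum_mem G (b + s) b (b + s) b using 1
    rw [sub_self, ← two_mul]
    push_cast
    rw [show (2 : ZMod 2) = 0 from rfl, zero_mul]
  have r3 : M.rho (3 * M.lam) = 0 := by
    rw [rho, face5, sub_self, M.pair.zero]; ring
  have r0 : M.rho 0 = 1 := by
    rw [rho, neg_zero, ThetaPair.face5_zero M.f2 M.f3, mul_one]
  refine M.inversion_interpolation hm ?_ ?_ ?_ ?_ ?_ v
  · rw [Pi.sub_apply, M.invSum_zero h1 h1 hG, r0, if_pos rfl, sub_self]
  · rw [Pi.sub_apply, M.invSum_three h1 h1 hG, r3, sub_self]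
  · rw [Pi.sub_apply, M.invSum_neg_three h1 h1 hG, rho_neg, r3, sub_self]
  · rw [Pi.sub_apply, sub_eq_zero, M.invSum_eq h1 h1 hG hs, M.main_side hs, M.main_side hs,
      M.main_side_centre hs, M.main_centre_side hs, M.main_sides hs, rho]
    have hb := M.sigma_ne b
    have e := M.sigma_ratio hs b
    have h := M.pair.diag_side M.f2 M.f3 (M.F0 hs b) (M.F2 hs b) (M.G1 (M.pos s b))
      (M.G2 _) (M.sigma (b + s) * M.sigma (b + -s) / M.sigma b ^ 2
        * M.mainFace b (b + -s) (b + s) (-M.lam))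
    rw [← h]
    have e' : heightRatio M.f M.g M.lam (M.pos s b) = M.sigma (b + s) ^ 2 / M.sigma b ^ 2 := by
      rw [e]; field_simp
    rw [e']
    ring
  · rw [sub_zero, thetaOf_zero]; exact M.f1

theorem invSum_sides (v : ℂ) : M.invSum G (b + s) b (b + -s) b v = 0 := by
  obtain ⟨h1, h2, h3⟩ := near hs b
  have hne : b + s ≠ b + -s := by omega
  refine M.inversion_interpolation (M.invSum_mem G (b + s) b (b + -s) b) ?_
    (M.invSum_three h1 h3 hG) (M.invSum_neg_three h1 h3 hG) ?_ ?_ v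
  · rw [M.invSum_zero h1 h3 hG, if_neg hne]
  · rw [M.invSum_eq h1 h3 hG hs, M.main_side hs, M.main_side_centre hs, M.main_sides hs,
      M.main_sides hs, M.main_centre_side (neg_pm hs), M.pos_neg, Complex.ofReal_neg]
    have h := M.pair.offdiag_sides M.f2 M.f3 (M.F0 hs b) (M.F2 hs b) (M.G1 _) (M.G2 _)
      (M.G1' (M.pos s b)) (M.mainFace b (b + -s) (b + -s) (-M.lam))
    linear_combination M.sigma (b + s) * M.sigma (b + -s) / M.sigma b ^ 2 * h
  · rw [show (((b + s + (b + -s) : ℤ)) : ZMod 2) = 0 by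
      rw [show b + s + (b + -s) = 2 * b by ring]; push_cast
      rw [show (2 : ZMod 2) = 0 from rfl, zero_mul], thetaOf_zero]
    have e : M.lam - (M.expo (b + -s) - M.expo (b + s)) = 2 * M.pos s b + ((1 : ℤ) : ℝ) * M.lam := by
      rw [expo, expo, pos]; push_cast; ring
    rw [e]
    exact M.pair.f_ne _ (M.sin_pos_ne hs b 1)

theorem invSum_side_centre (v : ℂ) : M.invSum G (b + s) b b b v = 0 := by
  obtain ⟨h1, h2, h3⟩ := near hs b
  refine M.inversion_interpolation (M.invSum_mem G (b + s) b b b) ?_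
    (M.invSum_three h1 h2 hG) (M.invSum_neg_three h1 h2 hG) ?_ ?_ v
  · rw [M.invSum_zero h1 h2 hG, if_neg (by omega)]
  · rw [M.invSum_eq h1 h2 hG hs, M.main_side hs, M.main_side_centre hs, M.main_sides hs,
      M.main_side_centre hs, M.main_centre hs]
    have h := M.pair.offdiag_centre M.f2 M.f3 M.f4 M.f6 (M.F0 hs b) (M.F2 hs b) (M.G1 _) (M.G2 _)
      (M.G1' (M.pos s b)) (M.G2' _) (M.sigma (b + -s) / M.sigma b
        * M.mainFace b (b + -s) b (-M.lam))
    linear_combination M.sigma (b + s) / M.sigma b * h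
  · rw [show (((b + s + b : ℤ)) : ZMod 2) = 1 by
      push_cast
      rw [show (s : ZMod 2) = 1 by rcases hs with rfl | rfl <;> rfl]
      have h2 : (2 : ZMod 2) = 0 := rfl
      linear_combination (b : ZMod 2) * h2, thetaOf_one]
    exact M.pair.g_ne _

theorem invSum_centre_side (v : ℂ) : M.invSum G b b (b + s) b v = 0 := by
  rw [← M.invSum_side_centre hG hs (-v), invSum, invSum]
  refine Finset.sum_congr rfl fun g _ => ?_
  rw [neg_neg, M.weight_swap b b g b, M.weight_swap g b (b + s) b, mul_comm]

/-- The last diagonal entry follows from the other entries: if `A` and `B` are the symmetric matrices of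
the weights at `v` and at `-v`, then it is determined by `(AB)A = A(BA)`. -/
theorem invSum_centre (v : ℂ) : M.invSum G b b b b v = M.rho v := by
  obtain ⟨h1, h2, h3⟩ := near hs b
  rw [← sub_eq_zero]
  have hd : Differentiable ℂ fun v => M.invSum G b b b b v - M.rho v :=
    (thetaSpace_differentiable M.pair (M.invSum_mem G b b b b)).sub
      (thetaSpace_differentiable M.pair M.rho_mem)
  refine entire_eq_zero hd ?_ v
  filter_upwards [eventually_sin_ne_zero 0 (k := 1) one_ne_zero] with v hv
  have hn : M.mainFace b b (b + s) v ≠ 0 := by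
    rw [M.main_centre_side hs, face3]
    refine mul_ne_zero (div_ne_zero (M.sigma_ne _) (M.sigma_ne _)) (div_ne_zero (mul_ne_zero ?_ ?_)
      (mul_ne_zero M.f3 (M.G1 _)))
    · rw [zero_add, one_mul] at hv; exact M.pair.f_ne _ hv
    · have := M.pair.g_ne (M.pos s b - 2 * M.lam + v)
      push_cast at this
      exact this
  have c1 := M.invSum_centre_side hG hs v
  have c2 := M.invSum_centre_side hG (neg_pm hs) v
  have d1 := M.invSum_side_side hG hs v
  have d2 := M.invSum_side_centre hG hs v
  have d3 := M.invSum_sides hG hs v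
  have d0 := M.invSum_eq h2 h2 hG hs v
  rw [M.invSum_eq h2 h1 hG hs] at c1
  rw [M.invSum_eq h2 h3 hG hs] at c2
  rw [M.invSum_eq h1 h1 hG hs] at d1
  rw [M.invSum_eq h1 h2 hG hs] at d2
  rw [M.invSum_eq h1 h3 hG hs] at d3
  rw [d0, sub_eq_zero]
  apply mul_right_cancel₀ hn
  simp only [M.mainFace_comm b (b + s) b, M.mainFace_comm b (b + -s) b,
    M.mainFace_comm b (b + -s) (b + s)] at *
  linear_combination M.mainFace b b (b + s) v * d1 + M.mainFace b b b v * d2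
    + M.mainFace b b (b + -s) v * d3 - M.mainFace b (b + s) (b + s) v * c1
    - M.mainFace b (b + s) (b + -s) v * c2

end

theorem tau_ratio {s : ℤ} (hs : s = 1 ∨ s = -1) (b : ℤ) : M.tau (min b (b + s)) ^ 2
    = M.g (M.pos s b + 3 * M.lam) * M.g (M.pos s b - M.lam) / M.g (M.pos s b + M.lam) ^ 2 := by
  rw [M.tau_sq]
  rcases hs with rfl | rfl
  · rw [min_eq_left (by omega), pos]
    push_cast
    rw [one_mul]
  · have e := M.pos_flip (.inr rfl) b
    rw [neg_neg] at e
    rw [min_eq_right (by omega), show (M.x : ℂ) + 2 * ((b + -1 : ℤ) : ℂ) * M.lam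
      = ((M.pos 1 (b + -1) : ℝ) : ℂ) by rw [pos]; push_cast; ring, e]
    push_cast
    generalize ((M.pos (-1) b : ℝ) : ℂ) = y
    rw [show -y - 2 * (M.lam : ℂ) + 3 * M.lam = -(y - M.lam) by ring,
      show -y - 2 * (M.lam : ℂ) - M.lam = -(y + 3 * M.lam) by ring,
      show -y - 2 * (M.lam : ℂ) + M.lam = -(y + M.lam) by ring, M.pair.even, M.pair.even,
      M.pair.even, mul_comm]

/-- The inversion relation. -/
theorem inversion {a b c f : ℤ} {G : Finset ℤ} (hG : ∀ g, |g - b| ≤ 1 → g ∈ G)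
    (hac : a = c → |a - b| ≤ 1 ∧ |a - f| ≤ 1) (v : ℂ) :
    ∑ g ∈ G, M.weight a b g f v * M.weight g b c f (-v) = if a = c then M.rho v else 0 := by
  by_cases H : |a - b| ≤ 1 ∧ |a - f| ≤ 1 ∧ |c - b| ≤ 1 ∧ |c - f| ≤ 1
  swap
  · have hne : a ≠ c := by
      rintro rfl
      have := hac rfl
      tauto
    rw [if_neg hne]
    refine Finset.sum_eq_zero fun g _ => ?_
    by_cases h : |a - b| ≤ 1 ∧ |a - f| ≤ 1
    · rw [M.weight_eq_zero (a := g) _ (by rw [abs_sub_comm b c]; tauto), mul_zero]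
    · rw [M.weight_eq_zero (a := a) _ (by rw [abs_sub_comm f a]; tauto), zero_mul]
  obtain ⟨h1, h2, h3, h4⟩ := H
  by_cases hbf : b = f
  · subst hbf
    have hs : (1 : ℤ) = 1 ∨ (1 : ℤ) = -1 := .inl rfl
    change M.invSum G a b c b v = _
    rcases near_cases hs h1 with rfl | rfl | rfl
    · rcases near_cases hs h3 with rfl | rfl | rfl
      · rw [M.invSum_side_side hG hs, if_pos rfl]
      · rw [M.invSum_side_centre hG hs, if_neg (by omega)]
      · rw [M.invSum_sides hG hs, if_neg (by omega)]
    · rcases near_cases hs h3 with rfl | rfl | rfl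
      · rw [M.invSum_centre_side hG hs, if_neg (by omega)]
      · rw [M.invSum_centre hG hs, if_pos rfl]
      · rw [M.invSum_centre_side hG (neg_pm hs), if_neg (by omega)]
    · rcases near_cases hs h3 with rfl | rfl | rfl
      · have := M.invSum_sides hG (neg_pm hs) v
        rw [neg_neg] at this
        rw [this, if_neg (by omega)]
      · rw [M.invSum_side_centre hG (neg_pm hs), if_neg (by omega)]
      · rw [M.invSum_side_side hG (neg_pm hs), if_pos rfl]
  by_cases hd : |f - b| ≤ 1
  · have hs := sub_eq_pm hd (Ne.symm hbf)
    have near2 : ∀ g : ℤ, |g - b| ≤ 1 → |g - f| ≤ 1 → g = b ∨ g = f := by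
      intro g h h'; rw [abs_le] at h h'; omega
    have hsum : ∑ g ∈ G, M.weight a b g f v * M.weight g b c f (-v)
        = M.weight a b b f v * M.weight b b c f (-v)
          + M.weight a b f f v * M.weight f b c f (-v) := by
      have hsub : ({b, f} : Finset ℤ) ⊆ G := by
        intro g hg
        simp only [Finset.mem_insert, Finset.mem_singleton] at hg
        rcases hg with rfl | rfl
        · exact hG _ (by simp)
        · exact hG _ hd
      rw [← Finset.sum_subset hsub, Finset.sum_pair hbf]
      intro g _ hg
      simp only [Finset.mem_insert, Finset.mem_singleton] at hg
      rw [M.weight_eq_zero (a := a) _, zero_mul]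
      rintro ⟨-, h5, h6, -⟩
      exact hg (near2 g (by rwa [abs_sub_comm]) h6)
    have e1 : ∀ u, M.weight b b b f u = face2 M.f M.g M.lam (M.pos (f - b) b) u := by
      intro u
      rw [weight, if_pos (by simpa [abs_sub_comm b f] using hd), if_neg hbf, if_pos rfl, crossFace,
        if_pos rfl]
    have e2 : ∀ u, M.weight b b f f u = M.tau (min b f) * face4 M.f M.lam u := by
      intro u
      rw [weight, if_pos (by simpa [abs_sub_comm b f] using hd), if_neg hbf, if_neg hbf]
    have e3 : ∀ u, M.weight f b f f u
        = face2 M.f M.g M.lam (-M.pos (f - b) b - 2 * M.lam) u := by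
      intro u
      have e := M.pos_flip hs b
      rw [add_sub_cancel, neg_sub] at e
      rw [weight, if_pos (by simpa [abs_sub_comm b f] using hd), if_neg hbf, if_pos rfl, crossFace,
        if_neg (Ne.symm hbf), if_pos rfl, e]
      push_cast
      rfl
    have e4 : ∀ u, M.weight f b b f u = M.tau (min b f) * face4 M.f M.lam u := by
      intro u; rw [M.weight_swap, e2]
    have t := M.tau_ratio hs b
    rw [add_sub_cancel] at t
    rw [hsum]
    have d1 := M.pair.two_diag (M.f2) M.f3 (M.G1 (M.pos (f - b) b)) v
    rw [← t] at d1
    have d2 := M.pair.two_offdiag M.lam (M.pos (f - b) b) v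
    have t' := M.tau_ratio (neg_pm hs) f
    have ef := M.pos_flip hs b
    rw [add_sub_cancel, neg_sub] at ef
    rw [neg_sub, add_sub_cancel, ef, min_comm] at t'
    have d3 := M.pair.two_diag (M.f2) M.f3 (M.G1 (-M.pos (f - b) b - 2 * M.lam)) v
    rw [← t'] at d3
    have d4 := M.pair.two_offdiag M.lam ((-M.pos (f - b) b - 2 * M.lam : ℝ) : ℂ) v
    push_cast at d3 d4
    rw [show -(-((M.pos (f - b) b : ℝ) : ℂ) - 2 * M.lam) - 2 * M.lam = M.pos (f - b) b by ring] at d4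
    rw [rho]
    rcases near2 a h1 h2 with rfl | rfl
    · rcases near2 c h3 h4 with rfl | rfl
      · rw [if_pos rfl, e1, e1, e2, e4]
        linear_combination d1
      · rw [if_neg hbf, e1, e2, e2, e3]
        linear_combination M.tau (min a c) * d2
    · rcases near2 c h3 h4 with rfl | rfl
      · rw [if_neg (Ne.symm hbf), e4, e1, e3, e4]
        linear_combination M.tau (min c a) * d4
      · rw [if_pos rfl, e4, e2, e3, e3]
        linear_combination d3
  · have hc : a = c ∧ b ≠ f ∧ a ≠ b ∧ a ≠ f := by
      simp only [abs_le] at h1 h2 h3 h4 hd; omega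
    obtain ⟨rfl, -, hab, haf⟩ := hc
    have e : ∀ u, M.weight a b a f u = face5 M.f M.lam u := by
      intro u
      rw [weight, if_pos (by simp only [abs_le] at *; omega), if_neg hbf, if_pos rfl, crossFace,
        if_neg hab, if_neg haf]
    rw [if_pos rfl, Finset.sum_eq_single_of_mem a (hG a h1), e, e, rho]
    intro g _ hg
    rw [M.weight_eq_zero (a := a) _, zero_mul]
    rintro ⟨-, h5, h6, -⟩
    simp only [abs_le] at *
    omega

end HeightModel
end

/-! ### The Yang-Baxter equation for the unrestricted model -/

section

namespace HeightModel

variable {M : HeightModel}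

/-- At `u = 0` a face is a Kronecker symbol in its free corner. -/
theorem weight_zero_delta (g : ℤ) {b c d : ℤ} (hbc : |b - c| ≤ 1) (hcd : |c - d| ≤ 1) :
    M.weight g b c d 0 = if g = c then 1 else 0 := by
  by_cases h : g = c
  · subst h
    rw [M.weight_zero (by rwa [abs_sub_comm]) hbc hcd (by rwa [abs_sub_comm])]
  · by_cases H : |g - b| ≤ 1 ∧ |b - c| ≤ 1 ∧ |c - d| ≤ 1 ∧ |d - g| ≤ 1
    · rw [M.weight_zero H.1 H.2.1 H.2.2.1 H.2.2.2]
    · rw [M.weight_eq_zero _ H, if_neg h]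

theorem weight_zero_near (f g d : ℤ) {e : ℤ} (hde : |d - e| ≤ 1) (hef : |e - f| ≤ 1) :
    M.weight f g d e 0 = if f = d then if |g - f| ≤ 1 then 1 else 0 else 0 := by
  by_cases H : |f - g| ≤ 1 ∧ |g - d| ≤ 1 ∧ |d - e| ≤ 1 ∧ |e - f| ≤ 1
  · rw [M.weight_zero H.1 H.2.1 H.2.2.1 H.2.2.2, if_pos (c := |g - f| ≤ 1) (by rw [abs_sub_comm]; exact H.1)]
  · rw [M.weight_eq_zero _ H]
    by_cases h : f = d
    · subst h
      rw [if_pos rfl, if_neg]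
      intro hg
      exact H ⟨by rwa [abs_sub_comm], hg, hde, hef⟩
    · rw [if_neg h]

/-- At `u = 3λ` a face is, up to crossing factors, a Kronecker symbol in the other direction. -/
theorem weight_three_delta (g : ℤ) {f d e : ℤ} (hfe : |f - e| ≤ 1) (hed : |e - d| ≤ 1) :
    M.weight f g d e (3 * M.lam) = if g = e then M.sigma f * M.sigma d / M.sigma e ^ 2 else 0 := by
  have h := M.weight_cross f g d e 0
  rw [sub_zero] at h
  rw [h, M.weight_swap, M.weight_zero_delta g hfe hed]
  by_cases hg : g = e
  · rw [if_pos hg, if_pos hg, hg, mul_one, sq]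
  · rw [if_neg hg, if_neg hg, mul_zero]

theorem weight_three_near (g : ℤ) {b c d : ℤ} (hbc : |b - c| ≤ 1) (hcd : |c - d| ≤ 1) :
    M.weight g b c d (3 * M.lam)
      = if b = d then if |g - b| ≤ 1 then M.sigma g * M.sigma c / M.sigma b ^ 2 else 0 else 0 := by
  have h := M.weight_cross g b c d 0
  rw [sub_zero] at h
  rw [h, M.weight_zero_near d g b hbc hcd]
  by_cases hbd : b = d
  · subst hbd
    rw [if_pos rfl, if_pos rfl, sq, mul_ite, mul_one, mul_zero]
  · rw [if_neg hbd, if_neg (Ne.symm hbd), mul_zero]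

/-- The difference of the two sides of the Yang-Baxter equation. -/
noncomputable def ybe (M : HeightModel) (G : Finset ℤ) (a b c d e f : ℤ) (u v : ℂ) : ℂ :=
  ∑ g ∈ G, M.weight f g d e u * M.weight g b c d (u - v) * M.weight a b g f v
    - ∑ g ∈ G, M.weight a b c g u * M.weight f a g e (u - v) * M.weight g c d e v

/-- A hexagon of successively adjacent heights, and a finite set containing all heights adjacent
to one of them. -/
structure Hexagon (G : Finset ℤ) (a b c d e f : ℤ) : Prop where
  ab : |a - b| ≤ 1
  bc : |b - c| ≤ 1
  cd : |c - d| ≤ 1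
  de : |d - e| ≤ 1
  ef : |e - f| ≤ 1
  fa : |f - a| ≤ 1
  near_a : ∀ g, |g - a| ≤ 1 → g ∈ G
  near_b : ∀ g, |g - b| ≤ 1 → g ∈ G
  near_c : ∀ g, |g - c| ≤ 1 → g ∈ G
  near_d : ∀ g, |g - d| ≤ 1 → g ∈ G
  near_e : ∀ g, |g - e| ≤ 1 → g ∈ G
  near_f : ∀ g, |g - f| ≤ 1 → g ∈ G

variable {G : Finset ℤ} {a b c d e f : ℤ}

theorem sum_delta (F : ℤ → ℂ) {e : ℤ} (he : e ∈ G) (h : ∀ g, g ≠ e → F g = 0) :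
    ∑ g ∈ G, F g = F e :=
  Finset.sum_eq_single_of_mem e he fun g _ hg => h g hg

/-- At `u = v` the faces with parameter `u - v` are Kronecker symbols, and each side of the equation
consists of one term. -/
theorem ybe_diag (h : Hexagon G a b c d e f) (v : ℂ) : M.ybe G a b c d e f v v = 0 := by
  rw [ybe, sub_self, sum_delta _ (h.near_c c (by simp)), sum_delta _ (h.near_f f (by simp)),
    M.weight_zero_delta c h.bc h.cd, M.weight_swap f a f e,
    M.weight_zero_delta f (by rw [abs_sub_comm]; exact h.fa) (by rw [abs_sub_comm]; exact h.ef),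
    if_pos rfl, if_pos rfl]
  · ring
  · intro g hg
    rw [M.weight_swap f a g e,
      M.weight_zero_delta g (by rw [abs_sub_comm]; exact h.fa) (by rw [abs_sub_comm]; exact h.ef),
      if_neg hg]
    ring
  · intro g hg
    rw [M.weight_zero_delta g h.bc h.cd, if_neg hg]
    ring

/-- At `v = 0` the equation is trivial. -/
theorem ybe_zero_right (h : Hexagon G a b c d e f) (u : ℂ) : M.ybe G a b c d e f u 0 = 0 := by
  rw [ybe, sub_zero, sum_delta _ (h.near_a a (by simp)), sum_delta _ (h.near_d d (by simp)),
    M.weight_swap a b a f,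
    M.weight_zero_delta a (by rw [abs_sub_comm]; exact h.ab) (by rw [abs_sub_comm]; exact h.fa),
    M.weight_zero_delta d h.cd h.de, if_pos rfl, if_pos rfl]
  · ring
  · intro g hg
    rw [M.weight_zero_delta g h.cd h.de, if_neg hg]
    ring
  · intro g hg
    rw [M.weight_swap a b g f,
      M.weight_zero_delta g (by rw [abs_sub_comm]; exact h.ab) (by rw [abs_sub_comm]; exact h.fa),
      if_neg hg]
    ring

/-- At `u = 0` the equation reduces to the inversion relation. -/
theorem ybe_zero_left (h : Hexagon G a b c d e f) (v : ℂ) : M.ybe G a b c d e f 0 v = 0 := by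
  have e1 : ∑ g ∈ G, M.weight f g d e 0 * M.weight g b c d (0 - v) * M.weight a b g f v
      = if f = d then if a = c then M.rho v else 0 else 0 := by
    by_cases hfd : f = d
    · subst hfd
      rw [if_pos rfl, ← M.inversion (f := f) h.near_b (fun _ => ⟨h.ab, by
        rw [abs_sub_comm]; exact h.fa⟩) v]
      refine Finset.sum_congr rfl fun g _ => ?_
      rw [M.weight_zero_near f g f h.de h.ef, if_pos rfl, zero_sub]
      by_cases hg : |g - f| ≤ 1
      · rw [if_pos hg]; ring
      · rw [if_neg hg, M.weight_eq_zero (a := a) _ (by tauto)]; ring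
    · rw [if_neg hfd]
      refine Finset.sum_eq_zero fun g _ => ?_
      rw [M.weight_zero_near f g d h.de h.ef, if_neg hfd]
      ring
  have e2 : ∑ g ∈ G, M.weight a b c g 0 * M.weight f a g e (0 - v) * M.weight g c d e v
      = if f = d then if a = c then M.rho v else 0 else 0 := by
    by_cases hac : a = c
    · subst hac
      simp only [if_true]
      rw [← M.rho_neg, ← M.inversion (f := e) h.near_a (fun _ => ⟨h.fa, by
        rw [abs_sub_comm]; exact h.ef⟩) (-v)]
      refine Finset.sum_congr rfl fun g _ => ?_
      rw [M.weight_swap', M.weight_zero_near a g a h.ab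
        (by rw [abs_sub_comm]; exact h.ab), if_pos rfl, zero_sub, neg_neg]
      by_cases hg : |g - a| ≤ 1
      · rw [if_pos hg]; ring
      · rw [if_neg hg, M.weight_eq_zero (a := g) _ (by tauto)]; ring
    · simp only [if_neg hac, ite_self]
      refine Finset.sum_eq_zero fun g _ => ?_
      rw [M.weight_swap', M.weight_zero_near a g c (by rw [abs_sub_comm]; exact h.bc)
        (by rw [abs_sub_comm]; exact h.ab), if_neg hac]
      ring
  rw [ybe, e1, e2, sub_self]

/-- At `u = 3λ` each side of the equation consists of one term, and the terms agree by crossing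
symmetry. -/
theorem ybe_three_left (h : Hexagon G a b c d e f) (v : ℂ) :
    M.ybe G a b c d e f (3 * M.lam) v = 0 := by
  have ha := M.sigma_ne a
  have hb := M.sigma_ne b
  have hc := M.sigma_ne c
  have hd := M.sigma_ne d
  have he := M.sigma_ne e
  have hf := M.sigma_ne f
  have w1 : ∀ g, M.weight f g d e (3 * M.lam) = _ := fun g => M.weight_three_delta g
    (by rw [abs_sub_comm]; exact h.ef) (by rw [abs_sub_comm]; exact h.de)
  have w2 : ∀ g, M.weight a b c g (3 * M.lam) = _ := fun g => by
    rw [M.weight_swap', M.weight_three_delta g h.ab h.bc]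
  rw [ybe, sum_delta _ (h.near_e e (by simp)), sum_delta _ (h.near_b b (by simp)), w1, w2,
    if_pos rfl, if_pos rfl, M.weight_cross e b c d, M.weight_cross f a b e, M.weight_rotate d e b c,
    M.weight_rotate e f a b]
  · field_simp
    ring
  · intro g hg
    rw [w2, if_neg hg]; ring
  · intro g hg
    rw [w1, if_neg hg]; ring

/-- At `u = v + 3λ` the equation reduces to the inversion relation, by crossing symmetry. -/
theorem ybe_add_three (h : Hexagon G a b c d e f) (v : ℂ) :
    M.ybe G a b c d e f (v + 3 * M.lam) v = 0 := by
  have ha := M.sigma_ne a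
  have hb := M.sigma_ne b
  have hc := M.sigma_ne c
  have hd := M.sigma_ne d
  have he := M.sigma_ne e
  have hf := M.sigma_ne f
  have e1 : ∑ g ∈ G, M.weight f g d e (v + 3 * M.lam) * M.weight g b c d (v + 3 * M.lam - v)
      * M.weight a b g f v
      = if b = d then if a = e then M.sigma f * M.sigma c / (M.sigma b * M.sigma e) * M.rho v
        else 0 else 0 := by
    simp only [add_sub_cancel_left, M.weight_three_near _ h.bc h.cd]
    by_cases hbd : b = d
    · subst hbd
      rw [if_pos rfl, ← mul_ite_zero, ← M.inversion (f := f) h.near_b (fun _ => ⟨h.ab, by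
        rw [abs_sub_comm]; exact h.fa⟩) v, Finset.mul_sum]
      refine Finset.sum_congr rfl fun g _ => ?_
      by_cases hg : |g - b| ≤ 1
      · rw [if_pos rfl, if_pos hg, show v + 3 * (M.lam : ℂ) = 3 * M.lam - -v by ring,
          M.weight_cross, M.weight_rotate e f g b]
        have hg := M.sigma_ne g
        field_simp
      · rw [if_pos rfl, if_neg hg, M.weight_eq_zero (a := a) _ (by rw [abs_sub_comm b g]; tauto)]
        ring
    · simp only [if_neg hbd, mul_zero, zero_mul, Finset.sum_const_zero]
  have e2 : ∑ g ∈ G, M.weight a b c g (v + 3 * M.lam) * M.weight f a g e (v + 3 * M.lam - v)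
      * M.weight g c d e v
      = if b = d then if a = e then M.sigma f * M.sigma c / (M.sigma b * M.sigma e) * M.rho v
        else 0 else 0 := by
    have w : ∀ g, M.weight f a g e (3 * M.lam) = _ := fun g => by
      rw [M.weight_swap, M.weight_three_near g (by rw [abs_sub_comm]; exact h.fa)
        (by rw [abs_sub_comm]; exact h.ef)]
    simp only [add_sub_cancel_left, w]
    by_cases hae : a = e
    · subst hae
      have := M.inversion (a := d) (c := b) (f := c) h.near_a (fun hdb => ⟨h.de, by
        rw [abs_sub_comm]; exact h.cd⟩) v
      simp only [if_true]
      rw [← mul_ite_zero, show (if b = d then M.rho v else 0) = if d = b then M.rho v else 0 by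
        simp only [eq_comm], ← this, Finset.mul_sum]
      refine Finset.sum_congr rfl fun g _ => ?_
      by_cases hg : |g - a| ≤ 1
      · rw [if_pos hg, show v + 3 * (M.lam : ℂ) = 3 * M.lam - -v by ring,
          M.weight_cross, M.weight_swap g c d a, M.weight_swap' d c g a]
        have hg := M.sigma_ne g
        field_simp
      · rw [if_neg hg, M.weight_eq_zero (a := d) _ (by rw [abs_sub_comm a g]; tauto)]
        ring
    · simp only [if_neg hae, mul_zero, zero_mul, Finset.sum_const_zero, ite_self]
  rw [ybe, e1, e2, sub_self]

/-- At `v = 3λ` the equation reduces to the inversion relation, by crossing symmetry. -/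
theorem ybe_three_right (h : Hexagon G a b c d e f) (u : ℂ) :
    M.ybe G a b c d e f u (3 * M.lam) = 0 := by
  have ha := M.sigma_ne a
  have hb := M.sigma_ne b
  have hc := M.sigma_ne c
  have hd := M.sigma_ne d
  have he := M.sigma_ne e
  have hf := M.sigma_ne f
  have e1 : ∑ g ∈ G, M.weight f g d e u * M.weight g b c d (u - 3 * M.lam)
      * M.weight a b g f (3 * M.lam)
      = if b = f then if e = c then M.sigma a * M.sigma d / (M.sigma b * M.sigma e)
        * M.rho (3 * M.lam - u) else 0 else 0 := by
    have w : ∀ g, M.weight a b g f (3 * M.lam) = _ := fun g => by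
      rw [M.weight_swap, M.weight_three_near g (by rw [abs_sub_comm]; exact h.ab)
        (by rw [abs_sub_comm]; exact h.fa)]
    simp only [w]
    by_cases hbf : b = f
    · subst hbf
      rw [if_pos rfl, ← mul_ite_zero, ← M.inversion (f := d) h.near_b (fun hec => ⟨h.ef, by
        rw [abs_sub_comm]; exact h.de⟩) (3 * M.lam - u), Finset.mul_sum]
      refine Finset.sum_congr rfl fun g _ => ?_
      by_cases hg : |g - b| ≤ 1
      · have hc := M.weight_cross b g d e (3 * M.lam - u)
        rw [sub_sub_cancel] at hc
        rw [if_pos rfl, if_pos hg, hc, neg_sub]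
        have hg := M.sigma_ne g
        field_simp
      · rw [if_pos rfl, if_neg hg, M.weight_eq_zero (a := e) _ (by rw [abs_sub_comm b g]; tauto)]
        ring
    · simp only [if_neg hbf, mul_zero, Finset.sum_const_zero]
  have e2 : ∑ g ∈ G, M.weight a b c g u * M.weight f a g e (u - 3 * M.lam)
      * M.weight g c d e (3 * M.lam)
      = if b = f then if e = c then M.sigma a * M.sigma d / (M.sigma b * M.sigma e)
        * M.rho (3 * M.lam - u) else 0 else 0 := by
    simp only [M.weight_three_near _ h.cd h.de]
    by_cases hec : e = c
    · subst hec
      have := M.inversion (a := b) (c := f) (f := e) h.near_a (fun _ => ⟨by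
        rw [abs_sub_comm]; exact h.ab, h.bc⟩) (3 * M.lam - u)
      simp only [if_true]
      rw [← mul_ite_zero, ← this, Finset.mul_sum]
      refine Finset.sum_congr rfl fun g _ => ?_
      by_cases hg : |g - e| ≤ 1
      · have hc := M.weight_cross a b e g (3 * M.lam - u)
        rw [sub_sub_cancel] at hc
        rw [if_pos hg, hc, neg_sub, M.weight_swap f a g e, M.weight_swap g a b e]
        have hg := M.sigma_ne g
        field_simp
      · rw [if_neg hg, M.weight_eq_zero (a := b) _ (by tauto)]
        ring
    · rw [Finset.sum_eq_zero]
      · simp only [if_neg hec, ite_self]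
      · intro g _
        rw [if_neg (Ne.symm hec), mul_zero]
  rw [ybe, e1, e2, sub_self]

/-- The sum of the zeros of the two sides avoids the excluded value of `thetaSpace_eq_zero`, unless the
two pairs of heights coincide. -/
theorem expo_ne {p q r t : ℤ} (hpr : |p - r| ≤ 1) (hqt : |q - t| ≤ 1) (hrq : |r - q| ≤ 2)
    (h1 : ¬(p = r ∧ q = t)) (h2 : ¬(p = t ∧ q = r)) {ε : ZMod 2}
    (hε : ε = ((p + q + r + t : ℤ) : ZMod 2)) :
    thetaOf M.f M.g ε ((M.expo p + M.expo q - M.expo r - M.expo t : ℝ) : ℂ) ≠ 0 := by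
  subst hε
  by_cases hpar : (p + q + r + t) % 2 = 0
  · have h0 : ((p + q + r + t : ℤ) : ZMod 2) = 0 := by
      rw [ZMod.intCast_zmod_eq_zero_iff_dvd]; exact Int.dvd_of_emod_eq_zero hpar
    rw [h0, thetaOf_zero]
    apply M.pair.f_ne
    simp only [abs_le] at hpr hqt hrq
    have h5 : p - r = 1 ∨ p - r = -1 := by omega
    have h6 : q - t = p - r ∨ q - t = -(p - r) := by omega
    rcases h6 with h6 | h6
    · rcases h5 with h5 | h5
      · rw [show M.expo p + M.expo q - M.expo r - M.expo t
          = 2 * M.x + ((r + t + (p - r) : ℤ) : ℝ) * M.lam * 2 by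
          rw [show p = r + 1 by omega, show q = t + 1 by omega]
          simp only [expo]; push_cast; ring]
        have e := M.sin_generic (2 * (r + t + (p - r)))
        rwa [show ((2 * (r + t + (p - r)) : ℤ) : ℝ) * M.lam
          = ((r + t + (p - r) : ℤ) : ℝ) * M.lam * 2 by push_cast; ring] at e
      · rw [show M.expo p + M.expo q - M.expo r - M.expo t
          = -(2 * M.x + ((2 * (r + t + (p - r)) : ℤ) : ℝ) * M.lam) by
          rw [show p = r - 1 by omega, show q = t - 1 by omega]
          simp only [expo]; push_cast; ring, Real.sin_neg, neg_ne_zero]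
        exact M.sin_generic _
    · have e1 : M.expo p + M.expo q - M.expo r - M.expo t
          = ((2 * (p - r) * (r - q) : ℤ) : ℝ) * M.lam := by
        rw [show t = q + (p - r) by omega]
        rcases h5 with h5 | h5
        · rw [h5, show p = r + 1 by omega]; simp only [expo]; push_cast; ring
        · rw [h5, show p = r + -1 by omega]; simp only [expo]; push_cast; ring
      rw [e1]
      have h7 : 2 * (p - r) * (r - q) = 2 ∨ 2 * (p - r) * (r - q) = -2
          ∨ 2 * (p - r) * (r - q) = 4 ∨ 2 * (p - r) * (r - q) = -4 := by
        rcases h5 with h5 | h5 <;> rw [h5] <;> omega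
      have s2 := M.sin_two
      have s4 := M.sin_four
      rcases h7 with h7 | h7 | h7 | h7 <;> rw [h7] <;> push_cast
      · exact s2
      · rwa [neg_mul, Real.sin_neg, neg_ne_zero]
      · exact s4
      · rwa [neg_mul, Real.sin_neg, neg_ne_zero]
  · have h0 : ((p + q + r + t : ℤ) : ZMod 2) = 1 := by
      rcases zmod_two_eq ((p + q + r + t : ℤ) : ZMod 2) with h | h
      · rw [ZMod.intCast_zmod_eq_zero_iff_dvd] at h
        exact absurd (Int.emod_eq_zero_of_dvd h) hpar
      · exact h
    rw [h0, thetaOf_one]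
    exact M.pair.g_ne _

theorem zmod_two_cast {k l : ℤ} (h : (k - l) % 2 = 0) : (k : ZMod 2) = (l : ZMod 2) := by
  rw [← sub_eq_zero, ← Int.cast_sub, ZMod.intCast_zmod_eq_zero_iff_dvd]
  exact Int.dvd_of_emod_eq_zero h

/-- As a function of `u`, each side of the equation is a theta function of order four, with a
quasi-periodicity that does not depend on the inner height. -/
theorem ybe_mem_left (G : Finset ℤ) (a b c d e f : ℤ) (v : ℝ) :
    (fun u => M.ybe G a b c d e f u v) ∈ thetaSpace M.f M.g 4 ((f + c + e + b : ℤ) : ZMod 2)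
      (6 * M.lam + 2 * v + M.expo e + M.expo b - M.expo f - M.expo c) := by
  have he : (fun u => M.ybe G a b c d e f u v)
      = ∑ g ∈ G, M.weight a b g f v • (fun u => M.weight f g d e u * M.weight g b c d (u - v))
        - ∑ g ∈ G, M.weight g c d e v • (fun u => M.weight a b c g u * M.weight f a g e (u - v)) := by
    ext u
    rw [ybe, Pi.sub_apply, Finset.sum_apply, Finset.sum_apply]
    congr 1 <;> refine Finset.sum_congr rfl fun g _ => ?_ <;>
      rw [Pi.smul_apply, smul_eq_mul] <;> ring
  rw [he]
  refine Submodule.sub_mem _ (Submodule.sum_mem _ fun g _ => Submodule.smul_mem _ _ ?_)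
    (Submodule.sum_mem _ fun g _ => Submodule.smul_mem _ _ ?_)
  · convert! thetaSpace_mul (M.weight_mem f g d e) (thetaSpace_shift v (M.weight_mem g b c d)) using 1
    congr 1
    · rw [← Int.cast_add]; exact zmod_two_cast (by omega)
    · push_cast; ring
  · convert! thetaSpace_mul (M.weight_mem a b c g) (thetaSpace_shift v (M.weight_mem f a g e)) using 1
    congr 1
    · rw [← Int.cast_add]; exact zmod_two_cast (by omega)
    · push_cast; ring

theorem ybe_mem_right (G : Finset ℤ) (a b c d e f : ℤ) (u : ℝ) :
    (fun v => M.ybe G a b c d e f u v) ∈ thetaSpace M.f M.g 4 ((d + a + c + f : ℤ) : ZMod 2)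
      (2 * u + M.expo c + M.expo f - M.expo d - M.expo a) := by
  have he : (fun v => M.ybe G a b c d e f u v)
      = ∑ g ∈ G, M.weight f g d e u • (fun v => M.weight g b c d (-(v - u)) * M.weight a b g f v)
        - ∑ g ∈ G, M.weight a b c g u • (fun v => M.weight f a g e (-(v - u))
          * M.weight g c d e v) := by
    ext v
    rw [ybe, Pi.sub_apply, Finset.sum_apply, Finset.sum_apply]
    congr 1 <;> refine Finset.sum_congr rfl fun g _ => ?_ <;>
      rw [Pi.smul_apply, smul_eq_mul, neg_sub] <;> ring
  rw [he]
  refine Submodule.sub_mem _ (Submodule.sum_mem _ fun g _ => Submodule.smul_mem _ _ ?_)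
    (Submodule.sum_mem _ fun g _ => Submodule.smul_mem _ _ ?_)
  · convert! thetaSpace_mul (thetaSpace_shift u (thetaSpace_reflect M.pair
      (M.weight_mem g b c d))) (M.weight_mem a b g f) using 1
    congr 1
    · rw [← Int.cast_add]; exact zmod_two_cast (by omega)
    · push_cast; ring
  · convert! thetaSpace_mul (thetaSpace_shift u (thetaSpace_reflect M.pair
      (M.weight_mem f a g e))) (M.weight_mem g c d e) using 1
    congr 1
    · rw [← Int.cast_add]; exact zmod_two_cast (by omega)
    · push_cast; ring

theorem ybe_differentiable_left (G : Finset ℤ) (a b c d e f : ℤ) (v : ℂ) :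
    Differentiable ℂ fun u => M.ybe G a b c d e f u v := by
  have hw := M.weight_differentiable
  refine Differentiable.sub (Differentiable.fun_sum fun g _ => ?_)
    (Differentiable.fun_sum fun g _ => ?_)
  · exact ((hw f g d e).mul ((hw g b c d).comp (differentiable_id.sub_const v))).mul_const _
  · exact ((hw a b c g).mul ((hw f a g e).comp (differentiable_id.sub_const v))).mul_const _

theorem ybe_differentiable_right (G : Finset ℤ) (a b c d e f : ℤ) (u : ℂ) :
    Differentiable ℂ fun v => M.ybe G a b c d e f u v := by
  have hw := M.weight_differentiable
  refine Differentiable.sub (Differentiable.fun_sum fun g _ => ?_)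
    (Differentiable.fun_sum fun g _ => ?_)
  · exact (((hw g b c d).comp ((differentiable_const u).sub differentiable_id)).const_mul _).mul
      (hw a b g f)
  · exact (((hw f a g e).comp ((differentiable_const u).sub differentiable_id)).const_mul _).mul
      (hw g c d e)

/-- The Yang-Baxter equation if the quasi-periodicity in `u` is generic. -/
theorem ybe_generic_left (h : Hexagon G a b c d e f) (h1 : ¬(f = e ∧ c = b))
    (h2 : ¬(f = b ∧ c = e)) (u v : ℂ) : M.ybe G a b c d e f u v = 0 := by
  refine entire_eq_zero (M.ybe_differentiable_right G a b c d e f u) ?_ v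
  filter_upwards [eventually_sin_ne_zero 0 (k := 1) one_ne_zero,
    eventually_sin_ne_zero (3 * M.lam) (k := 1) one_ne_zero,
    eventually_sin_ne_zero (3 * M.lam) (k := -1) (by norm_num)] with v hv1 hv2 hv3
  rw [zero_add, one_mul] at hv1
  rw [one_mul] at hv2
  rw [neg_one_mul, ← sub_eq_add_neg] at hv3
  refine thetaSpace_eq_zero M.pair (M.ybe_mem_left G a b c d e f v) 0 v (3 * M.lam) (v + 3 * M.lam)
    (by simpa using M.ybe_zero_left h v) (M.ybe_diag h v) (by simpa using M.ybe_three_left h v)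
    (by simpa using M.ybe_add_three h v) ?_ ?_ ?_ ?_ ?_ ?_ ?_ u
  · rwa [sub_zero]
  · rw [sub_zero]; exact M.sin_three
  · rwa [sub_zero, add_comm]
  · exact hv3
  · rw [add_sub_cancel_left]; exact M.sin_three
  · rwa [add_sub_cancel_right]
  · rw [show 0 + v + 3 * M.lam + (v + 3 * M.lam) - (6 * M.lam + 2 * v + M.expo e + M.expo b
      - M.expo f - M.expo c) = M.expo f + M.expo c - M.expo e - M.expo b by ring]
    have h3 := h.ef
    have h4 := h.bc
    have h5 := h.cd
    have h6 := h.de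
    refine M.expo_ne (by rwa [abs_sub_comm]) (by rwa [abs_sub_comm]) ?_ h1 h2 rfl
    simp only [abs_le] at *
    omega

/-- The Yang-Baxter equation if the quasi-periodicity in `v` is generic. -/
theorem ybe_generic_right (h : Hexagon G a b c d e f) (h1 : ¬(d = c ∧ a = f))
    (h2 : ¬(d = f ∧ a = c)) (u v : ℂ) : M.ybe G a b c d e f u v = 0 := by
  refine entire_eq_zero (M.ybe_differentiable_left G a b c d e f v) ?_ u
  filter_upwards [eventually_sin_ne_zero 0 (k := 1) one_ne_zero,
    eventually_sin_ne_zero (-(3 * M.lam)) (k := 1) one_ne_zero,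
    eventually_sin_ne_zero (-(6 * M.lam)) (k := 1) one_ne_zero] with u hv1 hv2 hv3
  rw [zero_add, one_mul] at hv1
  rw [one_mul, neg_add_eq_sub] at hv2 hv3
  refine thetaSpace_eq_zero M.pair (M.ybe_mem_right G a b c d e f u) 0 u (3 * M.lam) (u - 3 * M.lam)
    (by simpa using M.ybe_zero_right h u) (M.ybe_diag h u) (by simpa using M.ybe_three_right h u)
    (by simpa using M.ybe_add_three h (u - 3 * M.lam)) ?_ ?_ ?_ ?_ ?_ ?_ ?_ v
  · rwa [sub_zero]
  · rw [sub_zero]; exact M.sin_three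
  · rwa [sub_zero]
  · rwa [← neg_sub, Real.sin_neg, neg_ne_zero]
  · rw [sub_sub_cancel_left, Real.sin_neg, neg_ne_zero]; exact M.sin_three
  · rwa [show u - 3 * M.lam - 3 * M.lam = u - 6 * M.lam by ring]
  · rw [show 0 + u + 3 * M.lam + (u - 3 * M.lam) - (2 * u + M.expo c + M.expo f
      - M.expo d - M.expo a) = M.expo d + M.expo a - M.expo c - M.expo f by ring]
    have h3 := h.cd
    have h4 := h.fa
    have h5 := h.ab
    have h6 := h.bc
    refine M.expo_ne (by rwa [abs_sub_comm]) (by rwa [abs_sub_comm]) ?_ h1 h2 rfl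
    simp only [abs_le] at *
    omega

/-- If both quasi-periodicities are degenerate, then the Yang-Baxter equation follows from its
validity at one further point. -/
theorem ybe_of_point (h : Hexagon G a b c d e f) (he : M.expo e + M.expo b = M.expo f + M.expo c)
    (ha : M.expo d + M.expo a = M.expo f + M.expo c)
    (hp : ((f + c + e + b : ℤ) : ZMod 2) = 0) (hp' : ((d + a + c + f : ℤ) : ZMod 2) = 0)
    (h0 : M.ybe G a b c d e f (2 * M.lam) M.lam = 0) (u v : ℂ) :
    M.ybe G a b c d e f u v = 0 := by
  have s1 := M.sin_one
  have s2 := M.sin_two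
  have s3 := M.sin_three
  have h1 : ∀ u, M.ybe G a b c d e f u M.lam = 0 := by
    have hm := M.ybe_mem_left G a b c d e f M.lam
    rw [hp] at hm
    refine thetaSpace_eq_zero M.pair hm 0 M.lam (3 * M.lam)
      (2 * M.lam) (by simpa using M.ybe_zero_left h M.lam) (M.ybe_diag h M.lam)
      (by simpa using M.ybe_three_left h M.lam) (by simpa using h0) ?_ ?_ ?_ ?_ ?_ ?_ ?_
    · rwa [sub_zero]
    · rwa [sub_zero]
    · rwa [sub_zero]
    · rwa [show 3 * M.lam - M.lam = 2 * M.lam by ring]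
    · rwa [show 2 * M.lam - M.lam = M.lam by ring]
    · rwa [show 2 * M.lam - 3 * M.lam = -M.lam by ring, Real.sin_neg, neg_ne_zero]
    · rw [show 0 + M.lam + 3 * M.lam + 2 * M.lam - (6 * M.lam + 2 * M.lam + M.expo e + M.expo b
        - M.expo f - M.expo c) = -(2 * M.lam) by linear_combination -he, thetaOf_zero]
      exact M.pair.f_ne _ (by rwa [Real.sin_neg, neg_ne_zero])
  refine entire_eq_zero (M.ybe_differentiable_left G a b c d e f v) ?_ u
  filter_upwards [eventually_sin_ne_zero 0 (k := 1) one_ne_zero,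
    eventually_sin_ne_zero (3 * M.lam) (k := -1) (by norm_num),
    eventually_sin_ne_zero M.lam (k := -1) (by norm_num),
    eventually_sin_ne_zero (4 * M.lam) (k := -1) (by norm_num)] with u hv1 hv2 hv3 hv4
  rw [zero_add, one_mul] at hv1
  rw [neg_one_mul, ← sub_eq_add_neg] at hv2 hv3 hv4
  have hm := M.ybe_mem_right G a b c d e f u
  rw [hp'] at hm
  refine thetaSpace_eq_zero M.pair hm 0 u (3 * M.lam) M.lam
    (by simpa using M.ybe_zero_right h u) (M.ybe_diag h u) (by simpa using M.ybe_three_right h u)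
    (h1 u) ?_ ?_ ?_ ?_ ?_ ?_ ?_ v
  · rwa [sub_zero]
  · rwa [sub_zero]
  · rwa [sub_zero]
  · exact hv2
  · exact hv3
  · rwa [show M.lam - 3 * M.lam = -(2 * M.lam) by ring, Real.sin_neg, neg_ne_zero]
  · rw [show 0 + u + 3 * M.lam + M.lam - (2 * u + M.expo c + M.expo f
        - M.expo d - M.expo a) = 4 * M.lam - u by linear_combination ha, thetaOf_zero]
    exact M.pair.f_ne _ hv4

end HeightModel
end

/-! ### The degenerate hexagons -/

section

namespace HeightModel

variable {M : HeightModel}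

section values

variable {s : ℤ} (hs : s = 1 ∨ s = -1) (b : ℤ) (u : ℂ)
include hs

theorem two_near : |b + s - b| ≤ 1 ∧ |b - (b + s)| ≤ 1 := by
  simp only [abs_le]
  omega

theorem weight_bbbf : M.weight b b b (b + s) u = face2 M.f M.g M.lam (M.pos s b) u := by
  rw [weight, if_pos (by simpa using two_near hs b), if_neg (by omega), if_pos rfl, crossFace,
    if_pos rfl, add_sub_cancel_left]

theorem weight_bfbb : M.weight b (b + s) b b u = face2 M.f M.g M.lam (M.pos s b) u := by
  rw [M.weight_swap', M.weight_bbbf hs]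

theorem weight_bbff : M.weight b b (b + s) (b + s) u
    = M.tau (min b (b + s)) * face4 M.f M.lam u := by
  rw [weight, if_pos (by simpa using two_near hs b), if_neg (by omega), if_neg (by omega)]

theorem weight_bffb : M.weight b (b + s) (b + s) b u
    = M.tau (min b (b + s)) * face4 M.f M.lam u := by
  rw [M.weight_swap', M.weight_bbff hs]

theorem weight_fbbb : M.weight (b + s) b b b u
    = M.sigma (b + s) / M.sigma b * face3 M.f M.g M.lam (M.pos s b) u := by
  rw [M.weight_main (near hs b).1 (near hs b).2.1, M.main_side_centre hs]

theorem weight_bbfb : M.weight b b (b + s) b u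
    = M.sigma (b + s) / M.sigma b * face3 M.f M.g M.lam (M.pos s b) u := by
  rw [M.weight_swap, M.weight_fbbb hs]

theorem weight_bbbb : M.weight b b b b u = face1 M.f M.g M.lam (M.pos s b) u := by
  rw [M.weight_main (near hs b).2.1 (near hs b).2.1, M.main_centre hs]

theorem weight_fbfb : M.weight (b + s) b (b + s) b u = face7 M.f M.g M.lam (M.pos s b) u := by
  rw [M.weight_main (near hs b).1 (near hs b).1, M.main_side hs]

theorem weight_opposite : M.weight b (b - s) b (b + s) u = face5 M.f M.lam u := by
  rw [weight, if_pos (by simp only [abs_le]; omega), if_neg (by omega), if_pos rfl, crossFace,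
    if_neg (by omega), if_neg (by omega)]

end values

section faceValues

variable {f g : ℂ → ℂ} (l y : ℂ)

theorem face2_at_one : face2 f g l y l = f (2 * l) * g y / (f (3 * l) * g (y + l)) := by
  rw [face2, show 3 * l - l = 2 * l by ring, add_sub_cancel_right]

theorem face2_at_two : face2 f g l y (2 * l) = f l * g (y - l) / (f (3 * l) * g (y + l)) := by
  rw [face2, show 3 * l - 2 * l = l by ring, show y + l - 2 * l = y - l by ring]

theorem face3_at_one : face3 f g l y l = f l * g (y - l) / (f (3 * l) * g (y + l)) := by
  rw [face3, show y - 2 * l + l = y - l by ring]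

theorem face3_at_two : face3 f g l y (2 * l) = f (2 * l) * g y / (f (3 * l) * g (y + l)) := by
  rw [face3, sub_add_cancel]

theorem face4_at_one (h : f (2 * l) ≠ 0) : face4 f l l = f l / f (3 * l) := by
  rw [face4, show 3 * l - l = 2 * l by ring, mul_comm, mul_div_mul_left _ _ h]

theorem face4_at_two (h : f (2 * l) ≠ 0) : face4 f l (2 * l) = f l / f (3 * l) := by
  rw [face4, show 3 * l - 2 * l = l by ring, mul_div_mul_left _ _ h]

/-- `face1` is symmetric under `u ↦ 3λ - u`. -/
theorem face1_at_one (f g : ℂ → ℂ) (l y : ℂ) : face1 f g l y l = face1 f g l y (2 * l) := by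
  rw [← ThetaPair.face1_cross, show 3 * l - l = 2 * l by ring]

end faceValues

/-- The values of the weights of faces with two adjacent heights `p` and `q` at `λ` and `2λ`, in
terms of values of theta functions `a₁, a₂, a₃`, `g₋₁, …, g₃` and square roots `t` and `r`. -/
structure PairValues (M : HeightModel) (p q : ℤ) (a₁ a₂ a₃ k g0 g1 g2 g3 t r : ℂ) : Prop where
  ha₁ : a₁ ≠ 0
  ha₂ : a₂ ≠ 0
  ha₃ : a₃ ≠ 0
  hk : k ≠ 0
  hg1 : g1 ≠ 0
  hg3 : g3 ≠ 0
  hr : r ≠ 0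
  ht : t ^ 2 = g3 * k / g1 ^ 2
  w2 : M.weight p p p q M.lam = a₂ * g0 / (a₃ * g1)
  w2' : M.weight p p p q (2 * M.lam) = a₁ * k / (a₃ * g1)
  w3 : M.weight q p p p M.lam = r * (a₁ * k / (a₃ * g1))
  w3' : M.weight q p p p (2 * M.lam) = r * (a₂ * g0 / (a₃ * g1))
  w4 : M.weight p p q q M.lam = t * (a₁ / a₃)
  w4' : M.weight p p q q (2 * M.lam) = t * (a₁ / a₃)
  w1 : M.weight p p p p M.lam = a₂ ^ 2 * g0 ^ 2 / (a₁ * a₃ * g1 * k)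
  w1' : M.weight p p p p (2 * M.lam) = a₂ ^ 2 * g0 ^ 2 / (a₁ * a₃ * g1 * k)
  w7 : M.weight q p q p M.lam = a₁ * g3 / (a₃ * g1)
  w7' : M.weight q p q p (2 * M.lam) = r ^ 2 * (a₁ * k / (a₃ * g1))

theorem pairValues {s : ℤ} (hs : s = 1 ∨ s = -1) (p : ℤ) :
    PairValues M p (p + s) (M.f M.lam) (M.f (2 * M.lam)) (M.f (3 * M.lam))
      (M.g (M.pos s p - M.lam)) (M.g (M.pos s p)) (M.g (M.pos s p + M.lam))
      (M.g (M.pos s p + 2 * M.lam)) (M.g (M.pos s p + 3 * M.lam)) (M.tau (min p (p + s)))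
      (M.sigma (p + s) / M.sigma p) where
  ha₁ := M.f1
  ha₂ := M.f2
  ha₃ := M.f3
  hk := M.G1' _
  hg1 := M.G1 _
  hg3 := by simpa using M.G_ne (M.pos s p) 3
  hr := div_ne_zero (M.sigma_ne _) (M.sigma_ne _)
  ht := M.tau_ratio hs p
  w2 := by rw [M.weight_bbbf hs, face2_at_one]
  w2' := by rw [M.weight_bbbf hs, face2_at_two]
  w3 := by rw [M.weight_fbbb hs, face3_at_one]
  w3' := by rw [M.weight_fbbb hs, face3_at_two]
  w4 := by rw [M.weight_bbff hs, face4_at_one _ M.f2]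
  w4' := by rw [M.weight_bbff hs, face4_at_two _ M.f2]
  w1 := by
    rw [M.weight_bbbb hs, face1_at_one, M.pair.face1_at_two M.f1 M.f2 M.f3 M.f4 M.f6 (M.F0 hs p)
      (M.G1 _) (M.G1' _) (M.G2 _) (M.G2' _)]
  w1' := by
    rw [M.weight_bbbb hs, M.pair.face1_at_two M.f1 M.f2 M.f3 M.f4 M.f6 (M.F0 hs p)
      (M.G1 _) (M.G1' _) (M.G2 _) (M.G2' _)]
  w7 := by
    rw [M.weight_fbfb hs, M.pair.face7_at_one M.f3 (M.F0 hs p) (M.F2 hs p) (M.G1 _) (M.G2 _)]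
  w7' := by
    have e := M.sigma_ratio hs p
    rw [M.weight_fbfb hs, M.pair.face7_at_two M.f3 (M.F0 hs p) (M.F2 hs p) (M.G1 _) (M.G2 _),
      div_pow, e, mul_div_cancel_right₀ _ (pow_ne_zero 2 (M.sigma_ne p))]

theorem pairValues' {s : ℤ} (hs : s = 1 ∨ s = -1) (p : ℤ) :
    PairValues M (p + s) p (M.f M.lam) (M.f (2 * M.lam)) (M.f (3 * M.lam))
      (M.g (M.pos s p + 3 * M.lam)) (M.g (M.pos s p + 2 * M.lam)) (M.g (M.pos s p + M.lam))
      (M.g (M.pos s p)) (M.g (M.pos s p - M.lam)) (M.tau (min p (p + s)))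
      (M.sigma (p + s) / M.sigma p)⁻¹ := by
  have h := pairValues (M := M) (neg_pm hs) (p + s)
  have e := M.pos_flip hs p
  rw [add_neg_cancel_right, e, min_comm] at h
  push_cast at h
  generalize ((M.pos s p : ℝ) : ℂ) = y at *
  rwa [show -y - 2 * (M.lam : ℂ) - M.lam = -(y + 3 * M.lam) by ring,
    show -y - 2 * (M.lam : ℂ) + M.lam = -(y + M.lam) by ring,
    show -y - 2 * (M.lam : ℂ) + 2 * M.lam = -y by ring,
    show -y - 2 * (M.lam : ℂ) + 3 * M.lam = -(y - M.lam) by ring,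
    show -y - 2 * (M.lam : ℂ) = -(y + 2 * M.lam) by ring, M.pair.even, M.pair.even, M.pair.even,
    M.pair.even, M.pair.even, ← inv_div] at h

theorem sum_pair {G : Finset ℤ} {p q : ℤ} (hpq : p ≠ q) (hp : p ∈ G) (hq : q ∈ G) (F : ℤ → ℂ)
    (h : ∀ g, ¬(g = p ∨ g = q) → F g = 0) : ∑ g ∈ G, F g = F p + F q := by
  have hsub : ({p, q} : Finset ℤ) ⊆ G := by
    intro g hg
    simp only [Finset.mem_insert, Finset.mem_singleton] at hg
    rcases hg with rfl | rfl <;> assumption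
  rw [← Finset.sum_subset hsub, Finset.sum_pair hpq]
  intro g _ hg
  simp only [Finset.mem_insert, Finset.mem_singleton] at hg
  exact h g hg

variable {G : Finset ℤ}

/-- The point `(2λ, λ)` for the three degenerate hexagons in which `p` and `q` form two blocks. -/
theorem ybe_point_blocks {p s : ℤ} (hs : s = 1 ∨ s = -1) (hp : p ∈ G) (hq : p + s ∈ G) :
    M.ybe G p p p (p + s) (p + s) (p + s) (2 * M.lam) M.lam = 0
      ∧ M.ybe G p (p + s) (p + s) (p + s) p p (2 * M.lam) M.lam = 0
      ∧ M.ybe G p p (p + s) (p + s) (p + s) p (2 * M.lam) M.lam = 0 := by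
  have A := pairValues (M := M) hs p
  have B := pairValues' (M := M) hs p
  have hne : p ≠ p + s := by omega
  have near2 : ∀ g : ℤ, ¬(g = p ∨ g = p + s) → ¬(|g - p| ≤ 1 ∧ |g - (p + s)| ≤ 1) := by
    intro g hg; simp only [abs_le]; omega
  have ht := A.ht
  have hk := A.hk
  have h1 := A.ha₁
  have h2 := A.ha₂
  have h3 := A.ha₃
  have hg1 := A.hg1
  have hg3 := A.hg3
  have hr := A.hr
  generalize M.g (M.pos s p - M.lam) = k at *
  generalize M.g (M.pos s p) = g0 at *
  generalize M.g (M.pos s p + M.lam) = g1 at *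
  generalize M.g (M.pos s p + 2 * M.lam) = g2 at *
  generalize M.g (M.pos s p + 3 * M.lam) = g3 at *
  generalize M.tau (min p (p + s)) = t at *
  generalize M.sigma (p + s) / M.sigma p = r at *
  generalize M.f M.lam = a₁ at *
  generalize M.f (2 * M.lam) = a₂ at *
  generalize M.f (3 * M.lam) = a₃ at *
  generalize hq' : p + s = q at *
  have el : 2 * (M.lam : ℂ) - M.lam = M.lam := by ring
  have A4 : ∀ u, M.weight q p p q u = M.weight p p q q u := fun u => by rw [M.weight_swap]
  have A4' : ∀ u, M.weight p q q p u = M.weight p p q q u := fun u => by rw [M.weight_swap']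
  have A2 : ∀ u, M.weight q p q q u = M.weight q q q p u := fun u => by rw [M.weight_swap']
  have A2' : ∀ u, M.weight p q p p u = M.weight p p p q u := fun u => by rw [M.weight_swap']
  have A3 : ∀ u, M.weight p p q p u = M.weight q p p p u := fun u => by rw [M.weight_swap]
  have ht2 : t * (a₁ / a₃) * (t * (a₁ / a₃)) = g3 * k / g1 ^ 2 * (a₁ / a₃) ^ 2 := by
    rw [← ht]; ring
  have ht3 : ∀ X, X * (t * (a₁ / a₃)) * (t * (a₁ / a₃)) = X * (g3 * k / g1 ^ 2 * (a₁ / a₃) ^ 2) :=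
    fun X => by rw [← ht2]; ring
  have ht4 : ∀ X, t * (a₁ / a₃) * X * (t * (a₁ / a₃)) = X * (g3 * k / g1 ^ 2 * (a₁ / a₃) ^ 2) :=
    fun X => by rw [← ht2]; ring
  refine ⟨?_, ?_, ?_⟩
  · rw [ybe, sum_pair hne hp hq, sum_pair hne hp hq, el, A2, A2, B.w2', A.w2, B.w1', A4, A.w4,
      A.w2', B.w2, A.w1', ht3, ht3]
    · field_simp
      ring
    · intro g hg
      rw [M.weight_eq_zero (a := q) (b := p), mul_zero, zero_mul]
      rintro ⟨-, h5, h6, -⟩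
      exact near2 g hg ⟨by rwa [abs_sub_comm], h6⟩
    · intro g hg
      rw [M.weight_eq_zero (a := g) (b := p), mul_zero, zero_mul]
      rintro ⟨h5, -, -, h6⟩
      exact near2 g hg ⟨h5, by rwa [abs_sub_comm]⟩
  · rw [ybe, sum_pair hne hp hq, sum_pair hne hp hq, el, A3, A3, A.w3', B.w3, A2', A.w2, A4', A.w4',
      B.w1, A4', A.w4, A.w1, B.w3', A.w3, B.w2, ht4, ht4]
    · field_simp
      ring
    · intro g hg
      rw [M.weight_eq_zero (a := p) (b := q), zero_mul, zero_mul]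
      rintro ⟨-, -, h5, h6⟩
      exact near2 g hg ⟨h6, by rwa [abs_sub_comm]⟩
    · intro g hg
      rw [M.weight_eq_zero (a := p) (b := g), zero_mul, zero_mul]
      rintro ⟨h5, h6, -, -⟩
      exact near2 g hg ⟨by rwa [abs_sub_comm], h6⟩
  · rw [ybe, sum_pair hne hp hq, sum_pair hne hp hq, el, A3, A3, A.w4', A.w4, A.w1, B.w3', A2, B.w2,
      A.w3, A.w3', A.w2, B.w3, B.w1, ht2]
    · field_simp
      ring
    · intro g hg
      rw [M.weight_eq_zero (a := p) (b := p), zero_mul, zero_mul]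
      rintro ⟨-, -, h5, h6⟩
      exact near2 g hg ⟨h6, by rwa [abs_sub_comm]⟩
    · intro g hg
      rw [M.weight_eq_zero (a := p) (b := g), zero_mul, zero_mul]
      rintro ⟨h5, h6, -, -⟩
      exact near2 g hg ⟨by rwa [abs_sub_comm], h6⟩

/-- The point `(2λ, λ)` for the alternating hexagon. -/
theorem ybe_point_alternating {p s : ℤ} (hs : s = 1 ∨ s = -1) (hp : ∀ g, |g - p| ≤ 1 → g ∈ G)
    (hq : ∀ g, |g - (p + s)| ≤ 1 → g ∈ G) :
    M.ybe G p (p + s) p (p + s) p (p + s) (2 * M.lam) M.lam = 0 := by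
  have A := pairValues (M := M) hs p
  have B := pairValues' (M := M) hs p
  have z : face6 M.f M.lam M.lam = 0 := by rw [face6, sub_self, M.pair.zero]; ring
  have z1 : M.weight (p + -s) p (p + s) p M.lam = 0 := by
    rw [M.weight_main (near hs p).2.2 (near hs p).1, M.mainFace_comm, M.main_sides hs, z, mul_zero]
  have z2 : M.weight (p + s + s) (p + s) p (p + s) M.lam = 0 := by
    have := M.main_sides (neg_pm hs) (p + s) M.lam
    rw [neg_neg, add_neg_cancel_right] at this
    rw [M.weight_main (near hs (p + s)).1 (two_near hs p).2, M.mainFace_comm, this, z, mul_zero]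
  have hk := A.hk
  have h1 := A.ha₁
  have h2 := A.ha₂
  have h3 := A.ha₃
  have hg1 := A.hg1
  have hg3 := A.hg3
  have hr := A.hr
  have el : 2 * (M.lam : ℂ) - M.lam = M.lam := by ring
  rw [ybe, sum_near (neg_pm hs) hq, sum_near hs hp, el, neg_neg, add_neg_cancel_right, z1, z2]
  · generalize M.g (M.pos s p - M.lam) = k at *
    generalize M.g (M.pos s p) = g0 at *
    generalize M.g (M.pos s p + M.lam) = g1 at *
    generalize M.g (M.pos s p + 2 * M.lam) = g2 at *
    generalize M.g (M.pos s p + 3 * M.lam) = g3 at *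
    generalize M.tau (min p (p + s)) = t at *
    generalize M.sigma (p + s) / M.sigma p = r at *
    generalize M.f M.lam = a₁ at *
    generalize M.f (2 * M.lam) = a₂ at *
    generalize M.f (3 * M.lam) = a₃ at *
    generalize hq' : p + s = q at *
    have A2 : ∀ u, M.weight q p q q u = M.weight q q q p u := fun u => by rw [M.weight_swap']
    have A2' : ∀ u, M.weight p q p p u = M.weight p p p q u := fun u => by rw [M.weight_swap']
    have A3 : ∀ u, M.weight p p q p u = M.weight q p p p u := fun u => by rw [M.weight_swap]
    have A3' : ∀ u, M.weight q q p q u = M.weight p q q q u := fun u => by rw [M.weight_swap]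
    rw [A3, A3', B.w7', A.w7', B.w7, A.w7, B.w2', A2', A.w2', A.w3, B.w3]
    field_simp
    ring
  · intro g hg
    rw [M.weight_eq_zero (a := g), mul_zero]
    rw [abs_sub_comm p g]; tauto
  · intro g hg
    rw [M.weight_eq_zero (a := g), mul_zero, zero_mul]
    rw [abs_sub_comm (p + s) g]; tauto

/-- The Yang-Baxter equation for the unrestricted model. -/
theorem ybe_eq_zero {a b c d e f : ℤ} (h : Hexagon G a b c d e f) (u v : ℂ) :
    M.ybe G a b c d e f u v = 0 := by
  by_cases h1 : (f = e ∧ c = b) ∨ (f = b ∧ c = e)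
  swap
  · push Not at h1
    exact M.ybe_generic_left h (fun ⟨x, y⟩ => h1.1 x y) (fun ⟨x, y⟩ => h1.2 x y) u v
  by_cases h2 : (d = c ∧ a = f) ∨ (d = f ∧ a = c)
  swap
  · push Not at h2
    exact M.ybe_generic_right h (fun ⟨x, y⟩ => h2.1 x y) (fun ⟨x, y⟩ => h2.2 x y) u v
  have hab := h.ab
  have hbc := h.bc
  have hcd := h.cd
  have hp := h.near_a
  have key : ∀ q, |q - a| ≤ 1 → q = a ∨ ∃ s : ℤ, (s = 1 ∨ s = -1) ∧ q = a + s := by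
    intro q hq
    by_cases hqa : q = a
    · exact .inl hqa
    · exact .inr ⟨q - a, sub_eq_pm hq hqa, by ring⟩
  have const : ∀ x : ℤ, M.ybe G x x x x x x u v = 0 := by
    intro x
    rw [ybe, sub_eq_zero]
    refine Finset.sum_congr rfl fun g _ => ?_
    rw [M.weight_swap' x g x x, M.weight_swap x x g x (u - v), M.weight_swap x x g x v]
  rcases h1 with ⟨rfl, rfl⟩ | ⟨rfl, rfl⟩ <;> rcases h2 with ⟨rfl, rfl⟩ | ⟨rfl, rfl⟩
  · rcases key d (by rwa [abs_sub_comm]) with rfl | ⟨s, hs, rfl⟩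
    · exact const _
    · refine ybe_of_point h (by ring) (by ring) (zmod_two_cast (l := 0) (by omega))
        (zmod_two_cast (l := 0) (by omega)) ?_ u v
      exact (ybe_point_blocks hs (hp _ (by simp)) (hp _ (near hs _).1)).2.1
  · rcases key d (by rwa [abs_sub_comm]) with rfl | ⟨s, hs, rfl⟩
    · exact const _
    · refine ybe_of_point h (by ring) (by ring) (zmod_two_cast (l := 0) (by omega))
        (zmod_two_cast (l := 0) (by omega)) ?_ u v
      exact (ybe_point_blocks hs (hp _ (by simp)) (hp _ (near hs _).1)).1
  · rcases key d (by rwa [abs_sub_comm]) with rfl | ⟨s, hs, rfl⟩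
    · exact const _
    · refine ybe_of_point h (by ring) (by ring) (zmod_two_cast (l := 0) (by omega))
        (zmod_two_cast (l := 0) (by omega)) ?_ u v
      exact (ybe_point_blocks hs (hp _ (by simp)) (hp _ (near hs _).1)).2.2
  · rcases key d (by rwa [abs_sub_comm]) with rfl | ⟨s, hs, rfl⟩
    · exact const _
    · refine ybe_of_point h (by ring) (by ring) (zmod_two_cast (l := 0) (by omega))
        (zmod_two_cast (l := 0) (by omega)) ?_ u v
      exact ybe_point_alternating hs hp h.near_b

end HeightModel
end

/-! ### The face weights in terms of theta function quotients -/

section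

theorem S_div_S (p lam : ℝ) {s : ℤ} (hs : s = 1 ∨ s = -1) (a : ℤ) :
    S p lam (a + s) / S p lam a
      = heightRatio (theta1 p) (theta4 p) lam (s * 2 * a * lam) := by
  rw [S, S, div_div_div_eq, heightRatio]
  rcases hs with rfl | rfl
  · rw [zpow_add₀ (by norm_num), zpow_one, mul_neg_one, neg_mul, neg_mul, neg_div]
    push_cast
    rw [show (4 : ℂ) * (a + 1) * lam = 4 * a * lam + 4 * lam by ring,
      show (2 : ℂ) * (a + 1) * lam = 2 * a * lam + 2 * lam by ring,
      show (2 : ℂ) * (1 * 2 * a * lam) = 4 * a * lam by ring, one_mul, mul_assoc, mul_left_comm _ ((-1) ^ a),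
      mul_div_mul_left _ _ (zpow_ne_zero _ (by norm_num)), mul_comm (theta4 p (_ + _))]
  · rw [zpow_add₀ (by norm_num), zpow_neg_one, inv_neg, inv_one, mul_neg_one, neg_mul, neg_mul,
      neg_div]
    push_cast
    rw [show (4 : ℂ) * (a + -1) * lam = -(-(4 * a * lam) + 4 * lam) by ring,
      show (2 : ℂ) * (a + -1) * lam = -(-1 * 2 * a * lam + 2 * lam) by ring,
      show (2 : ℂ) * (-1 * 2 * a * lam) = -(4 * a * lam) by ring,
      show theta4 p (-1 * 2 * a * lam) = theta4 p (2 * a * lam) by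
        rw [← theta4_neg p]; ring_nf, theta1_neg, theta1_neg, theta4_neg, mul_assoc,
      mul_left_comm _ ((-1) ^ a), mul_div_mul_left _ _ (zpow_ne_zero _ (by norm_num)), neg_mul (theta1 p (_ + _))]
    ring

theorem w1_eq (p lam : ℝ) (a : ℤ) (u : ℂ) :
    w1 p lam a u = face1 (theta1 p) (theta4 p) lam ((1 : ℤ) * 2 * a * lam) u := by
  rw [w1, face1, sub_eq_add_neg a 1, S_div_S p lam (.inl rfl), S_div_S p lam (.inr rfl)]
  push_cast
  rw [one_mul, show -(2 * (a : ℂ) * lam) = -1 * 2 * a * lam by ring]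

theorem w2_eq (p lam : ℝ) (s a : ℤ) (u : ℂ) :
    w2 p lam s a u = face2 (theta1 p) (theta4 p) lam (s * 2 * a * lam) u := rfl

theorem w3_eq (p lam : ℝ) (s a : ℤ) (u : ℂ) : w3 p lam s a u
    = sqrtC (S p lam (a + s) / S p lam a)
      * face3 (theta1 p) (theta4 p) lam (s * 2 * a * lam) u := rfl

theorem w4_eq (p lam : ℝ) (s a : ℤ) (u : ℂ) : w4 p lam s a u
    = sqrtC (theta4 p (s * 2 * a * lam + 3 * lam) * theta4 p (s * 2 * a * lam - lam)
      / theta4 p (s * 2 * a * lam + lam) ^ 2) * face4 (theta1 p) lam u := rfl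

theorem w5_eq (p lam : ℝ) (u : ℂ) : w5 p lam u = face5 (theta1 p) lam u := rfl

theorem w6_eq (p lam : ℝ) (a : ℤ) (u : ℂ) : w6 p lam a u
    = sqrtC (S p lam (a - 1) * S p lam (a + 1) / S p lam a ^ 2) * face6 (theta1 p) lam u := by
  rw [w6, face6, neg_mul, mul_neg]

/-- The second expression for the weight `W(a±1 a a±1 a | u)`, as in `ThetaPair.face7_eq`. -/
noncomputable def face7' (f g : ℂ → ℂ) (l y u : ℂ) : ℂ :=
  f (3 * l + u) * f (2 * y - 4 * l + u) / (f (3 * l) * f (2 * y - 4 * l))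
    + (heightRatio f g l (-y) * (f (4 * l) / f (2 * l)) - g (y - 5 * l) / g (y + l))
      * (f u * f (2 * y - l + u) / (f (3 * l) * f (2 * y - 4 * l)))

theorem w7_eq (p lam : ℝ) {s : ℤ} (hs : s = 1 ∨ s = -1) (a : ℤ) (u : ℂ)
    (h : theta1 p (2 * (s * 2 * a * lam) + 2 * lam) ≠ 0) :
    w7 p lam s a u = face7 (theta1 p) (theta4 p) lam (s * 2 * a * lam) u := by
  have e : 2 * ((s : ℂ) * 2 * a * lam) = s * 4 * a * lam := by ring
  rw [e] at h
  rw [w7, if_pos h, face7, S_div_S p lam hs, e]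

theorem w7_eq' (p lam : ℝ) {s : ℤ} (hs : s = 1 ∨ s = -1) (a : ℤ) (u : ℂ)
    (h : theta1 p (2 * (s * 2 * a * lam) + 2 * lam) = 0) :
    w7 p lam s a u = face7' (theta1 p) (theta4 p) lam (s * 2 * a * lam) u := by
  have e : 2 * ((s : ℂ) * 2 * a * lam) = s * 4 * a * lam := by ring
  rw [e] at h
  rw [w7, if_neg (by simpa using h), face7', sub_eq_add_neg a s, S_div_S p lam (HeightModel.neg_pm hs), e]
  push_cast
  rw [show -((s : ℂ) * 2 * a * lam) = -s * 2 * a * lam by ring]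

section faceWeight

variable (p lam : ℝ) {s : ℤ} (hs : s = 1 ∨ s = -1) (a : ℤ) (u : ℂ)

theorem faceWeight_aaaa : faceWeight p lam a a a a u = w1 p lam a u := by simp [faceWeight]

include hs

theorem faceWeight_bbbf : faceWeight p lam a a a (a + s) u = w2 p lam s a u := by
  rcases hs with rfl | rfl <;> simp [faceWeight]

theorem faceWeight_bfbb : faceWeight p lam a (a + s) a a u = w2 p lam s a u := by
  rcases hs with rfl | rfl <;> simp [faceWeight]

theorem faceWeight_fbbb : faceWeight p lam (a + s) a a a u = w3 p lam s a u := by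
  rcases hs with rfl | rfl <;> simp [faceWeight]

theorem faceWeight_bbfb : faceWeight p lam a a (a + s) a u = w3 p lam s a u := by
  rcases hs with rfl | rfl <;> simp [faceWeight]

theorem faceWeight_bffb : faceWeight p lam a (a + s) (a + s) a u = w4 p lam s a u := by
  rcases hs with rfl | rfl <;> simp [faceWeight]

theorem faceWeight_bbff : faceWeight p lam a a (a + s) (a + s) u = w4 p lam s a u := by
  rcases hs with rfl | rfl <;> simp [faceWeight]

theorem faceWeight_cross : faceWeight p lam a (a - s) a (a + s) u = w5 p lam u := by
  rcases hs with rfl | rfl <;> (simp [faceWeight]; try omega)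

theorem faceWeight_main : faceWeight p lam (a + s) a (a - s) a u = w6 p lam a u := by
  rcases hs with rfl | rfl <;> simp [faceWeight]

theorem faceWeight_fbfb : faceWeight p lam (a + s) a (a + s) a u = w7 p lam s a u := by
  rcases hs with rfl | rfl <;> simp [faceWeight]

end faceWeight

theorem faceWeight_eq_zero (p lam : ℝ) {a b c d : ℤ} (u : ℂ)
    (h : ¬(|a - b| ≤ 1 ∧ |b - c| ≤ 1 ∧ |c - d| ≤ 1 ∧ |d - a| ≤ 1)) :
    faceWeight p lam a b c d u = 0 := by
  have e : ∀ x : ℤ, |x| = 1 ↔ x = 1 ∨ x = -1 := fun x => abs_eq (by norm_num)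
  simp only [abs_le] at h
  simp only [faceWeight, e]
  repeat rw [if_neg (by omega)]

/-- The possible heights of the corners of a face. -/
theorem square_cases {P : ℤ → ℤ → ℤ → ℤ → Prop} {a b c d : ℤ}
    (h : |a - b| ≤ 1 ∧ |b - c| ≤ 1 ∧ |c - d| ≤ 1 ∧ |d - a| ≤ 1)
    (h1 : b = a → c = a → d = a → P a a a a)
    (h2 : ∀ s, (s = 1 ∨ s = -1) → b = a → c = a → d = a + s → P a a a (a + s))
    (h2' : ∀ s, (s = 1 ∨ s = -1) → b = a + s → c = a → d = a → P a (a + s) a a)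
    (h3 : ∀ s, (s = 1 ∨ s = -1) → a = b + s → c = b → d = b → P (b + s) b b b)
    (h3' : ∀ s, (s = 1 ∨ s = -1) → b = a → c = a + s → d = a → P a a (a + s) a)
    (h4 : ∀ s, (s = 1 ∨ s = -1) → b = a + s → c = a + s → d = a → P a (a + s) (a + s) a)
    (h4' : ∀ s, (s = 1 ∨ s = -1) → b = a → c = a + s → d = a + s → P a a (a + s) (a + s))
    (h5 : ∀ s, (s = 1 ∨ s = -1) → b = a - s → c = a → d = a + s → P a (a - s) a (a + s))
    (h6 : ∀ s, (s = 1 ∨ s = -1) → a = b + s → c = b - s → d = b → P (b + s) b (b - s) b)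
    (h7 : ∀ s, (s = 1 ∨ s = -1) → a = b + s → c = b + s → d = b → P (b + s) b (b + s) b) :
    P a b c d := by
  simp only [abs_le] at h
  have key : ∀ {a' b' c' d' : ℤ}, a' = a → b' = b → c' = c → d' = d → P a' b' c' d' → P a b c d := by
    rintro _ _ _ _ rfl rfl rfl rfl h; exact h
  by_cases hbd : b = d
  · by_cases hac : a = c
    · by_cases hab : a = b
      · exact key (by omega) (by omega) (by omega) (by omega) (h1 (by omega) (by omega) (by omega))
      · exact key (by omega) (by omega) (by omega) (by omega)
          (h7 (a - b) (by omega) (by omega) (by omega) (by omega))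
    · by_cases hab : a = b
      · exact key (by omega) (by omega) (by omega) (by omega)
          (h3' (c - a) (by omega) (by omega) (by omega) (by omega))
      · by_cases hcb : c = b
        · exact key (by omega) (by omega) (by omega) (by omega)
            (h3 (a - b) (by omega) (by omega) (by omega) (by omega))
        · exact key (by omega) (by omega) (by omega) (by omega)
            (h6 (a - b) (by omega) (by omega) (by omega) (by omega))
  · by_cases hac : a = c
    · by_cases hab : a = b
      · exact key (by omega) (by omega) (by omega) (by omega)
          (h2 (d - a) (by omega) (by omega) (by omega) (by omega))
      · by_cases had : a = d
        · exact key (by omega) (by omega) (by omega) (by omega)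
            (h2' (b - a) (by omega) (by omega) (by omega) (by omega))
        · exact key (by omega) (by omega) (by omega) (by omega)
            (h5 (d - a) (by omega) (by omega) (by omega) (by omega))
    · by_cases hab : a = b
      · exact key (by omega) (by omega) (by omega) (by omega)
          (h4' (c - a) (by omega) (by omega) (by omega) (by omega))
      · exact key (by omega) (by omega) (by omega) (by omega)
          (h4 (b - a) (by omega) (by omega) (by omega) (by omega))

/-! ### The crossing parameter -/

/-- Properties of the crossing parameter `λ = (π/4) (L+1 ± 1)/(L+1)`. -/
structure CrossingParameter (L : ℕ) (lam : ℝ) : Prop where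
  sin_one : Real.sin lam ≠ 0
  sin_two : Real.sin (2 * lam) ≠ 0
  sin_three : Real.sin (3 * lam) ≠ 0
  sin_four : Real.sin (4 * lam) ≠ 0
  sin_six : Real.sin (6 * lam) ≠ 0
  sin_last : Real.sin (4 * (L + 1) * lam) = 0
  exists_sign : ∃ κ : ℝ, ∀ a : ℤ, 1 ≤ a → a ≤ L → 0 < κ * ((-1) ^ a * Real.sin (4 * a * lam))

theorem sin_mul_crossing_ne {L : ℕ} (hL1 : 1 ≤ L) (hL : L ≠ 2) {lam : ℝ}
    (hlam : lam = Real.pi / 4 * ((L : ℝ) / ((L : ℝ) + 1)) ∨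
      lam = Real.pi / 4 * (((L : ℝ) + 2) / ((L : ℝ) + 1))) {j : ℤ}
    (hj : j = 1 ∨ j = 2 ∨ j = 3 ∨ j = 4 ∨ j = 6) : Real.sin (j * lam) ≠ 0 := by
  intro h
  obtain ⟨k, hk⟩ := Real.sin_eq_zero_iff.mp h
  have hL' : (L : ℝ) + 1 ≠ 0 := by positivity
  have hpi := Real.pi_ne_zero
  have key : 4 * k * (L + 1) = j * L ∨ 4 * k * (L + 1) = j * (L + 2 : ℤ) := by
    rcases hlam with rfl | rfl
    · left
      field_simp at hk
      exact_mod_cast (by linarith : (4 : ℝ) * k * (L + 1) = j * L)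
    · right
      field_simp at hk
      exact_mod_cast (by linarith : (4 : ℝ) * k * (L + 1) = j * (L + 2))
  have hk1 : 1 ≤ k := by
    by_contra hk'
    have : k * (L + 1 : ℤ) ≤ 0 := mul_nonpos_of_nonpos_of_nonneg (by omega) (by omega)
    rcases hj with rfl | rfl | rfl | rfl | rfl <;> rw [mul_assoc] at key <;> omega
  have hk2 : k ≤ 2 := by
    by_contra hk'
    have : 3 * (L + 1 : ℤ) ≤ k * (L + 1 : ℤ) := mul_le_mul_of_nonneg_right (by omega) (by omega)
    rcases hj with rfl | rfl | rfl | rfl | rfl <;> rw [mul_assoc] at key <;> omega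
  obtain rfl | rfl : k = 1 ∨ k = 2 := by omega
  all_goals rcases hj with rfl | rfl | rfl | rfl | rfl <;> omega

theorem crossingParameter {L : ℕ} (hL1 : 1 ≤ L) (hL : L ≠ 2) {lam : ℝ}
    (hlam : lam = Real.pi / 4 * ((L : ℝ) / ((L : ℝ) + 1)) ∨
      lam = Real.pi / 4 * (((L : ℝ) + 2) / ((L : ℝ) + 1))) : CrossingParameter L lam := by
  have hne := @sin_mul_crossing_ne L hL1 hL lam hlam
  have hL' : (L : ℝ) + 1 ≠ 0 := by positivity
  refine ⟨by simpa using hne (j := 1), by simpa using hne (j := 2), by simpa using hne (j := 3),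
    by simpa using hne (j := 4), by simpa using hne (j := 6), ?_, ?_⟩
  · rcases hlam with rfl | rfl
    · rw [show 4 * ((L : ℝ) + 1) * (Real.pi / 4 * (L / (L + 1))) = L * Real.pi by field_simp]
      exact Real.sin_nat_mul_pi L
    · rw [show 4 * ((L : ℝ) + 1) * (Real.pi / 4 * ((L + 2) / (L + 1))) = (L + 2 : ℕ) * Real.pi by
        push_cast; field_simp]
      exact Real.sin_nat_mul_pi _
  · -- `4aλ = aπ ∓ aπ/(L+1)`
    have hpos : ∀ a : ℤ, 1 ≤ a → a ≤ L → 0 < Real.sin (a * Real.pi / (L + 1)) := by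
      intro a h1 h2
      have h1' : (1 : ℝ) ≤ a := by exact_mod_cast h1
      have h2' : (a : ℝ) ≤ L := by exact_mod_cast h2
      have := Real.pi_pos
      refine Real.sin_pos_of_pos_of_lt_pi (by positivity) ?_
      rw [div_lt_iff₀ (by positivity)]
      nlinarith
    have hsq : ∀ a : ℤ, ((-1 : ℝ) ^ a) * (-1) ^ a = 1 := fun a => by
      rw [← mul_zpow]; simp
    rcases hlam with rfl | rfl
    · refine ⟨-1, fun a h1 h2 => ?_⟩
      rw [show 4 * (a : ℝ) * (Real.pi / 4 * (L / (L + 1)))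
        = a * Real.pi - a * Real.pi / (L + 1) by field_simp; ring, Real.sin_sub,
        Real.sin_int_mul_pi, Real.cos_int_mul_pi]
      have := hpos a h1 h2
      linear_combination this - Real.sin (a * Real.pi / (L + 1)) * hsq a
    · refine ⟨1, fun a h1 h2 => ?_⟩
      rw [show 4 * (a : ℝ) * (Real.pi / 4 * ((L + 2) / (L + 1)))
        = a * Real.pi + a * Real.pi / (L + 1) by field_simp; ring, Real.sin_add,
        Real.sin_int_mul_pi, Real.cos_int_mul_pi]
      have := hpos a h1 h2
      linear_combination this - Real.sin (a * Real.pi / (L + 1)) * hsq a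

end

/-! ### The restricted model as a limit of unrestricted models -/

section

open Filter Topology

/-- The crossing factor `S_a`, with the heights shifted by `x`. -/
noncomputable def shiftedS (p lam x : ℝ) (a : ℤ) : ℝ :=
  (-1) ^ a * realTheta1 p (2 * (x + 2 * a * lam)) / realTheta4 p (x + 2 * a * lam)

/-- A square root of a real number, which depends continuously on it. -/
noncomputable def realRoot (r : ℝ) : ℂ := √r + √(-r) * Complex.I

theorem realRoot_sq (r : ℝ) : realRoot r ^ 2 = r := by
  have h : (realRoot r) ^ 2 = (√r : ℂ) ^ 2 - (√(-r) : ℂ) ^ 2 + 2 * ((√r * √(-r) : ℝ) : ℂ) * Complex.I := by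
    rw [realRoot, Complex.ofReal_mul]
    linear_combination ((√(-r) : ℂ) ^ 2) * Complex.I_sq
  rw [h]
  rcases le_total 0 r with hr | hr
  · rw [Real.sqrt_eq_zero_of_nonpos (neg_nonpos.mpr hr), ← Complex.ofReal_pow, Real.sq_sqrt hr]
    simp
  · rw [Real.sqrt_eq_zero_of_nonpos hr, ← Complex.ofReal_pow (√(-r)),
      Real.sq_sqrt (neg_nonneg.mpr hr)]
    simp

theorem realRoot_of_nonneg {r : ℝ} (hr : 0 ≤ r) : realRoot r = √r := by
  rw [realRoot, Real.sqrt_eq_zero_of_nonpos (neg_nonpos.mpr hr)]; simp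

theorem continuous_realRoot : Continuous realRoot := by unfold realRoot; fun_prop

theorem sqrtC_ofReal {r : ℝ} (hr : 0 ≤ r) : sqrtC r = √r := by
  rw [sqrtC, Real.sqrt_eq_rpow, Complex.ofReal_cpow hr]; norm_num

theorem theta1_eq_zero {p y : ℝ} (hy : Real.sin y = 0) : theta1 p y = 0 := by
  obtain ⟨k, rfl⟩ := Real.sin_eq_zero_iff.mp hy
  have h : ∀ n : ℕ, Complex.sin ((2 * (n : ℂ) + 1) * ((k * Real.pi : ℝ) : ℂ)) = 0 := fun n => by
    have := Complex.sin_int_mul_pi ((2 * n + 1) * k)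
    push_cast at this ⊢
    rwa [← mul_assoc]
  simp only [theta1, h, mul_zero, tsum_zero]

theorem continuous_realTheta1 {p : ℝ} (hp : |p| < 1) : Continuous (realTheta1 p) := by
  have h : Continuous fun y : ℝ => (theta1 p (y : ℂ)).re :=
    Complex.continuous_re.comp ((differentiable_theta1 hp).continuous.comp Complex.continuous_ofReal)
  exact h.congr fun y => by rw [theta1_ofReal, Complex.ofReal_re]

theorem continuous_shiftedS {p : ℝ} (hp : |p| < 1) (lam : ℝ) (a : ℤ) :
    Continuous fun x => shiftedS p lam x a := by
  have h1 := continuous_realTheta1 hp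
  have h4 := continuous_realTheta4 hp
  unfold shiftedS
  fun_prop (disch := exact fun x => realTheta4_ne_zero hp _)

theorem S_eq_shiftedS (p lam : ℝ) (a : ℤ) : S p lam a = shiftedS p lam 0 a := by
  rw [S, shiftedS]
  push_cast
  rw [← theta1_ofReal, ← theta4_ofReal]
  push_cast
  rw [zero_add, show (2 : ℂ) * (2 * a * lam) = 4 * a * lam by ring]

/-- Generic values of the shift of the heights. -/
def GenericShift (lam x : ℝ) : Prop := ∀ k : ℤ, Real.sin (2 * x + k * lam) ≠ 0

/-- All but countably many shifts are generic. -/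
theorem exists_genericShift (lam : ℝ) :
    ∃ x : ℕ → ℝ, (∀ n, GenericShift lam (x n)) ∧ Tendsto x atTop (𝓝 0) := by
  have h : {x | GenericShift lam x}ᶜ.Countable := by
    have e : {x | GenericShift lam x}ᶜ = ⋃ k : ℤ, {x | Real.sin (k * lam + 2 * x) ≠ 0}ᶜ := by
      ext x
      simp [GenericShift, add_comm]
    rw [e]
    exact Set.countable_iUnion fun k =>
      mem_cocountable.mp (eventually_sin_ne_zero (k * lam) (k := 2) two_ne_zero)
  have hd : Dense {x | GenericShift lam x} := by simpa using h.dense_compl ℝ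
  have h0 := hd 0
  obtain ⟨x, hx, hlim⟩ := mem_closure_iff_seq_limit.mp h0
  exact ⟨x, hx, hlim⟩

section limit

variable {L : ℕ} {p lam : ℝ}

/-- The unrestricted model with the theta functions of nome `p`, and with heights shifted by `x`. -/
noncomputable def shiftedModel (hp : |p| < 1) (hlam : CrossingParameter L lam) (κ : ℝ)
    (hκ : κ ≠ 0) (x : ℝ) (hx : GenericShift lam x) : HeightModel where
  f := theta1 p
  g := theta4 p
  pair := thetaPair hp
  lam := lam
  x := x
  sigma a := realRoot (κ * shiftedS p lam x a)
  tau a := √(realTheta4 p (x + 2 * a * lam + 3 * lam) * realTheta4 p (x + 2 * a * lam - lam)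
    / realTheta4 p (x + 2 * a * lam + lam) ^ 2)
  sin_one := hlam.sin_one
  sin_two := hlam.sin_two
  sin_three := hlam.sin_three
  sin_four := hlam.sin_four
  sin_six := hlam.sin_six
  sin_generic := hx
  sigma_ne a h := by
    have h2 := realRoot_sq (κ * shiftedS p lam x a)
    rw [h, zero_pow two_ne_zero, eq_comm, Complex.ofReal_eq_zero] at h2
    have h1 := theta1_ofReal_ne_zero hp (hx (4 * a))
    rw [theta1_ofReal, Complex.ofReal_ne_zero] at h1
    push_cast at h1
    rw [show 2 * x + 4 * a * lam = 2 * (x + 2 * a * lam) by ring] at h1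
    exact mul_ne_zero hκ (div_ne_zero (mul_ne_zero (zpow_ne_zero _ (by norm_num)) h1)
      (realTheta4_ne_zero hp _)) h2
  sigma_sq a := by
    rw [realRoot_sq, realRoot_sq, heightRatio]
    have h1 := theta1_ofReal_ne_zero hp (hx (4 * a))
    have h4 := theta4_ofReal_ne_zero hp (x + 2 * a * lam)
    have h4' := theta4_ofReal_ne_zero hp (x + 2 * a * lam + 2 * lam)
    push_cast [shiftedS, ← theta1_ofReal, ← theta4_ofReal] at h1 h4 h4' ⊢
    rw [zpow_add₀ (by norm_num), zpow_one,
      show (2 : ℂ) * (x + 2 * (a + 1) * lam) = 2 * (x + 2 * a * lam) + 4 * lam by ring,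
      show (x : ℂ) + 2 * (a + 1) * lam = x + 2 * a * lam + 2 * lam by ring]
    rw [show (2 : ℂ) * x + 4 * a * lam = 2 * (x + 2 * a * lam) by ring] at h1
    generalize theta1 p (2 * (x + 2 * a * lam)) = A at *
    generalize theta4 p (x + 2 * a * lam) = B at *
    generalize theta4 p (x + 2 * a * lam + 2 * lam) = C at *
    field_simp
  tau_sq a := by
    have h1 := realTheta4_pos hp (x + 2 * a * lam + 3 * lam)
    have h2 := realTheta4_pos hp (x + 2 * a * lam - lam)
    rw [← Complex.ofReal_pow, Real.sq_sqrt (by positivity)]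
    push_cast [← theta4_ofReal]
    rfl

variable (hp : |p| < 1) (hlam : CrossingParameter L lam)
include hp hlam

/-- The crossing factors of the heights `1, …, L` have the same sign. Multiplied by this sign, they have
positive square roots. -/
theorem exists_sign : ∃ κ : ℝ, κ ≠ 0 ∧ (∀ a : ℤ, 1 ≤ a → a ≤ L → 0 < κ * shiftedS p lam 0 a) := by
  obtain ⟨κ, hκ⟩ := hlam.exists_sign
  by_cases hL : L = 0
  · subst hL
    exact ⟨1, one_ne_zero, fun a h1 h2 => absurd (h1.trans h2) (by norm_num)⟩
  refine ⟨κ, ?_, fun a h1 h2 => ?_⟩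
  · rintro rfl
    simpa using hκ 1 le_rfl (by exact_mod_cast Nat.one_le_iff_ne_zero.mpr hL)
  have h := hκ a h1 h2
  have hs : Real.sin (4 * a * lam) ≠ 0 := by
    intro h0; rw [h0] at h; simp at h
  have h' := realTheta1_mul_sin_pos hp hs
  rw [shiftedS, zero_add, show 2 * (2 * a * lam) = 4 * a * lam by ring, mul_div_assoc']
  refine div_pos ?_ (realTheta4_pos hp _)
  have h2 : 0 < Real.sin (4 * a * lam) ^ 2 := by positivity
  refine pos_of_mul_pos_left ?_ h2.le
  nlinarith [mul_pos h h']

/-- A sequence of unrestricted models with shifts of the heights that converge to `0`; the number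
`κ` is such that `κ S_a > 0` for `1 ≤ a ≤ L`. -/
structure IsApproximation (L : ℕ) (p lam κ : ℝ) (M : ℕ → HeightModel) : Prop where
  nome : |p| < 1
  crossing : CrossingParameter L lam
  pos_S : ∀ a : ℤ, 1 ≤ a → a ≤ L → 0 < κ * shiftedS p lam 0 a
  f_eq : ∀ n, (M n).f = theta1 p
  g_eq : ∀ n, (M n).g = theta4 p
  lam_eq : ∀ n, (M n).lam = lam
  tendsto_x : Tendsto (fun n => (M n).x) atTop (𝓝 0)
  sigma_eq : ∀ n a, (M n).sigma a = realRoot (κ * shiftedS p lam (M n).x a)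
  tau_eq : ∀ n a, (M n).tau a = √(realTheta4 p ((M n).x + 2 * a * lam + 3 * lam)
    * realTheta4 p ((M n).x + 2 * a * lam - lam) / realTheta4 p ((M n).x + 2 * a * lam + lam) ^ 2)

theorem exists_approximation : ∃ κ M, IsApproximation L p lam κ M := by
  obtain ⟨κ, h0, hκ⟩ := exists_sign hp hlam
  obtain ⟨x, hx, hlim⟩ := exists_genericShift lam
  exact ⟨κ, fun n => shiftedModel hp hlam κ h0 (x n) (hx n), hp, hlam, hκ, fun _ => rfl,
    fun _ => rfl, fun _ => rfl, hlim, fun _ _ => rfl, fun _ _ => rfl⟩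

end limit

section continuity

variable {f g : ℂ → ℂ} (H : ThetaPair f g) (l y : ℝ) (u : ℂ)
include H

theorem continuousAt_heightRatio (h : f (2 * y) ≠ 0) :
    ContinuousAt (fun y => heightRatio f g l y) y := by
  have hf := H.diff_f.continuous
  have hg := H.diff_g.continuous
  have h2 : g ((y : ℂ) + 2 * l) ≠ 0 := by simpa using H.g_ne (y + 2 * l)
  have h3 := mul_ne_zero h h2
  unfold heightRatio
  fun_prop (disch := assumption)

theorem continuousAt_face1 (h : f (2 * y) ≠ 0) :
    ContinuousAt (fun y => face1 f g l y u) y := by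
  have hg := H.diff_g.continuous
  have h1 := continuousAt_heightRatio H l y h
  have h2 : ContinuousAt (fun y => heightRatio f g l (-y)) y := by
    have h' : f (2 * ((-y : ℝ) : ℂ)) ≠ 0 := by
      push_cast; rw [mul_neg, H.odd]; exact neg_ne_zero.mpr h
    have := continuousAt_heightRatio H l (-y) h'
    push_cast at this
    exact ContinuousAt.comp' (f := fun y : ℂ => -y) this continuous_neg.continuousAt
  have g1 : g ((y : ℂ) + l) ≠ 0 := by simpa using H.g_ne (y + l)
  have g2 : g ((y : ℂ) - l) ≠ 0 := by simpa using H.g_ne (y - l)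
  unfold face1
  exact continuousAt_const.sub (((h1.mul (ContinuousAt.div (by fun_prop) (by fun_prop) g1)).add
    (h2.mul (ContinuousAt.div (by fun_prop) (by fun_prop) g2))).mul continuousAt_const)

theorem continuousAt_face2 (h : f (3 * l) ≠ 0) : ContinuousAt (fun y => face2 f g l y u) y := by
  have hg := H.diff_g.continuous
  have g1 : g ((y : ℂ) + l) ≠ 0 := by simpa using H.g_ne (y + l)
  unfold face2
  exact ContinuousAt.div (by fun_prop) (by fun_prop) (mul_ne_zero h g1)

theorem continuousAt_face3 (h : f (3 * l) ≠ 0) : ContinuousAt (fun y => face3 f g l y u) y := by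
  have hg := H.diff_g.continuous
  have g1 : g ((y : ℂ) + l) ≠ 0 := by simpa using H.g_ne (y + l)
  unfold face3
  exact ContinuousAt.div (by fun_prop) (by fun_prop) (mul_ne_zero h g1)

theorem continuousAt_face7 (h3 : f (3 * l) ≠ 0) (h : f (2 * y) ≠ 0) (h' : f (2 * y + 2 * l) ≠ 0) :
    ContinuousAt (fun y => face7 f g l y u) y := by
  have hf := H.diff_f.continuous
  have h1 := continuousAt_heightRatio H l y h
  have h4 := mul_ne_zero h3 h'
  unfold face7
  fun_prop (disch := assumption)

theorem continuousAt_face7' (h3 : f (3 * l) ≠ 0) (h : f (2 * y) ≠ 0)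
    (h' : f (2 * y - 4 * l) ≠ 0) : ContinuousAt (fun y => face7' f g l y u) y := by
  have hf := H.diff_f.continuous
  have hg := H.diff_g.continuous
  have h2 : ContinuousAt (fun y => heightRatio f g l (-y)) y := by
    have h' : f (2 * ((-y : ℝ) : ℂ)) ≠ 0 := by
      push_cast; rw [mul_neg, H.odd]; exact neg_ne_zero.mpr h
    have := continuousAt_heightRatio H l (-y) h'
    push_cast at this
    exact ContinuousAt.comp' (f := fun y : ℂ => -y) this continuous_neg.continuousAt
  have g1 : g ((y : ℂ) + l) ≠ 0 := by simpa using H.g_ne (y + l)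
  have h4 := mul_ne_zero h3 h'
  unfold face7'
  fun_prop (disch := assumption)

end continuity

namespace IsApproximation

variable {L : ℕ} {p lam κ : ℝ} {M : ℕ → HeightModel} (H : IsApproximation L p lam κ M)
include H

theorem tendsto_pos (s a : ℤ) :
    Tendsto (fun n => (((M n).pos s a : ℝ) : ℂ)) atTop (𝓝 ((s * 2 * a * lam : ℝ) : ℂ)) := by
  refine (Complex.continuous_ofReal.tendsto _).comp ?_
  simp only [HeightModel.pos, H.lam_eq]
  have := (H.tendsto_x.add_const (2 * (a : ℝ) * lam)).const_mul (s : ℝ)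
  rwa [zero_add, ← mul_assoc, ← mul_assoc] at this

theorem tendsto_sigma (a : ℤ) :
    Tendsto (fun n => (M n).sigma a) atTop (𝓝 (realRoot (κ * shiftedS p lam 0 a))) := by
  simp only [H.sigma_eq]
  exact ((continuous_realRoot.comp (continuous_const.mul
    (continuous_shiftedS H.nome lam a))).tendsto 0).comp H.tendsto_x

theorem realRoot_ne {a : ℤ} (h1 : 1 ≤ a) (h2 : a ≤ L) :
    realRoot (κ * shiftedS p lam 0 a) ≠ 0 := by
  have h := H.pos_S a h1 h2
  rw [realRoot_of_nonneg h.le, Complex.ofReal_ne_zero]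
  positivity

/-- The crossing factors vanish at the heights `0` and `L + 1`. This decouples the heights from `1` to `L`
from the others. -/
theorem tendsto_sigma_boundary {z : ℤ} (hz : z = 0 ∨ z = L + 1) :
    Tendsto (fun n => (M n).sigma z) atTop (𝓝 0) := by
  have h : shiftedS p lam 0 z = 0 := by
    have h : theta1 p ((2 * (0 + 2 * z * lam) : ℝ) : ℂ) = 0 := by
      apply theta1_eq_zero
      rcases hz with rfl | rfl
      · simp
      · have := H.crossing.sin_last
        rwa [show 2 * (0 + 2 * ((L + 1 : ℤ) : ℝ) * lam) = 4 * (L + 1) * lam by push_cast; ring]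
    rw [theta1_ofReal, Complex.ofReal_eq_zero] at h
    rw [shiftedS, h, mul_zero, zero_div]
  have := H.tendsto_sigma z
  rwa [h, mul_zero, realRoot_of_nonneg le_rfl, Real.sqrt_zero, Complex.ofReal_zero] at this

theorem sqrtC_S_div {a b : ℤ} (ha : 1 ≤ a ∧ a ≤ L) (hb : 1 ≤ b ∧ b ≤ L) :
    sqrtC (S p lam a / S p lam b)
      = realRoot (κ * shiftedS p lam 0 a) / realRoot (κ * shiftedS p lam 0 b) := by
  have h1 := H.pos_S a ha.1 ha.2
  have h2 := H.pos_S b hb.1 hb.2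
  have hκ : κ ≠ 0 := fun h => by rw [h, zero_mul] at h1; exact lt_irrefl _ h1
  rw [S_eq_shiftedS, S_eq_shiftedS, ← Complex.ofReal_div, ← mul_div_mul_left _ _ hκ,
    sqrtC_ofReal (div_nonneg h1.le h2.le), Real.sqrt_div h1.le, realRoot_of_nonneg h1.le,
    realRoot_of_nonneg h2.le, Complex.ofReal_div]

theorem sqrtC_S_mul_div {a b c : ℤ} (ha : 1 ≤ a ∧ a ≤ L) (hb : 1 ≤ b ∧ b ≤ L)
    (hc : 1 ≤ c ∧ c ≤ L) : sqrtC (S p lam a * S p lam c / S p lam b ^ 2)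
      = realRoot (κ * shiftedS p lam 0 a) * realRoot (κ * shiftedS p lam 0 c)
        / realRoot (κ * shiftedS p lam 0 b) ^ 2 := by
  have h1 := H.pos_S a ha.1 ha.2
  have h2 := H.pos_S b hb.1 hb.2
  have h3 := H.pos_S c hc.1 hc.2
  have hκ : κ ≠ 0 := fun h => by rw [h, zero_mul] at h1; exact lt_irrefl _ h1
  rw [S_eq_shiftedS, S_eq_shiftedS, S_eq_shiftedS, ← Complex.ofReal_mul, ← Complex.ofReal_pow,
    ← Complex.ofReal_div, ← mul_div_mul_left _ _ (pow_ne_zero 2 hκ), ← mul_pow,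
    show κ ^ 2 * (shiftedS p lam 0 a * shiftedS p lam 0 c)
      = κ * shiftedS p lam 0 a * (κ * shiftedS p lam 0 c) by ring,
    sqrtC_ofReal (by positivity), Real.sqrt_div (by positivity), Real.sqrt_mul h1.le,
    Real.sqrt_sq h2.le, realRoot_of_nonneg h1.le, realRoot_of_nonneg h2.le,
    realRoot_of_nonneg h3.le, ← Complex.ofReal_pow, Real.sq_sqrt h2.le]
  push_cast
  rfl

theorem tendsto_tau {s : ℤ} (hs : s = 1 ∨ s = -1) (a : ℤ) :
    Tendsto (fun n => (M n).tau (min a (a + s))) atTop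
      (𝓝 (sqrtC (theta4 p (s * 2 * a * lam + 3 * lam) * theta4 p (s * 2 * a * lam - lam)
        / theta4 p (s * 2 * a * lam + lam) ^ 2))) := by
  have h4 := continuous_realTheta4 H.nome
  have key : ∀ b : ℤ, Tendsto (fun n => (M n).tau b) atTop
      (𝓝 (sqrtC (theta4 p (2 * b * lam + 3 * lam) * theta4 p (2 * b * lam - lam)
        / theta4 p (2 * b * lam + lam) ^ 2))) := by
    intro b
    have hc : Continuous fun x : ℝ => (√(realTheta4 p (x + 2 * b * lam + 3 * lam)
        * realTheta4 p (x + 2 * b * lam - lam) / realTheta4 p (x + 2 * b * lam + lam) ^ 2) : ℂ) := by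
      fun_prop (disch := exact fun x => pow_ne_zero _ (realTheta4_ne_zero H.nome _))
    have h1 := realTheta4_pos H.nome (0 + 2 * b * lam + 3 * lam)
    have h2 := realTheta4_pos H.nome (0 + 2 * b * lam - lam)
    have h := (hc.tendsto 0).comp H.tendsto_x
    rw [← sqrtC_ofReal (by positivity)] at h
    push_cast [← theta4_ofReal] at h
    rw [zero_add] at h
    exact h.congr fun n => (H.tau_eq n b).symm
  rcases hs with rfl | rfl
  · rw [min_eq_left (by omega)]
    convert key a using 6 <;> push_cast <;> ring_nf
  · rw [min_eq_right (by omega)]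
    have h := key (a + -1)
    rw [← theta4_neg p (_ + 3 * _), ← theta4_neg p (_ - _), ← theta4_neg p (_ + _), mul_comm] at h
    push_cast at h ⊢
    ring_nf at h ⊢
    exact h

theorem theta1_three : theta1 p (3 * lam) ≠ 0 := by
  simpa using theta1_ofReal_ne_zero H.nome H.crossing.sin_three

theorem theta1_height {s a : ℤ} (hs : s = 1 ∨ s = -1) (ha : 1 ≤ a ∧ a ≤ L) :
    theta1 p (2 * ((s * 2 * a * lam : ℝ) : ℂ)) ≠ 0 := by
  have h : Real.sin (4 * a * lam) ≠ 0 := by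
    intro h0
    have h1 := H.pos_S a ha.1 ha.2
    have h2 := theta1_eq_zero (p := p) h0
    rw [theta1_ofReal, Complex.ofReal_eq_zero] at h2
    rw [shiftedS, zero_add, show 2 * (2 * (a : ℝ) * lam) = 4 * a * lam by ring, h2, mul_zero,
      zero_div, mul_zero] at h1
    exact lt_irrefl _ h1
  have h' := theta1_ofReal_ne_zero H.nome h
  rcases hs with rfl | rfl
  · convert h' using 2; push_cast; ring
  · rw [← neg_ne_zero, ← theta1_neg]
    convert h' using 2; push_cast; ring

theorem tendsto_face2 (s a : ℤ) (u : ℂ) :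
    Tendsto (fun n => face2 (M n).f (M n).g (M n).lam ((M n).pos s a) u) atTop
      (𝓝 (w2 p lam s a u)) := by
  simp only [H.f_eq, H.g_eq, H.lam_eq]
  have h := (continuousAt_face2 (thetaPair H.nome) lam (s * 2 * a * lam) u H.theta1_three).tendsto.comp
    (H.tendsto_pos s a)
  rw [w2_eq]
  push_cast at h
  exact h

theorem tendsto_face3 (s a : ℤ) (u : ℂ) :
    Tendsto (fun n => face3 (M n).f (M n).g (M n).lam ((M n).pos s a) u) atTop
      (𝓝 (face3 (theta1 p) (theta4 p) lam (s * 2 * a * lam) u)) := by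
  simp only [H.f_eq, H.g_eq, H.lam_eq]
  have h := (continuousAt_face3 (thetaPair H.nome) lam (s * 2 * a * lam) u H.theta1_three).tendsto.comp
    (H.tendsto_pos s a)
  push_cast at h
  exact h

/-- The limit of `face7` is taken in whichever of its two expressions is regular at `x = 0`. -/
theorem tendsto_face7 {s a : ℤ} (hs : s = 1 ∨ s = -1) (ha : 1 ≤ a ∧ a ≤ L) (u : ℂ) :
    Tendsto (fun n => face7 (M n).f (M n).g (M n).lam ((M n).pos s a) u) atTop
      (𝓝 (w7 p lam s a u)) := by
  have hT := thetaPair H.nome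
  by_cases h : theta1 p (2 * (s * 2 * a * lam) + 2 * lam) ≠ 0
  · rw [w7_eq p lam hs a u h]
    simp only [H.f_eq, H.g_eq, H.lam_eq]
    have h := (continuousAt_face7 hT lam (s * 2 * a * lam) u H.theta1_three
      (H.theta1_height hs ha) (by push_cast; exact h)).tendsto.comp (H.tendsto_pos s a)
    push_cast at h
    exact h
  · rw [not_not] at h
    rw [w7_eq' p lam hs a u h]
    have h' : theta1 p (2 * ((s * 2 * a * lam : ℝ) : ℂ) - 4 * lam) ≠ 0 := by
      have h0 : Real.sin (2 * (s * 2 * a * lam) + 2 * lam) = 0 := by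
        by_contra h0
        have := theta1_ofReal_ne_zero H.nome h0
        push_cast at this
        exact this h
      have h1 : Real.sin (2 * (s * 2 * a * lam) - 4 * lam) ≠ 0 := by
        rw [show 2 * (s * 2 * a * lam) - 4 * lam = (2 * (s * 2 * a * lam) + 2 * lam) - 6 * lam by ring,
          Real.sin_sub, h0, zero_mul, zero_sub, neg_ne_zero]
        refine mul_ne_zero (fun hc => ?_) H.crossing.sin_six
        have := Real.sin_sq_add_cos_sq (2 * (s * 2 * a * lam) + 2 * lam)
        rw [h0, hc] at this
        norm_num at this
      simpa using theta1_ofReal_ne_zero H.nome h1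
    have h := (continuousAt_face7' hT lam (s * 2 * a * lam) u H.theta1_three
      (H.theta1_height hs ha) h').tendsto.comp (H.tendsto_pos s a)
    push_cast at h
    refine h.congr fun n => ?_
    rw [(M n).pair.face7_eq (M n).f2 (M n).f3 ((M n).F0 hs a) ((M n).F2 hs a)
      (by simpa [sub_eq_add_neg] using (M n).F_ne hs a (-4)) ((M n).G1 _) ((M n).G2 _)
      ((M n).G2' _), H.f_eq, H.g_eq, H.lam_eq]
    rfl

/-- Between heights from `1` to `L` the weights converge to those of the restricted model. -/
theorem tendsto_weight {a b c d : ℤ} (ha : 1 ≤ a ∧ a ≤ L) (hb : 1 ≤ b ∧ b ≤ L)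
    (hc : 1 ≤ c ∧ c ≤ L) (hd : 1 ≤ d ∧ d ≤ L) (u : ℂ) :
    Tendsto (fun n => (M n).weight a b c d u) atTop (𝓝 (faceWeight p lam a b c d u)) := by
  by_cases h : |a - b| ≤ 1 ∧ |b - c| ≤ 1 ∧ |c - d| ≤ 1 ∧ |d - a| ≤ 1
  swap
  · rw [faceWeight_eq_zero p lam u h]
    exact tendsto_const_nhds.congr fun n => ((M n).weight_eq_zero u h).symm
  have e4 : ∀ n, face4 (M n).f (M n).lam u = face4 (theta1 p) lam u := fun n => by
    rw [H.f_eq, H.lam_eq]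
  have e6 : ∀ n, face6 (M n).f (M n).lam u = face6 (theta1 p) lam u := fun n => by
    rw [H.f_eq, H.lam_eq]
  refine square_cases (P := fun a b c d => (1 ≤ a ∧ a ≤ L) → (1 ≤ b ∧ b ≤ L) → (1 ≤ c ∧ c ≤ L) →
    (1 ≤ d ∧ d ≤ L) → Tendsto (fun n => (M n).weight a b c d u) atTop
      (𝓝 (faceWeight p lam a b c d u))) h ?_ ?_ ?_ ?_ ?_ ?_ ?_ ?_ ?_ ?_ ha hb hc hd
  · intro _ _ _ ha _ _ _
    simp only [HeightModel.weight_bbbb (.inl rfl), faceWeight_aaaa, w1_eq, H.f_eq, H.g_eq, H.lam_eq]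
    have h := (continuousAt_face1 (thetaPair H.nome) lam ((1 : ℤ) * 2 * a * lam) u
      (H.theta1_height (.inl rfl) ha)).tendsto.comp (H.tendsto_pos 1 a)
    push_cast at h ⊢
    exact h
  · intro s hs _ _ _ _ _ _ _
    simp only [HeightModel.weight_bbbf hs, faceWeight_bbbf p lam hs]
    exact H.tendsto_face2 s a u
  · intro s hs _ _ _ _ _ _ _
    simp only [HeightModel.weight_bfbb hs, faceWeight_bfbb p lam hs]
    exact H.tendsto_face2 s a u
  · intro s hs _ _ _ h1 h2 _ _
    simp only [HeightModel.weight_fbbb hs, faceWeight_fbbb p lam hs, w3_eq, H.sqrtC_S_div h1 h2]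
    exact ((H.tendsto_sigma _).div (H.tendsto_sigma _) (H.realRoot_ne h2.1 h2.2)).mul
      (H.tendsto_face3 s b u)
  · intro s hs _ _ _ h2 _ h1 _
    simp only [HeightModel.weight_bbfb hs, faceWeight_bbfb p lam hs, w3_eq, H.sqrtC_S_div h1 h2]
    exact ((H.tendsto_sigma _).div (H.tendsto_sigma _) (H.realRoot_ne h2.1 h2.2)).mul
      (H.tendsto_face3 s a u)
  · intro s hs _ _ _ _ _ _ _
    simp only [HeightModel.weight_bffb hs, faceWeight_bffb p lam hs, w4_eq, e4]
    exact (H.tendsto_tau hs a).mul_const _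
  · intro s hs _ _ _ _ _ _ _
    simp only [HeightModel.weight_bbff hs, faceWeight_bbff p lam hs, w4_eq, e4]
    exact (H.tendsto_tau hs a).mul_const _
  · intro s hs _ _ _ _ _ _ _
    simp only [HeightModel.weight_opposite hs, faceWeight_cross p lam hs, w5_eq, H.f_eq, H.lam_eq]
    exact tendsto_const_nhds
  · intro s hs _ _ _ h1 h2 h3 _
    have e : S p lam (b - 1) * S p lam (b + 1) = S p lam (b + s) * S p lam (b - s) := by
      rcases hs with rfl | rfl
      · rw [mul_comm]
      · rw [sub_neg_eq_add]; rfl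
    rw [faceWeight_main p lam hs, w6_eq, e, H.sqrtC_S_mul_div h1 h2 h3]
    refine ((((H.tendsto_sigma _).mul (H.tendsto_sigma _)).div ((H.tendsto_sigma _).pow 2)
      (pow_ne_zero _ (H.realRoot_ne h2.1 h2.2))).mul_const _).congr fun n => ?_
    rw [sub_eq_add_neg, HeightModel.weight_main (HeightModel.near hs b).1
      (HeightModel.near hs b).2.2, HeightModel.main_sides hs, e6]
    rfl
  · intro s hs _ _ _ h1 h2 h3 _
    simp only [HeightModel.weight_fbfb hs, faceWeight_fbfb p lam hs]
    exact H.tendsto_face7 hs h2 u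

end IsApproximation

end

/-! ### The relations between the weights of the restricted model -/

section

open Filter Topology

namespace IsApproximation

variable {L : ℕ} {p lam κ : ℝ} {M : ℕ → HeightModel} (H : IsApproximation L p lam κ M)
include H

/-- The weights with one corner at the height `0` or `L + 1`, if the opposite corner is a height of
the restricted model. -/
theorem tendsto_weight_boundary {z b c d : ℤ} (hz : z = 0 ∨ z = L + 1) (hb : 1 ≤ b ∧ b ≤ L)
    (hc : 1 ≤ c ∧ c ≤ L) (hd : 1 ≤ d ∧ d ≤ L) (u : ℂ) :
    Tendsto (fun n => (M n).weight z b c d u) atTop (𝓝 0) := by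
  by_cases h : |z - b| ≤ 1 ∧ |b - c| ≤ 1 ∧ |c - d| ≤ 1 ∧ |d - z| ≤ 1
  swap
  · exact tendsto_const_nhds.congr fun n => ((M n).weight_eq_zero u h).symm
  obtain ⟨s, hs, rfl⟩ : ∃ s : ℤ, (s = 1 ∨ s = -1) ∧ z = b + s :=
    ⟨z - b, by simp only [abs_le] at h; omega, by ring⟩
  have e6 : ∀ n, face6 (M n).f (M n).lam u = face6 (theta1 p) lam u := fun n => by
    rw [H.f_eq, H.lam_eq]
  have h0 := H.tendsto_sigma_boundary hz
  have hn := H.realRoot_ne hb.1 hb.2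
  simp only [abs_le] at h
  obtain rfl : d = b := by omega
  obtain rfl | rfl : c = d ∨ c = d + -s := by omega
  · simp only [HeightModel.weight_fbbb hs]
    simpa using (h0.div (H.tendsto_sigma _) hn).mul (H.tendsto_face3 s c u)
  · have := ((h0.mul (H.tendsto_sigma (d + -s))).div ((H.tendsto_sigma d).pow 2)
      (pow_ne_zero _ hn)).mul_const (face6 (theta1 p) lam u)
    rw [zero_mul, zero_div, zero_mul] at this
    refine this.congr fun n => ?_
    rw [HeightModel.weight_main (HeightModel.near hs d).1 (HeightModel.near hs d).2.2,
      HeightModel.main_sides hs, e6]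
    rfl

/-- If the height `0` or `L + 1` is on the other diagonal of the face, the weight has a limit, which need
not be zero. -/
theorem tendsto_weight_boundary' {a z c d : ℤ} (hz : z = 0 ∨ z = L + 1) (ha : 1 ≤ a ∧ a ≤ L)
    (hc : 1 ≤ c ∧ c ≤ L) (hd : 1 ≤ d ∧ d ≤ L) (u : ℂ) :
    ∃ w, Tendsto (fun n => (M n).weight a z c d u) atTop (𝓝 w) := by
  by_cases h : |a - z| ≤ 1 ∧ |z - c| ≤ 1 ∧ |c - d| ≤ 1 ∧ |d - a| ≤ 1
  swap
  · exact ⟨0, tendsto_const_nhds.congr fun n => ((M n).weight_eq_zero u h).symm⟩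
  obtain ⟨s, hs, rfl⟩ : ∃ s : ℤ, (s = 1 ∨ s = -1) ∧ z = a + s :=
    ⟨z - a, by simp only [abs_le] at h; omega, by ring⟩
  simp only [abs_le] at h
  obtain rfl : c = a := by omega
  obtain rfl | rfl : d = c ∨ d = c + -s := by omega
  · simp only [HeightModel.weight_bfbb hs]
    exact ⟨_, H.tendsto_face2 s d u⟩
  · refine ⟨face5 (theta1 p) lam u, tendsto_const_nhds.congr fun n => ?_⟩
    have := (M n).weight_opposite (HeightModel.neg_pm hs) c u
    rw [sub_neg_eq_add] at this
    rw [this, H.f_eq, H.lam_eq]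

end IsApproximation

/-- The integer that stands for a height of the restricted model. -/
def toHeight {L : ℕ} (a : Fin L) : ℤ := ((a : ℕ) : ℤ) + 1

theorem toHeight_mem {L : ℕ} (a : Fin L) : 1 ≤ toHeight a ∧ toHeight a ≤ L := by
  unfold toHeight; omega

theorem W_eq (L : ℕ) (p lam : ℝ) (a b c d : Fin L) (u : ℂ) :
    W L p lam a b c d u
      = faceWeight p lam (toHeight a) (toHeight b) (toHeight c) (toHeight d) u := rfl

theorem adj_iff {L : ℕ} {a b : Fin L} : Adj L a b ↔ |toHeight a - toHeight b| ≤ 1 := by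
  rw [Adj, toHeight, toHeight, add_sub_add_right_eq_sub]

/-- The heights from `0` to `L + 1`. -/
def heightRange (L : ℕ) : Finset ℤ :=
  insert 0 (insert ((L : ℤ) + 1) (Finset.univ.image (toHeight : Fin L → ℤ)))

theorem toHeight_near {L : ℕ} (a : Fin L) (g : ℤ) (h : |g - toHeight a| ≤ 1) :
    g ∈ heightRange L := by
  have := toHeight_mem a
  rw [abs_le] at h
  simp only [heightRange, Finset.mem_insert, Finset.mem_image, Finset.mem_univ, true_and]
  by_cases h0 : g = 0
  · exact .inl h0
  by_cases h1 : g = L + 1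
  · exact .inr (.inl h1)
  refine .inr (.inr ⟨⟨(g - 1).toNat, by omega⟩, ?_⟩)
  simp only [toHeight]
  omega

theorem sum_heightRange {L : ℕ} (F : ℤ → ℂ) :
    ∑ g ∈ heightRange L, F g = F 0 + (F (L + 1) + ∑ g : Fin L, F (toHeight g)) := by
  rw [heightRange, Finset.sum_insert, Finset.sum_insert, Finset.sum_image]
  · intro a _ b _ h
    simp only [toHeight] at h
    omega
  · simp only [Finset.mem_image, Finset.mem_univ, true_and, not_exists]
    intro a h
    have := toHeight_mem a
    omega
  · simp only [Finset.mem_insert, Finset.mem_image, Finset.mem_univ, true_and, not_or, not_exists]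
    exact ⟨by omega, fun a h => by have := toHeight_mem a; omega⟩

/-- The properties of the elementary weights from which the fused Yang-Baxter equation follows. -/
structure IsSolvable (L : ℕ) (p lam : ℝ) : Prop where
  eq_zero : ∀ (a b c d : Fin L) (u : ℂ),
    ¬(Adj L a b ∧ Adj L b c ∧ Adj L c d ∧ Adj L d a) → W L p lam a b c d u = 0
  swap : ∀ (a b c d : Fin L) (u : ℂ), W L p lam a b c d u = W L p lam c b a d u
  swap' : ∀ (a b c d : Fin L) (u : ℂ), W L p lam a b c d u = W L p lam a d c b u
  ybe : ∀ (a b c d e f : Fin L) (u v : ℂ),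
    ∑ g, W L p lam f g d e u * W L p lam g b c d (u - v) * W L p lam a b g f v
      = ∑ g, W L p lam a b c g u * W L p lam f a g e (u - v) * W L p lam g c d e v
  inversion : ∀ a b c f : Fin L, ∑ g,
    W L p lam a b g f (2 * lam) * W L p lam g b c f (-(2 * lam)) = 0
  peak_ne : ∀ a b : Fin L, (b : ℕ) = a + 1 → W L p lam a a b a (2 * lam) ≠ 0
  step_ne : ∀ a b : Fin L, (b : ℕ) = a + 1 → W L p lam a a b b (2 * lam) ≠ 0

namespace IsApproximation

variable {L : ℕ} {p lam κ : ℝ} {M : ℕ → HeightModel} (H : IsApproximation L p lam κ M)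
include H

theorem tendsto_W (a b c d : Fin L) (u : ℂ) : Tendsto (fun n => (M n).weight (toHeight a)
    (toHeight b) (toHeight c) (toHeight d) u) atTop (𝓝 (W L p lam a b c d u)) :=
  H.tendsto_weight (toHeight_mem a) (toHeight_mem b) (toHeight_mem c) (toHeight_mem d) u

theorem tendsto_first {z : ℤ} (hz : z = 0 ∨ z = L + 1) (b c d : Fin L) (u : ℂ) :
    Tendsto (fun n => (M n).weight z (toHeight b) (toHeight c) (toHeight d) u) atTop (𝓝 0) :=
  H.tendsto_weight_boundary hz (toHeight_mem b) (toHeight_mem c) (toHeight_mem d) u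

theorem tendsto_third {z : ℤ} (hz : z = 0 ∨ z = L + 1) (a b d : Fin L) (u : ℂ) :
    Tendsto (fun n => (M n).weight (toHeight a) (toHeight b) z (toHeight d) u) atTop (𝓝 0) :=
  (H.tendsto_first hz b a d u).congr fun n => (M n).weight_swap _ _ _ _ u

theorem tendsto_second {z : ℤ} (hz : z = 0 ∨ z = L + 1) (a c d : Fin L) (u : ℂ) :
    ∃ w, Tendsto (fun n => (M n).weight (toHeight a) z (toHeight c) (toHeight d) u) atTop (𝓝 w) :=
  H.tendsto_weight_boundary' hz (toHeight_mem a) (toHeight_mem c) (toHeight_mem d) u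

theorem tendsto_fourth {z : ℤ} (hz : z = 0 ∨ z = L + 1) (a b c : Fin L) (u : ℂ) :
    ∃ w, Tendsto (fun n => (M n).weight (toHeight a) (toHeight b) (toHeight c) z u) atTop (𝓝 w) := by
  obtain ⟨w, hw⟩ := H.tendsto_second hz a c b u
  exact ⟨w, hw.congr fun n => (M n).weight_swap' _ _ _ _ u⟩

/-- In the limit the heights `0` and `L + 1` of the inner corner do not contribute: each term contains a
weight that tends to zero and weights that stay bounded. -/
theorem tendsto_ybe (a b c d e f : Fin L) (u v : ℂ) :
    Tendsto (fun n => (M n).ybe (heightRange L) (toHeight a) (toHeight b) (toHeight c) (toHeight d)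
      (toHeight e) (toHeight f) u v) atTop
      (𝓝 (∑ g, W L p lam f g d e u * W L p lam g b c d (u - v) * W L p lam a b g f v
        - ∑ g, W L p lam a b c g u * W L p lam f a g e (u - v) * W L p lam g c d e v)) := by
  have h1 : ∀ z : ℤ, (z = 0 ∨ z = L + 1) → Tendsto (fun n =>
      (M n).weight (toHeight f) z (toHeight d) (toHeight e) u
        * (M n).weight z (toHeight b) (toHeight c) (toHeight d) (u - v)
        * (M n).weight (toHeight a) (toHeight b) z (toHeight f) v) atTop (𝓝 0) := by
    intro z hz
    obtain ⟨w, hw⟩ := H.tendsto_second hz f d e u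
    simpa using (hw.mul (H.tendsto_first hz b c d (u - v))).mul (H.tendsto_third hz a b f v)
  have h2 : ∀ z : ℤ, (z = 0 ∨ z = L + 1) → Tendsto (fun n =>
      (M n).weight (toHeight a) (toHeight b) (toHeight c) z u
        * (M n).weight (toHeight f) (toHeight a) z (toHeight e) (u - v)
        * (M n).weight z (toHeight c) (toHeight d) (toHeight e) v) atTop (𝓝 0) := by
    intro z hz
    obtain ⟨w, hw⟩ := H.tendsto_fourth hz a b c u
    simpa using (hw.mul (H.tendsto_third hz f a e (u - v))).mul (H.tendsto_first hz c d e v)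
  have h3 := tendsto_finsetSum (Finset.univ : Finset (Fin L)) fun g _ =>
    ((H.tendsto_W f g d e u).mul (H.tendsto_W g b c d (u - v))).mul (H.tendsto_W a b g f v)
  have h4 := tendsto_finsetSum (Finset.univ : Finset (Fin L)) fun g _ =>
    ((H.tendsto_W a b c g u).mul (H.tendsto_W f a g e (u - v))).mul (H.tendsto_W g c d e v)
  have h5 := ((h1 0 (.inl rfl)).add ((h1 _ (.inr rfl)).add h3)).sub
    ((h2 0 (.inl rfl)).add ((h2 _ (.inr rfl)).add h4))
  simp only [zero_add] at h5
  refine h5.congr fun n => ?_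
  rw [HeightModel.ybe, sum_heightRange, sum_heightRange]

theorem tendsto_inversion (a b c f : Fin L) (v : ℂ) :
    Tendsto (fun n => ∑ g ∈ heightRange L,
      (M n).weight (toHeight a) (toHeight b) g (toHeight f) v
        * (M n).weight g (toHeight b) (toHeight c) (toHeight f) (-v)) atTop
      (𝓝 (∑ g, W L p lam a b g f v * W L p lam g b c f (-v))) := by
  have h1 : ∀ z : ℤ, (z = 0 ∨ z = L + 1) → Tendsto (fun n =>
      (M n).weight (toHeight a) (toHeight b) z (toHeight f) v
        * (M n).weight z (toHeight b) (toHeight c) (toHeight f) (-v)) atTop (𝓝 0) := by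
    intro z hz
    simpa using (H.tendsto_third hz a b f v).mul (H.tendsto_first hz b c f (-v))
  have h3 := tendsto_finsetSum (Finset.univ : Finset (Fin L)) fun g _ =>
    (H.tendsto_W a b g f v).mul (H.tendsto_W g b c f (-v))
  have h5 := (h1 0 (.inl rfl)).add ((h1 _ (.inr rfl)).add h3)
  simp only [zero_add] at h5
  exact h5.congr fun n => by rw [sum_heightRange]

theorem isSolvable : IsSolvable L p lam := by
  have hz : ∀ (a b c d : Fin L) (u : ℂ),
      ¬(Adj L a b ∧ Adj L b c ∧ Adj L c d ∧ Adj L d a) → W L p lam a b c d u = 0 := by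
    intro a b c d u h
    simp only [adj_iff] at h
    rw [W_eq, faceWeight_eq_zero p lam u h]
  have f1 : theta1 p lam ≠ 0 := theta1_ofReal_ne_zero H.nome H.crossing.sin_one
  have f2 : theta1 p (2 * lam) ≠ 0 := by
    simpa using theta1_ofReal_ne_zero H.nome H.crossing.sin_two
  have f3 := H.theta1_three
  have hsucc : ∀ {a b : Fin L}, (b : ℕ) = a + 1 → toHeight b = toHeight a + 1 := fun h => by
    simp only [toHeight]; omega
  refine ⟨hz, ?_, ?_, ?_, ?_, ?_, ?_⟩
  · exact fun a b c d u => tendsto_nhds_unique (H.tendsto_W a b c d u)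
      ((H.tendsto_W c b a d u).congr fun n => (M n).weight_swap _ _ _ _ u)
  · exact fun a b c d u => tendsto_nhds_unique (H.tendsto_W a b c d u)
      ((H.tendsto_W a d c b u).congr fun n => (M n).weight_swap' _ _ _ _ u)
  · intro a b c d e f u v
    by_cases h : Adj L a b ∧ Adj L b c ∧ Adj L c d ∧ Adj L d e ∧ Adj L e f ∧ Adj L f a
    · obtain ⟨ab, bc, cd, de, ef, fa⟩ := h
      rw [← sub_eq_zero]
      refine tendsto_nhds_unique (H.tendsto_ybe a b c d e f u v)
        (tendsto_const_nhds.congr fun n => (HeightModel.ybe_eq_zero ⟨?_, ?_, ?_, ?_, ?_, ?_,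
          toHeight_near a, toHeight_near b, toHeight_near c, toHeight_near d, toHeight_near e,
          toHeight_near f⟩ u v).symm) <;> rwa [← adj_iff]
    · rw [Finset.sum_eq_zero, Finset.sum_eq_zero]
      · intro g _
        by_cases h1 : Adj L a b ∧ Adj L b c
        · by_cases h2 : Adj L f a ∧ Adj L e f
          · rw [hz g, mul_zero]; tauto
          · rw [hz f a, mul_zero, zero_mul]; tauto
        · rw [hz a b, zero_mul, zero_mul]; tauto
      · intro g _
        by_cases h1 : Adj L d e ∧ Adj L e f
        · by_cases h2 : Adj L b c ∧ Adj L c d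
          · rw [hz a b, mul_zero]; tauto
          · rw [hz g b, mul_zero, zero_mul]; tauto
        · rw [hz f g, zero_mul, zero_mul]; tauto
  · intro a b c f
    by_cases hac : a = c ∧ ¬(Adj L a b ∧ Adj L f a)
    · refine Finset.sum_eq_zero fun g _ => ?_
      rw [hz a, zero_mul]
      tauto
    · refine tendsto_nhds_unique (H.tendsto_inversion a b c f (2 * lam))
        (tendsto_const_nhds.congr fun n => ?_)
      have h0 : (M n).rho (2 * lam) = 0 := by
        rw [HeightModel.rho, face5, H.lam_eq, sub_self, H.f_eq, theta1_zero]; ring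
      rw [HeightModel.inversion (toHeight_near b), h0, ite_self]
      intro h
      have hac' : a = c := by
        simp only [toHeight] at h
        omega
      rw [abs_sub_comm _ (toHeight f), ← adj_iff, ← adj_iff]
      tauto
  · intro a b h
    rw [W_eq, hsucc h, faceWeight_bbfb p lam (.inl rfl), w3_eq, ← hsucc h,
      H.sqrtC_S_div (toHeight_mem b) (toHeight_mem a)]
    have g1 := theta4_ofReal_ne_zero H.nome (2 * toHeight a * lam)
    have g2 := theta4_ofReal_ne_zero H.nome (2 * toHeight a * lam + lam)
    push_cast at g1 g2
    refine mul_ne_zero (div_ne_zero (H.realRoot_ne (toHeight_mem b).1 (toHeight_mem b).2)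
      (H.realRoot_ne (toHeight_mem a).1 (toHeight_mem a).2)) ?_
    rw [face3, sub_add_cancel, Int.cast_one, one_mul]
    exact div_ne_zero (mul_ne_zero f2 g1) (mul_ne_zero f3 g2)
  · intro a b h
    rw [W_eq, hsucc h, faceWeight_bbff p lam (.inl rfl), w4_eq]
    have g1 := realTheta4_pos H.nome (2 * toHeight a * lam + 3 * lam)
    have g2 := realTheta4_pos H.nome (2 * toHeight a * lam - lam)
    have g3 := realTheta4_pos H.nome (2 * toHeight a * lam + lam)
    have e : theta4 p ((1 : ℤ) * 2 * (toHeight a) * lam + 3 * lam)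
          * theta4 p ((1 : ℤ) * 2 * (toHeight a) * lam - lam)
          / theta4 p ((1 : ℤ) * 2 * (toHeight a) * lam + lam) ^ 2
        = ((realTheta4 p (2 * toHeight a * lam + 3 * lam) * realTheta4 p (2 * toHeight a * lam - lam)
          / realTheta4 p (2 * toHeight a * lam + lam) ^ 2 : ℝ) : ℂ) := by
      push_cast [← theta4_ofReal]
      simp only [one_mul]
    rw [e, sqrtC_ofReal (by positivity), face4, show 3 * (lam : ℂ) - 2 * lam = lam by ring]
    refine mul_ne_zero ?_ (div_ne_zero (mul_ne_zero f2 f1) (mul_ne_zero f2 f3))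
    rw [Complex.ofReal_ne_zero]
    positivity

end IsApproximation

/-- The weights of the dilute `A_L` model satisfy the Yang-Baxter equation. -/
theorem isSolvable {L : ℕ} (hL : L ≠ 2) {p : ℝ} (hp : |p| < 1) {lam : ℝ}
    (hlam : lam = Real.pi / 4 * ((L : ℝ) / ((L : ℝ) + 1)) ∨
      lam = Real.pi / 4 * (((L : ℝ) + 2) / ((L : ℝ) + 1))) (hL1 : 1 ≤ L) : IsSolvable L p lam := by
  obtain ⟨κ, M, H⟩ := exists_approximation hp (crossingParameter hL1 hL hlam)
  exact H.isSolvable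

end

/-! ### Rows of faces -/

section

section sequences

variable {α : Type*} [Fintype α] {n : ℕ}

theorem sum_fin_cons (F : (Fin (n + 1) → α) → ℂ) :
    ∑ z, F z = ∑ a, ∑ t : Fin n → α, F (Fin.cons a t) := by
  rw [← Fintype.sum_prod_type' (fun a (t : Fin n → α) => F (Fin.cons a t))]
  exact (Fintype.sum_equiv (Fin.consEquiv fun _ => α) _ _ fun _ => rfl).symm

theorem sum_fin_snoc (F : (Fin (n + 1) → α) → ℂ) :
    ∑ z, F z = ∑ a, ∑ t : Fin n → α, F (Fin.snoc t a) := by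
  rw [← Fintype.sum_prod_type' (fun a (t : Fin n → α) => F (Fin.snoc t a))]
  exact (Fintype.sum_equiv (Fin.snocEquiv fun _ => α) _ _ fun _ => rfl).symm

theorem sum_rev (F : (Fin n → α) → ℂ) : ∑ z, F z = ∑ z : Fin n → α, F (z ∘ Fin.rev) :=
  (Fintype.sum_equiv (Equiv.arrowCongr Fin.revPerm (Equiv.refl α)) _ _ fun _ => rfl).symm

theorem rev_rev_comp {α : Type*} (z : Fin n → α) : (z ∘ Fin.rev) ∘ Fin.rev = z := by
  funext i; simp

end sequences

variable {L : ℕ} {p lam : ℝ}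

/-- A row of faces with arbitrary spectral parameters `r`, with heights `x` along the bottom and
`y` along the top. -/
noncomputable def row (L : ℕ) (p lam : ℝ) {n : ℕ} (r : Fin n → ℂ) (x y : Fin (n + 1) → Fin L) : ℂ :=
  ∏ k, W L p lam (x k.castSucc) (x k.succ) (y k.succ) (y k.castSucc) (r k)

/-- The spectral parameters `u, u+2λ, …, u+2(n-1)λ`. -/
noncomputable def ladder (lam : ℝ) (n : ℕ) (u : ℂ) : Fin n → ℂ :=
  fun k => u + 2 * ((k : ℕ) : ℂ) * lam

theorem row_zero (r : Fin 0 → ℂ) (x y : Fin 1 → Fin L) : row L p lam r x y = 1 := rfl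

theorem row_succ {n : ℕ} (r : Fin (n + 1) → ℂ) (x y : Fin (n + 2) → Fin L) :
    row L p lam r x y = W L p lam (x 0) (x 1) (y 1) (y 0) (r 0)
      * row L p lam (Fin.tail r) (Fin.tail x) (Fin.tail y) :=
  Fin.prod_univ_succ _

theorem row_last {n : ℕ} (r : Fin (n + 1) → ℂ) (x y : Fin (n + 2) → Fin L) :
    row L p lam r x y = row L p lam (Fin.init r) (Fin.init x) (Fin.init y)
      * W L p lam (x (Fin.last n).castSucc) (x (Fin.last (n + 1))) (y (Fin.last (n + 1)))
        (y (Fin.last n).castSucc) (r (Fin.last n)) :=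
  Fin.prod_univ_castSucc _

namespace IsSolvable

variable (H : IsSolvable L p lam)
include H

theorem rotate (a b c d : Fin L) (u : ℂ) : W L p lam a b c d u = W L p lam c d a b u := by
  rw [H.swap, H.swap']

theorem row_rev {n : ℕ} (r : Fin n → ℂ) (x y : Fin (n + 1) → Fin L) :
    row L p lam r (x ∘ Fin.rev) (y ∘ Fin.rev) = row L p lam (r ∘ Fin.rev) y x := by
  unfold row
  rw [← Equiv.prod_comp Fin.revPerm]
  refine Finset.prod_congr rfl fun k _ => ?_
  rw [H.rotate]
  simp [Fin.rev_castSucc, Fin.rev_succ]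

theorem row_eq_zero {n : ℕ} {r : Fin n → ℂ} {x y : Fin (n + 1) → Fin L}
    (h : ¬((∀ i : Fin n, Adj L (x i.castSucc) (x i.succ))
      ∧ ∀ i : Fin n, Adj L (y i.castSucc) (y i.succ))) : row L p lam r x y = 0 := by
  rw [← forall_and, not_forall] at h
  obtain ⟨i, hi⟩ := h
  refine Finset.prod_eq_zero (Finset.mem_univ i) (H.eq_zero _ _ _ _ _ fun h => hi ⟨h.1, ?_⟩)
  have := h.2.2.1
  rwa [Adj, abs_sub_comm]

/-- The Yang-Baxter equation for two rows of faces. -/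
theorem row_ybe {n : ℕ} (r : Fin n → ℂ) (t : ℂ) (x y : Fin (n + 1) → Fin L) (f c : Fin L) :
    (∑ z : Fin (n + 1) → Fin L, if z 0 = f then row L p lam r x z
        * row L p lam (fun k => r k + t) z y
        * W L p lam (z (Fin.last n)) (x (Fin.last n)) c (y (Fin.last n)) t else 0)
      = ∑ z : Fin (n + 1) → Fin L, if z (Fin.last n) = c then W L p lam f (x 0) (z 0) (y 0) t
        * row L p lam (fun k => r k + t) x z * row L p lam r z y else 0 := by
  induction n generalizing f with
  | zero =>
    rw [sum_fin_cons, sum_fin_cons]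
    simp [row_zero, Fin.last]
  | succ n ih =>
    have step : ∀ g : Fin L, (∑ z' : Fin (n + 1) → Fin L, if z' 0 = g then
          row L p lam (Fin.tail r) (Fin.tail x) z'
          * row L p lam (fun k => Fin.tail r k + t) z' (Fin.tail y)
          * W L p lam (z' (Fin.last n)) (x (Fin.last (n + 1))) c (y (Fin.last (n + 1))) t else 0)
        = ∑ z' : Fin (n + 1) → Fin L, if z' (Fin.last n) = c then W L p lam g (x 1) (z' 0) (y 1) t
          * row L p lam (fun k => Fin.tail r k + t) (Fin.tail x) z'
          * row L p lam (Fin.tail r) z' (Fin.tail y) else 0 :=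
      fun g => ih (Fin.tail r) (Fin.tail x) (Fin.tail y) g
    calc _ = ∑ z' : Fin (n + 1) → Fin L, ∑ g : Fin L, if z' 0 = g then
          W L p lam (x 0) (x 1) g f (r 0) * W L p lam f g (y 1) (y 0) (r 0 + t)
          * (row L p lam (Fin.tail r) (Fin.tail x) z'
          * row L p lam (fun k => Fin.tail r k + t) z' (Fin.tail y)
          * W L p lam (z' (Fin.last n)) (x (Fin.last (n + 1))) c (y (Fin.last (n + 1))) t)
          else 0 := by
          rw [sum_fin_cons, Finset.sum_eq_single f]
          · refine Finset.sum_congr rfl fun z' _ => ?_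
            rw [Finset.sum_ite_eq, if_pos (Finset.mem_univ _),
              if_pos (show (Fin.cons f z' : Fin (n + 2) → Fin L) 0 = f from rfl), row_succ, row_succ,
              Fin.cons_zero, Fin.tail_cons, ← Fin.succ_last, Fin.cons_succ]
            rw [show (Fin.cons f z' : Fin (n + 2) → Fin L) 1 = z' 0 from rfl]
            have : Fin.tail (fun k => r k + t) = fun k => Fin.tail r k + t := rfl
            rw [this]
            ring
          · intro a _ ha
            exact Finset.sum_eq_zero fun z' _ => if_neg ha
          · exact fun h => absurd (Finset.mem_univ f) h
      _ = ∑ g : Fin L, W L p lam (x 0) (x 1) g f (r 0) * W L p lam f g (y 1) (y 0) (r 0 + t)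
          * ∑ z' : Fin (n + 1) → Fin L, if z' 0 = g then row L p lam (Fin.tail r) (Fin.tail x) z'
          * row L p lam (fun k => Fin.tail r k + t) z' (Fin.tail y)
          * W L p lam (z' (Fin.last n)) (x (Fin.last (n + 1))) c (y (Fin.last (n + 1))) t else 0 := by
          rw [Finset.sum_comm]
          simp only [Finset.mul_sum, mul_ite, mul_zero]
      _ = ∑ z' : Fin (n + 1) → Fin L, if z' (Fin.last n) = c then
            row L p lam (fun k => Fin.tail r k + t) (Fin.tail x) z'
            * row L p lam (Fin.tail r) z' (Fin.tail y)
            * ∑ g, W L p lam f g (y 1) (y 0) (r 0 + t)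
              * W L p lam g (x 1) (z' 0) (y 1) (r 0 + t - r 0) * W L p lam (x 0) (x 1) g f (r 0)
            else 0 := by
          simp only [step, Finset.mul_sum]
          rw [Finset.sum_comm]
          refine Finset.sum_congr rfl fun z' _ => ?_
          split_ifs with h
          · refine Finset.sum_congr rfl fun g _ => ?_
            rw [add_sub_cancel_left]
            ring
          · simp
      _ = _ := by
          conv_rhs => rw [sum_fin_cons, Finset.sum_comm]
          refine Finset.sum_congr rfl fun z' _ => ?_
          rw [← Fin.succ_last]
          simp only [Fin.cons_succ]
          split_ifs with h
          · rw [H.ybe, Finset.mul_sum]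
            refine Finset.sum_congr rfl fun g _ => ?_
            rw [row_succ, row_succ, Fin.cons_zero, Fin.tail_cons, add_sub_cancel_left]
            rw [show (Fin.cons g z' : Fin (n + 2) → Fin L) 1 = z' 0 from rfl]
            have : Fin.tail (fun k => r k + t) = fun k => Fin.tail r k + t := rfl
            rw [this]
            ring
          · simp

end IsSolvable

end

/-! ### The projectors -/

section

variable {L : ℕ} {p lam : ℝ}

theorem symProj_ends {N : ℕ} {y x : Fin (N + 1) → Fin L} (h : symProj L p lam N y x ≠ 0) :
    y 0 = x 0 ∧ y (Fin.last N) = x (Fin.last N) := by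
  rcases N with _ | _ | N
  · rw [symProj] at h
    by_cases e : y = x
    · rw [e]; exact ⟨rfl, rfl⟩
    · exact absurd (if_neg e) h
  · rw [symProj, proj] at h
    by_cases e : y = x
    · rw [e]; exact ⟨rfl, rfl⟩
    · exact absurd (if_neg e) h
  · rw [symProj, proj] at h
    by_contra e
    exact h (if_neg e)

theorem snoc_zero {n : ℕ} {α : Type*} (t : Fin (n + 1) → α) (a : α) :
    (Fin.snoc t a : Fin (n + 2) → α) 0 = t 0 := by
  rw [← Fin.castSucc_zero, Fin.snoc_castSucc (α := fun _ => α)]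

theorem ladder_add (N : ℕ) (u t : ℂ) : (fun k => ladder lam N u k + t) = ladder lam N (u + t) := by
  funext k; simp only [ladder]; ring

theorem tail_ladder (N : ℕ) (u : ℂ) :
    Fin.tail (ladder lam (N + 1) u) = ladder lam N (u + 2 * lam) := by
  funext k; simp only [Fin.tail, ladder, Fin.val_succ]; push_cast; ring

theorem init_ladder (N : ℕ) (u : ℂ) : Fin.init (ladder lam (N + 1) u) = ladder lam N u := rfl

theorem tail_ladder_rev (N : ℕ) (u : ℂ) :
    Fin.tail (ladder lam (N + 1) u ∘ Fin.rev) = ladder lam N u ∘ Fin.rev := by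
  funext k; simp only [Fin.tail, Function.comp, ladder, Fin.rev_succ, Fin.val_castSucc]

open Classical in
theorem mem_paths {n : ℕ} {a b : Fin L} {q : Fin (n + 1) → Fin L} : q ∈ paths L n a b ↔
    q 0 = a ∧ q (Fin.last n) = b ∧ ∀ i : Fin n, Adj L (q i.castSucc) (q i.succ) := by
  rw [paths, Finset.mem_filter]
  exact and_iff_right (Finset.mem_univ _)

namespace IsSolvable

variable (H : IsSolvable L p lam)
include H

/-- The recursion for the projectors, without reference to paths. -/
theorem symProj_succ (N : ℕ) (y x : Fin (N + 2) → Fin L) : symProj L p lam (N + 1) y x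
    = if y 0 = x 0 ∧ y (Fin.last (N + 1)) = x (Fin.last (N + 1)) then
        ∑ c, symProj L p lam N c (Fin.tail x)
          * row L p lam (ladder lam N (-2 * (N : ℂ) * lam)) c (Fin.init y)
      else 0 := by
  cases N with
  | zero =>
    rw [symProj, proj]
    have e : (y = x) ↔ (y 0 = x 0 ∧ y (Fin.last 1) = x (Fin.last 1)) := by
      rw [funext_iff, Fin.forall_fin_two]; rfl
    simp only [e, row_zero, symProj, mul_one]
    rw [Finset.sum_ite_eq' Finset.univ, if_pos (Finset.mem_univ _)]
  | succ N =>
    rw [symProj, proj]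
    refine if_congr Iff.rfl ?_ rfl
    refine Finset.sum_subset (Finset.subset_univ _) fun c _ hc => ?_
    by_cases h0 : symProj L p lam (N + 1) c (Fin.tail x) = 0
    · exact mul_eq_zero_of_left h0 _
    refine mul_eq_zero_of_right _ (H.row_eq_zero fun h => hc ?_)
    exact mem_paths.mpr ⟨(symProj_ends h0).1, (symProj_ends h0).2, h.1⟩

/-- A row of faces with spectral parameters `u, u+2λ, …` can be pushed through a projector. -/
theorem symProj_push (N : ℕ) (u : ℂ) (low y : Fin (N + 1) → Fin L) :
    ∑ x, symProj L p lam N x low * row L p lam (ladder lam N u) x y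
      = ∑ x, row L p lam (ladder lam N u ∘ Fin.rev) low x * symProj L p lam N y x := by
  induction N with
  | zero => simp [row_zero, symProj]
  | succ N ih =>
    set t : ℂ := u + 2 * N * lam with ht
    have hr : (fun k => ladder lam N (-2 * (N : ℂ) * lam) k + t) = ladder lam N u := by
      rw [ladder_add]; congr 1; rw [ht]; ring
    have key : ∀ c : Fin (N + 1) → Fin L, symProj L p lam N c (Fin.tail low) *
          (∑ x' : Fin (N + 1) → Fin L, if x' 0 = low 0 then
            row L p lam (ladder lam N (-2 * (N : ℂ) * lam)) c x'
              * row L p lam (ladder lam N u) x' (Fin.init y)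
              * W L p lam (x' (Fin.last N)) (low (Fin.last (N + 1))) (y (Fin.last (N + 1)))
                (y (Fin.last N).castSucc) t else 0)
        = ∑ z : Fin (N + 1) → Fin L, symProj L p lam N c (Fin.tail low)
            * if z (Fin.last N) = y (Fin.last (N + 1)) then
              W L p lam (low 0) (low 1) (z 0) (y 0) t * row L p lam (ladder lam N u) c z
                * row L p lam (ladder lam N (-2 * (N : ℂ) * lam)) z (Fin.init y) else 0 := by
      intro c
      by_cases h0 : symProj L p lam N c (Fin.tail low) = 0
      · simp [h0]
      obtain ⟨h1, h2⟩ := symProj_ends h0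
      have h := H.row_ybe (ladder lam N (-2 * (N : ℂ) * lam)) t c (Fin.init y) (low 0)
        (y (Fin.last (N + 1)))
      rw [hr, h1, h2] at h
      rw [← Finset.mul_sum]
      exact congrArg _ h
    calc _ = ∑ c : Fin (N + 1) → Fin L, symProj L p lam N c (Fin.tail low) *
          (∑ x' : Fin (N + 1) → Fin L, if x' 0 = low 0 then
            row L p lam (ladder lam N (-2 * (N : ℂ) * lam)) c x'
              * row L p lam (ladder lam N u) x' (Fin.init y)
              * W L p lam (x' (Fin.last N)) (low (Fin.last (N + 1))) (y (Fin.last (N + 1)))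
                (y (Fin.last N).castSucc) t else 0) := by
          rw [sum_fin_snoc, Finset.sum_eq_single (low (Fin.last (N + 1)))]
          · simp only [Finset.mul_sum]
            rw [Finset.sum_comm]
            refine Finset.sum_congr rfl fun x' _ => ?_
            rw [H.symProj_succ, snoc_zero, Fin.snoc_last]
            by_cases h : x' 0 = low 0
            · rw [if_pos ⟨h, rfl⟩, Finset.sum_mul]
              refine Finset.sum_congr rfl fun c _ => ?_
              rw [if_pos h, row_last, Fin.init_snoc, Fin.snoc_last,
                Fin.snoc_castSucc (α := fun _ => Fin L), init_ladder]
              rw [show ladder lam (N + 1) u (Fin.last N) = t from rfl]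
              ring
            · rw [if_neg (fun e => h e.1), zero_mul]
              simp [h]
          · intro a _ ha
            refine Finset.sum_eq_zero fun x' _ => ?_
            rw [H.symProj_succ, snoc_zero, Fin.snoc_last, if_neg (fun e => ha e.2), zero_mul]
          · exact fun h => absurd (Finset.mem_univ _) h
      _ = ∑ z : Fin (N + 1) → Fin L, if z (Fin.last N) = y (Fin.last (N + 1)) then
            W L p lam (low 0) (low 1) (z 0) (y 0) t
            * row L p lam (ladder lam N (-2 * (N : ℂ) * lam)) z (Fin.init y)
            * ∑ c, symProj L p lam N c (Fin.tail low) * row L p lam (ladder lam N u) c z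
            else 0 := by
          simp only [key]
          rw [Finset.sum_comm]
          refine Finset.sum_congr rfl fun z _ => ?_
          split_ifs
          · rw [Finset.mul_sum]
            refine Finset.sum_congr rfl fun c _ => ?_
            ring
          · simp
      _ = _ := by
          simp only [ih]
          conv_rhs => rw [sum_fin_cons]
          rw [Finset.sum_eq_single_of_mem (y 0) (Finset.mem_univ _)]
          · simp only [H.symProj_succ, Fin.tail_cons, Finset.mul_sum]
            have e : ∀ x' z : Fin (N + 1) → Fin L, (if z (Fin.last N) = y (Fin.last (N + 1)) then
                W L p lam (low 0) (low 1) (z 0) (y 0) t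
                  * row L p lam (ladder lam N (-2 * (N : ℂ) * lam)) z (Fin.init y)
                  * (row L p lam (ladder lam N u ∘ Fin.rev) (Fin.tail low) x'
                    * symProj L p lam N z x') else 0)
                = if y (Fin.last (N + 1)) = x' (Fin.last N) then
                  W L p lam (low 0) (low 1) (x' 0) (y 0) t
                  * row L p lam (ladder lam N (-2 * (N : ℂ) * lam)) z (Fin.init y)
                  * (row L p lam (ladder lam N u ∘ Fin.rev) (Fin.tail low) x'
                    * symProj L p lam N z x') else 0 := by
              intro x' z
              by_cases h0 : symProj L p lam N z x' = 0
              · simp [h0]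
              · rw [(symProj_ends h0).1, (symProj_ends h0).2]
                exact if_congr eq_comm rfl rfl
            have e2 : ∀ z : Fin (N + 1) → Fin L, (if z (Fin.last N) = y (Fin.last (N + 1)) then
                ∑ x', W L p lam (low 0) (low 1) (z 0) (y 0) t
                  * row L p lam (ladder lam N (-2 * (N : ℂ) * lam)) z (Fin.init y)
                  * (row L p lam (ladder lam N u ∘ Fin.rev) (Fin.tail low) x'
                    * symProj L p lam N z x') else 0)
                = ∑ x', if y (Fin.last (N + 1)) = x' (Fin.last N) then
                  W L p lam (low 0) (low 1) (x' 0) (y 0) t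
                  * row L p lam (ladder lam N (-2 * (N : ℂ) * lam)) z (Fin.init y)
                  * (row L p lam (ladder lam N u ∘ Fin.rev) (Fin.tail low) x'
                    * symProj L p lam N z x') else 0 := by
              intro z
              simp only [← e]
              split_ifs <;> simp
            simp only [e2]
            rw [Finset.sum_comm]
            refine Finset.sum_congr rfl fun x' _ => ?_
            rw [row_succ, tail_ladder_rev, Fin.tail_cons, Fin.cons_zero]
            rw [show (Fin.cons (y 0) x' : Fin (N + 2) → Fin L) 1 = x' 0 from rfl,
              show (Fin.cons (y 0) x' : Fin (N + 2) → Fin L) (Fin.last (N + 1)) = x' (Fin.last N)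
                from rfl, show (ladder lam (N + 1) u ∘ Fin.rev) 0 = t by
                simp [ladder, Fin.rev_zero, ht]]
            by_cases h : y (Fin.last (N + 1)) = x' (Fin.last N)
            · simp only [h, true_and, if_true, Finset.mul_sum]
              refine Finset.sum_congr rfl fun z _ => ?_
              ring
            · simp [h]
          · intro b _ hb
            refine Finset.sum_eq_zero fun x' _ => ?_
            rw [H.symProj_succ, if_neg (fun e => hb e.1.symm), mul_zero]

/-- The projector is symmetric in its upper and lower paths. -/
theorem symProj_comm (N : ℕ) (y x : Fin (N + 1) → Fin L) :
    symProj L p lam N y x = symProj L p lam N x y := by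
  induction N using Nat.twoStepInduction with
  | zero => simp only [symProj, eq_comm]
  | one => simp only [symProj, proj, eq_comm]
  | more N ih1 ih2 =>
    -- the two top rows of the triangular array, around a triangular array of two steps less
    have two : ∀ y x : Fin (N + 3) → Fin L, symProj L p lam (N + 2) y x
        = if y 0 = x 0 ∧ y (Fin.last (N + 2)) = x (Fin.last (N + 2)) then
          ∑ t : Fin (N + 1) → Fin L, ∑ e : Fin (N + 1) → Fin L,
            if t (Fin.last N) = x (Fin.last (N + 2)) then symProj L p lam N e t
              * row L p lam (ladder lam N (-2 * (N : ℂ) * lam)) e (Fin.init (Fin.tail x))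
              * row L p lam (ladder lam N (-2 * (N : ℂ) * lam)) t (Fin.tail (Fin.init y))
              * W L p lam (x 1) (t 0) (y 1) (y 0) (-2 * ((N : ℂ) + 1) * lam) else 0 else 0 := by
      intro y x
      rw [H.symProj_succ]
      refine if_congr Iff.rfl ?_ rfl
      rw [sum_fin_cons, Finset.sum_eq_single (x 1)]
      · refine Finset.sum_congr rfl fun t _ => ?_
        rw [ih2, H.symProj_succ, Fin.tail_cons, Fin.cons_zero]
        rw [show (Fin.cons (x 1) t : Fin (N + 2) → Fin L) (Fin.last (N + 1)) = t (Fin.last N)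
          from rfl, show Fin.tail x (Fin.last (N + 1)) = x (Fin.last (N + 2)) from rfl]
        by_cases h : t (Fin.last N) = x (Fin.last (N + 2))
        · simp only [h, if_true]
          rw [if_pos ⟨rfl, trivial⟩, Finset.sum_mul]
          refine Finset.sum_congr rfl fun e _ => ?_
          rw [row_succ, tail_ladder, Fin.tail_cons, Fin.cons_zero]
          rw [show (Fin.cons (x 1) t : Fin (N + 2) → Fin L) 1 = t 0 from rfl,
            show Fin.init y 1 = y 1 from rfl, show Fin.init y 0 = y 0 from rfl,
            show ladder lam (N + 1) (-2 * ((N + 1 : ℕ) : ℂ) * lam) 0 = -2 * ((N : ℂ) + 1) * lam by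
              simp [ladder],
            show -2 * ((N + 1 : ℕ) : ℂ) * lam + 2 * lam = -2 * (N : ℂ) * lam by push_cast; ring]
          ring
        · rw [if_neg (fun e => h e.2.symm), zero_mul]
          simp [h]
      · intro b _ hb
        refine Finset.sum_eq_zero fun t _ => ?_
        rw [ih2, H.symProj_succ, if_neg, zero_mul]
        exact fun e => hb e.1.symm
      · exact fun h => absurd (Finset.mem_univ _) h
    rw [two, two]
    by_cases h : y 0 = x 0 ∧ y (Fin.last (N + 2)) = x (Fin.last (N + 2))
    · rw [if_pos h, if_pos ⟨h.1.symm, h.2.symm⟩, Finset.sum_comm]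
      refine Finset.sum_congr rfl fun t _ => Finset.sum_congr rfl fun e _ => ?_
      rw [ih1 t e]
      by_cases h0 : symProj L p lam N e t = 0
      · simp [h0]
      rw [(symProj_ends h0).1, (symProj_ends h0).2, h.2, H.swap (x 1), h.1,
        Fin.tail_init_eq_init_tail, Fin.tail_init_eq_init_tail]
      refine if_congr Iff.rfl ?_ rfl
      ring
    · rw [if_neg h, if_neg (fun e => h ⟨e.1.symm, e.2.symm⟩)]

/-- The recursion that removes the last step of the upper path, in place of the first step of the lower
one. -/
theorem symProj_succ' (N : ℕ) (y x : Fin (N + 2) → Fin L) : symProj L p lam (N + 1) y x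
    = if y 0 = x 0 ∧ y (Fin.last (N + 1)) = x (Fin.last (N + 1)) then
        ∑ c, row L p lam (ladder lam N (-2 * (N : ℂ) * lam) ∘ Fin.rev) (Fin.tail x) c
          * symProj L p lam N (Fin.init y) c
      else 0 := by
  rw [H.symProj_succ, H.symProj_push]

/-- The projector is invariant under the reversal of both paths. -/
theorem symProj_rev (N : ℕ) (y x : Fin (N + 1) → Fin L) :
    symProj L p lam N (y ∘ Fin.rev) (x ∘ Fin.rev) = symProj L p lam N y x := by
  induction N with
  | zero =>
    rw [symProj, symProj]
    refine if_congr ⟨fun h => ?_, fun h => by rw [h]⟩ rfl rfl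
    rw [← rev_rev_comp y, h, rev_rev_comp]
  | succ N ih =>
    rw [H.symProj_comm (N + 1) y x, H.symProj_succ', H.symProj_succ]
    have h1 : Fin.tail (x ∘ Fin.rev) = Fin.init x ∘ Fin.rev := by
      funext k; simp [Fin.tail, Fin.init, Fin.rev_succ]
    have h2 : Fin.init (y ∘ Fin.rev) = Fin.tail y ∘ Fin.rev := by
      funext k; simp [Fin.tail, Fin.init, Fin.rev_castSucc]
    refine if_congr ?_ ?_ rfl
    · simp only [Function.comp, Fin.rev_zero, Fin.rev_last]
      exact ⟨fun h => ⟨h.2.symm, h.1.symm⟩, fun h => ⟨h.2.symm, h.1.symm⟩⟩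
    · rw [sum_rev]
      refine Finset.sum_congr rfl fun c _ => ?_
      rw [h1, h2, ih, H.row_rev, H.symProj_comm, mul_comm, rev_rev_comp]

end IsSolvable

end

/-! ### Closed paths and their reversals -/

section

/-- A sequence of heights with equal ends and steps in `{-1, 0, 1}` that has no local maximum,
except where it is constant, is a palindrome. -/
theorem palindrome_of_convex {N : ℕ} {Y : ℕ → ℤ} (hstep : ∀ k < N, |Y k - Y (k + 1)| ≤ 1)
    (hconv : ∀ k, k + 2 ≤ N →
      ¬(Y k ≤ Y (k + 1) ∧ Y (k + 2) ≤ Y (k + 1) ∧ ¬(Y k = Y (k + 1) ∧ Y (k + 2) = Y (k + 1))))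
    (hends : Y 0 = Y N) {k : ℕ} (hk : k ≤ N) : Y k = Y (N - k) := by
  simp only [abs_le] at hstep
  have mono : ∀ i k, i ≤ k → k < N → Y (i + 1) - Y i ≤ Y (k + 1) - Y k := by
    intro i k hik
    induction k, hik using Nat.le_induction with
    | base => exact fun _ => le_rfl
    | succ k _ ih =>
      intro hk
      have h1 := ih (by omega)
      have h2 := hconv k (by omega)
      have h3 := hstep k (by omega)
      have h4 := hstep (k + 1) (by omega)
      rw [show k + 1 + 1 = k + 2 from rfl] at h4 ⊢
      omega
  have up : ∀ s t, s ≤ t → t ≤ N → (∀ i, s ≤ i → i < t → 0 ≤ Y (i + 1) - Y i) → Y s ≤ Y t := by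
    intro s t hst
    induction t, hst using Nat.le_induction with
    | base => exact fun _ _ => le_rfl
    | succ t hst ih =>
      intro ht h
      have h1 := ih (by omega) fun i h1 h2 => h i h1 (by omega)
      have h2 := h t hst (by omega)
      omega
  have down : ∀ s t, s ≤ t → t ≤ N → (∀ i, s ≤ i → i < t → Y (i + 1) - Y i ≤ 0) → Y t ≤ Y s := by
    intro s t hst
    induction t, hst using Nat.le_induction with
    | base => exact fun _ _ => le_rfl
    | succ t hst ih =>
      intro ht h
      have h1 := ih (by omega) fun i h1 h2 => h i h1 (by omega)
      have h2 := h t hst (by omega)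
      omega
  have half : ∀ j, 2 * j ≤ N → Y j = Y (N - j) := by
    intro j
    induction j with
    | zero => exact fun _ => hends
    | succ j ih =>
      intro hj
      have h0 := ih (by omega)
      have e : N - (j + 1) + 1 = N - j := by omega
      have h1 := hstep j (by omega)
      have h2 := hstep (N - (j + 1)) (by omega)
      rw [e] at h2
      by_cases ha : 0 ≤ Y (j + 1) - Y j
      · have u1 := up (j + 1) (N - (j + 1)) (by omega) (by omega) fun i h1 h2 =>
          ha.trans (mono j i (by omega) (by omega))
        have u2 := mono j (N - (j + 1)) (by omega) (by omega)
        rw [e] at u2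
        omega
      · by_cases hb : Y (N - j) - Y (N - (j + 1)) ≤ 0
        · have d1 := down (j + 1) (N - j) (by omega) (by omega) fun i h1 h2 => by
            have := mono i (N - (j + 1)) (by omega) (by omega)
            rw [e] at this
            omega
          omega
        · omega
  by_cases h : 2 * k ≤ N
  · exact half k h
  · have := half (N - k) (by omega)
    rw [show N - (N - k) = k by omega] at this
    exact this.symm

variable {L : ℕ} {p lam : ℝ}

theorem update_inner_ends {α : Type*} {M : ℕ} (y : Fin (M + 3) → α) (i : Fin (M + 1)) (g : α) :
    Function.update y i.succ.castSucc g 0 = y 0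
      ∧ Function.update y i.succ.castSucc g (Fin.last (M + 2)) = y (Fin.last (M + 2)) := by
  refine ⟨Function.update_of_ne (fun h => ?_) _ _,
    Function.update_of_ne (Fin.castSucc_ne_last _).symm _ _⟩
  have := congrArg Fin.val h
  simp at this

namespace IsSolvable

variable (H : IsSolvable L p lam)
include H

/-- The last face of the top row of the triangular array has the parameter `-2λ`. Hence a face with the
parameter `2λ` that is attached to it gives zero, by the inversion relation. -/
theorem symProj_relation_last (M : ℕ) (y x : Fin (M + 3) → Fin L) (a : Fin L) :
    ∑ g, W L p lam a (y (Fin.last (M + 2))) g (y (Fin.last M).castSucc.castSucc) (2 * lam)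
      * symProj L p lam (M + 2) (Function.update y (Fin.last M).succ.castSucc g) x = 0 := by
  simp only [H.symProj_succ (M + 1), update_inner_ends]
  by_cases h : y 0 = x 0 ∧ y (Fin.last (M + 2)) = x (Fin.last (M + 2))
  swap
  · exact Finset.sum_eq_zero fun g _ => by rw [if_neg h, mul_zero]
  simp only [if_pos h, Finset.mul_sum]
  rw [Finset.sum_comm]
  refine Finset.sum_eq_zero fun c _ => ?_
  by_cases h0 : symProj L p lam (M + 1) c (Fin.tail x) = 0
  · simp [h0]
  have hc : c (Fin.last (M + 1)) = y (Fin.last (M + 2)) := (symProj_ends h0).2.trans h.2.symm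
  have e : ∀ g, row L p lam (ladder lam (M + 1) (-2 * ((M + 1 : ℕ) : ℂ) * lam)) c
      (Fin.init (Function.update y (Fin.last M).succ.castSucc g))
      = row L p lam (Fin.init (ladder lam (M + 1) (-2 * ((M + 1 : ℕ) : ℂ) * lam))) (Fin.init c)
        (Fin.init (Fin.init y)) * W L p lam g (y (Fin.last (M + 2))) (c (Fin.last M).castSucc)
          (y (Fin.last M).castSucc.castSucc) (-(2 * lam)) := by
    intro g
    rw [Fin.init_update_castSucc, row_last, Fin.succ_last, Fin.init_update_last,
      Function.update_self, Function.update_of_ne (Fin.castSucc_ne_last _), hc, H.swap g,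
      show ladder lam (M + 1) (-2 * ((M + 1 : ℕ) : ℂ) * lam) (Fin.last M) = -(2 * lam) by
        simp only [ladder, Fin.val_last]; push_cast; ring]
    rfl
  simp only [e]
  have hinv := H.inversion a (y (Fin.last (M + 2))) (c (Fin.last M).castSucc)
    (y (Fin.last M).castSucc.castSucc)
  rw [← mul_zero (symProj L p lam (M + 1) c (Fin.tail x)
    * row L p lam (Fin.init (ladder lam (M + 1) (-2 * ((M + 1 : ℕ) : ℂ) * lam))) (Fin.init c)
        (Fin.init (Fin.init y))), ← hinv, Finset.mul_sum]
  refine Finset.sum_congr rfl fun g _ => ?_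
  ring

/-- The local linear relations between the values of the projector at upper paths that differ in one
height: the projector contains a factor `W(… | -2λ)` at every inner height of its upper path, and
`W(… | 2λ) W(… | -2λ) = 0`. -/
theorem symProj_relation (M : ℕ) (y x : Fin (M + 3) → Fin L) (i : Fin (M + 1)) (a : Fin L) :
    ∑ g, W L p lam a (y i.succ.succ) g (y i.castSucc.castSucc) (2 * lam)
      * symProj L p lam (M + 2) (Function.update y i.succ.castSucc g) x = 0 := by
  induction M with
  | zero =>
    obtain rfl : i = Fin.last 0 := Fin.eq_zero i
    exact H.symProj_relation_last 0 y x a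
  | succ M ih =>
    induction i using Fin.lastCases with
    | last => exact H.symProj_relation_last (M + 1) y x a
    | cast i =>
      simp only [H.symProj_succ' (M + 2), update_inner_ends]
      by_cases h : y 0 = x 0 ∧ y (Fin.last (M + 3)) = x (Fin.last (M + 3))
      swap
      · exact Finset.sum_eq_zero fun g _ => by rw [if_neg h, mul_zero]
      simp only [if_pos h, Finset.mul_sum]
      rw [Finset.sum_comm]
      refine Finset.sum_eq_zero fun c _ => ?_
      have h1 := ih (Fin.init y) c i
      rw [← mul_zero (row L p lam (ladder lam (M + 2) (-2 * ((M + 2 : ℕ) : ℂ) * lam) ∘ Fin.rev)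
        (Fin.tail x) c), ← h1, Finset.mul_sum]
      refine Finset.sum_congr rfl fun g _ => ?_
      rw [show i.castSucc.succ.castSucc = i.succ.castSucc.castSucc from rfl,
        Fin.init_update_castSucc]
      change W L p lam a (y i.castSucc.succ.succ) g (y i.castSucc.castSucc.castSucc) (2 * lam) * _
        = _ * (W L p lam a (y i.succ.succ.castSucc) g (y i.castSucc.castSucc.castSucc) (2 * lam) * _)
      rw [show i.castSucc.succ.succ = i.succ.succ.castSucc from rfl]
      ring

/-- At a local maximum of a path, one of the local relations has a non-zero coefficient at that path. -/
theorem exists_peak_ne {l m r : Fin L} (hl : Adj L l m) (hr : Adj L m r) (hlm : l ≤ m) (hrm : r ≤ m)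
    (h : ¬(l = m ∧ r = m)) : ∃ a, W L p lam a r m l (2 * lam) ≠ 0 := by
  rw [Adj, abs_le] at hl hr
  have hlm' : (l : ℕ) ≤ m := hlm
  have hrm' : (r : ℕ) ≤ m := hrm
  by_cases h1 : l = m
  · subst h1
    have h2 : (r : ℕ) ≠ l := fun e => h ⟨rfl, Fin.ext e⟩
    exact ⟨r, H.step_ne r l (by omega)⟩
  · have h1' : (l : ℕ) ≠ m := fun e => h1 (Fin.ext e)
    refine ⟨l, ?_⟩
    by_cases h2 : r = m
    · subst h2
      rw [H.swap']
      exact H.step_ne l r (by omega)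
    · have h2' : (r : ℕ) ≠ m := fun e => h2 (Fin.ext e)
      obtain rfl : r = l := Fin.ext (by omega)
      exact H.peak_ne r m (by omega)

/-- The projector does not distinguish a closed path from the reversed path. The local relations
lower the peaks of a path until it is a palindrome. -/
theorem symProj_rev_of_closed {N : ℕ} {y : Fin (N + 1) → Fin L} (x : Fin (N + 1) → Fin L)
    (hy : ∀ i : Fin N, Adj L (y i.castSucc) (y i.succ)) (hc : y 0 = y (Fin.last N)) :
    symProj L p lam N (y ∘ Fin.rev) x = symProj L p lam N y x := by
  rcases N with _ | _ | M
  · congr 1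
    funext i
    rw [Function.comp, Fin.eq_zero (Fin.rev i), Fin.eq_zero i]
  · congr 1
    funext i
    refine Fin.cases ?_ (fun j => ?_) i
    · exact hc.symm
    · rw [Fin.eq_zero j]
      exact hc
  -- induction on the sum of the heights
  obtain ⟨s, hs⟩ : ∃ s, s = ∑ i, ((y i : Fin L) : ℕ) := ⟨_, rfl⟩
  induction s using Nat.strong_induction_on generalizing y with
  | _ s ih =>
    by_cases hpk : ∃ i : Fin (M + 1), y i.castSucc.castSucc ≤ y i.succ.castSucc
        ∧ y i.succ.succ ≤ y i.succ.castSucc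
        ∧ ¬(y i.castSucc.castSucc = y i.succ.castSucc ∧ y i.succ.succ = y i.succ.castSucc)
    · obtain ⟨i, h1, h2, h3⟩ := hpk
      have hl : Adj L (y i.castSucc.castSucc) (y i.succ.castSucc) := hy i.castSucc
      have hr : Adj L (y i.succ.castSucc) (y i.succ.succ) := hy i.succ
      obtain ⟨a, ha⟩ := H.exists_peak_ne hl hr h1 h2 h3
      have r1 := H.symProj_relation M y x i a
      have r2 := H.symProj_relation M (y ∘ Fin.rev) x (Fin.rev i) a
      have e1 : (Fin.rev i).succ.castSucc = Fin.rev (i.succ.castSucc) := by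
        rw [Fin.rev_castSucc, Fin.rev_succ]; rfl
      have e2 : (Fin.rev i).succ.succ = Fin.rev i.castSucc.castSucc := by
        rw [Fin.rev_castSucc, Fin.rev_castSucc]
      have e3 : (Fin.rev i).castSucc.castSucc = Fin.rev i.succ.succ := by
        rw [Fin.rev_succ, Fin.rev_succ]
      have e4 : ∀ g, Function.update (y ∘ Fin.rev) (Fin.rev i.succ.castSucc) g
          = Function.update y i.succ.castSucc g ∘ Fin.rev := by
        intro g
        funext k
        by_cases hk : k = Fin.rev i.succ.castSucc
        · rw [hk]; simp
        · have hk' : Fin.rev k ≠ i.succ.castSucc := fun e => hk (by rw [← e, Fin.rev_rev])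
          rw [Function.update_of_ne hk, Function.comp, Function.comp, Function.update_of_ne hk']
      simp only [e1, e2, e3, e4, Function.comp_apply, Fin.rev_rev] at r2
      rw [← sub_eq_zero]
      have r3 : ∑ g, W L p lam a (y i.succ.succ) g (y i.castSucc.castSucc) (2 * lam)
          * (symProj L p lam (M + 2) (Function.update y i.succ.castSucc g ∘ Fin.rev) x
            - symProj L p lam (M + 2) (Function.update y i.succ.castSucc g) x) = 0 := by
        simp only [mul_sub, Finset.sum_sub_distrib]
        rw [r1, sub_zero, ← r2]
        exact Finset.sum_congr rfl fun g _ => by rw [H.swap']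
      rw [Finset.sum_eq_single_of_mem (y i.succ.castSucc) (Finset.mem_univ _),
        Function.update_eq_self] at r3
      · exact (mul_eq_zero.mp r3).resolve_left ha
      · intro g _ hg
        by_cases hw : Adj L (y i.succ.succ) g ∧ Adj L g (y i.castSucc.castSucc)
        swap
        · rw [H.eq_zero, zero_mul]
          tauto
        refine mul_eq_zero_of_right _ (sub_eq_zero.mpr (ih _ ?_ ?_ ?_ rfl))
        · -- the new height is lower
          have hlt : (g : ℕ) < y i.succ.castSucc := by
            have h1' : ((y i.castSucc.castSucc : Fin L) : ℕ) ≤ y i.succ.castSucc := h1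
            have h2' : ((y i.succ.succ : Fin L) : ℕ) ≤ y i.succ.castSucc := h2
            have hg' : (g : ℕ) ≠ y i.succ.castSucc := fun e => hg (Fin.ext e)
            have h3' : ¬(((y i.castSucc.castSucc : Fin L) : ℕ) = y i.succ.castSucc
              ∧ ((y i.succ.succ : Fin L) : ℕ) = y i.succ.castSucc) := fun e =>
              h3 ⟨Fin.ext e.1, Fin.ext e.2⟩
            simp only [Adj, abs_le] at hw
            omega
          rw [hs]
          refine Finset.sum_lt_sum (fun k _ => ?_) ⟨i.succ.castSucc, Finset.mem_univ _, ?_⟩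
          · by_cases hk : k = i.succ.castSucc
            · rw [hk, Function.update_self]; exact hlt.le
            · rw [Function.update_of_ne hk]
          · rwa [Function.update_self]
        · intro k
          have adj_symm : ∀ {a b : Fin L}, Adj L a b → Adj L b a := fun h => by
            rwa [Adj, abs_sub_comm]
          by_cases k1 : k = i.succ
          · subst k1
            rw [Function.update_self, Function.update_of_ne]
            · exact adj_symm hw.1
            · exact (Fin.castSucc_lt_succ).ne'
          · by_cases k2 : k = i.castSucc
            · subst k2
              rw [show i.castSucc.succ = i.succ.castSucc from rfl, Function.update_self,
                Function.update_of_ne]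
              · exact adj_symm hw.2
              · exact fun e => (Fin.castSucc_lt_succ (i := i)).ne (Fin.castSucc_injective _ e)
            · rw [Function.update_of_ne, Function.update_of_ne]
              · exact hy k
              · exact fun e => k2 (Fin.succ_injective _ e)
              · exact fun e => k1 (Fin.castSucc_injective _ e)
        · rw [(update_inner_ends y i g).1, (update_inner_ends y i g).2, hc]
    · congr 1
      push Not at hpk
      set Y : ℕ → ℤ := fun k => if h : k < M + 3 then ((y ⟨k, h⟩ : Fin L) : ℕ) else 0 with hY
      have hYk : ∀ (k : ℕ) (h : k < M + 3), Y k = ((y ⟨k, h⟩ : Fin L) : ℕ) := fun k h => dif_pos h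
      funext k
      have key := palindrome_of_convex (N := M + 2) (Y := Y) ?_ ?_ ?_ (k := k) (by omega)
      · rw [hYk k (by omega), hYk (M + 2 - k) (by omega)] at key
        rw [Function.comp]
        refine Fin.ext ?_
        have : Fin.rev k = ⟨M + 2 - k, by omega⟩ := Fin.ext (by rw [Fin.val_rev]; simp only []; omega)
        rw [this]
        exact_mod_cast key.symm
      · intro k hk
        rw [hYk k (by omega), hYk (k + 1) (by omega)]
        exact hy ⟨k, hk⟩
      · intro k hk
        rw [hYk k (by omega), hYk (k + 1) (by omega), hYk (k + 2) (by omega)]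
        rintro ⟨h1, h2, h3⟩
        have h := hpk ⟨k, by omega⟩ (Fin.mk_le_mk.mpr (by exact_mod_cast h1))
          (Fin.mk_le_mk.mpr (by exact_mod_cast h2))
        exact h3 ⟨congrArg (fun a : Fin L => ((a : ℕ) : ℤ)) h.1,
          congrArg (fun a : Fin L => ((a : ℕ) : ℤ)) h.2⟩
      · rw [hYk 0 (by omega), hYk (M + 2) (by omega)]
        exact_mod_cast congrArg Fin.val hc

end IsSolvable

end

/-! ### Functionals of paths that factor through the projector -/

section

variable {L : ℕ} {p lam : ℝ}

theorem adj_symm {a b : Fin L} (h : Adj L a b) : Adj L b a := by rwa [Adj, abs_sub_comm]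

theorem rev_mem_paths {n : ℕ} {a b : Fin L} {q : Fin (n + 1) → Fin L} (h : q ∈ paths L n a b) :
    q ∘ Fin.rev ∈ paths L n b a := by
  obtain ⟨h1, h2, h3⟩ := mem_paths.mp h
  refine mem_paths.mpr ⟨by simpa using h2, by simpa using h1, fun i => ?_⟩
  have := adj_symm (h3 (Fin.rev i))
  rwa [Function.comp, Function.comp, Fin.rev_castSucc, Fin.rev_succ]

/-- The projector preserves the adjacency of successive heights. -/
theorem IsSolvable.adj_of_symProj_ne (H : IsSolvable L p lam) {N : ℕ} {y x : Fin (N + 1) → Fin L}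
    (hy : ∀ i : Fin N, Adj L (y i.castSucc) (y i.succ)) (h : symProj L p lam N y x ≠ 0) :
    ∀ i : Fin N, Adj L (x i.castSucc) (x i.succ) := by
  rcases N with _ | _ | N
  · exact fun i => i.elim0
  · obtain rfl : y = x := by
      rw [symProj, proj] at h
      by_contra e
      exact h (if_neg e)
    exact hy
  · have h1 := h
    rw [H.symProj_succ' (N + 1)] at h1
    rw [H.symProj_comm, H.symProj_succ (N + 1)] at h
    have e := fun e => h (if_neg e)
    rw [imp_false, not_not] at e
    rw [if_pos e] at h
    rw [if_pos ⟨e.1.symm, e.2.symm⟩] at h1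
    obtain ⟨c, -, hc⟩ := Finset.exists_ne_zero_of_sum_ne_zero h
    obtain ⟨d, -, hd⟩ := Finset.exists_ne_zero_of_sum_ne_zero h1
    have hc := right_ne_zero_of_mul hc
    have hd := left_ne_zero_of_mul hd
    have a1 := not_imp_comm.mp H.row_eq_zero hc
    have a2 := not_imp_comm.mp H.row_eq_zero hd
    intro i
    refine Fin.cases ?_ (fun j => a2.1 j) i
    exact a1.2 0

/-- A functional of the paths from `a` to `b` that factors through the projector. -/
def Fusible (L : ℕ) (p lam : ℝ) (n : ℕ) (a b : Fin L) (ℓ : (Fin (n + 1) → Fin L) → ℂ) : Prop :=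
  ∃ κ : (Fin (n + 1) → Fin L) → ℂ, ∀ y ∈ paths L n a b,
    ℓ y = ∑ x, κ x * symProj L p lam n y x

namespace Fusible

variable {n : ℕ} {a b c d : Fin L} {ℓ ℓ' : (Fin (n + 1) → Fin L) → ℂ}

theorem congr (h : Fusible L p lam n a b ℓ) (e : ∀ y ∈ paths L n a b, ℓ' y = ℓ y) :
    Fusible L p lam n a b ℓ' := by
  obtain ⟨κ, hκ⟩ := h
  exact ⟨κ, fun y hy => (e y hy).trans (hκ y hy)⟩

theorem mul_left (h : Fusible L p lam n a b ℓ) (z : ℂ) :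
    Fusible L p lam n a b fun y => z * ℓ y := by
  obtain ⟨κ, hκ⟩ := h
  refine ⟨fun x => z * κ x, fun y hy => ?_⟩
  simp only [hκ y hy, Finset.mul_sum, mul_assoc]

theorem sum {ι : Type*} {s : Finset ι} {ℓ : ι → (Fin (n + 1) → Fin L) → ℂ}
    (h : ∀ i ∈ s, Fusible L p lam n a b (ℓ i)) :
    Fusible L p lam n a b fun y => ∑ i ∈ s, ℓ i y := by
  choose! κ hκ using h
  refine ⟨fun x => ∑ i ∈ s, κ i x, fun y hy => ?_⟩
  simp only [Finset.sum_mul]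
  rw [Finset.sum_comm]
  exact Finset.sum_congr rfl fun i hi => hκ i hi y hy

theorem zero : Fusible L p lam n a b fun _ => 0 := ⟨0, fun y _ => by simp⟩

variable (H : IsSolvable L p lam)
include H

/-- A row of faces with spectral parameters `u, u+2λ, …` transports a functional that factors
through the projector from its bottom to its top. -/
theorem row_push (h : Fusible L p lam n a b ℓ) (u : ℂ) : Fusible L p lam n d c
    fun y => ∑ x ∈ paths L n a b, ℓ x * row L p lam (ladder lam n u) x y := by
  classical
  obtain ⟨κ, hκ⟩ := h
  set κ' : (Fin (n + 1) → Fin L) → ℂ :=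
    fun x => if x 0 = a ∧ x (Fin.last n) = b then κ x else 0 with hκ'
  refine ⟨fun x' => ∑ x, κ' x * row L p lam (ladder lam n u ∘ Fin.rev) x x', fun y _ => ?_⟩
  calc _ = ∑ x ∈ paths L n a b, ∑ z, κ' z * (symProj L p lam n x z
        * row L p lam (ladder lam n u) x y) := by
        refine Finset.sum_congr rfl fun x hx => ?_
        rw [hκ x hx, Finset.sum_mul]
        refine Finset.sum_congr rfl fun z _ => ?_
        by_cases h0 : symProj L p lam n x z = 0
        · simp [h0]
        obtain ⟨e1, e2⟩ := symProj_ends h0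
        obtain ⟨m1, m2, -⟩ := mem_paths.mp hx
        rw [hκ', mul_assoc]
        simp only
        rw [if_pos ⟨e1.symm.trans m1, e2.symm.trans m2⟩]
    _ = ∑ x, ∑ z, κ' z * (symProj L p lam n x z * row L p lam (ladder lam n u) x y) := by
        refine Finset.sum_subset (Finset.subset_univ _) fun x _ hx => ?_
        refine Finset.sum_eq_zero fun z _ => ?_
        by_cases h0 : symProj L p lam n x z = 0
        · simp [h0]
        obtain ⟨e1, e2⟩ := symProj_ends h0
        by_cases hz : z 0 = a ∧ z (Fin.last n) = b
        · rw [H.row_eq_zero, mul_zero, mul_zero]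
          exact fun e => hx (mem_paths.mpr ⟨e1.trans hz.1, e2.trans hz.2, e.1⟩)
        · rw [hκ']
          simp only [if_neg hz, zero_mul]
    _ = _ := by
        rw [Finset.sum_comm]
        simp only [← Finset.mul_sum, H.symProj_push, Finset.sum_mul]
        simp only [Finset.mul_sum]
        rw [Finset.sum_comm]
        simp only [mul_assoc]

theorem rev_of_closed (h : Fusible L p lam n a a ℓ) {y : Fin (n + 1) → Fin L}
    (hy : y ∈ paths L n a a) : ℓ (y ∘ Fin.rev) = ℓ y := by
  obtain ⟨κ, hκ⟩ := h
  obtain ⟨h1, h2, h3⟩ := mem_paths.mp hy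
  rw [hκ _ (rev_mem_paths hy), hκ y hy]
  simp only [H.symProj_rev_of_closed _ h3 (h1.trans h2.symm)]

end Fusible

namespace IndPaths

variable (B : IndPaths L p lam) (H : IsSolvable L p lam) {n : ℕ} {a b : Fin L}
  {q : Fin (n + 1) → Fin L}

theorem phi_spec (hq : q ∈ paths L n a b) : ∀ low ∈ paths L n a b,
    symProj L p lam n q low
      = ∑ α ∈ Finset.Icc 1 (B.num n a b), B.phi n a b q α * symProj L p lam n (B.path n a b α) low := by
  rw [phi, dif_pos hq]
  exact Classical.choose_spec (B.maximal n a b q hq)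

/-- The coefficients of a path are unique. -/
theorem phi_unique (hq : q ∈ paths L n a b) (x : ℕ → ℂ) (hx : ∀ low ∈ paths L n a b,
    symProj L p lam n q low
      = ∑ α ∈ Finset.Icc 1 (B.num n a b), x α * symProj L p lam n (B.path n a b α) low)
    {α : ℕ} (hα : α ∈ Finset.Icc 1 (B.num n a b)) : B.phi n a b q α = x α := by
  rw [← sub_eq_zero]
  refine B.indep n a b (fun α => B.phi n a b q α - x α) (fun low hlow => ?_) α hα
  simp only [sub_mul, Finset.sum_sub_distrib]
  rw [← B.phi_spec hq low hlow, ← hx low hlow, sub_self]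

include H

theorem symProj_eq_sum (hq : q ∈ paths L n a b) (low : Fin (n + 1) → Fin L) :
    symProj L p lam n q low
      = ∑ α ∈ Finset.Icc 1 (B.num n a b), B.phi n a b q α * symProj L p lam n (B.path n a b α) low := by
  by_cases hl : low ∈ paths L n a b
  · exact B.phi_spec hq low hl
  have h0 : ∀ x ∈ paths L n a b, symProj L p lam n x low = 0 := by
    intro x hx
    by_contra h0
    obtain ⟨h1, h2, h3⟩ := mem_paths.mp hx
    obtain ⟨e1, e2⟩ := symProj_ends h0
    exact hl (mem_paths.mpr ⟨e1.symm.trans h1, e2.symm.trans h2, H.adj_of_symProj_ne h3 h0⟩)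
  rw [h0 q hq, Finset.sum_eq_zero]
  intro α hα
  rw [h0 _ (B.mem n a b α hα), mul_zero]

/-- The coefficients `φ(·|α)` are such functionals, since the rows of the projector that belong to the
independent paths are linearly independent. -/
theorem fusible_phi {α : ℕ} (hα : α ∈ Finset.Icc 1 (B.num n a b)) :
    Fusible L p lam n a b fun q => B.phi n a b q α := by
  -- the dual basis of the rows of the projector that belong to the independent paths
  let T : ({α // α ∈ Finset.Icc 1 (B.num n a b)} → ℂ) →ₗ[ℂ] ((Fin (n + 1) → Fin L) → ℂ) :=
    { toFun := fun c low => ∑ α, c α * symProj L p lam n (B.path n a b α) low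
      map_add' := fun c d => by
        funext low; simp only [Pi.add_apply, add_mul, Finset.sum_add_distrib]
      map_smul' := fun z c => by
        funext low
        simp only [Pi.smul_apply, smul_eq_mul, Finset.mul_sum, mul_assoc, RingHom.id_apply] }
  have hT : LinearMap.ker T = ⊥ := by
    rw [LinearMap.ker_eq_bot']
    intro c hc
    classical
    have h := B.indep n a b (fun α => if h : α ∈ Finset.Icc 1 (B.num n a b) then c ⟨α, h⟩ else 0)
      (fun low _ => by
        rw [← Finset.sum_coe_sort]
        have := congrFun hc low
        refine Eq.trans ?_ this
        exact Finset.sum_congr rfl fun α _ => by rw [dif_pos α.2])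
    funext α
    have := h α α.2
    rwa [dif_pos α.2] at this
  obtain ⟨g, hg⟩ := LinearMap.exists_leftInverse_of_injective T hT
  refine ⟨fun x => g (Pi.single x 1) ⟨α, hα⟩, fun q hq => ?_⟩
  have h1 : T (fun α => B.phi n a b q α) = fun low => symProj L p lam n q low := by
    funext low
    rw [B.symProj_eq_sum H hq low, ← Finset.sum_coe_sort]
    rfl
  have h2 := congrFun (LinearMap.congr_fun hg fun α => B.phi n a b q α) ⟨α, hα⟩
  rw [LinearMap.comp_apply, h1, LinearMap.id_apply] at h2
  change B.phi n a b q α = _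
  rw [← h2, LinearMap.pi_apply_eq_sum_univ g, Finset.sum_apply]
  refine Finset.sum_congr rfl fun x _ => ?_
  rw [Pi.smul_apply, smul_eq_mul, mul_comm]
  congr 1
  change g _ ⟨α, hα⟩ = g (Pi.single x 1) ⟨α, hα⟩
  refine congrFun (congrArg g (funext fun j => ?_)) _
  simp [Pi.single_apply, eq_comm]

/-- The expansion of a functional with respect to the independent paths. -/
theorem sum_phi_mul {ℓ : (Fin (n + 1) → Fin L) → ℂ} (h : Fusible L p lam n a b ℓ)
    (hq : q ∈ paths L n a b) :
    ∑ α ∈ Finset.Icc 1 (B.num n a b), B.phi n a b q α * ℓ (B.path n a b α) = ℓ q := by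
  obtain ⟨κ, hκ⟩ := h
  rw [hκ q hq]
  simp only [B.symProj_eq_sum H hq, Finset.mul_sum]
  rw [Finset.sum_comm]
  refine Finset.sum_congr rfl fun α hα => ?_
  rw [hκ _ (B.mem n a b α hα), Finset.mul_sum]
  exact Finset.sum_congr rfl fun x _ => by ring

/-- The coefficients of a path and of the reversed path agree. For distinct end points this is the
convention for the reversed edge; for equal end points it is the invariance of the projector under the
reversal of a closed path. -/
theorem phi_rev (hq : q ∈ paths L n a b) {α : ℕ} (hα : α ∈ Finset.Icc 1 (B.num n a b)) :
    B.phi n b a (q ∘ Fin.rev) α = B.phi n a b q α := by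
  by_cases hab : a = b
  · subst hab
    exact (B.fusible_phi H hα).rev_of_closed H hq
  · refine B.phi_unique (rev_mem_paths hq) _ (fun low _ => ?_) (by rwa [B.num_reverse])
    rw [← rev_rev_comp low, H.symProj_rev, B.symProj_eq_sum H hq, B.num_reverse n a b]
    refine Finset.sum_congr rfl fun α hα => ?_
    rw [B.path_reverse n a b hab α hα, H.symProj_rev]

/-- The independent paths of the reversed edge serve equally well for the evaluation of a functional that
factors through the projector. -/
theorem apply_path_rev {ℓ : (Fin (n + 1) → Fin L) → ℂ} (h : Fusible L p lam n a b ℓ) {α : ℕ}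
    (hα : α ∈ Finset.Icc 1 (B.num n a b)) :
    ℓ (B.path n b a α ∘ Fin.rev) = ℓ (B.path n a b α) := by
  by_cases hab : a = b
  · subst hab
    exact h.rev_of_closed H (B.mem n a a α hα)
  · rw [B.path_reverse n a b hab α hα, rev_rev_comp]

/-- The expansion of a functional, with the coefficients of the reversed edge. -/
theorem sum_phi_rev_mul {ℓ : (Fin (n + 1) → Fin L) → ℂ} (h : Fusible L p lam n a b ℓ)
    (hq : q ∈ paths L n b a) :
    ∑ α ∈ Finset.Icc 1 (B.num n a b), B.phi n b a q α * ℓ (B.path n a b α) = ℓ (q ∘ Fin.rev) := by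
  rw [← B.sum_phi_mul H h (rev_mem_paths hq)]
  refine Finset.sum_congr rfl fun α hα => ?_
  rw [B.phi_rev H hq (by rwa [B.num_reverse])]

end IndPaths

end

/-! ### Rectangular blocks of faces -/

section

variable {L : ℕ} {p lam : ℝ}

/-- The partition function of a rectangular block of faces with the heights `x` along the bottom,
`e` along the right, `y` along the top and `q` along the left edge. The face in row `k` (from the
bottom) and column `j` has the spectral parameter `r k j`. -/
noncomputable def grid (L : ℕ) (p lam : ℝ) {m n : ℕ} (r : Fin m → Fin n → ℂ)
    (x : Fin (n + 1) → Fin L) (e : Fin (m + 1) → Fin L) (y : Fin (n + 1) → Fin L)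
    (q : Fin (m + 1) → Fin L) : ℂ :=
  ∑ h : Fin (m + 1) → Fin (n + 1) → Fin L,
    if h 0 = x ∧ h (Fin.last m) = y ∧ (∀ k, h k 0 = q k) ∧ ∀ k, h k (Fin.last n) = e k then
      ∏ k, row L p lam (r k) (h k.castSucc) (h k.succ) else 0

variable {m n l : ℕ}

/-- A block vanishes unless its four edges fit together. -/
theorem grid_corners {r : Fin m → Fin n → ℂ} {x y : Fin (n + 1) → Fin L}
    {e q : Fin (m + 1) → Fin L} (h : grid L p lam r x e y q ≠ 0) :
    x 0 = q 0 ∧ x (Fin.last n) = e 0 ∧ y 0 = q (Fin.last m)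
      ∧ y (Fin.last n) = e (Fin.last m) := by
  obtain ⟨h, -, hh⟩ := Finset.exists_ne_zero_of_sum_ne_zero h
  have := fun e => hh (if_neg e)
  rw [imp_false, not_not] at this
  obtain ⟨rfl, rfl, h3, h4⟩ := this
  exact ⟨h3 0, h4 0, h3 _, h4 _⟩

theorem grid_zero (r : Fin 0 → Fin n → ℂ) (x y : Fin (n + 1) → Fin L) (e q : Fin 1 → Fin L) :
    grid L p lam r x e y q = if x = y ∧ x 0 = q 0 ∧ x (Fin.last n) = e 0 then 1 else 0 := by
  rw [grid, Finset.sum_eq_single_of_mem (fun _ => x) (Finset.mem_univ _)]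
  · simp
  · intro h _ hh
    rw [if_neg]
    rintro ⟨h1, -⟩
    exact hh (funext fun k => by rw [Fin.eq_zero k, h1])

/-- The decomposition of a block into its bottom row and the remaining rows. -/
theorem grid_succ (r : Fin (m + 1) → Fin n → ℂ) (x y : Fin (n + 1) → Fin L)
    (e q : Fin (m + 2) → Fin L) : grid L p lam r x e y q
      = if x 0 = q 0 ∧ x (Fin.last n) = e 0 then
          ∑ z, row L p lam (r 0) x z * grid L p lam (Fin.tail r) z (Fin.tail e) y (Fin.tail q)
        else 0 := by
  rw [grid, sum_fin_cons, Finset.sum_eq_single_of_mem x (Finset.mem_univ _)]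
  · simp only [Fin.cons_zero, ← Fin.succ_last, Fin.cons_succ, true_and, Fin.forall_fin_succ (n := m + 1),
      Fin.prod_univ_succ]
    by_cases hx : x 0 = q 0 ∧ x (Fin.last n) = e 0
    · simp only [hx, true_and, if_true, grid, Finset.mul_sum]
      rw [Finset.sum_comm]
      refine Finset.sum_congr rfl fun h _ => ?_
      rw [Finset.sum_eq_single_of_mem (h 0) (Finset.mem_univ _)]
      · rw [mul_ite, mul_zero]
        exact if_congr ⟨fun h => ⟨rfl, h⟩, fun h => h.2⟩ rfl rfl
      · intro z _ hz
        rw [if_neg (fun e => hz e.1.symm), mul_zero]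
    · rw [if_neg hx]
      refine Finset.sum_eq_zero fun h _ => if_neg ?_
      rintro ⟨-, ⟨h1, -⟩, h2, -⟩
      exact hx ⟨h1, h2⟩
  · intro a _ ha
    exact Finset.sum_eq_zero fun h _ => if_neg fun e => ha e.1

namespace IsSolvable

variable (H : IsSolvable L p lam)
include H

/-- The rows of a block are the columns of the block that is reflected in a diagonal. -/
theorem grid_transpose (r : Fin m → Fin n → ℂ) (x y : Fin (n + 1) → Fin L)
    (e q : Fin (m + 1) → Fin L) :
    grid L p lam r x e y q = grid L p lam (fun j k => r k j) q y e x := by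
  rw [grid, grid]
  refine Fintype.sum_equiv (Equiv.piComm fun _ _ => Fin L) _ _ fun h => ?_
  refine if_congr ?_ ?_ rfl
  · simp only [funext_iff, Equiv.piComm_apply, Function.swap]
    tauto
  · simp only [row, Equiv.piComm_apply, Function.swap]
    rw [Finset.prod_comm]
    exact Finset.prod_congr rfl fun j _ => Finset.prod_congr rfl fun k _ => H.swap' _ _ _ _ _

theorem grid_adj (hm : 0 < m) {r : Fin m → Fin n → ℂ} {x y : Fin (n + 1) → Fin L}
    {e q : Fin (m + 1) → Fin L} (h : grid L p lam r x e y q ≠ 0) :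
    (∀ i : Fin n, Adj L (x i.castSucc) (x i.succ))
      ∧ ∀ i : Fin n, Adj L (y i.castSucc) (y i.succ) := by
  obtain ⟨m, rfl⟩ := Nat.exists_eq_succ_of_ne_zero hm.ne'
  obtain ⟨h, -, hh⟩ := Finset.exists_ne_zero_of_sum_ne_zero h
  have := fun e => hh (if_neg e)
  rw [imp_false, not_not] at this
  rw [if_pos this] at hh
  rw [Finset.prod_ne_zero_iff] at hh
  have a1 := not_imp_comm.mp H.row_eq_zero (hh 0 (Finset.mem_univ _))
  have a2 := not_imp_comm.mp H.row_eq_zero (hh (Fin.last m) (Finset.mem_univ _))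
  rw [← this.1, ← this.2.1]
  exact ⟨a1.1, a2.2⟩

theorem grid_mem_paths (hm : 0 < m) (hn : 0 < n) {r : Fin m → Fin n → ℂ} {x y : Fin (n + 1) → Fin L}
    {e q : Fin (m + 1) → Fin L} (h : grid L p lam r x e y q ≠ 0) :
    x ∈ paths L n (x 0) (x (Fin.last n)) ∧ e ∈ paths L m (e 0) (e (Fin.last m))
      ∧ y ∈ paths L n (y 0) (y (Fin.last n)) ∧ q ∈ paths L m (q 0) (q (Fin.last m)) := by
  have h1 := H.grid_adj hm h
  rw [H.grid_transpose] at h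
  have h2 := H.grid_adj hn h
  exact ⟨mem_paths.mpr ⟨rfl, rfl, h1.1⟩, mem_paths.mpr ⟨rfl, rfl, h2.2⟩,
    mem_paths.mpr ⟨rfl, rfl, h1.2⟩, mem_paths.mpr ⟨rfl, rfl, h2.1⟩⟩

/-- A row of faces passes through a block: the Yang-Baxter equation for one line in one direction,
and many lines in the two other directions. -/
theorem slab_ybe (v : Fin l → ℂ) (c : Fin n → ℂ) (u : ℂ) (α z : Fin (n + 1) → Fin L)
    (ρ ζ : Fin (l + 1) → Fin L) (h0 : α 0 = ρ 0) (h1 : z (Fin.last n) = ζ (Fin.last l)) :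
    ∑ η₁, ∑ η₂, grid L p lam (fun i j => v i + c j) α η₂ η₁ ρ
        * row L p lam (fun j => u + c j) η₁ z * row L p lam (fun i => u - v i) ζ η₂
      = ∑ η₁, ∑ η₂, row L p lam (fun j => u + c j) α η₁ * row L p lam (fun i => u - v i) η₂ ρ
        * grid L p lam (fun i j => v i + c j) η₁ ζ z η₂ := by
  induction l generalizing α with
  | zero =>
    have e0 : ∀ F : (Fin 1 → Fin L) → ℂ, ∑ η, F η = ∑ a, F (fun _ => a) := fun F =>
      Fintype.sum_equiv (Equiv.funUnique (Fin 1) (Fin L)) _ _ fun η =>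
        congrArg F (funext fun k => by rw [Fin.eq_zero k]; rfl)
    simp only [e0, grid_zero, row_zero, mul_one]
    have h1' : z (Fin.last n) = ζ 0 := h1
    rw [Finset.sum_eq_single_of_mem α (Finset.mem_univ _),
      Finset.sum_eq_single_of_mem (α (Fin.last n)) (Finset.mem_univ _),
      Finset.sum_eq_single_of_mem z (Finset.mem_univ _),
      Finset.sum_eq_single_of_mem (z 0) (Finset.mem_univ _)]
    · rw [if_pos ⟨rfl, h0, rfl⟩, if_pos ⟨rfl, rfl, h1'⟩, one_mul, mul_one]
    · exact fun b _ hb => by rw [if_neg fun e => hb e.2.1.symm, mul_zero]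
    · exact fun b _ hb => Finset.sum_eq_zero fun c _ => by rw [if_neg fun e => hb e.1, mul_zero]
    · exact fun b _ hb => by rw [if_neg fun e => hb e.2.2.symm, zero_mul]
    · exact fun b _ hb => Finset.sum_eq_zero fun c _ => by rw [if_neg fun e => hb e.1.symm, zero_mul]
  | succ l ih =>
    have hr : (fun k => v 0 + c k + (u - v 0)) = fun k => u + c k := by funext k; ring
    have ht : ∀ h (t : Fin (l + 1) → Fin L), (Fin.cons h t : Fin (l + 2) → Fin L) 1 = t 0 :=
      fun _ _ => rfl
    have hg : Fin.tail (fun i j => v i + c j) = fun i j => Fin.tail v i + c j := rfl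
    have hv : Fin.tail (fun i => u - v i) = fun i => u - Fin.tail v i := rfl
    calc _ = ∑ σ, if σ 0 = ρ 1 then row L p lam (fun j => v 0 + c j) α σ
          * W L p lam (ζ 0) (ζ 1) (σ (Fin.last n)) (α (Fin.last n)) (u - v 0)
          * ∑ η₁, ∑ t, grid L p lam (fun i j => Fin.tail v i + c j) σ t η₁ (Fin.tail ρ)
            * row L p lam (fun j => u + c j) η₁ z
            * row L p lam (fun i => u - Fin.tail v i) (Fin.tail ζ) t else 0 := by
          have : ∀ η₁, (∑ η₂, grid L p lam (fun i j => v i + c j) α η₂ η₁ ρ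
              * row L p lam (fun j => u + c j) η₁ z * row L p lam (fun i => u - v i) ζ η₂)
              = ∑ σ, ∑ t, if σ 0 = ρ 1 then row L p lam (fun j => v 0 + c j) α σ
                * W L p lam (ζ 0) (ζ 1) (σ (Fin.last n)) (α (Fin.last n)) (u - v 0)
                * (grid L p lam (fun i j => Fin.tail v i + c j) σ t η₁ (Fin.tail ρ)
                * row L p lam (fun j => u + c j) η₁ z
                * row L p lam (fun i => u - Fin.tail v i) (Fin.tail ζ) t) else 0 := by
            intro η₁
            rw [sum_fin_cons, Finset.sum_eq_single_of_mem (α (Fin.last n)) (Finset.mem_univ _),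
              Finset.sum_comm (s := Finset.univ (α := Fin (n + 1) → Fin L))]
            · refine Finset.sum_congr rfl fun t _ => ?_
              rw [grid_succ, if_pos ⟨h0, rfl⟩, Finset.sum_mul, Finset.sum_mul]
              refine Finset.sum_congr rfl fun σ _ => ?_
              rw [row_succ (r := fun i => u - v i), hg, hv, Fin.tail_cons, ht,
                Fin.cons_zero]
              by_cases hz : grid L p lam (fun i j => Fin.tail v i + c j) σ t η₁ (Fin.tail ρ) = 0
              · simp [hz]
              · obtain ⟨c1, c2, -⟩ := grid_corners hz
                rw [if_pos (show σ 0 = ρ 1 from c1), c2]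
                ring
            · intro b _ hb
              refine Finset.sum_eq_zero fun t _ => ?_
              rw [grid_succ, if_neg fun e => hb e.2.symm, zero_mul, zero_mul]
          simp only [this]
          rw [Finset.sum_comm]
          refine Finset.sum_congr rfl fun σ _ => ?_
          split_ifs
          · simp only [Finset.mul_sum]
          · simp
      _ = ∑ η₁, ∑ t, row L p lam (fun i => u - Fin.tail v i) t (Fin.tail ρ)
          * grid L p lam (fun i j => Fin.tail v i + c j) η₁ (Fin.tail ζ) z t
          * ∑ σ, if σ 0 = ρ 1 then row L p lam (fun j => v 0 + c j) α σ
            * row L p lam (fun j => v 0 + c j + (u - v 0)) σ η₁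
            * W L p lam (σ (Fin.last n)) (α (Fin.last n)) (ζ 0) (η₁ (Fin.last n)) (u - v 0)
            else 0 := by
          conv_rhs =>
            simp only [Finset.mul_sum]
            enter [2, η₁]
            rw [Finset.sum_comm]
          conv_rhs => rw [Finset.sum_comm]
          refine Finset.sum_congr rfl fun σ _ => ?_
          split_ifs with hσ
          · rw [ih (Fin.tail v) σ (Fin.tail ρ) (Fin.tail ζ) hσ h1, Finset.mul_sum]
            refine Finset.sum_congr rfl fun η₁ _ => ?_
            rw [Finset.mul_sum]
            refine Finset.sum_congr rfl fun t _ => ?_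
            by_cases hz : grid L p lam (fun i j => Fin.tail v i + c j) η₁ (Fin.tail ζ) z t = 0
            · simp [hz]
            · obtain ⟨-, c2, -⟩ := grid_corners hz
              rw [H.rotate (ζ 0), hr, c2]
              change _ * W L p lam _ _ _ (Fin.tail ζ 0) _ * _ = _
              ring
          · simp
      _ = ∑ η₁, ∑ t, row L p lam (fun i => u - Fin.tail v i) t (Fin.tail ρ)
          * grid L p lam (fun i j => Fin.tail v i + c j) η₁ (Fin.tail ζ) z t
          * ∑ σ, if σ (Fin.last n) = ζ 0 then W L p lam (ρ 1) (α 0) (σ 0) (η₁ 0) (u - v 0)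
            * row L p lam (fun j => u + c j) α σ * row L p lam (fun j => v 0 + c j) σ η₁
            else 0 := by
          refine Finset.sum_congr rfl fun η₁ _ => Finset.sum_congr rfl fun t _ => ?_
          have := H.row_ybe (fun j => v 0 + c j) (u - v 0) α η₁ (ρ 1) (ζ 0)
          simp only [hr] at this ⊢
          rw [this]
      _ = _ := by
          simp only [Finset.mul_sum]
          conv_lhs => enter [2, η₁]; rw [Finset.sum_comm]
          rw [Finset.sum_comm (s := Finset.univ (α := Fin (n + 1) → Fin L))]
          refine Finset.sum_congr rfl fun σ _ => ?_
          rw [sum_fin_cons (n := l + 1), Finset.sum_eq_single_of_mem (σ 0) (Finset.mem_univ _), Finset.sum_comm]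
          · refine Finset.sum_congr rfl fun t _ => ?_
            rw [grid_succ, hg, Fin.cons_zero, Fin.tail_cons, row_succ (r := fun i => u - v i),
              hv, Fin.tail_cons, ht, Fin.cons_zero]
            by_cases hσ : σ (Fin.last n) = ζ 0
            · simp only [if_pos hσ, true_and, Finset.mul_sum]
              refine Finset.sum_congr rfl fun η₁ _ => ?_
              by_cases hz : grid L p lam (fun i j => Fin.tail v i + c j) η₁ (Fin.tail ζ) z t = 0
              · simp [hz]
              · obtain ⟨c1, -⟩ := grid_corners hz
                rw [H.rotate (ρ 1), c1, h0]
                ring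
            · simp [if_neg hσ]
          · intro b _ hb
            refine Finset.sum_eq_zero fun t _ => ?_
            rw [grid_succ, if_neg fun e => hb e.1.symm, mul_zero]

end IsSolvable

end

/-! ### The Yang-Baxter equation for blocks -/

section

variable {L : ℕ} {p lam : ℝ} {m n l : ℕ}

theorem sum_comm_three_two {A B C D E : Type*} [Fintype A] [Fintype B] [Fintype C] [Fintype D]
    [Fintype E] (F : A → B → C → D → E → ℂ) :
    ∑ a, ∑ b, ∑ c, ∑ d, ∑ e, F a b c d e = ∑ d, ∑ e, ∑ a, ∑ b, ∑ c, F a b c d e := by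
  calc _ = ∑ x : (A × B × C) × (D × E), F x.1.1 x.1.2.1 x.1.2.2 x.2.1 x.2.2 := by
        simp only [Fintype.sum_prod_type]
    _ = ∑ x : (D × E) × (A × B × C), F x.2.1 x.2.2.1 x.2.2.2 x.1.1 x.1.2 :=
        Fintype.sum_equiv (Equiv.prodComm _ _) _ _ fun _ => rfl
    _ = _ := by simp only [Fintype.sum_prod_type]

namespace IsSolvable

variable (H : IsSolvable L p lam)
include H

/-- The decomposition of a block into its bottom row and the remaining rows, for a block whose
columns are numbered from right to left. -/
theorem grid_rev_succ (u : Fin (m + 1) → ℂ) (v : Fin l → ℂ) (η γ : Fin (l + 1) → Fin L)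
    (β δ : Fin (m + 2) → Fin L) :
    grid L p lam (fun k i => u k - v (Fin.rev i)) (η ∘ Fin.rev) β (γ ∘ Fin.rev) δ
      = if η (Fin.last l) = δ 0 ∧ η 0 = β 0 then
          ∑ ζ : Fin (l + 1) → Fin L, row L p lam (fun i => u 0 - v i) ζ η
            * grid L p lam (fun k i => Fin.tail u k - v (Fin.rev i)) (ζ ∘ Fin.rev) (Fin.tail β)
              (γ ∘ Fin.rev) (Fin.tail δ)
        else 0 := by
  rw [grid_succ, sum_rev]
  refine if_congr (by simp) (Finset.sum_congr rfl fun ζ _ => ?_) rfl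
  rw [H.row_rev]
  congr 2
  funext i
  simp

/-- The Yang-Baxter equation for blocks of faces, with arbitrary spectral parameters of the lines. -/
theorem block_ybe (u : Fin m → ℂ) (v : Fin l → ℂ) (c : Fin n → ℂ) (α μ : Fin (n + 1) → Fin L)
    (β ν : Fin (m + 1) → Fin L) (γ ρ : Fin (l + 1) → Fin L) :
    ∑ η₁, ∑ η₂, ∑ η₃, grid L p lam (fun i j => v i + c j) α η₂ η₁ ρ
        * (grid L p lam (fun k j => u k + c j) η₁ η₃ μ ν
        * grid L p lam (fun k i => u k - v (Fin.rev i)) (η₂ ∘ Fin.rev) β (γ ∘ Fin.rev) η₃)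
      = ∑ η₁, ∑ η₂, ∑ η₃, grid L p lam (fun k j => u k + c j) α β η₁ η₃
        * grid L p lam (fun k i => u k - v (Fin.rev i)) (ρ ∘ Fin.rev) η₃ (η₂ ∘ Fin.rev) ν
        * grid L p lam (fun i j => v i + c j) η₁ γ μ η₂ := by
  induction m generalizing α ρ with
  | zero =>
    have hrev : ∀ x y : Fin (l + 1) → Fin L, x ∘ Fin.rev = y ∘ Fin.rev ↔ x = y := fun x y =>
      ⟨fun h => by rw [← rev_rev_comp x, h, rev_rev_comp], fun h => by rw [h]⟩
    have e0 : ∀ F : (Fin 1 → Fin L) → ℂ, ∑ η, F η = ∑ a, F (fun _ => a) := fun F =>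
      Fintype.sum_equiv (Equiv.funUnique (Fin 1) (Fin L)) _ _ fun η =>
        congrArg F (funext fun k => by rw [Fin.eq_zero k]; rfl)
    simp only [e0, grid_zero, hrev, Function.comp, Fin.rev_zero, Fin.rev_last]
    rw [Finset.sum_eq_single_of_mem μ (Finset.mem_univ _),
      Finset.sum_eq_single_of_mem γ (Finset.mem_univ _),
      Finset.sum_eq_single_of_mem (γ (Fin.last l)) (Finset.mem_univ _),
      Finset.sum_eq_single_of_mem α (Finset.mem_univ _),
      Finset.sum_eq_single_of_mem ρ (Finset.mem_univ _),
      Finset.sum_eq_single_of_mem (α 0) (Finset.mem_univ _)]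
    · by_cases hz : grid L p lam (fun i j => v i + c j) α γ μ ρ = 0
      · simp [hz]
      · obtain ⟨c1, c2, c3, c4⟩ := grid_corners hz
        simp only [c1, c2, c3, c4, true_and, and_true]
        split_ifs <;> simp
    · exact fun b _ hb => by rw [if_neg fun e => hb e.2.1.symm, zero_mul, zero_mul]
    · exact fun b _ hb => Finset.sum_eq_zero fun _ _ => by
        rw [if_neg (c := ρ = b ∧ _) fun e => hb e.1.symm, mul_zero, zero_mul]
    · exact fun b _ hb => Finset.sum_eq_zero fun _ _ => Finset.sum_eq_zero fun _ _ => by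
        rw [if_neg fun e => hb e.1.symm, zero_mul, zero_mul]
    · exact fun b _ hb => by
        rw [if_neg (c := γ = γ ∧ _) fun e => hb e.2.1.symm, mul_zero, mul_zero]
    · exact fun b _ hb => Finset.sum_eq_zero fun _ _ => by
        rw [if_neg (c := b = γ ∧ _) fun e => hb e.1, mul_zero, mul_zero]
    · exact fun b _ hb => Finset.sum_eq_zero fun _ _ => Finset.sum_eq_zero fun _ _ => by
        rw [if_neg fun e => hb e.1, zero_mul, mul_zero]
  | succ m ih =>
    have hg : Fin.tail (fun k j => u k + c j) = fun k j => Fin.tail u k + c j := rfl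
    have hl : ∀ η₁ η₂, (∑ η₃, grid L p lam (fun i j => v i + c j) α η₂ η₁ ρ
        * (grid L p lam (fun k j => u k + c j) η₁ η₃ μ ν
        * grid L p lam (fun k i => u k - v (Fin.rev i)) (η₂ ∘ Fin.rev) β (γ ∘ Fin.rev) η₃))
        = if α 0 = ρ 0 ∧ ρ (Fin.last l) = ν 0 ∧ α (Fin.last n) = β 0 then ∑ z, ∑ ζ, ∑ t,
          grid L p lam (fun i j => v i + c j) α η₂ η₁ ρ * row L p lam (fun j => u 0 + c j) η₁ z
          * row L p lam (fun i => u 0 - v i) ζ η₂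
          * (grid L p lam (fun k j => Fin.tail u k + c j) z t μ (Fin.tail ν)
          * grid L p lam (fun k i => Fin.tail u k - v (Fin.rev i)) (ζ ∘ Fin.rev) (Fin.tail β)
            (γ ∘ Fin.rev) t) else 0 := by
      intro η₁ η₂
      by_cases hz : grid L p lam (fun i j => v i + c j) α η₂ η₁ ρ = 0
      · simp [hz]
      obtain ⟨c1, c2, c3, c4⟩ := grid_corners hz
      rw [sum_fin_cons, Finset.sum_eq_single_of_mem (η₁ (Fin.last n)) (Finset.mem_univ _)]
      · simp only [grid_succ (r := fun k j => u k + c j), H.grid_rev_succ, Fin.cons_zero,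
          Fin.tail_cons, hg, c1, c2, c3, c4, true_and, and_true]
        by_cases hk : ρ (Fin.last l) = ν 0 ∧ η₂ 0 = β 0
        · simp only [if_pos hk, if_pos hk.1, if_pos hk.2, Finset.sum_mul, Finset.mul_sum]
          conv_lhs =>
            enter [2, t]
            rw [Finset.sum_comm]
          rw [Finset.sum_comm]
          refine Finset.sum_congr rfl fun z _ => ?_
          rw [Finset.sum_comm]
          refine Finset.sum_congr rfl fun ζ _ => ?_
          refine Finset.sum_congr rfl fun t _ => ?_
          ring
        · rw [if_neg hk]
          refine Finset.sum_eq_zero fun t _ => ?_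
          rw [not_and_or] at hk
          rcases hk with hk | hk <;> simp [if_neg hk]
      · intro b _ hb
        refine Finset.sum_eq_zero fun t _ => ?_
        rw [grid_succ (r := fun k j => u k + c j), if_neg fun e => hb e.2.symm, zero_mul, mul_zero]
    have hr : ∀ z ζ, (∑ η₃, grid L p lam (fun k j => u k + c j) α β z η₃
        * grid L p lam (fun k i => u k - v (Fin.rev i)) (ρ ∘ Fin.rev) η₃ (ζ ∘ Fin.rev) ν
        * grid L p lam (fun i j => v i + c j) z γ μ ζ)
        = if α 0 = ρ 0 ∧ ρ (Fin.last l) = ν 0 ∧ α (Fin.last n) = β 0 then ∑ t, ∑ η₁, ∑ η₂,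
          row L p lam (fun j => u 0 + c j) α η₁ * row L p lam (fun i => u 0 - v i) η₂ ρ
          * (grid L p lam (fun k j => Fin.tail u k + c j) η₁ (Fin.tail β) z t
          * grid L p lam (fun k i => Fin.tail u k - v (Fin.rev i)) (η₂ ∘ Fin.rev) t
            (ζ ∘ Fin.rev) (Fin.tail ν) * grid L p lam (fun i j => v i + c j) z γ μ ζ) else 0 := by
      intro z ζ
      rw [sum_fin_cons, Finset.sum_eq_single_of_mem (α 0) (Finset.mem_univ _)]
      · simp only [grid_succ (r := fun k j => u k + c j), H.grid_rev_succ, Fin.cons_zero,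
          Fin.tail_cons, hg, true_and]
        by_cases hk : α 0 = ρ 0 ∧ ρ (Fin.last l) = ν 0 ∧ α (Fin.last n) = β 0
        · simp only [if_pos hk, if_pos hk.2.2, if_pos (And.intro hk.2.1 hk.1.symm), Finset.sum_mul,
            Finset.mul_sum]
          refine Finset.sum_congr rfl fun t _ => ?_
          rw [Finset.sum_comm]
          exact Finset.sum_congr rfl fun _ _ => Finset.sum_congr rfl fun _ _ => by ring
        · rw [if_neg hk]
          refine Finset.sum_eq_zero fun t _ => ?_
          by_cases h1 : α (Fin.last n) = β 0
          · rw [if_neg (c := _ ∧ _) fun e => hk ⟨e.2.symm, e.1, h1⟩, mul_zero, zero_mul]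
          · rw [if_neg h1, zero_mul, zero_mul]
      · intro b _ hb
        refine Finset.sum_eq_zero fun t _ => ?_
        rw [grid_succ (r := fun k j => u k + c j), if_neg fun e => hb e.1.symm, zero_mul, zero_mul]
    simp only [hl, hr]
    by_cases hk : α 0 = ρ 0 ∧ ρ (Fin.last l) = ν 0 ∧ α (Fin.last n) = β 0
    swap
    · simp [if_neg hk]
    simp only [if_pos hk]
    refine (sum_comm_three_two _).symm.trans (Eq.trans ?_ (sum_comm_three_two _).symm)
    calc _ = ∑ z, ∑ ζ, ∑ t, ∑ η₁, ∑ η₂, row L p lam (fun j => u 0 + c j) α η₁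
          * row L p lam (fun i => u 0 - v i) η₂ ρ
          * (grid L p lam (fun i j => v i + c j) η₁ ζ z η₂
          * (grid L p lam (fun k j => Fin.tail u k + c j) z t μ (Fin.tail ν)
          * grid L p lam (fun k i => Fin.tail u k - v (Fin.rev i)) (ζ ∘ Fin.rev) (Fin.tail β)
            (γ ∘ Fin.rev) t)) := by
          refine Finset.sum_congr rfl fun z _ => Finset.sum_congr rfl fun ζ _ =>
            Finset.sum_congr rfl fun t _ => ?_
          simp only [← Finset.sum_mul, ← mul_assoc]
          by_cases h1 : grid L p lam (fun k j => Fin.tail u k + c j) z t μ (Fin.tail ν) = 0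
          · simp [h1]
          by_cases h2 : grid L p lam (fun k i => Fin.tail u k - v (Fin.rev i)) (ζ ∘ Fin.rev)
              (Fin.tail β) (γ ∘ Fin.rev) t = 0
          · simp [h2]
          obtain ⟨-, d1, -⟩ := grid_corners h1
          obtain ⟨d2, -⟩ := grid_corners h2
          rw [H.slab_ybe v c (u 0) α z ρ ζ hk.1 (d1.trans (by simpa using d2.symm))]
      _ = _ := by
          rw [sum_comm_three_two]
          refine Finset.sum_congr rfl fun η₁ _ => Finset.sum_congr rfl fun η₂ _ => ?_
          have := congrArg (row L p lam (fun j => u 0 + c j) α η₁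
            * row L p lam (fun i => u 0 - v i) η₂ ρ * ·)
            (ih (Fin.tail u) η₁ (Fin.tail β) (Fin.tail ν) η₂)
          simpa only [Finset.mul_sum] using this

end IsSolvable

end

/-! ### Fused faces as blocks of faces -/

section

variable {L : ℕ} {p lam : ℝ} {m n : ℕ} {a b c d : Fin L}

namespace Fusible

variable (H : IsSolvable L p lam) {ℓ : (Fin (n + 1) → Fin L) → ℂ}
include H

/-- A block whose rows have spectral parameters of the form `u, u+2λ, …` transports a functional
that factors through the projector from its bottom to its top. -/
theorem grid_push (h : Fusible L p lam n a b ℓ) (w : Fin m → ℂ) (e q : Fin (m + 1) → Fin L) :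
    Fusible L p lam n d c fun y => ∑ x ∈ paths L n a b,
      ℓ x * grid L p lam (fun k => ladder lam n (w k)) x e y q := by
  induction m generalizing a b ℓ with
  | zero =>
    by_cases hk : a = q 0 ∧ b = e 0 ∧ a = d ∧ b = c
    · obtain ⟨h1, h2, rfl, rfl⟩ := hk
      refine h.congr fun y hy => ?_
      obtain ⟨y1, y2, -⟩ := mem_paths.mp hy
      rw [Finset.sum_eq_single_of_mem y hy, grid_zero, if_pos ⟨rfl, y1.trans h1, y2.trans h2⟩,
        mul_one]
      exact fun x _ hx => by rw [grid_zero, if_neg fun e => hx e.1, mul_zero]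
    · refine Fusible.zero.congr fun y hy => Finset.sum_eq_zero fun x hx => ?_
      obtain ⟨x1, x2, -⟩ := mem_paths.mp hx
      obtain ⟨y1, y2, -⟩ := mem_paths.mp hy
      rw [grid_zero, if_neg, mul_zero]
      rintro ⟨rfl, e1, e2⟩
      exact hk ⟨x1.symm.trans e1, x2.symm.trans e2, x1.symm.trans y1, x2.symm.trans y2⟩
  | succ m ih =>
    by_cases hk : a = q 0 ∧ b = e 0
    · refine (ih (h.row_push H (w 0) (d := q 1) (c := e 1)) (Fin.tail w) (Fin.tail e)
        (Fin.tail q)).congr fun y _ => ?_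
      simp only [Finset.sum_mul]
      rw [Finset.sum_comm]
      refine Finset.sum_congr rfl fun x hx => ?_
      obtain ⟨x1, x2, -⟩ := mem_paths.mp hx
      rw [grid_succ, if_pos ⟨x1.trans hk.1, x2.trans hk.2⟩, Finset.mul_sum]
      refine (Finset.sum_subset (Finset.subset_univ (paths L n (q 1) (e 1))) fun z _ hz => ?_).symm.trans
        (Finset.sum_congr rfl fun z _ => (mul_assoc _ _ _).symm)
      by_contra h0
      have h0 := right_ne_zero_of_mul h0
      obtain ⟨z1, z2, -⟩ := grid_corners (right_ne_zero_of_mul h0)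
      exact hz (mem_paths.mpr ⟨z1, z2,
        (not_imp_comm.mp H.row_eq_zero (left_ne_zero_of_mul h0)).2⟩)
    · refine Fusible.zero.congr fun y hy => Finset.sum_eq_zero fun x hx => ?_
      obtain ⟨x1, x2, -⟩ := mem_paths.mp hx
      rw [grid_succ, if_neg fun e => hk ⟨x1.symm.trans e.1, x2.symm.trans e.2⟩, mul_zero]

/-- A block whose columns have spectral parameters of the form `u, u+2λ, …` transports a functional
that factors through the projector from its left edge to its right edge. -/
theorem grid_push_right (h : Fusible L p lam n a b ℓ) (w : Fin m → ℂ) (x y : Fin (m + 1) → Fin L) :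
    Fusible L p lam n d c fun e => ∑ q ∈ paths L n a b,
      ℓ q * grid L p lam (fun k j => ladder lam n (w j) k) x e y q := by
  simp only [H.grid_transpose (x := x)]
  exact h.grid_push H w y x

end Fusible

namespace IndPaths

variable (B : IndPaths L p lam) (H : IsSolvable L p lam)

theorem phi_path {α β : ℕ} (hα : α ∈ Finset.Icc 1 (B.num n a b))
    (hβ : β ∈ Finset.Icc 1 (B.num n a b)) :
    B.phi n a b (B.path n a b β) α = if α = β then 1 else 0 := by
  refine B.phi_unique (B.mem n a b β hβ) (fun α => if α = β then 1 else 0) (fun low _ => ?_) hα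
  simp only [ite_mul, one_mul, zero_mul]
  rw [Finset.sum_ite_eq', if_pos hβ]

include H

/-- The sum over the inner horizontal bonds of a column of fused rows replaces these rows by a block
of faces. -/
theorem sum_prod_fusedRow (w : Fin m → ℂ) (q e : Fin (m + 1) → Fin L) {α β : ℕ}
    (hα : α ∈ Finset.Icc 1 (B.num n (q 0) (e 0)))
    (hβ : β ∈ Finset.Icc 1 (B.num n (q (Fin.last m)) (e (Fin.last m)))) :
    ∑ t ∈ (Fintype.piFinset fun k : Fin (m + 1) => Finset.Icc 1 (B.num n (q k) (e k))).filter
        (fun t => t 0 = α ∧ t (Fin.last m) = β),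
      ∏ k : Fin m, fusedRow B n (w k) (q k.castSucc) (e k.castSucc) (e k.succ) (q k.succ)
        (t k.castSucc) (t k.succ)
      = ∑ x ∈ paths L n (q 0) (e 0), B.phi n (q 0) (e 0) x α
        * grid L p lam (fun k => ladder lam n (w k)) x e
          (B.path n (q (Fin.last m)) (e (Fin.last m)) β) q := by
  induction m generalizing α with
  | zero =>
    have hβ' : β ∈ Finset.Icc 1 (B.num n (q 0) (e 0)) := hβ
    have hp := B.mem n _ _ β hβ'
    obtain ⟨p1, p2, -⟩ := mem_paths.mp hp
    rw [Finset.sum_eq_single_of_mem (B.path n (q 0) (e 0) β) hp, grid_zero,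
      if_pos ⟨rfl, p1, p2⟩, mul_one, B.phi_path hα hβ']
    · simp only [Finset.univ_eq_empty, Finset.prod_empty, Finset.sum_const, nsmul_eq_mul, mul_one]
      split_ifs with hαβ
      · subst hαβ
        rw [Nat.cast_eq_one, Finset.card_eq_one]
        refine ⟨fun _ => α, Finset.ext fun t => ?_⟩
        simp only [Finset.mem_filter, Fintype.mem_piFinset, Finset.mem_singleton]
        constructor
        · rintro ⟨-, h, -⟩
          funext k
          rw [Fin.eq_zero k, h]
        · rintro rfl
          exact ⟨fun k => by rwa [Fin.eq_zero k], rfl, rfl⟩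
      · rw [Nat.cast_eq_zero, Finset.card_eq_zero, Finset.filter_eq_empty_iff]
        rintro t - ⟨h1, h2⟩
        exact hαβ (h1.symm.trans h2)
    · intro x _ hx
      rw [grid_zero, if_neg fun e => hx e.1, mul_zero]
  | succ m ih =>
    calc _ = ∑ t ∈ (Fintype.piFinset fun k : Fin (m + 1) =>
          Finset.Icc 1 (B.num n (Fin.tail q k) (Fin.tail e k))).filter
            (fun t => t (Fin.last m) = β),
          fusedRow B n (w 0) (q 0) (e 0) (e 1) (q 1) α (t 0)
            * ∏ k : Fin m, fusedRow B n (Fin.tail w k) (Fin.tail q k.castSucc)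
              (Fin.tail e k.castSucc) (Fin.tail e k.succ) (Fin.tail q k.succ)
              (t k.castSucc) (t k.succ) := by
          refine Finset.sum_bij' (fun t _ => Fin.tail t) (fun t _ => Fin.cons α t) ?_ ?_ ?_ ?_ ?_
          · intro t ht
            simp only [Finset.mem_filter, Fintype.mem_piFinset] at ht ⊢
            exact ⟨fun k => ht.1 k.succ, ht.2.2⟩
          · intro t ht
            simp only [Finset.mem_filter, Fintype.mem_piFinset] at ht ⊢
            exact ⟨fun k => Fin.cases hα (fun k => ht.1 k) k, rfl, ht.2⟩
          · intro t ht
            simp only [Finset.mem_filter, Fintype.mem_piFinset] at ht ⊢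
            rw [← ht.2.1, Fin.cons_self_tail]
          · intro t _
            rw [Fin.tail_cons]
          · intro t ht
            simp only [Finset.mem_filter, Fintype.mem_piFinset] at ht
            rw [Fin.prod_univ_succ, Fin.castSucc_zero, ht.2.1]
            rfl
      _ = ∑ t₁ ∈ Finset.Icc 1 (B.num n (q 1) (e 1)),
          fusedRow B n (w 0) (q 0) (e 0) (e 1) (q 1) α t₁
            * ∑ t ∈ (Fintype.piFinset fun k : Fin (m + 1) =>
              Finset.Icc 1 (B.num n (Fin.tail q k) (Fin.tail e k))).filter
                (fun t => t 0 = t₁ ∧ t (Fin.last m) = β),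
              ∏ k : Fin m, fusedRow B n (Fin.tail w k) (Fin.tail q k.castSucc)
                (Fin.tail e k.castSucc) (Fin.tail e k.succ) (Fin.tail q k.succ)
                (t k.castSucc) (t k.succ) := by
          rw [← Finset.sum_fiberwise_of_maps_to (g := fun t => t 0)
            (t := Finset.Icc 1 (B.num n (q 1) (e 1)))]
          · refine Finset.sum_congr rfl fun t₁ _ => ?_
            rw [Finset.mul_sum, Finset.filter_filter]
            refine Finset.sum_congr (Finset.filter_congr fun t _ => and_comm) fun t ht => ?_
            rw [(Finset.mem_filter.mp ht).2.1]
          · intro t ht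
            exact Fintype.mem_piFinset.mp (Finset.mem_filter.mp ht).1 0
      _ = ∑ t₁ ∈ Finset.Icc 1 (B.num n (q 1) (e 1)),
          (∑ x ∈ paths L n (q 0) (e 0), B.phi n (q 0) (e 0) x α
            * row L p lam (ladder lam n (w 0)) x (B.path n (q 1) (e 1) t₁))
            * ∑ z ∈ paths L n (q 1) (e 1), B.phi n (q 1) (e 1) z t₁
              * grid L p lam (fun k => ladder lam n (Fin.tail w k)) z (Fin.tail e)
                (B.path n (q (Fin.last (m + 1))) (e (Fin.last (m + 1))) β) (Fin.tail q) :=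
          Finset.sum_congr rfl fun t₁ h₁ => congrArg _
            (ih (Fin.tail w) (Fin.tail q) (Fin.tail e) h₁ hβ)
      _ = ∑ z ∈ paths L n (q 1) (e 1), (∑ x ∈ paths L n (q 0) (e 0), B.phi n (q 0) (e 0) x α
            * row L p lam (ladder lam n (w 0)) x z)
            * grid L p lam (fun k => ladder lam n (Fin.tail w k)) z (Fin.tail e)
                (B.path n (q (Fin.last (m + 1))) (e (Fin.last (m + 1))) β) (Fin.tail q) := by
          simp only [Finset.mul_sum]
          rw [Finset.sum_comm]
          refine Finset.sum_congr rfl fun z hz => ?_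
          rw [← B.sum_phi_mul H ((B.fusible_phi H hα).row_push H (w 0) (d := q 1) (c := e 1)) hz,
            Finset.sum_mul]
          exact Finset.sum_congr rfl fun _ _ => by ring
      _ = _ := by
          simp only [Finset.sum_mul]
          rw [Finset.sum_comm]
          refine Finset.sum_congr rfl fun x hx => ?_
          obtain ⟨x1, x2, -⟩ := mem_paths.mp hx
          rw [grid_succ, if_pos ⟨x1, x2⟩, Finset.mul_sum]
          refine (Finset.sum_congr rfl fun z _ => mul_assoc _ _ _).trans
            (Finset.sum_subset (Finset.subset_univ _) fun z _ hz => ?_)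
          by_contra h0
          have h0 := right_ne_zero_of_mul h0
          obtain ⟨z1, z2, -⟩ := grid_corners (right_ne_zero_of_mul h0)
          exact hz (mem_paths.mpr ⟨z1, z2,
            (not_imp_comm.mp H.row_eq_zero (left_ne_zero_of_mul h0)).2⟩)

end IndPaths

/-- The spectral parameters of the faces that form a fused face. -/
noncomputable def faceParam (lam : ℝ) (m n : ℕ) (u : ℂ) (k : Fin m) (j : Fin n) : ℂ :=
  ladder lam n (u - 2 * ((m : ℂ) - 1 - ((k : ℕ) : ℂ)) * lam) j

/-- A fused face whose right edge `e` and top edge `y` are arbitrary paths. -/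
noncomputable def openFace (B : IndPaths L p lam) (m n : ℕ) (u : ℂ) (a b d : Fin L) (α μ : ℕ)
    (e : Fin (m + 1) → Fin L) (y : Fin (n + 1) → Fin L) : ℂ :=
  ∑ x ∈ paths L n a b, B.phi n a b x α * ∑ q ∈ paths L m a d, B.phi m a d q μ
    * grid L p lam (faceParam lam m n u) x e y q

variable {B : IndPaths L p lam} (H : IsSolvable L p lam) {α β μ ν : ℕ} {u : ℂ}

theorem openFace_comm (e : Fin (m + 1) → Fin L) (y : Fin (n + 1) → Fin L) :
    openFace B m n u a b d α μ e y = ∑ q ∈ paths L m a d, B.phi m a d q μ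
      * ∑ x ∈ paths L n a b, B.phi n a b x α * grid L p lam (faceParam lam m n u) x e y q := by
  simp only [openFace, Finset.mul_sum]
  rw [Finset.sum_comm]
  exact Finset.sum_congr rfl fun _ _ => Finset.sum_congr rfl fun _ _ => by ring

include H

/-- As a function of its top edge, a block whose bottom edge is summed with the coefficients `φ` factors
through the projector; the rows of the block have spectral parameters `w, w+2λ, …`. -/
theorem fusible_sum_grid_top (hα : α ∈ Finset.Icc 1 (B.num n a b)) {a' b' : Fin L}
    (e q : Fin (m + 1) → Fin L) : Fusible L p lam n a' b' fun y => ∑ x ∈ paths L n a b,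
      B.phi n a b x α * grid L p lam (faceParam lam m n u) x e y q :=
  (B.fusible_phi H hα).grid_push H _ e q

/-- The columns of the block, too, have spectral parameters `w, w+2λ, …`, so the same is true of its right
edge. -/
theorem fusible_sum_grid_right (hμ : μ ∈ Finset.Icc 1 (B.num m a d)) {a' b' : Fin L}
    (x y : Fin (n + 1) → Fin L) : Fusible L p lam m a' b' fun e => ∑ q ∈ paths L m a d,
      B.phi m a d q μ * grid L p lam (faceParam lam m n u) x e y q := by
  have h : faceParam lam m n u = fun k (j : Fin n) =>
      ladder lam m (u - 2 * ((m : ℂ) - 1) * lam + 2 * ((j : ℕ) : ℂ) * lam) k := by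
    funext k j
    simp only [faceParam, ladder]
    ring
  rw [h]
  exact (B.fusible_phi H hμ).grid_push_right H _ x y

theorem fusible_openFace_top (hα : α ∈ Finset.Icc 1 (B.num n a b)) {a' b' : Fin L}
    (e : Fin (m + 1) → Fin L) :
    Fusible L p lam n a' b' fun y => openFace B m n u a b d α μ e y := by
  simp only [openFace_comm]
  exact Fusible.sum fun q _ => (fusible_sum_grid_top H hα e q).mul_left _

theorem fusible_openFace_right (hμ : μ ∈ Finset.Icc 1 (B.num m a d)) {a' b' : Fin L}
    (y : Fin (n + 1) → Fin L) :
    Fusible L p lam m a' b' fun e => openFace B m n u a b d α μ e y :=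
  Fusible.sum fun x _ => (fusible_sum_grid_right H hμ x y).mul_left _

/-- A fused face is a block of faces whose bottom and left edges are summed with the coefficients `φ`, and
whose top and right edges are independent paths. -/
theorem fusedFace_eq_openFace (hα : α ∈ Finset.Icc 1 (B.num n a b))
    (hν : ν ∈ Finset.Icc 1 (B.num m b c)) (hβ : β ∈ Finset.Icc 1 (B.num n d c)) :
    fusedFace B m n u a b c d α ν β μ
      = openFace B m n u a b d α μ (B.path m b c ν) (B.path n d c β) := by
  obtain ⟨e1, e2, -⟩ := mem_paths.mp (B.mem m b c ν hν)
  simp only [openFace, Finset.mul_sum]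
  rw [Finset.sum_comm, fusedFace]
  refine Finset.sum_congr rfl fun q hq => ?_
  obtain ⟨q1, q2, -⟩ := mem_paths.mp hq
  rw [B.sum_prod_fusedRow H (fun k => u - 2 * ((m : ℂ) - 1 - ((k : ℕ) : ℂ)) * lam) q
    (B.path m b c ν) (by rwa [q1, e1]) (by rwa [q2, e2]), q1, q2, e1, e2, Finset.mul_sum]
  refine Finset.sum_congr rfl fun x _ => ?_
  rw [mul_left_comm]
  rfl

/-- The top edge of a fused face may be read in either direction. -/
theorem fusedFace_eq_openFace_rev (hα : α ∈ Finset.Icc 1 (B.num n a b))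
    (hν : ν ∈ Finset.Icc 1 (B.num m b c)) (hβ : β ∈ Finset.Icc 1 (B.num n d c)) :
    fusedFace B m n u a b c d α ν β μ
      = openFace B m n u a b d α μ (B.path m b c ν) (B.path n c d β ∘ Fin.rev) := by
  rw [fusedFace_eq_openFace H hα hν hβ]
  exact (B.apply_path_rev H (fusible_openFace_top H hα _) hβ).symm

end

/-! ### The Yang-Baxter equation for fused faces -/

section

section sums

variable {X Y Z R S T Q G : Type*}

theorem sum_comm_three_three (s₁ : Finset X) (s₂ : Finset Y) (s₃ : Finset Z) (t₁ : Finset R)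
    (t₂ : Finset S) (t₃ : Finset T) (F : X → Y → Z → R → S → T → ℂ) :
    ∑ x ∈ s₁, ∑ y ∈ s₂, ∑ z ∈ s₃, ∑ r ∈ t₁, ∑ s ∈ t₂, ∑ t ∈ t₃, F x y z r s t
      = ∑ r ∈ t₁, ∑ s ∈ t₂, ∑ t ∈ t₃, ∑ x ∈ s₁, ∑ y ∈ s₂, ∑ z ∈ s₃, F x y z r s t := by
  calc _ = ∑ a ∈ s₁ ×ˢ s₂ ×ˢ s₃, ∑ b ∈ t₁ ×ˢ t₂ ×ˢ t₃, F a.1 a.2.1 a.2.2 b.1 b.2.1 b.2.2 := by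
        simp only [Finset.sum_product]
    _ = ∑ b ∈ t₁ ×ˢ t₂ ×ˢ t₃, ∑ a ∈ s₁ ×ˢ s₂ ×ˢ s₃, F a.1 a.2.1 a.2.2 b.1 b.2.1 b.2.2 :=
        Finset.sum_comm
    _ = _ := by simp only [Finset.sum_product]

theorem sum_reverse_three (s₁ : Finset X) (s₂ : Finset Y) (s₃ : Finset Z) (F : X → Y → Z → ℂ) :
    ∑ x ∈ s₁, ∑ y ∈ s₂, ∑ z ∈ s₃, F x y z = ∑ z ∈ s₃, ∑ y ∈ s₂, ∑ x ∈ s₁, F x y z := by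
  rw [Finset.sum_comm]
  refine (Finset.sum_congr rfl fun y _ => Finset.sum_comm).trans ?_
  exact Finset.sum_comm

/-- Three faces with a common corner and with expansions along the three edges that meet there: the
sum over the bonds of these edges is a sum over paths. -/
theorem sum_bonds (I₁ I₂ I₃ : Finset ℕ) (PX : Finset X) (PR : Finset R) (PS : Finset S)
    (φ₁ : X → ℕ → ℂ) (φ₂ : R → ℕ → ℂ) (φ₃ : S → ℕ → ℂ) (p₁ : ℕ → X) (p₂ : ℕ → R) (p₃ : ℕ → S)
    (τ : R → R) (A : X → S → ℂ) (I : R → S → ℂ) (O : R → X → ℂ)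
    (h₁ : ∀ x ∈ PX, ∀ r, ∑ i ∈ I₁, φ₁ x i * O r (p₁ i) = O r x)
    (h₂ : ∀ r ∈ PR, ∀ x, ∑ k ∈ I₂, φ₂ r k * O (p₂ k) x = O (τ r) x)
    (h₃ : ∀ s ∈ PS, ∀ x, ∑ j ∈ I₃, φ₃ s j * A x (p₃ j) = A x s) :
    ∑ i ∈ I₁, ∑ k ∈ I₂, ∑ j ∈ I₃, (∑ x ∈ PX, φ₁ x i * A x (p₃ j))
        * (∑ r ∈ PR, φ₂ r k * ∑ s ∈ PS, φ₃ s j * I r s) * O (p₂ k) (p₁ i)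
      = ∑ x ∈ PX, ∑ r ∈ PR, ∑ s ∈ PS, A x s * I r s * O (τ r) x := by
  calc _ = ∑ i ∈ I₁, ∑ k ∈ I₂, ∑ j ∈ I₃, ∑ x ∈ PX, ∑ r ∈ PR, ∑ s ∈ PS,
        φ₁ x i * (φ₂ r k * O (p₂ k) (p₁ i)) * I r s * (φ₃ s j * A x (p₃ j)) := by
        refine Finset.sum_congr rfl fun i _ => Finset.sum_congr rfl fun k _ =>
          Finset.sum_congr rfl fun j _ => ?_
        rw [Finset.sum_mul_sum, Finset.sum_mul]
        refine Finset.sum_congr rfl fun x _ => ?_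
        rw [Finset.sum_mul]
        refine Finset.sum_congr rfl fun r _ => ?_
        rw [Finset.mul_sum, Finset.mul_sum, Finset.sum_mul]
        refine Finset.sum_congr rfl fun s _ => ?_
        ring
    _ = _ := by
        rw [sum_comm_three_three]
        refine Finset.sum_congr rfl fun x hx => Finset.sum_congr rfl fun r hr =>
          Finset.sum_congr rfl fun s hs => ?_
        simp only [← Finset.mul_sum, h₃ s hs, ← Finset.sum_mul, h₂ r hr, h₁ x hx]
        ring

/-- If the paths `x` determine the height `g` at the common corner, the sum over this height may be
omitted. -/
theorem sum_glue [Fintype G] [DecidableEq G] [Fintype X] [Fintype R] [Fintype S] (PX : G → Finset X)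
    (PR : G → Finset R) (PS : G → Finset S) (h : X → G) (hX : ∀ g, ∀ x ∈ PX g, h x = g)
    (F : X → R → S → ℂ)
    (hF : ∀ x r s, F x r s ≠ 0 → x ∈ PX (h x) ∧ r ∈ PR (h x) ∧ s ∈ PS (h x)) :
    ∑ g, ∑ x ∈ PX g, ∑ r ∈ PR g, ∑ s ∈ PS g, F x r s = ∑ x, ∑ r, ∑ s, F x r s := by
  classical
  calc _ = ∑ g, ∑ x, if x ∈ PX g then ∑ r, ∑ s, F x r s else 0 := by
        refine Finset.sum_congr rfl fun g _ => ?_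
        rw [Finset.sum_ite_mem, Finset.univ_inter]
        refine Finset.sum_congr rfl fun x hx => ?_
        have hg := hX g x hx
        rw [Finset.sum_subset (Finset.subset_univ (PR g)) fun r _ hr => Finset.sum_eq_zero fun s _ => ?_]
        · refine Finset.sum_congr rfl fun r _ =>
            Finset.sum_subset (Finset.subset_univ (PS g)) fun s _ hs => ?_
          by_contra h0
          exact hs (hg ▸ (hF x r s h0).2.2)
        · by_contra h0
          exact hr (hg ▸ (hF x r s h0).2.1)
    _ = _ := by
        rw [Finset.sum_comm]
        refine Finset.sum_congr rfl fun x _ => ?_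
        rw [Finset.sum_eq_single_of_mem (h x) (Finset.mem_univ _)]
        · rw [ite_eq_left_iff]
          intro hx
          refine (Finset.sum_eq_zero fun r _ => Finset.sum_eq_zero fun s _ => ?_).symm
          by_contra h0
          exact hx (hF x r s h0).1
        · exact fun g _ hg => if_neg fun hx => hg (hX g x hx).symm

theorem sum_factor [Fintype X] [Fintype R] [Fintype S] (PQ : Finset Q) (PY : Finset Y)
    (PT : Finset T) (φ : Q → ℂ) (χ : Y → ℂ) (ψ : T → ℂ) (A : X → S → Q → ℂ) (I : R → S → ℂ)
    (C : Y → T → R → X → ℂ) :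
    ∑ x, ∑ r, ∑ s, (∑ q ∈ PQ, φ q * A x s q) * I r s * (∑ y ∈ PY, χ y * ∑ t ∈ PT, ψ t * C y t r x)
      = ∑ y ∈ PY, ∑ t ∈ PT, ∑ q ∈ PQ, χ y * ψ t * φ q
        * ∑ x, ∑ r, ∑ s, C y t r x * (A x s q * I r s) := by
  simp only [Finset.mul_sum (s := Finset.univ)]
  rw [sum_comm_three_three]
  refine Finset.sum_congr rfl fun x _ => Finset.sum_congr rfl fun r _ =>
    Finset.sum_congr rfl fun s _ => ?_
  rw [Finset.mul_sum]
  refine Finset.sum_congr rfl fun y _ => ?_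
  rw [Finset.mul_sum, Finset.mul_sum]
  refine Finset.sum_congr rfl fun t _ => ?_
  rw [Finset.sum_mul, Finset.sum_mul]
  exact Finset.sum_congr rfl fun q _ => by ring

end sums

variable {L : ℕ} {p lam : ℝ} {m n l : ℕ} {a b c d e f : Fin L} {α β γ μ ν ρ : ℕ}

/-- The left-hand side of the Yang-Baxter equation as a sum over paths. -/
theorem IsSolvable.sum_fusedFace_left (H : IsSolvable L p lam) (B : IndPaths L p lam)
    (hm : 0 < m) (hn : 0 < n) (hl : 0 < l) (u v : ℂ)
    (hα : α ∈ Finset.Icc 1 (B.num n a b)) (hβ : β ∈ Finset.Icc 1 (B.num m b c))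
    (hγ : γ ∈ Finset.Icc 1 (B.num l d c)) (hμ : μ ∈ Finset.Icc 1 (B.num n e d))
    (hν : ν ∈ Finset.Icc 1 (B.num m f e)) (hρ : ρ ∈ Finset.Icc 1 (B.num l a f)) :
    ∑ g : Fin L, ∑ η₁ ∈ Finset.Icc 1 (B.num n f g), ∑ η₂ ∈ Finset.Icc 1 (B.num l b g),
      ∑ η₃ ∈ Finset.Icc 1 (B.num m g d), fusedFace B m n u f g d e η₁ η₃ μ ν
          * fusedFace B m l (u - v) g b c d η₂ β γ η₃
          * fusedFace B l n v a b g f α η₂ η₁ ρ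
      = ∑ y ∈ paths L n a b, ∑ t ∈ paths L l a f, ∑ q ∈ paths L m f e,
        B.phi n a b y α * B.phi l a f t ρ * B.phi m f e q ν * ∑ x, ∑ r, ∑ s,
          grid L p lam (faceParam lam l n v) y r x t
          * (grid L p lam (faceParam lam m n u) x s (B.path n e d μ) q
          * grid L p lam (faceParam lam m l (u - v)) (r ∘ Fin.rev) (B.path m b c β)
            (B.path l c d γ ∘ Fin.rev) s) := by
  obtain ⟨-, p2, -⟩ := mem_paths.mp (B.mem n e d μ hμ)
  obtain ⟨p3, -, -⟩ := mem_paths.mp (B.mem m b c β hβ)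
  set A : (Fin (n + 1) → Fin L) → (Fin (m + 1) → Fin L) → ℂ := fun x s =>
    ∑ q ∈ paths L m f e, B.phi m f e q ν
      * grid L p lam (faceParam lam m n u) x s (B.path n e d μ) q with hA
  set I : (Fin (l + 1) → Fin L) → (Fin (m + 1) → Fin L) → ℂ := fun r s =>
    grid L p lam (faceParam lam m l (u - v)) r (B.path m b c β) (B.path l c d γ ∘ Fin.rev) s with hI
  have key : ∀ g, (∑ η₁ ∈ Finset.Icc 1 (B.num n f g), ∑ η₂ ∈ Finset.Icc 1 (B.num l b g),
      ∑ η₃ ∈ Finset.Icc 1 (B.num m g d), fusedFace B m n u f g d e η₁ η₃ μ ν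
          * fusedFace B m l (u - v) g b c d η₂ β γ η₃
          * fusedFace B l n v a b g f α η₂ η₁ ρ)
      = ∑ x ∈ paths L n f g, ∑ r ∈ paths L l g b, ∑ s ∈ paths L m g d,
        A x s * I r s * openFace B l n v a b f α ρ (r ∘ Fin.rev) x := by
    intro g
    rw [← sum_bonds (Finset.Icc 1 (B.num n f g)) (Finset.Icc 1 (B.num l b g))
      (Finset.Icc 1 (B.num m g d)) (paths L n f g) (paths L l g b) (paths L m g d)
      (fun x i => B.phi n f g x i) (fun r k => B.phi l g b r k) (fun s j => B.phi m g d s j)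
      (fun i => B.path n f g i) (fun k => B.path l b g k) (fun j => B.path m g d j)
      (fun r => r ∘ Fin.rev) A I (fun r x => openFace B l n v a b f α ρ r x)]
    · refine Finset.sum_congr rfl fun i hi => Finset.sum_congr rfl fun k hk =>
        Finset.sum_congr rfl fun j hj => ?_
      rw [fusedFace_eq_openFace H hi hj hμ, fusedFace_eq_openFace_rev H (by rwa [B.num_reverse]) hβ hγ,
        fusedFace_eq_openFace H hα hk hi]
      rfl
    · exact fun x hx r => B.sum_phi_mul H
        (ℓ := fun y => openFace B l n v a b f α ρ r y) (fusible_openFace_top H hα r) hx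
    · exact fun r hr x => B.sum_phi_rev_mul H
        (ℓ := fun e => openFace B l n v a b f α ρ e x) (fusible_openFace_right H hρ x) hr
    · exact fun s hs x => B.sum_phi_mul H (ℓ := A x) (fusible_sum_grid_right H hν x _) hs
  simp only [key]
  rw [sum_glue (fun g => paths L n f g) (fun g => paths L l g b) (fun g => paths L m g d)
    (fun x => x (Fin.last n))]
  · have hrev : ∀ x, (∑ r, ∑ s, A x s * I r s * openFace B l n v a b f α ρ (r ∘ Fin.rev) x)
        = ∑ r, ∑ s, A x s * I (r ∘ Fin.rev) s * openFace B l n v a b f α ρ r x := by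
      intro x
      rw [sum_rev]
      simp only [rev_rev_comp]
    simp only [hrev]
    have := sum_factor (paths L m f e) (paths L n a b) (paths L l a f)
      (fun q => B.phi m f e q ν) (fun y => B.phi n a b y α) (fun t => B.phi l a f t ρ)
      (fun x s q => grid L p lam (faceParam lam m n u) x s (B.path n e d μ) q)
      (fun r s => I (r ∘ Fin.rev) s)
      (fun y t r x => grid L p lam (faceParam lam l n v) y r x t)
    simp only [hA, openFace]
    exact this
  · exact fun g x hx => (mem_paths.mp hx).2.1
  · intro x r s h0
    have h1 := left_ne_zero_of_mul (left_ne_zero_of_mul h0)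
    have h2 := right_ne_zero_of_mul (left_ne_zero_of_mul h0)
    obtain ⟨q, hq, h3⟩ := Finset.exists_ne_zero_of_sum_ne_zero h1
    have h3 := right_ne_zero_of_mul h3
    obtain ⟨q1, -, -⟩ := mem_paths.mp hq
    obtain ⟨c1, c2, -, c4⟩ := grid_corners h3
    obtain ⟨d1, d2, -, -⟩ := grid_corners h2
    obtain ⟨m1, m2, -, -⟩ := H.grid_mem_paths hm hn h3
    obtain ⟨m3, -, -, -⟩ := H.grid_mem_paths hm hl h2
    rw [c1, q1] at m1
    rw [← c4, p2, ← c2] at m2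
    rw [d1, d2, p3, ← c2] at m3
    exact ⟨m1, m3, m2⟩

/-- The right-hand side of the Yang-Baxter equation as a sum over paths. -/
theorem IsSolvable.sum_fusedFace_right (H : IsSolvable L p lam) (B : IndPaths L p lam)
    (hm : 0 < m) (hn : 0 < n) (hl : 0 < l) (u v : ℂ)
    (hα : α ∈ Finset.Icc 1 (B.num n a b)) (hβ : β ∈ Finset.Icc 1 (B.num m b c))
    (hγ : γ ∈ Finset.Icc 1 (B.num l d c)) (hμ : μ ∈ Finset.Icc 1 (B.num n e d))
    (hν : ν ∈ Finset.Icc 1 (B.num m f e)) (hρ : ρ ∈ Finset.Icc 1 (B.num l a f)) :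
    ∑ g : Fin L, ∑ η₁ ∈ Finset.Icc 1 (B.num n g c), ∑ η₂ ∈ Finset.Icc 1 (B.num l g e),
      ∑ η₃ ∈ Finset.Icc 1 (B.num m a g), fusedFace B m n u a b c g α β η₁ η₃
          * fusedFace B m l (u - v) f a g e ρ η₃ η₂ ν
          * fusedFace B l n v g c d e η₁ γ μ η₂
      = ∑ y ∈ paths L n a b, ∑ t ∈ paths L l a f, ∑ q ∈ paths L m f e,
        B.phi n a b y α * B.phi l a f t ρ * B.phi m f e q ν * ∑ x, ∑ r, ∑ s,
          grid L p lam (faceParam lam m n u) y (B.path m b c β) x s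
          * grid L p lam (faceParam lam m l (u - v)) (t ∘ Fin.rev) s (r ∘ Fin.rev) q
          * grid L p lam (faceParam lam l n v) x (B.path l c d γ) (B.path n e d μ) r := by
  obtain ⟨p2, -, -⟩ := mem_paths.mp (B.mem n e d μ hμ)
  obtain ⟨-, p3, -⟩ := mem_paths.mp (B.mem m b c β hβ)
  set A : (Fin (m + 1) → Fin L) → (Fin (n + 1) → Fin L) → ℂ := fun s x =>
    ∑ y ∈ paths L n a b, B.phi n a b y α
      * grid L p lam (faceParam lam m n u) y (B.path m b c β) x s with hA
  set I : (Fin (l + 1) → Fin L) → (Fin (n + 1) → Fin L) → ℂ := fun r x =>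
    grid L p lam (faceParam lam l n v) x (B.path l c d γ) (B.path n e d μ) r with hI
  set O : (Fin (l + 1) → Fin L) → (Fin (m + 1) → Fin L) → ℂ := fun r s =>
    ∑ t ∈ paths L l a f, B.phi l a f t ρ * ∑ q ∈ paths L m f e, B.phi m f e q ν
      * grid L p lam (faceParam lam m l (u - v)) (t ∘ Fin.rev) s r q with hO
  have hO' : ∀ r s, openFace B m l (u - v) f a e ρ ν s r = O r s := by
    intro r s
    refine Finset.sum_bij' (fun t _ => t ∘ Fin.rev) (fun t _ => t ∘ Fin.rev)
      (fun t ht => rev_mem_paths ht) (fun t ht => rev_mem_paths ht) (fun t _ => rev_rev_comp t)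
      (fun t _ => rev_rev_comp t) fun t ht => ?_
    rw [B.phi_rev H ht (by rwa [B.num_reverse]), rev_rev_comp]
  have hρ' : ρ ∈ Finset.Icc 1 (B.num l f a) := by rwa [B.num_reverse]
  have hγ' : γ ∈ Finset.Icc 1 (B.num l c d) := by rwa [B.num_reverse]
  have key : ∀ g, (∑ η₁ ∈ Finset.Icc 1 (B.num n g c), ∑ η₂ ∈ Finset.Icc 1 (B.num l g e),
      ∑ η₃ ∈ Finset.Icc 1 (B.num m a g), fusedFace B m n u a b c g α β η₁ η₃
          * fusedFace B m l (u - v) f a g e ρ η₃ η₂ ν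
          * fusedFace B l n v g c d e η₁ γ μ η₂)
      = ∑ s ∈ paths L m a g, ∑ r ∈ paths L l g e, ∑ x ∈ paths L n g c,
        A s x * I r x * O (r ∘ Fin.rev) s := by
    intro g
    rw [sum_reverse_three, ← sum_bonds (Finset.Icc 1 (B.num m a g)) (Finset.Icc 1 (B.num l g e))
      (Finset.Icc 1 (B.num n g c)) (paths L m a g) (paths L l g e) (paths L n g c)
      (fun s i => B.phi m a g s i) (fun r k => B.phi l g e r k) (fun x j => B.phi n g c x j)
      (fun i => B.path m a g i) (fun k => B.path l e g k) (fun j => B.path n g c j)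
      (fun r => r ∘ Fin.rev) A I O]
    · refine Finset.sum_congr rfl fun i hi => Finset.sum_congr rfl fun k hk =>
        Finset.sum_congr rfl fun j hj => ?_
      rw [fusedFace_eq_openFace H hα hβ hj, openFace_comm,
        fusedFace_eq_openFace H hρ' hi (by rwa [B.num_reverse]), hO',
        fusedFace_eq_openFace H hj hγ' hμ, openFace_comm]
      ring
    · intro s hs r
      simp only [← hO']
      exact B.sum_phi_mul H (ℓ := fun s => openFace B m l (u - v) f a e ρ ν s r)
        (fusible_openFace_right H hν r) hs
    · intro r hr s
      simp only [← hO', ← B.num_reverse l g e]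
      exact B.sum_phi_rev_mul H (ℓ := fun r => openFace B m l (u - v) f a e ρ ν s r)
        (fusible_openFace_top H hρ' s) hr
    · exact fun x hx s => B.sum_phi_mul H (ℓ := A s) (fusible_sum_grid_top H hα _ s) hx
  simp only [key]
  rw [sum_glue (fun g => paths L m a g) (fun g => paths L l g e) (fun g => paths L n g c)
    (fun s => s (Fin.last m))]
  · refine (sum_factor _ _ _ (fun y => B.phi n a b y α) (fun t => B.phi l a f t ρ)
      (fun q => B.phi m f e q ν)
      (fun s x y => grid L p lam (faceParam lam m n u) y (B.path m b c β) x s) I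
      (fun t q r s => grid L p lam (faceParam lam m l (u - v)) (t ∘ Fin.rev) s (r ∘ Fin.rev) q)).trans
      ?_
    rw [sum_reverse_three]
    refine Finset.sum_congr rfl fun y _ => ?_
    rw [Finset.sum_comm]
    refine Finset.sum_congr rfl fun t _ => Finset.sum_congr rfl fun q _ => ?_
    rw [sum_reverse_three Finset.univ Finset.univ Finset.univ]
    refine congr_arg₂ _ (by ring) (Finset.sum_congr rfl fun x _ => Finset.sum_congr rfl fun r _ =>
      Finset.sum_congr rfl fun s _ => ?_)
    rw [hI]
    ring
  · exact fun g x hx => (mem_paths.mp hx).2.1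
  · intro s r x h0
    have h1 := left_ne_zero_of_mul (left_ne_zero_of_mul h0)
    have h2 := right_ne_zero_of_mul (left_ne_zero_of_mul h0)
    obtain ⟨y, hy, h3⟩ := Finset.exists_ne_zero_of_sum_ne_zero h1
    have h3 := right_ne_zero_of_mul h3
    obtain ⟨y1, -, -⟩ := mem_paths.mp hy
    obtain ⟨c1, -, c3, c4⟩ := grid_corners h3
    obtain ⟨d1, -, d3, -⟩ := grid_corners h2
    obtain ⟨-, -, m2, m1⟩ := H.grid_mem_paths hm hn h3
    obtain ⟨-, -, -, m3⟩ := H.grid_mem_paths hl hn h2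
    rw [← c1, y1] at m1
    rw [c4, p3, c3] at m2
    rw [← d1, ← d3, p2, c3] at m3
    exact ⟨m1, m3, m2⟩

/-- The Yang-Baxter equation for fused faces. -/
theorem IsSolvable.fused_ybe (H : IsSolvable L p lam) (B : IndPaths L p lam)
    (hm : 0 < m) (hn : 0 < n) (hl : 0 < l) (u v : ℂ)
    (hα : α ∈ Finset.Icc 1 (B.num n a b)) (hβ : β ∈ Finset.Icc 1 (B.num m b c))
    (hγ : γ ∈ Finset.Icc 1 (B.num l d c)) (hμ : μ ∈ Finset.Icc 1 (B.num n e d))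
    (hν : ν ∈ Finset.Icc 1 (B.num m f e)) (hρ : ρ ∈ Finset.Icc 1 (B.num l a f)) :
    ∑ g : Fin L, ∑ η₁ ∈ Finset.Icc 1 (B.num n f g), ∑ η₂ ∈ Finset.Icc 1 (B.num l b g),
      ∑ η₃ ∈ Finset.Icc 1 (B.num m g d), fusedFace B m n u f g d e η₁ η₃ μ ν
          * fusedFace B m l (u - v) g b c d η₂ β γ η₃
          * fusedFace B l n v a b g f α η₂ η₁ ρ
      = ∑ g : Fin L, ∑ η₁ ∈ Finset.Icc 1 (B.num n g c), ∑ η₂ ∈ Finset.Icc 1 (B.num l g e),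
      ∑ η₃ ∈ Finset.Icc 1 (B.num m a g), fusedFace B m n u a b c g α β η₁ η₃
          * fusedFace B m l (u - v) f a g e ρ η₃ η₂ ν
          * fusedFace B l n v g c d e η₁ γ μ η₂ := by
  rw [H.sum_fusedFace_left B hm hn hl u v hα hβ hγ hμ hν hρ,
    H.sum_fusedFace_right B hm hn hl u v hα hβ hγ hμ hν hρ]
  -- the parameters of the lines of the three blocks
  have h1 : faceParam lam l n v = fun (i : Fin l) (j : Fin n) =>
      (v - 2 * ((l : ℂ) - 1 - ((i : ℕ) : ℂ)) * lam) + 2 * ((j : ℕ) : ℂ) * lam := rfl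
  have h2 : faceParam lam m n u = fun (k : Fin m) (j : Fin n) =>
      (u - 2 * ((m : ℂ) - 1 - ((k : ℕ) : ℂ)) * lam) + 2 * ((j : ℕ) : ℂ) * lam := rfl
  have h3 : faceParam lam m l (u - v) = fun (k : Fin m) (i : Fin l) =>
      (u - 2 * ((m : ℂ) - 1 - ((k : ℕ) : ℂ)) * lam)
        - (v - 2 * ((l : ℂ) - 1 - ((Fin.rev i : ℕ) : ℂ)) * lam) := by
    funext k i
    have : ((Fin.rev i : ℕ) : ℂ) = (l : ℂ) - 1 - ((i : ℕ) : ℂ) := by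
      rw [Fin.val_rev, Nat.cast_sub (by omega)]
      push_cast
      ring
    rw [this]
    simp only [faceParam, ladder]
    ring
  refine Finset.sum_congr rfl fun y _ => Finset.sum_congr rfl fun t _ =>
    Finset.sum_congr rfl fun q _ => ?_
  rw [h1, h2, h3]
  refine congrArg _ ?_
  have := H.block_ybe (fun k : Fin m => u - 2 * ((m : ℂ) - 1 - ((k : ℕ) : ℂ)) * lam)
    (fun i : Fin l => v - 2 * ((l : ℂ) - 1 - ((i : ℕ) : ℂ)) * lam)
    (fun j : Fin n => 2 * ((j : ℕ) : ℂ) * lam) y (B.path n e d μ) (B.path m b c β) q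
    (B.path l c d γ) t
  exact this

end

end DiluteA

theorem mainTheorem4 (L : ℕ) (hL : L ≠ 2) (p : ℝ) (hp : |p| < 1) (lam : ℝ)
    (hlam : lam = Real.pi / 4 * ((L : ℝ) / ((L : ℝ) + 1)) ∨
      lam = Real.pi / 4 * (((L : ℝ) + 2) / ((L : ℝ) + 1)))
    (B : DiluteA.IndPaths L p lam)
    (m n l : ℕ) (hm : 0 < m) (hn : 0 < n) (hl : 0 < l) (u v : ℂ)
    (a b c d e f : Fin L) (α β γ μ ν ρ : ℕ)
    (hα : α ∈ Finset.Icc 1 (B.num n a b)) (hβ : β ∈ Finset.Icc 1 (B.num m b c))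
    (hγ : γ ∈ Finset.Icc 1 (B.num l d c)) (hμ : μ ∈ Finset.Icc 1 (B.num n e d))
    (hν : ν ∈ Finset.Icc 1 (B.num m f e)) (hρ : ρ ∈ Finset.Icc 1 (B.num l a f)) :
    ∑ g : Fin L, ∑ η₁ ∈ Finset.Icc 1 (B.num n f g), ∑ η₂ ∈ Finset.Icc 1 (B.num l b g),
      ∑ η₃ ∈ Finset.Icc 1 (B.num m g d),
        DiluteA.fusedFace B m n u f g d e η₁ η₃ μ ν
          * DiluteA.fusedFace B m l (u - v) g b c d η₂ β γ η₃
          * DiluteA.fusedFace B l n v a b g f α η₂ η₁ ρ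
    = ∑ g : Fin L, ∑ η₁ ∈ Finset.Icc 1 (B.num n g c), ∑ η₂ ∈ Finset.Icc 1 (B.num l g e),
      ∑ η₃ ∈ Finset.Icc 1 (B.num m a g),
        DiluteA.fusedFace B m n u a b c g α β η₁ η₃
          * DiluteA.fusedFace B m l (u - v) f a g e ρ η₃ η₂ ν
          * DiluteA.fusedFace B l n v g c d e η₁ γ μ η₂ := by
  have hL1 : 1 ≤ L := Nat.one_le_iff_ne_zero.mpr fun h => (h ▸ a).elim0
  exact (DiluteA.isSolvable hL hp hlam hL1).fused_ybe B hm hn hl u v hα hβ hγ hμ hν hρ
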